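/- **The category $\mathsf{Atl}$.** Objects are $[0+]$, $[0-]$ and $[n]$ for $n\ge 1$; a circle of type $[n]$ has $2n$ marked points, numbered clockwise from a distinguished interval next to which the annulus is unshaded, and a circle of type $[0\pm]$ has none, with adjacent region unshaded for $+$ and shaded for $-$. An Atl tangle from $[m]$ to $[n]$ is a planar system of disjoint strings in an annulus with inner circle of type $[m]$ and outer circle of type $[n]$: every marked point is the end of exactly one string, there may also be non-contractible closed loops but no contractible ones, and the regions are shaded like a checkerboard, compatibly with the circles. Tangles are considered up to orientation-preserving diffeomorphisms of the annulus preserving each boundary circle and the markings; combinatorially, a tangle is the periodic non-crossing pairing of the lifted marked points on the two edges of the universal cover (an infinite strip), up to full turns of one edge against the other, together with the number of its non-contractible loops. A morphism of $\mathsf{Atl}$ is a triple $(T,c_+,c_-)$ with $T$ an Atl tangle and $c_\pm\in\mathbb Z_{\ge0}$; composition glues tangles along a circle, deletes the contractible loops that arise, and adds the number of the shaded ones to the sum of the $c_+$ and of the unshaded ones to the sum of the $c_-$. For $n\ge 2$ and $1\le i\le 2n$, $a_i\colon[n]\to[n-1]$ joins the inner points $i,i+1$ (mod $2n$) by a string and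 the other inner points to the outer points, so that outer point $1$ is joined to inner point $3$ if $i=1$, to inner point $1$ if $1<i<2n$, and to inner point $2n-1$ if $i=2n$; $a_1\colon[1]\to[0+]$ and $a_2\colon[1]\to[0-]$ are the tangles without loops; $b_i$ is the reflection of $a_i$ exchanging the two circles; $t\colon[n]\to[n]$ joins inner point $x$ to outer point $x+2$. **The category $\mathsf{a}\Delta$.** Same objects; generated by $\alpha_i\colon[n]\to[n-1]$ ($n\ge2$, $1\le i\le 2n$), $\alpha_1\colon[1]\to[0+]$, $\alpha_2\colon[1]\to[0-]$, $\beta_i\colon[n]\to[n+1]$ ($n\ge1$, $1\le i\le 2n+2$), $\beta_1\colon[0+]\to[1]$, $\beta_2\colon[0-]\to[1]$, $\tau\colon[n]\to[n]$ ($n\ge1$), and $\delta_\pm$ on every object, with the relations 1. $\alpha_i\alpha_j=\alpha_{j-2}\alpha_i$ for $i<j-1$, $(i,j)\ne(1,2n)$, on $[n]$; 2. $\beta_i\beta_j=\beta_{j+2}\beta_i$ for $i\le j$, $(i,j)\neq(1,2n+2)$, on $[n]$ (with $n=0$ for $[0\pm]$); 3. $\tau^n=\mathrm{id}_{[n]}$;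 4. $\alpha_i\tau=\tau\alpha_{i-2}$ for $i\ge3$; 5. $\beta_i\tau=\tau\beta_{i-2}$ for $i\ge3$; 6. $\alpha_1\beta_1=\delta_+$ on $[0+]$, $\alpha_2\beta_2=\delta_-$ on $[0-]$; and on $[n]$ with $n\ge1$: $\alpha_1\beta_{2n+2}=\tau^{-1}$, $\alpha_{2n+2}\beta_1=\tau$, $\alpha_i\beta_{i\pm1}=\mathrm{id}$, $\alpha_i\beta_i=\delta_+$ for odd $i$ and $\delta_-$ for even $i$, $\alpha_i\beta_j=\beta_{j-2}\alpha_i$ for all other $i<j-1$, and $\alpha_i\beta_j=\beta_j\alpha_{i-2}$ for all other $i>j+1$; 7. $\delta_\pm$ commute with all generators. **The category $\mathsf{c}\Delta^{\mathrm{op}}$** (opposite of the cyclic category). Objects $[n]$, $n\ge0$; generated by $d_i\colon[n]\to[n-1]$ ($n\ge1$, $0\le i\le n$), $s_i\colon[n]\to[n+1]$ ($0\le i\le n$), $t\colon[n]\to[n]$, with the relations $d_id_j=d_{j-1}d_i$ for $i<j$; $s_is_j=s_{j+1}s_i$ for $i\le j$; $d_is_j=s_{j-1}d_i$ for $i<j$,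 $=\mathrm{id}$ for $i\in\{j,j+1\}$, $=s_jd_{i-1}$ for $i>j+1$; $t^{n+1}=\mathrm{id}_{[n]}$; $d_it=td_{i-1}$ and $s_it=ts_{i-1}$ for $1\le i\le n$. **Subcategories.** A cap (cup) of a tangle is a string joining two inner (two outer) points; it is shaded or unshaded according to the region just inside the disc that it cuts off together with an arc of the circle. $\mathsf{cAtl}^+$ has the objects $[n]$, $n\ge1$, and as morphisms the tangles (with $c_+=c_-=0$) with no loops, only shaded caps and only unshaded cups; $\mathsf{cAtl}^-$ is defined likewise with no loops, only unshaded caps and only shaded cups. **Theorem.** $\mathsf{Atl}$ is a category, and the assignments $[n]\mapsto[n]$, $\alpha_i\mapsto a_i$, $\beta_i\mapsto b_i$, $\tau\mapsto t$, $\delta_+\mapsto(\mathrm{id},1,0)$, $\delta_-\mapsto(\mathrm{id},0,1)$ define a unique functor $F\colon\mathsf{a}\Delta\to\mathsf{Atl}$. Moreover: * The assignments $[n]\mapsto[n+1]$, $d_j\mapsto\alpha_{2j+1}$, $s_j\mapsto\beta_{2j+2}$, $t\mapsto\tau$ define a unique functor $H^+\colon\mathsf{c}\Delta^{\mathrm{op}}\to\mathsf{a}\Delta$,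 and $H^+$ is injective on objects and faithful. * The assignments $[n]\mapsto[n+1]$, $d_j\mapsto\alpha_{2j+2}$, $s_j\mapsto\beta_{2j+3}$, $t\mapsto\tau$ define a unique functor $H^-\colon\mathsf{c}\Delta^{\mathrm{op}}\to\mathsf{a}\Delta$, and $H^-$ is injective on objects and faithful. * $\mathsf{cAtl}^\pm$ is a subcategory of $\mathsf{Atl}$, the image of $F\circ H^\pm$ (on objects and on morphisms) is exactly $\mathsf{cAtl}^\pm$, and $F\circ H^\pm$ is an isomorphism of categories from $\mathsf{c}\Delta^{\mathrm{op}}$ onto $\mathsf{cAtl}^\pm$. -/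

import Mathlib

open CategoryTheory

namespace Annular

/-! ### Annular tangles

The annulus is cut open to its universal cover, an infinite horizontal strip whose lower edge covers
the inner circle and whose upper edge covers the outer circle, with the clockwise direction running
to the right.  A circle with `2n > 0` marked points lifts to a line whose marked points are the
integers: the integer `x` is a lift of the marked point with number `x` modulo `2n`, and the
distinguished (starred, unshaded) interval lifts to the gaps between `2nk` and `2nk + 1`.
A tangle is recorded by the planar, periodic pairing of the lifted marked points by its strings,
together with the numbers of its loops. -/

/-- The objects `[0+]`, `[0-]` and `[n]` for `n ≥ 1`; here `pos n` stands for `[n + 1]`. -/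
inductive AObj : Type
  | zeroPlus : AObj
  | zeroMinus : AObj
  | pos (n : ℕ) : AObj

/-- The number of marked points on a circle of the given type. -/
def AObj.width : AObj → ℕ
  | .zeroPlus => 0
  | .zeroMinus => 0
  | .pos n => 2 * (n + 1)

/-- The shading next to the circle in the gap between `g` and `g + 1`: `0` for unshaded and `1`
for shaded.  On `[0±]` there is only one adjacent region. -/
def AObj.shade : AObj → ℤ → ZMod 2
  | .zeroPlus, _ => 0
  | .zeroMinus, _ => 1
  | .pos _, g => (g : ZMod 2)

/-- The lifted marked points of a circle: the integers, or nothing if there is no marked point. -/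
def Pt (a : AObj) : Type := {_x : ℤ // 0 < a.width}

/-- Translation of a lifted marked point by `k` full turns. -/
def Pt.turn {a : AObj} (k : ℤ) (x : Pt a) : Pt a := ⟨x.1 + k * (a.width : ℤ), x.2⟩

/-- The lifted marked points of an annulus: inner ones (`inl`) and outer ones (`inr`). -/
abbrev Bdry (a b : AObj) : Type := Pt a ⊕ Pt b

/-- Simultaneous translation by `k` full turns. -/
def Bdry.turn {a b : AObj} (k : ℤ) : Bdry a b → Bdry a b := Sum.map (Pt.turn k) (Pt.turn k)

/-- Turning only the outer circle by `k` full turns. -/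
def Bdry.twist {a b : AObj} (k : ℤ) : Bdry a b → Bdry a b := Sum.map _root_.id (Pt.turn k)

/-- The order of the lifted marked points along the boundary of the strip: the lower edge from left
to right, then the upper edge from right to left. -/
def Bdry.before {a b : AObj} : Bdry a b → Bdry a b → Prop
  | .inl x, .inl y => x.1 < y.1
  | .inl _, .inr _ => True
  | .inr _, .inl _ => False
  | .inr x, .inr y => y.1 < x.1

/-- The lifted marked points to the left of a transversal of the strip that runs from the gap
`(g, g + 1)` of the lower edge to the gap `(h, h + 1)` of the upper edge. -/
def Bdry.left {a b : AObj} (g h : ℤ) : Bdry a b → Prop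
  | .inl x => x.1 ≤ g
  | .inr y => y.1 ≤ h

/-- The data of a triple `(T, c₊, c₋)`: the pairing of the lifted marked points by the strings of
`T`, the number of non-contractible loops of `T`, and the numbers `c₊`, `c₋` counting shaded and
unshaded contractible loops. -/
structure Diagram (a b : AObj) : Type where
  /-- a lifted string runs between `p` and `q` -/
  joined : Bdry a b → Bdry a b → Prop
  /-- the number of non-contractible loops -/
  core : ℕ
  /-- the number `c₊` -/
  shadedLoops : ℕ
  /-- the number `c₋` -/
  unshadedLoops : ℕ

namespace Diagram

variable {a b c : AObj}

/-- The number of lifted strings met by the transversal from the gap `g` to the gap `h`, when each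
string is drawn so as to meet it at most once. -/
noncomputable def crossings (D : Diagram a b) (g h : ℤ) : ℕ :=
  Set.ncard {p : Bdry a b | p.left g h ∧ ∃ q, D.joined p q ∧ ¬ q.left g h}

/-- The conditions for the data to come from an annular tangle. -/
structure IsTangle (D : Diagram a b) : Prop where
  symm : ∀ p q, D.joined p q → D.joined q p
  irrefl : ∀ p, ¬ D.joined p p
  /-- every marked point meets exactly one string -/
  existsUnique : ∀ p, ∃! q, D.joined p q
  /-- the lifted strings are lifts of strings in the annulus -/
  periodic : ∀ p q, D.joined p q → D.joined (p.turn 1) (q.turn 1)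
  /-- strings do not cross each other -/
  planar : ∀ p p' q q', D.joined p p' → D.joined q q' →
    ¬ (p.before q ∧ q.before p' ∧ p'.before q')
  /-- through strings do not cross the non-contractible loops -/
  core_eq_zero : ∀ (x : Pt a) (y : Pt b), D.joined (.inl x) (.inr y) → D.core = 0
  /-- regions can be shaded like a checkerboard, compatibly with the shadings at both circles: the
  shading changes at each string and each non-contractible loop that a transversal meets -/
  checkerboard : ∀ g h : ℤ,
    ((D.crossings g h + D.core : ℕ) : ZMod 2) = a.shade g + b.shade h

/-- The identity tangle: radial strings, no loops. -/
def id (a : AObj) : Diagram a a where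
  joined
    | .inl x, .inr y => x.1 = y.1
    | .inr x, .inl y => x.1 = y.1
    | _, _ => False
  core := 0
  shadedLoops := 0
  unshadedLoops := 0

/-- Reflection, exchanging the inner and the outer circle. -/
def star (D : Diagram a b) : Diagram b a where
  joined p q := D.joined p.swap q.swap
  core := D.core
  shadedLoops := D.shadedLoops
  unshadedLoops := D.unshadedLoops

/-- The lifted marked points on the three circles that appear when two tangles are glued. -/
abbrev Glued (a b c : AObj) : Type := Pt a ⊕ Pt b ⊕ Pt c

/-- The boundary of the inner of the two glued annuli. -/
def Glued.lower : Bdry a b → Glued a b c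
  | .inl x => .inl x
  | .inr y => .inr (.inl y)

/-- The boundary of the outer of the two glued annuli. -/
def Glued.upper : Bdry b c → Glued a b c
  | .inl y => .inr (.inl y)
  | .inr z => .inr (.inr z)

/-- The boundary of the union of the two glued annuli. -/
def Glued.outer : Bdry a c → Glued a b c
  | .inl x => .inl x
  | .inr z => .inr (.inr z)

/-- A marked point on the middle circle. -/
def Glued.mid (y : Pt b) : Glued a b c := .inr (.inl y)

/-- Two points are the ends of a lifted string of one of the two glued tangles. -/
inductive Link (S : Diagram a b) (T : Diagram b c) : Glued a b c → Glued a b c → Prop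
  | lower {p q : Bdry a b} : S.joined p q → Link S T (Glued.lower p) (Glued.lower q)
  | upper {p q : Bdry b c} : T.joined p q → Link S T (Glued.upper p) (Glued.upper q)

/-- Two points lie on the same component of the union of the lifted strings. -/
def Conn (S : Diagram a b) (T : Diagram b c) : Glued a b c → Glued a b c → Prop :=
  Relation.EqvGen (Link S T)

/-- The point `y` of the middle circle lies on a loop created by gluing. -/
def OnLoop (S : Diagram a b) (T : Diagram b c) (y : Pt b) : Prop :=
  ∀ p : Bdry a c, ¬ Conn S T (Glued.mid y) (Glued.outer p)

/-- All lifts of the points at which the loop through `y` meets the middle circle. -/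
def loopThrough (S : Diagram a b) (T : Diagram b c) (y : Pt b) : Set (Pt b) :=
  {z | ∃ k : ℤ, Conn S T (Glued.mid y) (Glued.mid (z.turn k))}

/-- The loop through `y` is not contractible: its lift through `y` is not a closed curve, that is,
it also passes through a different lift of the same point of the annulus. -/
def Winds (S : Diagram a b) (T : Diagram b c) (y : Pt b) : Prop :=
  ∃ k : ℤ, k ≠ 0 ∧ Conn S T (Glued.mid y) (Glued.mid (y.turn k))

/-- `z` is the leftmost point at which the lifted closed loop through `y` meets the middle line.
The gap to the right of `z` is then next to the loop on its inside, so that the loop is shaded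
if `z` is odd and unshaded if `z` is even. -/
def IsLeftmost (S : Diagram a b) (T : Diagram b c) (y z : Pt b) : Prop :=
  Conn S T (Glued.mid y) (Glued.mid z) ∧
    ∀ u : Pt b, Conn S T (Glued.mid y) (Glued.mid u) → z.1 ≤ u.1

/-- Composition, `S` being glued into the inner circle of `T` (so this is `T ∘ S`):  strings
are joined along the middle circle, contractible loops are removed and counted. -/
noncomputable def comp (S : Diagram a b) (T : Diagram b c) : Diagram a c where
  joined p q := p ≠ q ∧ Conn S T (Glued.outer p) (Glued.outer q)
  core := S.core + T.core +
    Set.ncard {L : Set (Pt b) | ∃ y, OnLoop S T y ∧ Winds S T y ∧ L = loopThrough S T y}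
  shadedLoops := S.shadedLoops + T.shadedLoops +
    Set.ncard {L : Set (Pt b) | ∃ y, OnLoop S T y ∧ ¬ Winds S T y ∧
      (∃ z, IsLeftmost S T y z ∧ Odd z.1) ∧ L = loopThrough S T y}
  unshadedLoops := S.unshadedLoops + T.unshadedLoops +
    Set.ncard {L : Set (Pt b) | ∃ y, OnLoop S T y ∧ ¬ Winds S T y ∧
      (∃ z, IsLeftmost S T y z ∧ Even z.1) ∧ L = loopThrough S T y}

/-- Two diagrams describe diffeomorphic tangles: they differ by full turns of the outer circle
(diffeomorphisms of the annulus need not fix the boundary circles). -/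
def Same (D D' : Diagram a b) : Prop :=
  (∃ k : ℤ, ∀ p q, D'.joined (p.twist k) (q.twist k) ↔ D.joined p q) ∧
    D'.core = D.core ∧ D'.shadedLoops = D.shadedLoops ∧ D'.unshadedLoops = D.unshadedLoops

theorem twist_zero (p : Bdry a b) : p.twist 0 = p := by
  rcases p with x | y
  · rfl
  · exact congrArg Sum.inr (Subtype.ext (by simp [Pt.turn]))

theorem twist_twist (j k : ℤ) (p : Bdry a b) : (p.twist j).twist k = p.twist (j + k) := by
  rcases p with x | y
  · rfl
  · exact congrArg Sum.inr (Subtype.ext (by simp [Pt.turn]; ring))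

theorem Same.refl (D : Diagram a b) : Same D D :=
  ⟨⟨0, fun p q => by rw [twist_zero, twist_zero]⟩, rfl, rfl, rfl⟩

theorem Same.symm {D D' : Diagram a b} (h : Same D D') : Same D' D := by
  obtain ⟨⟨k, hk⟩, h₁, h₂, h₃⟩ := h
  refine ⟨⟨-k, fun p q => ?_⟩, h₁.symm, h₂.symm, h₃.symm⟩
  rw [← hk, twist_twist, twist_twist, neg_add_cancel, twist_zero, twist_zero]

theorem Same.trans {D D' D'' : Diagram a b} (h : Same D D') (h' : Same D' D'') : Same D D'' := by
  obtain ⟨⟨k, hk⟩, h₁, h₂, h₃⟩ := h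
  obtain ⟨⟨l, hl⟩, h₁', h₂', h₃'⟩ := h'
  refine ⟨⟨k + l, fun p q => ?_⟩, h₁'.trans h₁, h₂'.trans h₂, h₃'.trans h₃⟩
  rw [← twist_twist, ← twist_twist, hl, hk]

/-- The diagram that pairs the lifted inner points `i` and `i + 1` (and their translates) and joins
the remaining inner points to the outer points from left to right, in such a way that inner point
`r` is joined to outer point `r` for the remaining `r` in the turn that ends at `i - 1`.  For
`1 < i < 2n` the inner points `r < i` are thus joined to the outer points `r` and the inner points
`r + 2 > i + 1` to the outer points `r`, while for `i = 1` outer point `1` is joined to inner point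
`3`, and for `i = 2n` outer point `1` is joined to inner point `2n - 1`. -/
def cap (a b : AObj) (i : ℕ) : Diagram a b where
  joined
    | .inl x, .inl y => ∃ k : ℤ,
        (x.1 = i + k * a.width ∧ y.1 = i + 1 + k * a.width) ∨
        (y.1 = i + k * a.width ∧ x.1 = i + 1 + k * a.width)
    | .inl x, .inr y => ∃ r k : ℤ, (i : ℤ) - a.width + 2 ≤ r ∧ r ≤ (i : ℤ) - 1 ∧
        x.1 = r + k * a.width ∧ y.1 = r + k * b.width
    | .inr y, .inl x => ∃ r k : ℤ, (i : ℤ) - a.width + 2 ≤ r ∧ r ≤ (i : ℤ) - 1 ∧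
        x.1 = r + k * a.width ∧ y.1 = r + k * b.width
    | .inr _, .inr _ => False
  core := 0
  shadedLoops := 0
  unshadedLoops := 0

/-- The rotation: inner point `x` is joined to outer point `x + 2`. -/
def rot (a : AObj) : Diagram a a where
  joined
    | .inl x, .inr y => y.1 = x.1 + 2
    | .inr y, .inl x => y.1 = x.1 + 2
    | _, _ => False
  core := 0
  shadedLoops := 0
  unshadedLoops := 0

end Diagram

/-- The sign in `H^±` and `cAtl^±`. -/
inductive Sgn : Type
  | plus : Sgn
  | minus : Sgn

/-- `0` for `+` and `1` for `-`. -/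
def Sgn.offset : Sgn → ℕ
  | .plus => 0
  | .minus => 1

/-- For `+`: no loops, only shaded caps, only unshaded cups.  For `-`: no loops, only unshaded caps,
only shaded cups.  The region cut off by a cap or cup with lifted ends `x < y` is next to it in the
gap `(x, x + 1)`, which is shaded exactly if `x` is odd. -/
def Diagram.IsCyclic {a b : AObj} (ε : Sgn) (D : Diagram a b) : Prop :=
  D.core = 0 ∧ D.shadedLoops = 0 ∧ D.unshadedLoops = 0 ∧
    (∀ x y : Pt a, D.joined (.inl x) (.inl y) → x.1 < y.1 →
      match ε with
      | .plus => Odd x.1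
      | .minus => Even x.1) ∧
    (∀ x y : Pt b, D.joined (.inr x) (.inr y) → x.1 < y.1 →
      match ε with
      | .plus => Even x.1
      | .minus => Odd x.1)

instance tangleSetoid (a b : AObj) : Setoid {D : Diagram a b // D.IsTangle} where
  r D D' := Diagram.Same D.1 D'.1
  iseqv := ⟨fun D => .refl D.1, fun h => h.symm, fun h h' => h.trans h'⟩

/-- The set of morphisms from `a` to `b` in `Atl`: diffeomorphism classes of tangles without
contractible loops, together with the two numbers `c₊` and `c₋`. -/
def AtlHom (a b : AObj) : Type := Quotient (tangleSetoid a b)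

/-- The assertion that gluing turns tangles into a category: tangles compose to tangles, the
composite does not depend on the representatives, and it is associative and unital. -/
structure AtlIsCategory : Prop where
  id_isTangle : ∀ a : AObj, (Diagram.id a).IsTangle
  comp_isTangle : ∀ {a b c : AObj} (S : Diagram a b) (T : Diagram b c),
    S.IsTangle → T.IsTangle → (S.comp T).IsTangle
  comp_same : ∀ {a b c : AObj} (S S' : Diagram a b) (T T' : Diagram b c),
    S.IsTangle → S'.IsTangle → T.IsTangle → T'.IsTangle → S.Same S' → T.Same T' →
      (S.comp T).Same (S'.comp T')
  id_comp : ∀ {a b : AObj} (S : Diagram a b), S.IsTangle → ((Diagram.id a).comp S).Same S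
  comp_id : ∀ {a b : AObj} (S : Diagram a b), S.IsTangle → (S.comp (Diagram.id b)).Same S
  assoc : ∀ {a b c d : AObj} (S : Diagram a b) (T : Diagram b c) (U : Diagram c d),
    S.IsTangle → T.IsTangle → U.IsTangle → ((S.comp T).comp U).Same (S.comp (T.comp U))

/-- The objects of the category `Atl`.  (The proof that gluing has the properties of a composition
is a parameter only so that the category structure can be found by inference.) -/
structure Atl (_hA : AtlIsCategory) : Type where
  obj : AObj

/-- The category `Atl`. -/
noncomputable instance atlCategory (hA : AtlIsCategory) : Category.{0} (Atl hA) where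
  Hom X Y := AtlHom X.obj Y.obj
  id X := Quotient.mk (tangleSetoid X.obj X.obj) ⟨Diagram.id X.obj, hA.id_isTangle X.obj⟩
  comp {X Y Z} f g := Quotient.map₂ (sa := tangleSetoid X.obj Y.obj)
    (sb := tangleSetoid Y.obj Z.obj) (sc := tangleSetoid X.obj Z.obj)
    (fun S T => ⟨S.1.comp T.1, hA.comp_isTangle S.1 T.1 S.2 T.2⟩)
    (fun S S' hS T T' hT => hA.comp_same S.1 S'.1 T.1 T'.1 S.2 S'.2 T.2 T'.2 hS hT) f g
  id_comp f := Quotient.inductionOn f fun S => Quotient.sound (hA.id_comp S.1 S.2)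
  comp_id f := Quotient.inductionOn f fun S => Quotient.sound (hA.comp_id S.1 S.2)
  assoc f g h := Quotient.inductionOn₃ f g h fun S T U =>
    Quotient.sound (hA.assoc S.1 T.1 U.1 S.2 T.2 U.2)

/-- The objects `[n]`, `n ≥ 1`, of `cAtl^±`. -/
def cAtlObj (hA : AtlIsCategory) : Set (Atl hA) := {X | ∃ n : ℕ, X.obj = .pos n}

/-- The morphisms of `cAtl^±`. -/
def cAtlHom (hA : AtlIsCategory) (ε : Sgn) : MorphismProperty (Atl hA) := fun X Y f =>
  X ∈ cAtlObj hA ∧ Y ∈ cAtlObj hA ∧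
    ∃ D : {D : Diagram X.obj Y.obj // D.IsTangle}, D.1.IsCyclic ε ∧
      Quotient.mk (tangleSetoid X.obj Y.obj) D = f

/-! ### The annular category `aΔ` by generators and relations -/

/-- The generators of `aΔ`. -/
inductive AGen : AObj → AObj → Type
  | αPlus : AGen (.pos 0) .zeroPlus
  | αMinus : AGen (.pos 0) .zeroMinus
  | α (n i : ℕ) (h₁ : 1 ≤ i) (h₂ : i ≤ 2 * n + 4) : AGen (.pos (n + 1)) (.pos n)
  | βPlus : AGen .zeroPlus (.pos 0)
  | βMinus : AGen .zeroMinus (.pos 0)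
  | β (n i : ℕ) (h₁ : 1 ≤ i) (h₂ : i ≤ 2 * n + 4) : AGen (.pos n) (.pos (n + 1))
  | τ (n : ℕ) : AGen (.pos n) (.pos n)
  | δPlus (a : AObj) : AGen a a
  | δMinus (a : AObj) : AGen a a

/-- The tangles `a_i`, `b_i`, `t`, `(id, 1, 0)`, `(id, 0, 1)` named by the generators. -/
def AGen.diagram : {a b : AObj} → AGen a b → Diagram a b
  | _, _, .αPlus => Diagram.cap _ _ 1
  | _, _, .αMinus => Diagram.cap _ _ 2
  | _, _, .α _ i _ _ => Diagram.cap _ _ i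
  | _, _, .βPlus => (Diagram.cap _ _ 1).star
  | _, _, .βMinus => (Diagram.cap _ _ 2).star
  | _, _, .β _ i _ _ => (Diagram.cap _ _ i).star
  | _, _, .τ _ => Diagram.rot _
  | _, _, .δPlus a => { Diagram.id a with shadedLoops := 1 }
  | _, _, .δMinus a => { Diagram.id a with unshadedLoops := 1 }

/-- The quiver of generators of `aΔ`. -/
instance : Quiver.{0} AObj := ⟨AGen⟩

/-- A generator as a word of length one. -/
def aw {a b : AObj} (e : AGen a b) : (Paths.of AObj).obj a ⟶ (Paths.of AObj).obj b :=
  (Paths.of AObj).map e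

/-- The `k`-fold composite of an endomorphism with itself. -/
def iter {C : Type} [Category.{0} C] {X : C} (f : X ⟶ X) : ℕ → (X ⟶ X)
  | 0 => 𝟙 X
  | k + 1 => iter f k ≫ f

/-- The relations of `aΔ`.  Composition is written diagrammatically, so `α_i α_j` reads
`α_j ≫ α_i`. -/
inductive ARel : HomRel (Paths AObj)
  -- (1) `α_i α_j = α_{j-2} α_i` for `i < j - 1` and `(i, j) ≠ (1, 2n)`
  | α_α (n i j : ℕ) (hi : 1 ≤ i) (hij : i + 1 < j) (hj : j ≤ 2 * n + 6)
      (hne : (i, j) ≠ (1, 2 * n + 6)) :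
      ARel (aw (.α (n + 1) j (by omega) (by omega)) ≫
          aw (.α n i hi (by omega)))
        (aw (.α (n + 1) i hi (by omega)) ≫ aw (.α n (j - 2) (by omega) (by omega)))
  | α_α_plus : ARel (aw (.α 0 3 (by omega) (by omega)) ≫ aw .αPlus)
      (aw (.α 0 1 (by omega) (by omega)) ≫ aw .αPlus)
  | α_α_minus : ARel (aw (.α 0 4 (by omega) (by omega)) ≫ aw .αMinus)
      (aw (.α 0 2 (by omega) (by omega)) ≫ aw .αMinus)
  -- (2) `β_i β_j = β_{j+2} β_i` for `i ≤ j` and `(i, j) ≠ (1, 2n + 2)`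
  | β_β (n i j : ℕ) (hi : 1 ≤ i) (hij : i ≤ j) (hj : j ≤ 2 * n + 4)
      (hne : (i, j) ≠ (1, 2 * n + 4)) :
      ARel (aw (.β n j (by omega) hj) ≫ aw (.β (n + 1) i hi (by omega)))
        (aw (.β n i hi (by omega)) ≫ aw (.β (n + 1) (j + 2) (by omega) (by omega)))
  | β_β_plus : ARel (aw .βPlus ≫ aw (.β 0 1 (by omega) (by omega)))
      (aw .βPlus ≫ aw (.β 0 3 (by omega) (by omega)))
  | β_β_minus : ARel (aw .βMinus ≫ aw (.β 0 2 (by omega) (by omega)))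
      (aw .βMinus ≫ aw (.β 0 4 (by omega) (by omega)))
  -- (3) `τ ^ n = id` on `[n]`
  | τ_pow (n : ℕ) : ARel (iter (aw (.τ n)) (n + 1)) (𝟙 _)
  -- (4) `α_i τ = τ α_{i-2}` for `i ≥ 3`
  | α_τ (n i : ℕ) (hi : 3 ≤ i) (hi' : i ≤ 2 * n + 4) :
      ARel (aw (.τ (n + 1)) ≫ aw (.α n i (by omega) hi'))
        (aw (.α n (i - 2) (by omega) (by omega)) ≫ aw (.τ n))
  -- (5) `β_i τ = τ β_{i-2}` for `i ≥ 3`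
  | β_τ (n i : ℕ) (hi : 3 ≤ i) (hi' : i ≤ 2 * n + 4) :
      ARel (aw (.τ n) ≫ aw (.β n i (by omega) hi'))
        (aw (.β n (i - 2) (by omega) (by omega)) ≫ aw (.τ (n + 1)))
  -- (6) the products `α_i β_j`, first on `[0±]`, then on `[n]` for `n ≥ 1`
  | α_β_zeroPlus : ARel (aw .βPlus ≫ aw .αPlus) (aw (.δPlus .zeroPlus))
  | α_β_zeroMinus : ARel (aw .βMinus ≫ aw .αMinus) (aw (.δMinus .zeroMinus))
  -- `α_1 β_{2n+2} = τ⁻¹`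
  | α_β_first_last (n : ℕ) :
      ARel (aw (.β n (2 * n + 4) (by omega) (by omega)) ≫ aw (.α n 1 (by omega) (by omega)) ≫
        aw (.τ n)) (𝟙 _)
  -- `α_i β_j = β_{j-2} α_i` for `i < j - 1` and `(i, j) ≠ (1, 2n + 2)`
  | α_β_lt (n i j : ℕ) (hi : 1 ≤ i) (hij : i + 1 < j) (hj : j ≤ 2 * n + 6)
      (hne : (i, j) ≠ (1, 2 * n + 6)) :
      ARel (aw (.β (n + 1) j (by omega) (by omega)) ≫ aw (.α (n + 1) i hi (by omega)))
        (aw (.α n i hi (by omega)) ≫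
          aw (.β n (j - 2) (by omega) (by omega)))
  | α_β_lt_plus :
      ARel (aw (.β 0 3 (by omega) (by omega)) ≫ aw (.α 0 1 (by omega) (by omega)))
        (aw .αPlus ≫ aw .βPlus)
  | α_β_lt_minus :
      ARel (aw (.β 0 4 (by omega) (by omega)) ≫ aw (.α 0 2 (by omega) (by omega)))
        (aw .αMinus ≫ aw .βMinus)
  -- `α_i β_{i+1} = id`
  | α_β_succ (n i : ℕ) (hi : 1 ≤ i) (hi' : i + 1 ≤ 2 * n + 4) :
      ARel (aw (.β n (i + 1) (by omega) hi') ≫ aw (.α n i hi (by omega))) (𝟙 _)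
  -- `α_i β_i = δ_±`
  | α_β_odd (n i : ℕ) (hi : 1 ≤ i) (hi' : i ≤ 2 * n + 4) (ho : Odd i) :
      ARel (aw (.β n i hi hi') ≫ aw (.α n i hi hi')) (aw (.δPlus (.pos n)))
  | α_β_even (n i : ℕ) (hi : 1 ≤ i) (hi' : i ≤ 2 * n + 4) (he : Even i) :
      ARel (aw (.β n i hi hi') ≫ aw (.α n i hi hi')) (aw (.δMinus (.pos n)))
  -- `α_{j+1} β_j = id`
  | α_β_pred (n j : ℕ) (hj : 1 ≤ j) (hj' : j + 1 ≤ 2 * n + 4) :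
      ARel (aw (.β n j hj (by omega)) ≫ aw (.α n (j + 1) (by omega) hj')) (𝟙 _)
  -- `α_i β_j = β_j α_{i-2}` for `i > j + 1` and `(i, j) ≠ (2n + 2, 1)`
  | α_β_gt (n i j : ℕ) (hj : 1 ≤ j) (hij : j + 1 < i) (hi : i ≤ 2 * n + 6)
      (hne : (i, j) ≠ (2 * n + 6, 1)) :
      ARel (aw (.β (n + 1) j hj (by omega)) ≫ aw (.α (n + 1) i (by omega) (by omega)))
        (aw (.α n (i - 2) (by omega) (by omega)) ≫
          aw (.β n j hj (by omega)))
  | α_β_gt_plus :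
      ARel (aw (.β 0 1 (by omega) (by omega)) ≫ aw (.α 0 3 (by omega) (by omega)))
        (aw .αPlus ≫ aw .βPlus)
  | α_β_gt_minus :
      ARel (aw (.β 0 2 (by omega) (by omega)) ≫ aw (.α 0 4 (by omega) (by omega)))
        (aw .αMinus ≫ aw .βMinus)
  -- `α_{2n+2} β_1 = τ`
  | α_β_last_first (n : ℕ) :
      ARel (aw (.β n 1 (by omega) (by omega)) ≫ aw (.α n (2 * n + 4) (by omega) (by omega)))
        (aw (.τ n))
  -- (7) `δ_±` commutes with all generators
  | δPlus_comm {a b : AObj} (e : AGen a b) :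
      ARel (aw (.δPlus a) ≫ aw e) (aw e ≫ aw (.δPlus b))
  | δMinus_comm {a b : AObj} (e : AGen a b) :
      ARel (aw (.δMinus a) ≫ aw e) (aw e ≫ aw (.δMinus b))

/-- The annular category `aΔ`. -/
abbrev ADelta : Type := CategoryTheory.Quotient ARel

/-- The generators as morphisms of `aΔ`. -/
def ADelta.gens : AObj ⥤q ADelta := Paths.of AObj ⋙q (Quotient.functor ARel).toPrefunctor

/-- The assignments `[n] ↦ [n]`, `α_i ↦ a_i`, `β_i ↦ b_i`, `τ ↦ t`, `δ₊ ↦ (id, 1, 0)`,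
`δ₋ ↦ (id, 0, 1)` on objects and generators. -/
def FGen (hA : AtlIsCategory) (hg : ∀ (a b : AObj) (e : AGen a b), e.diagram.IsTangle) :
    AObj ⥤q Atl hA where
  obj a := ⟨a⟩
  map {a b} e := Quotient.mk (tangleSetoid a b) ⟨AGen.diagram e, hg a b e⟩

/-! ### The opposite of the cyclic category by generators and relations -/

/-- The generators of `cΔᵒᵖ`. -/
inductive CGen : ℕ → ℕ → Type
  | d (n i : ℕ) (h : i ≤ n + 1) : CGen (n + 1) n
  | s (n i : ℕ) (h : i ≤ n) : CGen n (n + 1)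
  | t (n : ℕ) : CGen n n

/-- The objects `[n]`, `n ≥ 0`, of `cΔᵒᵖ`, and the quiver of its generators. -/
structure CObj : Type where
  idx : ℕ

instance : Quiver.{0} CObj := ⟨fun X Y => CGen X.idx Y.idx⟩

/-- A generator as a word of length one. -/
def cw {m n : ℕ} (e : CGen m n) : (Paths.of CObj).obj ⟨m⟩ ⟶ (Paths.of CObj).obj ⟨n⟩ :=
  (Paths.of CObj).map (X := ⟨m⟩) (Y := ⟨n⟩) e

/-- The relations of `cΔᵒᵖ`, composition being written diagrammatically. -/
inductive CRel : HomRel (Paths CObj)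
  -- (1) `d_i d_j = d_{j-1} d_i` for `i < j`
  | d_d (n i j : ℕ) (hij : i < j) (hj : j ≤ n + 2) :
      CRel (cw (.d (n + 1) j hj) ≫ cw (.d n i (by omega)))
        (cw (.d (n + 1) i (by omega)) ≫ cw (.d n (j - 1) (by omega)))
  -- (2) `s_i s_j = s_{j+1} s_i` for `i ≤ j`
  | s_s (n i j : ℕ) (hij : i ≤ j) (hj : j ≤ n) :
      CRel (cw (.s n j hj) ≫ cw (.s (n + 1) i (by omega)))
        (cw (.s n i (by omega)) ≫ cw (.s (n + 1) (j + 1) (by omega)))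
  -- (3) `d_i s_j = s_{j-1} d_i` for `i < j`, `= id` for `i = j, j + 1`, `= s_j d_{i-1}` otherwise
  | d_s_lt (n i j : ℕ) (hij : i < j) (hj : j ≤ n + 1) :
      CRel (cw (.s (n + 1) j hj) ≫ cw (.d (n + 1) i (by omega)))
        (cw (.d n i (by omega)) ≫ cw (.s n (j - 1) (by omega)))
  | d_s_eq (n i : ℕ) (hi : i ≤ n) :
      CRel (cw (.s n i hi) ≫ cw (.d n i (by omega))) (𝟙 _)
  | d_s_succ (n j : ℕ) (hj : j ≤ n) :
      CRel (cw (.s n j hj) ≫ cw (.d n (j + 1) (by omega))) (𝟙 _)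
  | d_s_gt (n i j : ℕ) (hij : j + 1 < i) (hi : i ≤ n + 2) :
      CRel (cw (.s (n + 1) j (by omega)) ≫ cw (.d (n + 1) i hi))
        (cw (.d n (i - 1) (by omega)) ≫ cw (.s n j (by omega)))
  -- (4) `t ^ (n + 1) = id` on `[n]`
  | t_pow (n : ℕ) : CRel (iter (cw (.t n)) (n + 1)) (𝟙 _)
  -- (5) `d_i t = t d_{i-1}` on `[n]` for `1 ≤ i ≤ n`
  | d_t (n i : ℕ) (hi : 1 ≤ i) (hi' : i ≤ n + 1) :
      CRel (cw (.t (n + 1)) ≫ cw (.d n i hi')) (cw (.d n (i - 1) (by omega)) ≫ cw (.t n))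
  -- (6) `s_i t = t s_{i-1}` on `[n]` for `1 ≤ i ≤ n`
  | s_t (n i : ℕ) (hi : 1 ≤ i) (hi' : i ≤ n) :
      CRel (cw (.t n) ≫ cw (.s n i hi')) (cw (.s n (i - 1) (by omega)) ≫ cw (.t (n + 1)))

/-- The opposite `cΔᵒᵖ` of the cyclic category. -/
abbrev CDeltaOp : Type := CategoryTheory.Quotient CRel

/-- The generators as morphisms of `cΔᵒᵖ`. -/
def CDeltaOp.gens : CObj ⥤q CDeltaOp := Paths.of CObj ⋙q (Quotient.functor CRel).toPrefunctor

/-- The generator of `aΔ` assigned to a generator of `cΔᵒᵖ`: for `+` these are `d_j ↦ α_{2j+1}`,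
`s_j ↦ β_{2j+2}`, `t ↦ τ`, and for `-` they are `d_j ↦ α_{2j+2}`, `s_j ↦ β_{2j+3}`, `t ↦ τ`. -/
def CGen.toAGen (ε : Sgn) : {m n : ℕ} → CGen m n → AGen (.pos m) (.pos n)
  | _, _, .d n j h => .α n (2 * j + 1 + ε.offset) (by omega)
      (by cases ε <;> simp only [Sgn.offset] <;> omega)
  | _, _, .s n j h => .β n (2 * j + 2 + ε.offset) (by omega)
      (by cases ε <;> simp only [Sgn.offset] <;> omega)
  | _, _, .t n => .τ n

/-- The assignments of `H^±` on objects (`[n] ↦ [n + 1]`) and on generators. -/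
def HGen (ε : Sgn) : CObj ⥤q ADelta where
  obj X := ADelta.gens.obj (.pos X.idx)
  map e := ADelta.gens.map (CGen.toAGen ε e)

/-! ### Subcategories -/

/-- A subcategory: a set of objects and a collection of morphisms between them that contains the
identities and is closed under composition. -/
structure Subcat (C : Type) [Category.{0} C] where
  obj : Set C
  hom : MorphismProperty C
  source_mem : ∀ {X Y : C} (f : X ⟶ Y), hom f → X ∈ obj
  target_mem : ∀ {X Y : C} (f : X ⟶ Y), hom f → Y ∈ obj
  id_mem : ∀ X ∈ obj, hom (𝟙 X)
  comp_mem : ∀ {X Y Z : C} (f : X ⟶ Y) (g : Y ⟶ Z), hom f → hom g → hom (f ≫ g)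

/-- The objects of a subcategory. -/
def Subcat.Carrier {C : Type} [Category.{0} C] (S : Subcat C) : Type := {X : C // X ∈ S.obj}

/-- A subcategory is a category. -/
instance {C : Type} [Category.{0} C] (S : Subcat C) : Category.{0} S.Carrier where
  Hom X Y := {f : X.1 ⟶ Y.1 // S.hom f}
  id X := ⟨𝟙 X.1, S.id_mem X.1 X.2⟩
  comp f g := ⟨f.1 ≫ g.1, S.comp_mem f.1 g.1 f.2 g.2⟩
  id_comp f := Subtype.ext (Category.id_comp f.1)
  comp_id f := Subtype.ext (Category.comp_id f.1)
  assoc f g h := Subtype.ext (Category.assoc f.1 g.1 h.1)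

/-- The inclusion functor of a subcategory. -/
def Subcat.incl {C : Type} [Category.{0} C] (S : Subcat C) : S.Carrier ⥤ C where
  obj X := X.1
  map f := f.1

/-- A functor is an isomorphism of categories. -/
def IsIsoOfCats {C D : Type} [Category.{0} C] [Category.{0} D] (E : C ⥤ D) : Prop :=
  ∃ G : D ⥤ C, E ⋙ G = 𝟭 C ∧ G ⋙ E = 𝟭 D

end Annular

namespace Annular

/-! ### Lifted marked points -/

/-! On the universal cover a tangle is a planar periodic perfect matching of two lines of integers.
Most of the work is to show that gluing such matchings behaves like gluing tangles.

Gluing: each component of the union of two matchings has at most two ends on the outer boundary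
(`outer_unique`, an argument about two involutions). A component with an end is finite, because it
cannot contain two translates of one point, and counting modulo `2` provides the second end. The
Jordan curve theorem is replaced by `lev`: for a finite union of components, the parity of the
number of its points to the right of a given point, corrected by the coordinate at its own points,
is constant along strings (`lev_eq`). This shows that the strings of a composite do not cross, that
a through string leaves no room for a winding loop, and that the leftmost points of a closed loop on
two circles have the same parity, so that the shade of a loop does not depend on the bracketing. The
checkerboard conditions of two tangles add up to that of the composite, once it is known that a
winding loop meets a transversal an odd number of times (`PeriodicMatching.odd_crossings`, a
displacement argument). For associativity both bracketings are compared with the components of the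
union of all three tangles (`conn₃_acd`, `conn₃_abd`, `ncard_loops_assoc`).

The functors: the relations of `aΔ` are checked in `Atl` at the points of a single turn, up to
reflection, and the relations of `cΔᵒᵖ` are instances of those of `aΔ`.

Faithfulness: every morphism of `cΔᵒᵖ` is a composite of generators `d`, followed by generators `s`
and `t` (`isDST`). The tangle of a word shows, by its caps and cups, which `d_i` can be split off in
front and which `s_0 ≫ t ^ j` at the end (`IsDST.startsD`, `IsST.endsS`). As these are split
epimorphisms and split monomorphisms, two words with the same tangle can be shortened simultaneously
until only rotations are left, and these are told apart by their shifts. So `F ∘ H^±` is faithful,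
and then so is `H^±`.

Image: the parity conditions force caps and cups to join neighbours, force through strings to exist,
and are stable under composition without creating loops (`Cyc.comp`). Conversely a cyclic tangle
with a cap factors, after a rotation, through the tangle of `d_0` (`exists_factor`); cups are
treated by reflection, and a tangle with neither is an even shift. So the image is exactly `cAtl^±`.
-/

theorem Pt.ext_val {a : AObj} {x y : Pt a} (h : x.1 = y.1) : x = y := Subtype.ext h

theorem Pt.turn_val {a : AObj} (k : ℤ) (x : Pt a) : (x.turn k).1 = x.1 + k * (a.width : ℤ) := rfl

theorem Pt.turn_zero {a : AObj} (x : Pt a) : x.turn 0 = x := Pt.ext_val (by simp [Pt.turn_val])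

theorem Pt.turn_turn {a : AObj} (j k : ℤ) (x : Pt a) : (x.turn j).turn k = x.turn (j + k) :=
  Pt.ext_val (by simp only [Pt.turn_val]; ring)

theorem Pt.width_pos {a : AObj} (x : Pt a) : (0 : ℤ) < a.width := by exact_mod_cast x.2

theorem Pt.turn_injective {a : AObj} (x : Pt a) : Function.Injective fun k => x.turn k := by
  intro j k h
  have := congrArg Subtype.val h
  have hw := x.width_pos
  simp only [Pt.turn, add_right_inj, mul_eq_mul_right_iff] at this
  omega

theorem AObj.two_dvd_width (a : AObj) : (2 : ℤ) ∣ a.width := by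
  cases a <;> simp [AObj.width]

theorem AObj.width_cast (a : AObj) : ((a.width : ℤ) : ZMod 2) = 0 :=
  (ZMod.intCast_zmod_eq_zero_iff_dvd _ 2).2 (by exact_mod_cast a.two_dvd_width)

theorem Pt.turn_cast {a : AObj} (k : ℤ) (x : Pt a) : ((x.turn k).1 : ZMod 2) = (x.1 : ZMod 2) := by
  rw [Pt.turn_val, Int.cast_add, Int.cast_mul, AObj.width_cast, mul_zero, add_zero]

/-- The existence of a marked point rules out `[0±]`, where the shade is constant. -/
theorem Pt.shade {a : AObj} (x : Pt a) (g : ℤ) : a.shade g = (g : ZMod 2) := by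
  have := x.2
  cases a <;> simp_all [AObj.width, AObj.shade]

theorem Pt.finite_Icc {a : AObj} (l u : ℤ) : {x : Pt a | l ≤ x.1 ∧ x.1 ≤ u}.Finite :=
  (Set.finite_Icc l u).preimage (f := fun x : Pt a => x.1) fun _ _ _ _ h => Pt.ext_val h

/-- The number of the turn in which a lifted marked point lies. -/
def Pt.idx {a : AObj} (x : Pt a) : ℤ := x.1 / a.width

theorem Pt.idx_turn {a : AObj} (k : ℤ) (x : Pt a) : (x.turn k).idx = x.idx + k := by
  have := x.width_pos
  simp only [Pt.idx, Pt.turn_val]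
  rw [Int.add_mul_ediv_right _ _ (by omega)]

theorem Pt.finite_idx {a : AObj} (K : ℤ) : {x : Pt a | -K ≤ x.idx ∧ x.idx ≤ K}.Finite := by
  refine (Pt.finite_Icc (-K * a.width) ((K + 1) * a.width)).subset ?_
  rintro x ⟨h₁, h₂⟩
  have hw := x.width_pos
  have e₁ : x.idx * a.width ≤ x.1 := Int.ediv_mul_le _ (by omega)
  have e₂ : x.1 < (x.idx + 1) * a.width := Int.lt_ediv_add_one_mul_self _ hw
  constructor <;> nlinarith

namespace Bdry
variable {a b : AObj}

/-- The number of the turn in which a lifted marked point lies. -/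
def idx : Bdry a b → ℤ := Sum.elim Pt.idx Pt.idx

theorem turn_zero (p : Bdry a b) : p.turn 0 = p := by
  rcases p with x | y
  · exact congrArg Sum.inl x.turn_zero
  · exact congrArg Sum.inr y.turn_zero

theorem turn_turn (j k : ℤ) (p : Bdry a b) : (p.turn j).turn k = p.turn (j + k) := by
  rcases p with x | y
  · exact congrArg Sum.inl (x.turn_turn j k)
  · exact congrArg Sum.inr (y.turn_turn j k)

theorem turn_inj (k : ℤ) {p q : Bdry a b} : p.turn k = q.turn k ↔ p = q := by
  refine ⟨fun h => ?_, fun h => h ▸ rfl⟩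
  have := congrArg (Bdry.turn (-k)) h
  simpa only [turn_turn, add_neg_cancel, turn_zero] using this

theorem turn_injective (p : Bdry a b) : Function.Injective fun k => p.turn k := by
  intro j k h
  rcases p with x | y
  · exact x.turn_injective (Sum.inl_injective h)
  · exact y.turn_injective (Sum.inr_injective h)

theorem idx_turn (k : ℤ) (p : Bdry a b) : (p.turn k).idx = p.idx + k := by
  rcases p with x | y <;> exact Pt.idx_turn _ _

theorem finite_idx (K : ℤ) : {p : Bdry a b | -K ≤ p.idx ∧ p.idx ≤ K}.Finite := by
  refine (((Pt.finite_idx (a := a) K).image Sum.inl).union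
    ((Pt.finite_idx (a := b) K).image Sum.inr)).subset ?_
  rintro (x | y) h
  · exact Or.inl ⟨x, h, rfl⟩
  · exact Or.inr ⟨y, h, rfl⟩

theorem not_before_self (p : Bdry a b) : ¬ p.before p := by
  rcases p with x | y <;> simp [before]

theorem before_trichotomy (p q : Bdry a b) : p.before q ∨ p = q ∨ q.before p := by
  rcases p with x | x <;> rcases q with y | y
  · rcases lt_trichotomy x.1 y.1 with h | h | h
    · exact Or.inl h
    · exact Or.inr (Or.inl (congrArg Sum.inl (Pt.ext_val h)))
    · exact Or.inr (Or.inr h)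
  · exact Or.inl trivial
  · exact Or.inr (Or.inr trivial)
  · rcases lt_trichotomy x.1 y.1 with h | h | h
    · exact Or.inr (Or.inr h)
    · exact Or.inr (Or.inl (congrArg Sum.inr (Pt.ext_val h)))
    · exact Or.inl h

theorem before_swap (p q : Bdry a b) : Bdry.before p.swap q.swap ↔ q.before p := by
  rcases p with x | x <;> rcases q with y | y <;> simp [before]

theorem map_turn {f : Bdry a b → Bdry a b} (h : ∀ p, f (p.turn 1) = (f p).turn 1) (k : ℤ)
    (p : Bdry a b) : f (p.turn k) = (f p).turn k := by
  induction k using Int.induction_on generalizing p with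
  | zero => simp only [Bdry.turn_zero]
  | succ k ih => rw [← Bdry.turn_turn, h, ih, Bdry.turn_turn]
  | pred k ih =>
    rw [← Bdry.turn_inj 1, ← h, Bdry.turn_turn, Bdry.turn_turn, sub_add_cancel, ih]

/-- The displacement in turns is invariant under turns, so its bound over the finitely many points
of turn `0` holds everywhere. -/
theorem exists_idx_bound {f : Bdry a b → Bdry a b} (h : ∀ p, f (p.turn 1) = (f p).turn 1) :
    ∃ C : ℤ, ∀ p, |(f p).idx - p.idx| ≤ C := by
  have hf : {p : Bdry a b | p.idx = 0}.Finite := (Bdry.finite_idx 0).subset fun p (hp : _ = _) => by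
    simp [hp]
  obtain ⟨C, hC⟩ := (hf.image fun p => |(f p).idx - p.idx|).bddAbove
  refine ⟨C, fun p => ?_⟩
  have := hC ⟨p.turn (-p.idx), by simp [Bdry.idx_turn], rfl⟩
  simpa only [map_turn h, Bdry.idx_turn, add_sub_add_right_eq_sub] using this

/-- An equivariant map displaces points by a bounded number of turns, so only points near the
transversal can change sides. -/
theorem finite_separated {f : Bdry a b → Bdry a b} (h : ∀ p, f (p.turn 1) = (f p).turn 1)
    (g k : ℤ) : {p : Bdry a b | p.left g k ∧ ¬ (f p).left g k}.Finite := by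
  obtain ⟨C, hC⟩ := exists_idx_bound h
  have aux : ∀ {a : AObj} (x : Pt a) (g : ℤ), (x.1 ≤ g → x.idx ≤ |g / a.width|) ∧
      (¬ x.1 ≤ g → -|g / a.width| ≤ x.idx) := fun x g => by
    have := x.width_pos
    refine ⟨fun e => (Int.ediv_le_ediv this e).trans (le_abs_self _), fun e => ?_⟩
    exact (neg_abs_le _).trans (Int.ediv_le_ediv this (by omega))
  refine (Bdry.finite_idx (|g / a.width| + |k / b.width| + |C|)).subset ?_
  rintro p ⟨hp, hq⟩
  have e₁ : p.idx ≤ |g / a.width| + |k / b.width| := by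
    rcases p with x | x
    · exact ((aux x g).1 hp).trans (le_add_of_nonneg_right (abs_nonneg _))
    · exact ((aux x k).1 hp).trans (le_add_of_nonneg_left (abs_nonneg _))
  have e₃ := abs_le.1 (hC p)
  have e₂ : -(|g / a.width| + |k / b.width|) ≤ (f p).idx := by
    have h₁ := abs_nonneg (g / a.width : ℤ)
    have h₂ := abs_nonneg (k / b.width : ℤ)
    generalize f p = q at hq
    rcases q with x | x
    · have := (aux x g).2 hq
      show _ ≤ x.idx
      omega
    · have := (aux x k).2 hq
      show _ ≤ x.idx
      omega
  have e₄ := le_abs_self C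
  have e₅ := abs_nonneg C
  constructor <;> omega

end Bdry

namespace Diagram.IsTangle
variable {a b : AObj} {D : Diagram a b}

/-! ### The strings of a single tangle -/

theorem eq_of_joined (h : D.IsTangle) {p q r : Bdry a b} (hq : D.joined p q)
    (hr : D.joined p r) : q = r := (h.existsUnique p).unique hq hr

/-- The other end of the lifted string at a marked point. -/
noncomputable def mate (h : D.IsTangle) (p : Bdry a b) : Bdry a b := (h.existsUnique p).choose

theorem joined_mate (h : D.IsTangle) (p : Bdry a b) : D.joined p (h.mate p) :=
  (h.existsUnique p).choose_spec.1

theorem mate_eq (h : D.IsTangle) {p q : Bdry a b} (hq : D.joined p q) : h.mate p = q :=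
  h.eq_of_joined (h.joined_mate p) hq

theorem mate_mate (h : D.IsTangle) (p : Bdry a b) : h.mate (h.mate p) = p :=
  h.mate_eq (h.symm _ _ (h.joined_mate p))

theorem mate_ne (h : D.IsTangle) (p : Bdry a b) : h.mate p ≠ p := fun e =>
  h.irrefl p (by simpa only [e] using h.joined_mate p)

theorem mate_turn_one (h : D.IsTangle) (p : Bdry a b) : h.mate (p.turn 1) = (h.mate p).turn 1 :=
  h.mate_eq (h.periodic _ _ (h.joined_mate p))

theorem mate_turn (h : D.IsTangle) (k : ℤ) (p : Bdry a b) :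
    h.mate (p.turn k) = (h.mate p).turn k :=
  Bdry.map_turn h.mate_turn_one k p

theorem joined_turn (h : D.IsTangle) (k : ℤ) {p q : Bdry a b} :
    D.joined (p.turn k) (q.turn k) ↔ D.joined p q := by
  constructor
  · intro e
    have := h.mate_eq e
    rw [mate_turn, Bdry.turn_inj] at this
    exact this ▸ h.joined_mate p
  · intro e
    rw [← h.mate_eq e, ← mate_turn]
    exact h.joined_mate _

/-- A string that leaves the arc cut off by another one would cross it. This is the form in which
planarity is mostly used. -/
theorem between_closed (h : D.IsTangle) {p p' q q' : Bdry a b} (hp : D.joined p p')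
    (hq : D.joined q q') (h₁ : p.before q) (h₂ : q.before p') : p.before q' ∧ q'.before p' := by
  constructor
  · rcases Bdry.before_trichotomy p q' with e | e | e
    · exact e
    · subst e
      have := h.eq_of_joined hp (h.symm _ _ hq)
      exact absurd (this ▸ h₂) (Bdry.not_before_self _)
    · exact absurd ⟨e, h₁, h₂⟩ (h.planar _ _ _ _ (h.symm _ _ hq) hp)
  · rcases Bdry.before_trichotomy q' p' with e | e | e
    · exact e
    · subst e
      have := h.eq_of_joined (h.symm _ _ hp) (h.symm _ _ hq)
      exact absurd (this ▸ h₁) (Bdry.not_before_self _)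
    · exact absurd ⟨h₁, h₂, e⟩ (h.planar _ _ _ _ hp hq)

open Classical in
/-- A finite union of strings has an even number of ends between the ends of a string. -/
theorem sum_between (h : D.IsTangle) {P : Finset (Bdry a b)}
    (hP : ∀ p q, D.joined p q → p ∈ P → q ∈ P) {p p' : Bdry a b} (hp : D.joined p p') :
    ∑ v ∈ P, (if p.before v ∧ v.before p' then (1 : ZMod 2) else 0) = 0 := by
  refine Finset.sum_involution (fun v _ => h.mate v) ?_ (fun v _ _ => h.mate_ne v)
    (fun v hv => hP _ _ (h.joined_mate v) hv) (fun v _ => h.mate_mate v)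
  intro v _
  by_cases e : p.before v ∧ v.before p'
  · rw [if_pos e, if_pos (h.between_closed hp (h.joined_mate v) e.1 e.2)]; rfl
  · rw [if_neg e, if_neg, add_zero]
    intro e'
    have := h.between_closed hp (h.symm _ _ (h.joined_mate v)) e'.1 e'.2
    exact e this

/-- The integers strictly between the ends are paired among themselves, so there is an even number
of them. -/
theorem odd_of_inl_inl (h : D.IsTangle) {x y : Pt a} (hj : D.joined (.inl x) (.inl y)) :
    (x.1 : ZMod 2) = y.1 + 1 := by
  classical
  wlog hxy : x.1 < y.1 generalizing x y
  · rcases lt_trichotomy x.1 y.1 with e | e | e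
    · exact absurd e hxy
    · obtain rfl := Pt.ext_val e
      exact absurd hj (h.irrefl _)
    · rw [this (h.symm _ _ hj) e, add_assoc, CharTwo.add_self_eq_zero, add_zero]
  let e : ℤ ↪ Bdry a b := ⟨fun t => .inl ⟨t, x.2⟩, fun s t hst => by
    simpa using congrArg Subtype.val (Sum.inl_injective hst)⟩
  have key := h.sum_between (P := (Finset.Ioo x.1 y.1).map e) (fun p q hpq hp => by
    simp only [Finset.mem_map, Finset.mem_Ioo] at hp
    obtain ⟨t, ⟨ht, ht'⟩, rfl⟩ := hp
    have := h.between_closed hj hpq ht ht'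
    rcases q with q | q
    · simp only [Finset.mem_map, Finset.mem_Ioo]
      exact ⟨q.1, this, rfl⟩
    · exact this.2.elim) hj
  rw [Finset.sum_map, Finset.sum_congr rfl (g := fun _ => (1 : ZMod 2))] at key
  · rw [Finset.sum_const, Int.card_Ioo, nsmul_eq_mul, mul_one] at key
    have e₂ : (((y.1 - x.1 - 1).toNat : ℤ) : ZMod 2) = 0 := by exact_mod_cast key
    rw [Int.toNat_of_nonneg (by omega)] at e₂
    push_cast at e₂
    rw [sub_sub, sub_eq_zero] at e₂
    rw [e₂, add_assoc, CharTwo.add_self_eq_zero, add_zero]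
  · intro t ht
    rw [Finset.mem_Ioo] at ht
    exact if_pos ht

/-- A transversal that runs along the string, just to its right, meets no string, and there are no
non-contractible loops beside a through string. The checkerboard condition then compares the two
shades. -/
theorem joined_inr_inl_eq (h : D.IsTangle) {x : Pt a} {y : Pt b}
    (hj : D.joined (.inl x) (.inr y)) : (x.1 : ZMod 2) = y.1 := by
  have hc := h.checkerboard x.1 y.1
  have h0 : D.crossings x.1 y.1 = 0 := by
    rw [crossings]
    convert Set.ncard_empty (Bdry a b)
    refine Set.eq_empty_of_forall_notMem ?_
    rintro p ⟨hp, q, hpq, hq⟩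
    have hq' : Bdry.before (.inl x) q ∧ q.before (.inr y) := by
      rcases q with q | q <;> simpa [Bdry.before, Bdry.left] using hq
    have := h.between_closed hj (h.symm _ _ hpq) hq'.1 hq'.2
    rcases p with p | p <;> simp [Bdry.before, Bdry.left] at this hp <;> omega
  rw [h0, h.core_eq_zero _ _ hj, x.shade, y.shade, Nat.cast_zero] at hc
  rw [eq_comm, add_comm, ← CharTwo.sub_eq_add, sub_eq_zero] at hc
  exact hc.symm

theorem star (h : D.IsTangle) : D.star.IsTangle where
  symm p q := h.symm _ _
  irrefl p := h.irrefl _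
  existsUnique p := by
    obtain ⟨q, hq, hu⟩ := h.existsUnique p.swap
    refine ⟨q.swap, by simpa [Diagram.star] using hq, fun r hr => ?_⟩
    rw [← hu r.swap hr, Sum.swap_swap]
  periodic p q hpq := by
    have := h.periodic _ _ hpq
    rcases p with p | p <;> rcases q with q | q <;> exact this
  planar p p' q q' hp hq := by
    rintro ⟨h₁, h₂, h₃⟩
    -- Reflection reverses the boundary order, so the interleaved quadruple is read backwards.
    exact h.planar _ _ _ _ (h.symm _ _ hq) (h.symm _ _ hp)
      ⟨(Bdry.before_swap _ _).2 h₃, (Bdry.before_swap _ _).2 h₂, (Bdry.before_swap _ _).2 h₁⟩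
  core_eq_zero x y hxy := h.core_eq_zero y x (h.symm _ _ hxy)
  checkerboard g k := by
    have e : D.star.crossings g k = D.crossings k g := by
      refine Set.ncard_congr (fun p _ => p.swap) ?_ (fun p q _ _ e => Sum.swap_rightInverse.injective e) ?_
      · rintro p ⟨hp, q, hpq, hq⟩
        refine ⟨?_, q.swap, hpq, ?_⟩
        · rcases p with p | p <;> exact hp
        · rcases q with q | q <;> exact hq
      · rintro p ⟨hp, q, hpq, hq⟩
        refine ⟨p.swap, ⟨?_, q.swap, by simpa [Diagram.star] using hpq, ?_⟩, p.swap_swap⟩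
        · rcases p with p | p <;> exact hp
        · rcases q with q | q <;> exact hq
    rw [e, add_comm (b.shade g)]
    exact h.checkerboard k g

theorem crossings_eq (h : D.IsTangle) (g k : ℤ) :
    {p : Bdry a b | p.left g k ∧ ∃ q, D.joined p q ∧ ¬ q.left g k} =
      {p : Bdry a b | p.left g k ∧ ¬ (h.mate p).left g k} := by
  ext p
  exact and_congr_right fun _ =>
    ⟨fun ⟨q, hq, hq'⟩ => h.mate_eq hq ▸ hq', fun hp => ⟨_, h.joined_mate p, hp⟩⟩

theorem finite_crossings (h : D.IsTangle) (g k : ℤ) :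
    {p : Bdry a b | p.left g k ∧ ∃ q, D.joined p q ∧ ¬ q.left g k}.Finite := by
  rw [h.crossings_eq]
  exact Bdry.finite_separated h.mate_turn_one g k

end Diagram.IsTangle

/-! ### Counting the ends of finite families of strings -/

/-- The parity of the number of points of a finite set to the right of a point. -/
def rk {a : AObj} (A : Finset (Pt a)) (x : Pt a) : ZMod 2 := ∑ v ∈ A, if x.1 < v.1 then 1 else 0

open Classical in
/-- The parity of `rk`, corrected by the coordinate for the points of the set. -/
noncomputable def lev {a : AObj} (A : Finset (Pt a)) (x : Pt a) : ZMod 2 :=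
  rk A x + if x ∈ A then (x.1 : ZMod 2) else 0

/-- Finite sets of inner and outer points that are unions of strings. -/
def Diagram.Closed {a b : AObj} (D : Diagram a b) (A : Finset (Pt a)) (B : Finset (Pt b)) : Prop :=
  ∀ p q, D.joined p q → p ∈ A.disjSum B → q ∈ A.disjSum B

namespace Diagram.IsTangle
variable {a b : AObj} {D : Diagram a b}

theorem _root_.Annular.Diagram.Closed.star {A : Finset (Pt a)} {B : Finset (Pt b)}
    (hAB : D.Closed A B) : D.star.Closed B A := by
  intro p q hpq hp
  have := hAB _ _ hpq (by rcases p with p | p <;> simpa using hp)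
  rcases q with q | q <;> simpa using this

theorem closed_iff (h : D.IsTangle) {A : Finset (Pt a)} {B : Finset (Pt b)} (hAB : D.Closed A B)
    {p q : Bdry a b} (hpq : D.joined p q) : p ∈ A.disjSum B ↔ q ∈ A.disjSum B :=
  ⟨hAB _ _ hpq, hAB _ _ (h.symm _ _ hpq)⟩

-- For `x < y` the two ranks differ by the points of `A` after `x` and up to `y`. Those strictly
-- between are paired up, which leaves `y`, and `y ∈ A` if and only if `x ∈ A`.
open Classical in
theorem rk_inl_inl (h : D.IsTangle) {A : Finset (Pt a)} {B : Finset (Pt b)} (hAB : D.Closed A B)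
    {x y : Pt a} (hj : D.joined (.inl x) (.inl y)) : rk A x = rk A y + if x ∈ A then 1 else 0 := by
  have hxy : x ∈ A ↔ y ∈ A := by simpa using h.closed_iff hAB hj
  wlog hlt : x.1 < y.1 generalizing x y
  · rcases lt_trichotomy x.1 y.1 with e | e | e
    · exact absurd e hlt
    · obtain rfl := Pt.ext_val e
      exact absurd hj (h.irrefl _)
    · rw [this (h.symm _ _ hj) hxy.symm e, add_assoc]
      simp only [hxy, CharTwo.add_self_eq_zero, add_zero]
  have key := h.sum_between (P := A.disjSum B) hAB hj
  rw [Finset.sum_disjSum, Finset.sum_eq_zero (s := B), add_zero] at key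
  · have e₂ : (if x ∈ A then (1 : ZMod 2) else 0) = ∑ v ∈ A, if v = y then 1 else 0 := by
      rw [Finset.sum_ite_eq' A y fun _ => (1 : ZMod 2)]
      simp only [hxy]
    rw [e₂, rk, rk, ← Finset.sum_add_distrib, ← sub_eq_zero, ← Finset.sum_sub_distrib]
    refine (Finset.sum_congr rfl fun v _ => ?_).trans key
    simp only [Bdry.before]
    have : v = y ↔ v.1 = y.1 := ⟨congrArg _, Pt.ext_val⟩
    rw [this]
    rcases lt_trichotomy v.1 y.1 with e | e | e
    · simp [e, e.ne, e.le.not_gt]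
    · simp [e, hlt]
    · simp [e, e.ne', e.le.not_gt, hlt.trans e]
  · intro v _
    simp [Bdry.before]

/-- The points of `A` to the right of `x` and those of `B` to the right of `y` are together the
points between the two ends in the boundary order, and these are paired up. -/
theorem rk_inl_inr (h : D.IsTangle) {A : Finset (Pt a)} {B : Finset (Pt b)} (hAB : D.Closed A B)
    {x : Pt a} {y : Pt b} (hj : D.joined (.inl x) (.inr y)) : rk A x = rk B y := by
  classical
  have key := h.sum_between (P := A.disjSum B) hAB hj
  rw [Finset.sum_disjSum, ← CharTwo.sub_eq_add, sub_eq_zero] at key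
  simpa [Bdry.before, rk] using key

/-- The quantity `lev` is constant along the strings of a tangle. -/
theorem lev_eq (h : D.IsTangle) {A : Finset (Pt a)} {B : Finset (Pt b)} (hAB : D.Closed A B)
    {p q : Bdry a b} (hj : D.joined p q) :
    Sum.elim (lev A) (lev B) p = Sum.elim (lev A) (lev B) q := by
  have inl_inl : ∀ {a b : AObj} {D : Diagram a b} (h : D.IsTangle) {A : Finset (Pt a)}
      {B : Finset (Pt b)} (hAB : D.Closed A B) {x y : Pt a} (hj : D.joined (.inl x) (.inl y)),
      lev A x = lev A y := by
    intro a b D h A B hAB x y hj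
    have hxy : x ∈ A ↔ y ∈ A := by simpa using h.closed_iff hAB hj
    -- Along a cap of the family both the rank and the coordinate change parity, and the two changes
    -- cancel.
    rw [lev, lev, h.rk_inl_inl hAB hj, h.odd_of_inl_inl hj, add_assoc]
    by_cases e : x ∈ A
    · rw [if_pos e, if_pos e, if_pos (hxy.1 e)]
      linear_combination (CharTwo.add_self_eq_zero (1 : ZMod 2))
    · rw [if_neg e, if_neg e, if_neg (hxy.not.1 e), add_zero]
  have inl_inr : ∀ {x : Pt a} {y : Pt b}, D.joined (.inl x) (.inr y) → lev A x = lev B y := by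
    intro x y hj
    have hxy : x ∈ A ↔ y ∈ B := by simpa using h.closed_iff hAB hj
    rw [lev, lev, h.rk_inl_inr hAB hj, h.joined_inr_inl_eq hj]
    by_cases e : x ∈ A
    · rw [if_pos e, if_pos (hxy.1 e)]
    · rw [if_neg e, if_neg (hxy.not.1 e)]
  rcases p with x | x <;> rcases q with y | y
  · exact inl_inl h hAB hj
  · exact inl_inr hj
  · exact (inl_inr (h.symm _ _ hj)).symm
  · exact inl_inl h.star hAB.star hj

/-- The ends of a finite union of strings are even in number. -/
theorem card_closed (h : D.IsTangle) {A : Finset (Pt a)} {B : Finset (Pt b)}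
    (hAB : D.Closed A B) : (A.card : ZMod 2) + B.card = 0 := by
  have := Finset.sum_involution (s := A.disjSum B) (f := fun _ => (1 : ZMod 2))
    (fun v _ => h.mate v) (fun _ _ => rfl) (fun v _ _ => h.mate_ne v)
    (fun v hv => hAB _ _ (h.joined_mate v) hv) (fun v _ => h.mate_mate v)
  simpa using this

open Classical in
/-- An involution moves an element across a boundary for a number of elements that has the parity of
the number of elements on one side. -/
theorem _root_.Annular.card_separated {X : Type} (P : Finset X) (f : X → X) (l : X → Prop)
    (hP : ∀ p ∈ P, f p ∈ P) (hf : ∀ p, f (f p) = p) (hne : ∀ p, f p ≠ p) :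
    ((P.filter fun p => l p ∧ ¬ l (f p)).card : ZMod 2) = ∑ p ∈ P, if l p then 1 else 0 := by
  -- Pairs that lie entirely on the side `l` contribute an even number.
  have key := Finset.sum_involution (s := P)
    (f := fun p => if l p ∧ l (f p) then (1 : ZMod 2) else 0)
    (fun v _ => f v) (fun v _ => by
      simp only [hf]
      by_cases h₁ : l v <;> by_cases h₂ : l (f v) <;> simp [h₁, h₂, CharTwo.add_self_eq_zero])
    (fun v _ _ => hne v) hP (fun v _ => hf v)
  rw [Finset.natCast_card_filter, ← sub_eq_zero, ← Finset.sum_sub_distrib]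
  refine (Finset.sum_congr rfl fun p _ => ?_).trans key
  by_cases h₁ : l p <;> by_cases h₂ : l (f p) <;> simp [h₁, h₂]

end Diagram.IsTangle
end Annular

namespace Annular

/-! ### Orbits of two involutions -/

/-- If `n` is even, only `j ≡ n / 2` is possible; if `n` is odd, only the solution of `2 * j ≡ 1`.
Either way the nonzero residue of `j` is determined. -/
theorem dvd_sub_of_dvd_two_mul {n j l : ℤ} (hj : ¬ n ∣ j) (hl : ¬ n ∣ l)
    (hj' : n ∣ 2 * j ∨ n ∣ 2 * j - 1) (hl' : n ∣ 2 * l ∨ n ∣ 2 * l - 1) : n ∣ j - l := by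
  have odd_of : ∀ {j a : ℤ}, ¬ n ∣ j → 2 * j = n * a → Odd a := by
    intro j a hj h
    by_contra ha
    obtain ⟨b, rfl⟩ := Int.not_odd_iff_even.1 ha
    exact hj ⟨b, by linarith⟩
  have mixed : ∀ {j l : ℤ}, ¬ n ∣ j → n ∣ 2 * j → n ∣ 2 * l - 1 → False := by
    rintro j l hj ⟨a, ha⟩ ⟨b, hb⟩
    have h₁ := odd_of hj ha
    have h₂ : Odd (n * b) := hb ▸ ⟨l - 1, by ring⟩
    have h₃ := (Int.odd_mul.1 h₂).1.mul h₁
    rw [← ha] at h₃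
    exact (Int.not_odd_iff_even.2 (even_two_mul j)) h₃
  have conclude : ∀ {a b : ℤ}, Odd a → Odd b → 2 * j - 2 * l = n * a - n * b → n ∣ j - l := by
    rintro a b ⟨a, rfl⟩ ⟨b, rfl⟩ h
    exact ⟨a - b, by linarith⟩
  rcases hj' with hj' | hj' <;> rcases hl' with hl' | hl'
  · obtain ⟨a, ha⟩ := hj'
    obtain ⟨b, hb⟩ := hl'
    exact conclude (odd_of hj ha) (odd_of hl hb) (by linarith)
  · exact (mixed hj hj' hl').elim
  · exact (mixed hl hl' hj').elim
  · obtain ⟨a, ha⟩ := hj'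
    obtain ⟨b, hb⟩ := hl'
    have h₁ : Odd (n * a) := ha ▸ ⟨j - 1, by ring⟩
    have h₂ : Odd (n * b) := hb ▸ ⟨l - 1, by ring⟩
    exact conclude (Int.odd_mul.1 h₁).2 (Int.odd_mul.1 h₂).2 (by linarith)

section Involutions
variable {X : Type} {σ ρ : Equiv.Perm X}

/-- The two involutions generate a dihedral group: conjugation by `σ` inverts `ρ * σ`. -/
theorem mul_zpow_of_involutions (hσ : σ * σ = 1) (hρ : ρ * ρ = 1) (j : ℤ) :
    σ * (ρ * σ) ^ j = (ρ * σ) ^ (-j) * σ := by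
  have h : SemiconjBy σ (ρ * σ) (ρ * σ)⁻¹ := by
    rw [SemiconjBy, mul_inv_rev, ← mul_eq_one_iff_eq_inv.1 hσ, ← mul_eq_one_iff_eq_inv.1 hρ,
      mul_assoc]
  rw [zpow_neg, ← inv_zpow]
  exact (h.zpow_right j).eq

/-- As `σ` fixes `x`, both involutions preserve the orbit of `x` under `ρ * σ`: on exponents, `σ`
acts by `j ↦ -j` and `ρ` by `j ↦ 1 - j`. -/
theorem exists_zpow_of_eqvGen (hσ : σ * σ = 1) (hρ : ρ * ρ = 1) {r : X → X → Prop}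
    (hr : ∀ u v, r u v → v = σ u ∨ v = ρ u) {x v : X} (hx : σ x = x)
    (hv : Relation.EqvGen r x v) : ∃ j : ℤ, v = ((ρ * σ) ^ j) x := by
  have hs : ∀ j : ℤ, σ (((ρ * σ) ^ j) x) = ((ρ * σ) ^ (-j)) x := fun j => by
    rw [← Equiv.Perm.mul_apply, mul_zpow_of_involutions hσ hρ, Equiv.Perm.mul_apply, hx]
  have hr' : ∀ j : ℤ, ρ (((ρ * σ) ^ j) x) = ((ρ * σ) ^ (1 - j)) x := fun j => by
    have : ρ = ρ * σ * σ := by rw [mul_assoc, hσ, mul_one]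
    rw [sub_eq_add_neg, zpow_add, zpow_one, Equiv.Perm.mul_apply _ _ x, ← hs,
      ← Equiv.Perm.mul_apply (ρ * σ) σ, ← this]
  have step : ∀ u v, r u v → ((∃ j : ℤ, u = ((ρ * σ) ^ j) x) ↔ ∃ j : ℤ, v = ((ρ * σ) ^ j) x) := by
    intro u v huv
    have h₁ : ∀ u, σ (σ u) = u := fun u => by rw [← Equiv.Perm.mul_apply, hσ, Equiv.Perm.one_apply]
    have h₂ : ∀ u, ρ (ρ u) = u := fun u => by rw [← Equiv.Perm.mul_apply, hρ, Equiv.Perm.one_apply]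
    rcases hr u v huv with rfl | rfl
    · exact ⟨fun ⟨j, h⟩ => ⟨_, h ▸ hs j⟩, fun ⟨j, h⟩ => ⟨-j, by rw [← hs, ← h, h₁]⟩⟩
    · exact ⟨fun ⟨j, h⟩ => ⟨_, h ▸ hr' j⟩, fun ⟨j, h⟩ => ⟨1 - j, by rw [← hr', ← h, h₂]⟩⟩
  have key : ∀ u v, Relation.EqvGen r u v →
      ((∃ j : ℤ, u = ((ρ * σ) ^ j) x) ↔ ∃ j : ℤ, v = ((ρ * σ) ^ j) x) := by
    intro u v huv
    induction huv with
    | rel u v h => exact step u v h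
    | refl => exact Iff.rfl
    | symm _ _ _ ih => exact ih.symm
    | trans _ _ _ _ _ ih₁ ih₂ => exact ih₁.trans ih₂
  exact (key x v hv).1 ⟨0, rfl⟩

/-- A point of exponent `j` is fixed by `σ` only if the period divides `2 * j`, and by `ρ` only if
it divides `2 * j - 1`. At most one nonzero residue satisfies one of these. -/
theorem fixed_points_unique_aux (hσ : σ * σ = 1) (hρ : ρ * ρ = 1) {r : X → X → Prop}
    (hr : ∀ u v, r u v → v = σ u ∨ v = ρ u) {x y z : X} (hx : σ x = x)
    (hy : σ y = y ∨ ρ y = y) (hz : σ z = z ∨ ρ z = z) (hxy : Relation.EqvGen r x y)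
    (hxz : Relation.EqvGen r x z) (hy' : y ≠ x) (hz' : z ≠ x) : y = z := by
  obtain ⟨j, rfl⟩ := exists_zpow_of_eqvGen hσ hρ hr hx hxy
  obtain ⟨l, rfl⟩ := exists_zpow_of_eqvGen hσ hρ hr hx hxz
  -- For an infinite orbit the period is `0`, and divisibility by `n` means being zero.
  let n : ℤ := Function.minimalPeriod ((ρ * σ) • ·) x
  have hn : ∀ j : ℤ, ((ρ * σ) ^ j) x = x ↔ n ∣ j := fun j =>
    MulAction.zpow_smul_eq_iff_minimalPeriod_dvd (a := ρ * σ) (b := x)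
  have hn' : ∀ i j : ℤ, ((ρ * σ) ^ i) x = ((ρ * σ) ^ j) x ↔ n ∣ i - j := fun i j => by
    rw [← hn, sub_eq_add_neg, add_comm, zpow_add, Equiv.Perm.mul_apply, zpow_neg,
      Equiv.Perm.inv_eq_iff_eq, eq_comm]
  have fix : ∀ j : ℤ, (σ (((ρ * σ) ^ j) x) = ((ρ * σ) ^ j) x ∨
      ρ (((ρ * σ) ^ j) x) = ((ρ * σ) ^ j) x) → n ∣ 2 * j ∨ n ∣ 2 * j - 1 := by
    have hs : ∀ j : ℤ, σ (((ρ * σ) ^ j) x) = ((ρ * σ) ^ (-j)) x := fun j => by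
      rw [← Equiv.Perm.mul_apply, mul_zpow_of_involutions hσ hρ, Equiv.Perm.mul_apply, hx]
    rintro j (h | h)
    · rw [hs, hn'] at h
      exact Or.inl ((Int.dvd_neg).1 (by convert h using 1; ring))
    · have : ρ = ρ * σ * σ := by rw [mul_assoc, hσ, mul_one]
      rw [this, Equiv.Perm.mul_apply (ρ * σ), ← this, hs, ← Equiv.Perm.mul_apply, ← zpow_one_add,
        hn'] at h
      exact Or.inr ((Int.dvd_neg).1 (by convert h using 1; ring))
  rw [hn']
  exact dvd_sub_of_dvd_two_mul ((hn j).not.1 hy') ((hn l).not.1 hz') (fix j hy) (fix l hz)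

/-- A path of a graph whose edges come from two matchings has at most two ends. -/
theorem fixed_points_unique (hσ : σ * σ = 1) (hρ : ρ * ρ = 1) {r : X → X → Prop}
    (hr : ∀ u v, r u v → v = σ u ∨ v = ρ u) {x y z : X} (hx : σ x = x ∨ ρ x = x)
    (hy : σ y = y ∨ ρ y = y) (hz : σ z = z ∨ ρ z = z) (hxy : Relation.EqvGen r x y)
    (hxz : Relation.EqvGen r x z) (hy' : y ≠ x) (hz' : z ≠ x) : y = z := by
  rcases hx with hx | hx
  · exact fixed_points_unique_aux hσ hρ hr hx hy hz hxy hxz hy' hz'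
  · exact fixed_points_unique_aux hρ hσ (fun u v h => (hr u v h).symm) hx hy.symm hz.symm hxy hxz
      hy' hz'

end Involutions

/-- Moving every point into turn `0` is injective on `C` and has a finite target. -/
theorem finite_of_turn {V : Type} (turn : ℤ → V → V) (idx : V → ℤ)
    (hfin : {v | idx v = 0}.Finite) (hidx : ∀ k v, idx (turn k v) = idx v + k)
    (h0 : ∀ v, turn 0 v = v) (hadd : ∀ j k v, turn k (turn j v) = turn (j + k) v) {C : Set V}
    (hC : ∀ v ∈ C, ∀ k, turn k v ∈ C → k = 0) : C.Finite := by
  refine Set.Finite.of_finite_image (f := fun v => turn (-idx v) v) (hfin.subset ?_) ?_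
  · rintro _ ⟨v, _, rfl⟩
    simp [hidx]
  · intro u hu v hv (e : turn (-idx u) u = turn (-idx v) v)
    have e₂ : turn (-idx u + idx v) u = v := by rw [← hadd, e, hadd, neg_add_cancel, h0]
    have := hC u hu _ (e₂ ▸ hv)
    rw [this, h0] at e₂
    exact e₂

namespace Diagram

/-! ### Components of glued tangles -/

section
variable {a b c : AObj}

/-- Simultaneous translation by `k` full turns. -/
def Glued.turn (k : ℤ) : Glued a b c → Glued a b c :=
  Sum.map (Pt.turn k) (Sum.map (Pt.turn k) (Pt.turn k))

/-- The number of the turn in which a point lies. -/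
def Glued.idx : Glued a b c → ℤ := Sum.elim Pt.idx (Sum.elim Pt.idx Pt.idx)

theorem Glued.turn_zero (u : Glued a b c) : Glued.turn 0 u = u := by
  rcases u with x | x | x
  · exact congrArg _ x.turn_zero
  · exact congrArg (fun x => Sum.inr (Sum.inl x)) x.turn_zero
  · exact congrArg (fun x => Sum.inr (Sum.inr x)) x.turn_zero

theorem Glued.turn_turn (j k : ℤ) (u : Glued a b c) :
    Glued.turn k (Glued.turn j u) = Glued.turn (j + k) u := by
  rcases u with x | x | x
  · exact congrArg _ (x.turn_turn j k)
  · exact congrArg (fun x => Sum.inr (Sum.inl x)) (x.turn_turn j k)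
  · exact congrArg (fun x => Sum.inr (Sum.inr x)) (x.turn_turn j k)

theorem Glued.idx_turn (k : ℤ) (u : Glued a b c) : Glued.idx (Glued.turn k u) = Glued.idx u + k := by
  rcases u with x | x | x <;> exact Pt.idx_turn _ _

theorem Glued.finite_idx : {u : Glued a b c | Glued.idx u = 0}.Finite := by
  refine (((Pt.finite_idx (a := a) 0).image Sum.inl).union
    (((Pt.finite_idx (a := b) 0).image (Sum.inr ∘ Sum.inl)).union
    ((Pt.finite_idx (a := c) 0).image (Sum.inr ∘ Sum.inr)))).subset ?_
  rintro (x | x | x) (h : x.idx = 0)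
  · exact Or.inl ⟨x, by simp [h], rfl⟩
  · exact Or.inr (Or.inl ⟨x, by simp [h], rfl⟩)
  · exact Or.inr (Or.inr ⟨x, by simp [h], rfl⟩)

theorem Glued.lower_turn (k : ℤ) (p : Bdry a b) :
    (Glued.lower (p.turn k) : Glued a b c) = Glued.turn k (Glued.lower p) := by
  rcases p with x | x <;> rfl

theorem Glued.upper_turn (k : ℤ) (p : Bdry b c) :
    (Glued.upper (p.turn k) : Glued a b c) = Glued.turn k (Glued.upper p) := by
  rcases p with x | x <;> rfl

theorem Glued.outer_turn (k : ℤ) (p : Bdry a c) :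
    (Glued.outer (p.turn k) : Glued a b c) = Glued.turn k (Glued.outer p) := by
  rcases p with x | x <;> rfl

theorem Glued.outer_injective : Function.Injective (Glued.outer : Bdry a c → Glued a b c) := by
  rintro (x | x) (y | y) h <;> simp_all [Glued.outer]

variable {S : Diagram a b} {T : Diagram b c}

theorem Conn.refl (u : Glued a b c) : Conn S T u u := Relation.EqvGen.refl u

theorem Conn.symm {u v : Glued a b c} (h : Conn S T u v) : Conn S T v u :=
  Relation.EqvGen.symm _ _ h

theorem Conn.trans {u v w : Glued a b c} (h : Conn S T u v) (h' : Conn S T v w) : Conn S T u w :=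
  Relation.EqvGen.trans _ _ _ h h'

theorem Conn.lower {p q : Bdry a b} (h : S.joined p q) :
    Conn S T (Glued.lower p) (Glued.lower q) := Relation.EqvGen.rel _ _ (.lower h)

theorem Conn.upper {p q : Bdry b c} (h : T.joined p q) :
    Conn S T (Glued.upper p) (Glued.upper q) := Relation.EqvGen.rel _ _ (.upper h)

theorem Conn.invariant {β : Type*} (f : Glued a b c → β)
    (hl : ∀ p q, S.joined p q → f (Glued.lower p) = f (Glued.lower q))
    (hu : ∀ p q, T.joined p q → f (Glued.upper p) = f (Glued.upper q))
    {u v : Glued a b c} (h : Conn S T u v) : f u = f v := by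
  induction h with
  | rel u v h =>
    rcases h with h | h
    · exact hl _ _ h
    · exact hu _ _ h
  | refl => rfl
  | symm _ _ _ ih => exact ih.symm
  | trans _ _ _ _ _ ih₁ ih₂ => exact ih₁.trans ih₂

/-- Maps between glued families of points that respect strings respect components. -/
theorem Conn.map {a' b' c' : AObj} {S' : Diagram a' b'} {T' : Diagram b' c'}
    (f : Glued a b c → Glued a' b' c')
    (hl : ∀ p q, S.joined p q → Conn S' T' (f (Glued.lower p)) (f (Glued.lower q)))
    (hu : ∀ p q, T.joined p q → Conn S' T' (f (Glued.upper p)) (f (Glued.upper q)))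
    {u v : Glued a b c} (h : Conn S T u v) : Conn S' T' (f u) (f v) := by
  induction h with
  | rel u v h =>
    rcases h with h | h
    · exact hl _ _ h
    · exact hu _ _ h
  | refl => exact .refl _
  | symm _ _ _ ih => exact ih.symm
  | trans _ _ _ _ _ ih₁ ih₂ => exact ih₁.trans ih₂

theorem Conn.turn (hS : S.IsTangle) (hT : T.IsTangle) (k : ℤ) {u v : Glued a b c} :
    Conn S T (Glued.turn k u) (Glued.turn k v) ↔ Conn S T u v := by
  have key : ∀ (k : ℤ) {u v : Glued a b c}, Conn S T u v →
      Conn S T (Glued.turn k u) (Glued.turn k v) := fun k u v h => by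
    refine Conn.map (Glued.turn k) (fun p q hpq => ?_) (fun p q hpq => ?_) h
    · rw [← Glued.lower_turn, ← Glued.lower_turn]
      exact .lower ((hS.joined_turn k).2 hpq)
    · rw [← Glued.upper_turn, ← Glued.upper_turn]
      exact .upper ((hT.joined_turn k).2 hpq)
  refine ⟨fun h => ?_, key k⟩
  simpa only [Glued.turn_turn, add_neg_cancel, Glued.turn_zero] using key (-k) h

theorem Conn.turn_mul (hS : S.IsTangle) (hT : T.IsTangle) {u : Glued a b c} {k : ℤ}
    (h : Conn S T u (Glued.turn k u)) (n : ℤ) : Conn S T u (Glued.turn (n * k) u) := by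
  have step : ∀ n : ℤ, Conn S T u (Glued.turn (n * k) u) ↔
      Conn S T u (Glued.turn ((n + 1) * k) u) := fun n => by
    have : Conn S T (Glued.turn (n * k) u) (Glued.turn ((n + 1) * k) u) := by
      rw [add_one_mul, add_comm, ← Glued.turn_turn, Conn.turn hS hT]
      exact h
    exact ⟨fun e => e.trans this, fun e => e.trans this.symm⟩
  induction n using Int.induction_on with
  | zero => rw [zero_mul, Glued.turn_zero]; exact .refl _
  | succ n ih => exact (step _).1 ih
  | pred n ih => rwa [step, sub_add_cancel]


/-- The other end of a string of the inner tangle; points of the outer circle are fixed. -/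
noncomputable def lowerMate (hS : S.IsTangle)  : Glued a b c → Glued a b c
  | .inl x => Glued.lower (hS.mate (.inl x))
  | .inr (.inl y) => Glued.lower (hS.mate (.inr y))
  | .inr (.inr z) => .inr (.inr z)

/-- The other end of a string of the outer tangle; points of the inner circle are fixed. -/
noncomputable def upperMate (hT : T.IsTangle)  : Glued a b c → Glued a b c
  | .inl x => .inl x
  | .inr (.inl y) => Glued.upper (hT.mate (.inl y))
  | .inr (.inr z) => Glued.upper (hT.mate (.inr z))

theorem lowerMate_lower (hS : S.IsTangle) (p : Bdry a b) :
    lowerMate hS (Glued.lower p : Glued a b c) = Glued.lower (hS.mate p) := by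
  rcases p with p | p <;> rfl

theorem upperMate_upper (hT : T.IsTangle) (p : Bdry b c) :
    upperMate hT (Glued.upper p : Glued a b c) = Glued.upper (hT.mate p) := by
  rcases p with p | p <;> rfl

theorem lowerMate_involutive (hS : S.IsTangle) : Function.Involutive (lowerMate hS (c := c)) := by
  have h : ∀ p : Bdry a b, lowerMate hS (lowerMate hS (Glued.lower p : Glued a b c)) = Glued.lower p :=
    fun p => by rw [lowerMate_lower, lowerMate_lower, hS.mate_mate]
  rintro (x | y | z)
  · exact h (.inl x)
  · exact h (.inr y)
  · rfl

theorem upperMate_involutive (hT : T.IsTangle) : Function.Involutive (upperMate hT (a := a)) := by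
  have h : ∀ p : Bdry b c, upperMate hT (upperMate hT (Glued.upper p : Glued a b c)) = Glued.upper p :=
    fun p => by rw [upperMate_upper, upperMate_upper, hT.mate_mate]
  rintro (x | y | z)
  · rfl
  · exact h (.inl y)
  · exact h (.inr z)

/-- All links come from two involutions of the points on the three circles. A point of the outer
boundary is fixed by one of them, so it is an end of a path. -/
theorem outer_unique (hS : S.IsTangle) (hT : T.IsTangle)
    {p q r : Bdry a c} (hq : Conn S T (Glued.outer p) (Glued.outer q))
    (hr : Conn S T (Glued.outer p) (Glued.outer r)) (hq' : q ≠ p) (hr' : r ≠ p) : q = r := by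
  have hfix : ∀ p : Bdry a c, (lowerMate_involutive hS (c := c)).toPerm _ (Glued.outer p) =
      Glued.outer p ∨ (upperMate_involutive hT (a := a)).toPerm _ (Glued.outer p) =
      Glued.outer p := by
    rintro (x | z)
    · exact Or.inr rfl
    · exact Or.inl rfl
  refine Glued.outer_injective (b := b) (fixed_points_unique (X := Glued a b c)
    (σ := (lowerMate_involutive hS (c := c)).toPerm _)
    (ρ := (upperMate_involutive hT (a := a)).toPerm _)
    (Equiv.ext fun u => lowerMate_involutive hS u) (Equiv.ext fun u => upperMate_involutive hT u)
    ?_ (hfix p) (hfix q) (hfix r) hq hr (Glued.outer_injective.ne hq')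
    (Glued.outer_injective.ne hr'))
  rintro u v (h | h)
  · exact Or.inl (by
      rw [Function.Involutive.coe_toPerm, lowerMate_lower, hS.mate_eq h])
  · exact Or.inr (by
      rw [Function.Involutive.coe_toPerm, upperMate_upper, hT.mate_eq h])

/-- Otherwise the translates by `k` and `2 * k` would be two further ends of the same component. -/
theorem outer_turn_eq_zero (hS : S.IsTangle) (hT : T.IsTangle)
    {p : Bdry a c} {k : ℤ}
    (h : Conn S T (Glued.outer p) (Glued.turn k (Glued.outer p))) : k = 0 := by
  by_contra hk
  have h₁ := h.turn_mul hS hT 2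
  rw [← Glued.outer_turn] at h h₁
  have hne : ∀ j : ℤ, j ≠ 0 → p.turn j ≠ p := fun j hj e =>
    hj (p.turn_injective (e.trans p.turn_zero.symm))
  have := p.turn_injective (outer_unique hS hT h h₁ (hne k hk) (hne _ (by omega)))
  omega

/-- Two translates of one point in the component would connect `u` to a translate of itself. -/
theorem finite_component (hS : S.IsTangle) (hT : T.IsTangle)
    {u : Glued a b c}
    (h : ∀ k, Conn S T u (Glued.turn k u) → k = 0) : {v | Conn S T u v}.Finite := by
  refine finite_of_turn Glued.turn Glued.idx Glued.finite_idx Glued.idx_turn Glued.turn_zero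
    Glued.turn_turn fun v hv k hk => h k ?_
  exact Conn.trans hk ((Conn.turn hS hT k).2 (Conn.symm hv))

/-- Finite sets of points on the three circles that are unions of components. -/
def ClosedUnder (S : Diagram a b) (T : Diagram b c) (A : Finset (Pt a)) (B : Finset (Pt b))
    (E : Finset (Pt c)) : Prop := S.Closed A B ∧ T.Closed B E

/-- Splits a finite union of components by circles, so that `lev` and counts modulo `2` apply to
both tangles at once. -/
theorem exists_levels {C : Set (Glued a b c)} (hf : C.Finite)
    (hC : ∀ u v, Conn S T u v → u ∈ C → v ∈ C) : ∃ A B E, ClosedUnder S T A B E ∧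
      (∀ x, x ∈ A ↔ Sum.inl x ∈ C) ∧ (∀ y, y ∈ B ↔ Sum.inr (Sum.inl y) ∈ C) ∧
      ∀ z, z ∈ E ↔ Sum.inr (Sum.inr z) ∈ C := by
  refine ⟨(hf.preimage (f := Sum.inl) Sum.inl_injective.injOn).toFinset,
    (hf.preimage (f := Sum.inr ∘ Sum.inl)
      (Sum.inr_injective.comp Sum.inl_injective).injOn).toFinset,
    (hf.preimage (f := Sum.inr ∘ Sum.inr)
      (Sum.inr_injective.comp Sum.inr_injective).injOn).toFinset, ⟨?_, ?_⟩, ?_, ?_, ?_⟩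
  · intro p q hpq hp
    have := hC _ _ (Conn.lower (T := T) hpq) (by rcases p with p | p <;> simpa [Glued.lower, Glued.upper] using hp)
    rcases q with q | q <;> simpa [Glued.lower, Glued.upper] using this
  · intro p q hpq hp
    have := hC _ _ (Conn.upper (S := S) hpq) (by rcases p with p | p <;> simpa [Glued.lower, Glued.upper] using hp)
    rcases q with q | q <;> simpa [Glued.lower, Glued.upper] using this
  all_goals intro x; simp

/-- The quantity `lev` on three circles. -/
noncomputable def lev₃ (A : Finset (Pt a)) (B : Finset (Pt b)) (E : Finset (Pt c)) :
    Glued a b c → ZMod 2 := Sum.elim (lev A) (Sum.elim (lev B) (lev E))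

theorem lev₃_eq (hS : S.IsTangle) (hT : T.IsTangle) {A : Finset (Pt a)} {B : Finset (Pt b)}
    {E : Finset (Pt c)} (h : ClosedUnder S T A B E) {u v : Glued a b c} (huv : Conn S T u v) :
    lev₃ A B E u = lev₃ A B E v := by
  refine huv.invariant (lev₃ A B E) (fun p q hpq => ?_) (fun p q hpq => ?_)
  · have := hS.lev_eq h.1 hpq
    rcases p with p | p <;> rcases q with q | q <;> exact this
  · have := hT.lev_eq h.2 hpq
    rcases p with p | p <;> rcases q with q | q <;> exact this

theorem card_closedUnder (hS : S.IsTangle) (hT : T.IsTangle) {A : Finset (Pt a)}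
    {B : Finset (Pt b)} {E : Finset (Pt c)} (h : ClosedUnder S T A B E) :
    (B.card : ZMod 2) = A.card ∧ (B.card : ZMod 2) = E.card := by
  have h₁ := hS.card_closed h.1
  have h₂ := hT.card_closed h.2
  rw [← CharTwo.sub_eq_add, sub_eq_zero] at h₁ h₂
  exact ⟨h₁.symm, h₂⟩

/-- The component of `p` is finite, and its numbers of points on the three circles agree modulo `2`,
because each tangle pairs up the points on its own two circles. So the outer boundary carries an
even number of its points, hence not `p` alone. -/
theorem exists_other_end (hS : S.IsTangle) (hT : T.IsTangle) (p : Bdry a c) :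
    ∃ q, q ≠ p ∧ Conn S T (Glued.outer p) (Glued.outer q) := by
  obtain ⟨A, B, E, hc, hA, hB, hE⟩ := exists_levels
    (finite_component hS hT fun k hk => outer_turn_eq_zero hS hT hk)
    (fun u v huv (hu : Conn S T (Glued.outer p) u) => hu.trans huv)
  have hmem : ∀ q : Bdry a c, q ∈ A.disjSum E ↔ Conn S T (Glued.outer p) (Glued.outer q) := by
    rintro (q | q)
    · simpa [Glued.outer] using hA q
    · simpa [Glued.outer] using hE q
  have hcard : ((A.disjSum E).card : ZMod 2) = 0 := by
    obtain ⟨h₁, h₂⟩ := card_closedUnder hS hT hc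
    rw [Finset.card_disjSum, Nat.cast_add, ← h₁, ← h₂, CharTwo.add_self_eq_zero]
  have hone : (A.disjSum E).card ≠ 1 := fun e => by rw [e] at hcard; exact absurd hcard (by decide)
  have hp : p ∈ A.disjSum E := (hmem p).2 (.refl _)
  have hpos := Finset.card_pos.2 ⟨p, hp⟩
  obtain ⟨q, hq, hne⟩ := Finset.exists_mem_ne (s := A.disjSum E) (by omega) p
  exact ⟨q, hne, (hmem q).1 hq⟩

theorem existsUnique_comp (hS : S.IsTangle) (hT : T.IsTangle) (p : Bdry a c) :
    ∃! q, (S.comp T).joined p q := by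
  obtain ⟨q, hq, hpq⟩ := exists_other_end hS hT p
  exact ⟨q, ⟨hq.symm, hpq⟩, fun r hr => outer_unique hS hT hr.2 hpq hr.1.symm hq⟩

theorem rk_disjSum_pair {p p' : Bdry a c} (hne : p ≠ p') {A : Finset (Pt a)} {E : Finset (Pt c)}
    (h : ∀ q, q ∈ A.disjSum E ↔ q = p ∨ q = p') (q : Bdry a c) :
    Sum.elim (rk A) (rk E) q =
      (Sum.elim (fun x => Sum.elim (fun v : Pt a => if x.1 < v.1 then (1 : ZMod 2) else 0) 0)
        (fun z => Sum.elim 0 fun v : Pt c => if z.1 < v.1 then (1 : ZMod 2) else 0) q p) +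
      (Sum.elim (fun x => Sum.elim (fun v : Pt a => if x.1 < v.1 then (1 : ZMod 2) else 0) 0)
        (fun z => Sum.elim 0 fun v : Pt c => if z.1 < v.1 then (1 : ZMod 2) else 0) q p') := by
  classical
  have hs : A.disjSum E = {p, p'} := by
    ext q
    simp [h]
  rw [← Finset.sum_pair hne (f := fun v => Sum.elim
      (fun x => Sum.elim (fun v : Pt a => if x.1 < v.1 then (1 : ZMod 2) else 0) 0)
      (fun z => Sum.elim 0 fun v : Pt c => if z.1 < v.1 then (1 : ZMod 2) else 0) q v), ← hs,
    Finset.sum_disjSum]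
  rcases q with q | q <;> simp [rk]

/-- The component of `p` meets the outer boundary in `p` and `p'` only. At an outer point off this
component, `lev` is the parity of the number of points among `p`, `p'` to its right on the same
circle. For interleaved ends the values at `q` and `q'` would differ, although these lie on one
component. -/
theorem planar_comp (hS : S.IsTangle) (hT : T.IsTangle) (p p' q q' : Bdry a c)
    (hp : (S.comp T).joined p p') (hq : (S.comp T).joined q q') :
    ¬ (p.before q ∧ q.before p' ∧ p'.before q') := by
  rintro ⟨h₁, h₂, h₃⟩
  obtain ⟨A, B, E, hc, hA, hB, hE⟩ := exists_levels
    (finite_component hS hT fun k hk => outer_turn_eq_zero hS hT hk)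
    (fun u v huv (hu : Conn S T (Glued.outer p) u) => hu.trans huv)
  have hmem : ∀ q : Bdry a c, q ∈ A.disjSum E ↔ q = p ∨ q = p' := by
    intro r
    have : r ∈ A.disjSum E ↔ Conn S T (Glued.outer p) (Glued.outer r) := by
      rcases r with r | r
      · simpa [Glued.outer] using hA r
      · simpa [Glued.outer] using hE r
    rw [this]
    constructor
    · intro hr
      by_cases hr' : r = p
      · exact Or.inl hr'
      · exact Or.inr (outer_unique hS hT hr hp.2 hr' hp.1.symm)
    · rintro (rfl | rfl)
      · exact .refl _
      · exact hp.2
  have key := lev₃_eq hS hT hc hq.2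
  have hout : ∀ r : Bdry a c, r ∉ A.disjSum E →
      lev₃ A B E (Glued.outer r) = Sum.elim (rk A) (rk E) r := by
    rintro (r | r) hr
    · have hr' : r ∉ A := by simpa using hr
      simp [lev₃, lev, Glued.outer, hr']
    · have hr' : r ∉ E := by simpa using hr
      simp [lev₃, lev, Glued.outer, hr']
  have h₄ : q ∉ A.disjSum E := by
    rw [hmem]
    rintro (rfl | rfl)
    · exact Bdry.not_before_self _ h₁
    · exact Bdry.not_before_self _ h₂
  have h₅ : q' ∉ A.disjSum E := by
    rw [hmem]
    rintro (rfl | rfl)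
    -- The boundary order is transitive, so `q'` cannot be `p`.
    · rcases q' with x | x <;> rcases q with y | y <;> rcases p' with z | z <;>
        simp [Bdry.before] at h₁ h₂ h₃ <;> omega
    · exact Bdry.not_before_self _ h₃
  rw [hout q h₄, hout q' h₅, rk_disjSum_pair hp.1 hmem, rk_disjSum_pair hp.1 hmem] at key
  rcases p with p | p <;> rcases q with q | q <;> rcases p' with p' | p' <;>
    rcases q' with q' | q' <;> simp [Bdry.before] at h₁ h₂ h₃ key <;>
    split_ifs at key <;> first | omega | exact absurd key (by decide)

end
end Diagram
end Annular

namespace Annular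

/-! ### Periodic non-crossing matchings of sets of integers -/

/-- A non-crossing perfect matching of a periodic set of integers, with the same period. -/
structure PeriodicMatching (W : Set ℤ) (w : ℤ) (σ : ℤ → ℤ) : Prop where
  mem : ∀ x ∈ W, σ x ∈ W
  invol : ∀ x ∈ W, σ (σ x) = x
  ne : ∀ x ∈ W, σ x ≠ x
  nested : ∀ x ∈ W, ∀ y ∈ W, x < y → y < σ x → x < σ y ∧ σ y < σ x
  periodic : ∀ x ∈ W, σ (x + w) = σ x + w

open Classical in
/-- The parity of the number of elements of `W` between `0` and `u`. -/
noncomputable def rankParity (W : Set ℤ) (u : ℤ) : ZMod 2 :=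
  (∑ x ∈ Finset.Ioc 0 u, if x ∈ W then 1 else 0) + ∑ x ∈ Finset.Ioc u 0, if x ∈ W then 1 else 0

open Classical in
theorem rankParity_succ (W : Set ℤ) (u : ℤ) :
    rankParity W (u + 1) = rankParity W u + if u + 1 ∈ W then 1 else 0 := by
  unfold rankParity
  by_cases hu : 0 ≤ u
  · have e₁ : Finset.Ioc 0 (u + 1) = insert (u + 1) (Finset.Ioc 0 u) := by ext; simp; omega
    have e₂ : Finset.Ioc (u + 1) 0 = ∅ := by ext; simp; omega
    have e₃ : Finset.Ioc u 0 = ∅ := by ext; simp; omega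
    rw [e₁, e₂, e₃, Finset.sum_insert (by simp), Finset.sum_empty, add_zero, add_zero, add_comm]
  · have e₁ : Finset.Ioc u 0 = insert (u + 1) (Finset.Ioc (u + 1) 0) := by ext; simp; omega
    have e₂ : Finset.Ioc 0 (u + 1) = ∅ := by ext; simp; omega
    have e₃ : Finset.Ioc 0 u = ∅ := by ext; simp; omega
    rw [e₁, e₂, e₃, Finset.sum_insert (by simp), Finset.sum_empty, zero_add, zero_add]
    rw [add_right_comm, CharTwo.add_self_eq_zero, zero_add]

open Classical in
theorem rankParity_add (W : Set ℤ) {l u : ℤ} (h : l ≤ u) :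
    rankParity W u = rankParity W l + ∑ x ∈ Finset.Ioc l u, if x ∈ W then 1 else 0 := by
  induction u, h using Int.leInduction with
  | base => simp
  | succ u hu ih =>
    have e₁ : Finset.Ioc l (u + 1) = insert (u + 1) (Finset.Ioc l u) := by ext; simp; omega
    rw [rankParity_succ, ih, e₁, Finset.sum_insert (by simp)]
    ring

theorem sum_Ioc_step {β : Type*} [AddCommGroup β] {w : ℤ} (hw : 0 < w) (f : ℤ → β) (G : ℤ) :
    ∑ x ∈ Finset.Ioc (G + 1) (G + 1 + w), f x =
      ∑ x ∈ Finset.Ioc G (G + w), f x + (f (G + 1 + w) - f (G + 1)) := by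
  have e₁ : Finset.Ioc G (G + w) = insert (G + 1) (Finset.Ioc (G + 1) (G + w)) := by
    ext; simp; omega
  have e₂ : Finset.Ioc (G + 1) (G + 1 + w) = insert (G + 1 + w) (Finset.Ioc (G + 1) (G + w)) := by
    ext; simp; omega
  rw [e₁, e₂, Finset.sum_insert (by simp), Finset.sum_insert (by simp)]
  abel

theorem sum_Ioc_periodic {β : Type*} [AddCommGroup β] {w : ℤ} (hw : 0 < w) {f : ℤ → β}
    (hf : ∀ x, f (x + w) = f x) (G G' : ℤ) :
    ∑ x ∈ Finset.Ioc G (G + w), f x = ∑ x ∈ Finset.Ioc G' (G' + w), f x := by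
  have step : ∀ G : ℤ, ∑ x ∈ Finset.Ioc (G + 1) (G + 1 + w), f x =
      ∑ x ∈ Finset.Ioc G (G + w), f x := fun G => by
    rw [sum_Ioc_step hw, hf, sub_self, add_zero]
  have key : ∀ G : ℤ, ∑ x ∈ Finset.Ioc G (G + w), f x = ∑ x ∈ Finset.Ioc 0 (0 + w), f x := by
    intro G
    induction G using Int.induction_on with
    | zero => rfl
    | succ n ih => rw [step, ih]
    | pred n ih => rw [← ih, ← step, sub_add_cancel]
  rw [key G, key G']

theorem periodic_mem {W : Set ℤ} {w : ℤ} (hW : ∀ x, x + w ∈ W ↔ x ∈ W) (x k : ℤ) :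
    x + k * w ∈ W ↔ x ∈ W := by
  induction k using Int.induction_on with
  | zero => simp
  | succ n ih => rw [← ih, ← hW (x + n * w)]; ring_nf
  | pred n ih => rw [← ih, ← hW (x + (-n - 1) * w)]; ring_nf

namespace PeriodicMatching
variable {W : Set ℤ} {w : ℤ} {σ ρ : ℤ → ℤ}

theorem periodic_mul (h : PeriodicMatching W w σ) (hW : ∀ x, x + w ∈ W ↔ x ∈ W) {x : ℤ}
    (hx : x ∈ W) (k : ℤ) : σ (x + k * w) = σ x + k * w := by
  induction k using Int.induction_on with
  | zero => simp
  | succ n ih =>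
    have := h.periodic _ ((periodic_mem hW x n).2 hx)
    rw [ih] at this
    rw [add_one_mul, ← add_assoc, this, add_assoc]
  | pred n ih =>
    have := h.periodic _ ((periodic_mem hW x (-n - 1)).2 hx)
    rw [sub_one_mul, add_assoc, sub_add_cancel, ih] at this
    rw [sub_one_mul]
    linarith

open Classical in
theorem sum_invariant (h : PeriodicMatching W w σ) {I : Finset ℤ}
    (hI : ∀ x ∈ I, x ∈ W → σ x ∈ I) : ∑ x ∈ I, (if x ∈ W then (1 : ZMod 2) else 0) = 0 := by
  rw [← Finset.sum_filter]
  refine Finset.sum_involution (fun x _ => σ x) (fun _ _ => rfl) (fun x hx _ => ?_)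
    (fun x hx => ?_) fun x hx => ?_
  · exact h.ne x (Finset.mem_filter.1 hx).2
  · rw [Finset.mem_filter] at hx ⊢
    exact ⟨hI x hx.1 hx.2, h.mem x hx.2⟩
  · exact h.invol x (Finset.mem_filter.1 hx).2

/-- The points strictly between `x` and `σ x` are matched among themselves, so only the far end
changes the parity. -/
theorem rankParity_mate (h : PeriodicMatching W w σ) {x : ℤ} (hx : x ∈ W) :
    rankParity W (σ x) = rankParity W x + 1 := by
  wlog hlt : x < σ x generalizing x
  · rcases lt_trichotomy x (σ x) with e | e | e
    · exact absurd e hlt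
    · exact absurd e.symm (h.ne x hx)
    · have := this (h.mem x hx) (by rwa [h.invol x hx])
      rw [h.invol x hx] at this
      rw [this, add_assoc, CharTwo.add_self_eq_zero, add_zero]
  classical
  have e₁ : Finset.Ioc x (σ x) = insert (σ x) (Finset.Ioo x (σ x)) := by ext; simp; omega
  rw [rankParity_add W hlt.le, e₁, Finset.sum_insert (by simp), if_pos (h.mem x hx),
    h.sum_invariant, add_zero]
  intro y hy hyW
  rw [Finset.mem_Ioo] at hy ⊢
  exact h.nested x hx y hyW hy.1 hy.2

/-- A gap which is crossed by no string. -/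
theorem exists_gap (h : PeriodicMatching W w σ) (hw : 0 < w) (hW : ∀ x, x + w ∈ W ↔ x ∈ W)
    (hne : W.Nonempty) : ∃ G, ∀ x ∈ W, σ x ≤ G ↔ x ≤ G := by
  classical
  have red : ∀ x ∈ W, x + -(x / w) * w ∈ (Finset.Ico 0 w).filter (· ∈ W) := by
    intro x hx
    rw [Finset.mem_filter, periodic_mem hW, Finset.mem_Ico]
    have h₁ := Int.emod_nonneg x hw.ne'
    have h₂ := Int.emod_lt_of_pos x hw
    rw [Int.emod_def, mul_comm] at h₁ h₂
    exact ⟨⟨by linarith, by linarith⟩, hx⟩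
  obtain ⟨x₀, hx₀⟩ := hne
  -- The gap wanted is the one just before the left end of a longest string: a string across it
  -- would enclose this one and be longer.
  obtain ⟨x, hx, hmax⟩ := Finset.exists_max_image _ (fun x => σ x - x) ⟨_, red x₀ hx₀⟩
  have hxW := (Finset.mem_filter.1 hx).2
  have hmax' : ∀ y ∈ W, σ y - y ≤ σ x - x := fun y hy => by
    have := hmax _ (red y hy)
    rw [h.periodic_mul hW hy] at this
    linarith
  have hpos : x < σ x := by
    have h₁ := hmax' _ (h.mem x hxW)
    rw [h.invol x hxW] at h₁
    have h₂ := h.ne x hxW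
    omega
  have key : ∀ u ∈ W, u ≤ x - 1 → σ u ≤ x - 1 := by
    intro u hu hle
    by_contra hcon
    have hne : σ u ≠ x := by
      rintro e
      rw [← e, h.invol u hu] at hpos
      omega
    have h₁ := h.nested u hu x hxW (by omega) (by omega)
    have h₂ := hmax' u hu
    omega
  refine ⟨x - 1, fun u hu => ⟨fun hle => ?_, key u hu⟩⟩
  have := key _ (h.mem u hu) hle
  rwa [h.invol u hu] at this

theorem gap_turn (h : PeriodicMatching W w σ) (hW : ∀ x, x + w ∈ W ↔ x ∈ W) {G : ℤ}
    (hG : ∀ x ∈ W, σ x ≤ G ↔ x ≤ G) (k : ℤ) : ∀ x ∈ W, σ x ≤ G + k * w ↔ x ≤ G + k * w := by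
  intro x hx
  have := hG _ ((periodic_mem hW x (-k)).2 hx)
  rw [h.periodic_mul hW hx] at this
  constructor <;> intro e
  · have := this.1 (by linarith); linarith
  · have := this.2 (by linarith); linarith

/-- If a period starts at a gap that no string crosses, its points are matched within the period, so
they are even in number. -/
theorem rankParity_turn (h : PeriodicMatching W w σ) (hw : 0 < w)
    (hW : ∀ x, x + w ∈ W ↔ x ∈ W) (hne : W.Nonempty) (u : ℤ) :
    rankParity W (u + w) = rankParity W u := by
  classical
  obtain ⟨G, hG⟩ := h.exists_gap hw hW hne
  rw [rankParity_add W (by omega : u ≤ u + w),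
    sum_Ioc_periodic hw (fun x => by simp only [hW]) u G, h.sum_invariant, add_zero]
  intro x hx hxW
  have h₁ := hG x hxW
  have h₂ := h.gap_turn hW hG 1 x hxW
  rw [one_mul] at h₂
  rw [Finset.mem_Ioc] at hx ⊢
  omega

theorem rankParity_turn_mul (h : PeriodicMatching W w σ) (hw : 0 < w)
    (hW : ∀ x, x + w ∈ W ↔ x ∈ W) (hne : W.Nonempty) (u k : ℤ) :
    rankParity W (u + k * w) = rankParity W u := by
  induction k using Int.induction_on with
  | zero => simp
  | succ n ih => rw [← ih, ← h.rankParity_turn hw hW hne (u + n * w)]; ring_nf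
  | pred n ih => rw [← ih, ← h.rankParity_turn hw hW hne (u + (-n - 1) * w)]; ring_nf

/-- The parity of the number of strings that cross a gap. -/
theorem card_crossings (h : PeriodicMatching W w σ) (hw : 0 < w)
    (hW : ∀ x, x + w ∈ W ↔ x ∈ W) (hne : W.Nonempty) {G : ℤ} (hG : ∀ x ∈ W, σ x ≤ G ↔ x ≤ G)
    (m : ℤ) : (({u | u ∈ W ∧ u ≤ m ∧ ¬ σ u ≤ m}.ncard : ℕ) : ZMod 2) =
      rankParity W m + rankParity W G := by
  classical
  -- Full turns move the uncrossed gap to the left of `m` without changing its rank parity.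
  wlog hGm : G ≤ m generalizing G
  · have hle : G + -(|G| + |m|) * w ≤ m := by
      have h₁ := neg_abs_le m
      have h₂ := le_abs_self G
      have h₃ := abs_nonneg G
      have h₄ := abs_nonneg m
      nlinarith
    rw [this (h.gap_turn hW hG _) hle, h.rankParity_turn_mul hw hW hne]
  have e : {u | u ∈ W ∧ u ≤ m ∧ ¬ σ u ≤ m} =
      (((Finset.Ioc G m).filter fun u => u ∈ W ∧ ¬ σ u ≤ m : Finset ℤ) : Set ℤ) := by
    ext u
    simp only [Set.mem_ofPred_eq, Finset.coe_filter, Finset.mem_Ioc]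
    constructor
    · rintro ⟨h₁, h₂, h₃⟩
      have := hG u h₁
      exact ⟨⟨by omega, h₂⟩, h₁, h₃⟩
    · rintro ⟨h₁, h₂, h₃⟩
      exact ⟨h₂, h₁.2, h₃⟩
  -- The points after `G` whose partners are also at most `m` are paired up; the others are the ends
  -- of the strings across `m`.
  have key : ∑ u ∈ (Finset.Ioc G m).filter (fun u => σ u ≤ m),
      (if u ∈ W then (1 : ZMod 2) else 0) = 0 := by
    refine h.sum_invariant fun x hx hxW => ?_
    have h₁ := hG x hxW
    simp only [Finset.mem_filter, Finset.mem_Ioc, h.invol x hxW] at hx ⊢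
    omega
  rw [Finset.sum_filter] at key
  have hsum : (∑ u ∈ Finset.Ioc G m, if u ∈ W ∧ ¬ σ u ≤ m then (1 : ZMod 2) else 0) +
      ∑ u ∈ Finset.Ioc G m, (if σ u ≤ m then if u ∈ W then (1 : ZMod 2) else 0 else 0) =
      ∑ u ∈ Finset.Ioc G m, if u ∈ W then 1 else 0 := by
    rw [← Finset.sum_add_distrib]
    refine Finset.sum_congr rfl fun u _ => ?_
    by_cases h₁ : u ∈ W <;> by_cases h₂ : σ u ≤ m <;> simp [h₁, h₂]
  rw [key, add_zero] at hsum
  rw [e, Set.ncard_coe_finset, Finset.natCast_card_filter, hsum, rankParity_add W hGm,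
    add_right_comm, CharTwo.add_self_eq_zero, zero_add]

/-- The sum of `g` over the points of a period whose rank has a given parity. -/
noncomputable def windowSum (W : Set ℤ) (w : ℤ) (ν : ZMod 2) (g : ℤ → ℤ) (G : ℤ) : ℤ :=
  open Classical in ∑ x ∈ Finset.Ioc G (G + w), if x ∈ W ∧ rankParity W x = ν then g x else 0

theorem windowSum_congr {ν : ZMod 2} {g g' : ℤ → ℤ}
    (h : ∀ x ∈ W, rankParity W x = ν → g x = g' x) (G : ℤ) :
    windowSum W w ν g G = windowSum W w ν g' G := by
  refine Finset.sum_congr rfl fun x _ => ?_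
  split_ifs with hx
  · exact h x hx.1 hx.2
  · rfl

theorem windowSum_add (ν : ZMod 2) (g g' : ℤ → ℤ) (G : ℤ) :
    windowSum W w ν (fun x => g x + g' x) G = windowSum W w ν g G + windowSum W w ν g' G := by
  unfold windowSum
  rw [← Finset.sum_add_distrib]
  refine Finset.sum_congr rfl fun x _ => ?_
  split_ifs <;> simp

theorem windowSum_sub (ν : ZMod 2) (g g' : ℤ → ℤ) (G : ℤ) :
    windowSum W w ν (fun x => g x - g' x) G = windowSum W w ν g G - windowSum W w ν g' G := by
  unfold windowSum
  rw [← Finset.sum_sub_distrib]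
  refine Finset.sum_congr rfl fun x _ => ?_
  split_ifs <;> simp

theorem windowSum_periodic (h : PeriodicMatching W w σ) (hw : 0 < w)
    (hW : ∀ x, x + w ∈ W ↔ x ∈ W) {ν : ZMod 2} {g : ℤ → ℤ} (hg : ∀ x ∈ W, g (x + w) = g x)
    (G G' : ℤ) : windowSum W w ν g G = windowSum W w ν g G' := by
  refine sum_Ioc_periodic hw (fun x => ?_) G G'
  rw [hW]
  by_cases hx : x ∈ W
  · rw [h.rankParity_turn hw hW ⟨x, hx⟩, hg x hx]
  · rw [if_neg (fun e => hx e.1), if_neg (fun e => hx e.1)]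

/-- At an uncrossed gap `σ` maps the window to itself and exchanges the two rank parities. -/
theorem windowSum_mate_gap (h : PeriodicMatching W w σ) (hW : ∀ x, x + w ∈ W ↔ x ∈ W) {G : ℤ}
    (hG : ∀ x ∈ W, σ x ≤ G ↔ x ≤ G) (ν : ZMod 2) (g : ℤ → ℤ) :
    windowSum W w ν (fun x => g (σ x)) G = windowSum W w (ν + 1) g G := by
  classical
  have hmem : ∀ μ : ZMod 2, ∀ x ∈ (Finset.Ioc G (G + w)).filter
      (fun x => x ∈ W ∧ rankParity W x = μ), σ x ∈ (Finset.Ioc G (G + w)).filter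
      (fun x => x ∈ W ∧ rankParity W x = μ + 1) := by
    intro μ x hx
    rw [Finset.mem_filter, Finset.mem_Ioc] at hx ⊢
    have h₁ := hG x hx.2.1
    have h₂ := h.gap_turn hW hG 1 x hx.2.1
    rw [one_mul] at h₂
    refine ⟨by omega, h.mem x hx.2.1, ?_⟩
    rw [h.rankParity_mate hx.2.1, hx.2.2]
  unfold windowSum
  rw [← Finset.sum_filter, ← Finset.sum_filter]
  refine Finset.sum_nbij' σ σ (hmem ν) (fun x hx => ?_) (fun x hx => ?_) (fun x hx => ?_)
    fun x _ => rfl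
  · simpa only [add_assoc, CharTwo.add_self_eq_zero, add_zero] using hmem _ x hx
  · exact h.invol x (Finset.mem_filter.1 hx).2.1
  · exact h.invol x (Finset.mem_filter.1 hx).2.1

theorem windowSum_mate (h : PeriodicMatching W w σ) (hw : 0 < w)
    (hW : ∀ x, x + w ∈ W ↔ x ∈ W) (hne : W.Nonempty) (ν : ZMod 2) {g : ℤ → ℤ}
    (hg : ∀ x ∈ W, g (x + w) = g x) (G : ℤ) :
    windowSum W w ν (fun x => g (σ x)) G = windowSum W w (ν + 1) g G := by
  obtain ⟨G', hG⟩ := h.exists_gap hw hW hne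
  rw [h.windowSum_periodic hw hW (fun x hx => by rw [h.periodic x hx, hg _ (h.mem x hx)]) G G',
    h.windowSum_mate_gap hW hG, h.windowSum_periodic hw hW hg G G']

/-- The alternating sum of the coordinates of the points in a period. -/
noncomputable def alternatingSum (W : Set ℤ) (w G : ℤ) : ℤ :=
  windowSum W w 1 (fun x => x) G - windowSum W w 0 (fun x => x) G

/-- Moving the window past a point of `W` replaces it by its translate, which changes the
alternating sum by `w` with the sign of its rank; the indicator term changes by the same amount. -/
theorem alternatingSum_eq (h : PeriodicMatching W w σ) (hw : 0 < w)
    (hW : ∀ x, x + w ∈ W ↔ x ∈ W) (G : ℤ) : alternatingSum W w G - (if rankParity W G = 1 then w else 0) =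
      alternatingSum W w 0 - (if rankParity W 0 = 1 then w else 0) := by
  classical
  have step : ∀ G : ℤ, alternatingSum W w (G + 1) - (if rankParity W (G + 1) = 1 then w else 0) =
      alternatingSum W w G - (if rankParity W G = 1 then w else 0) := by
    intro G
    have h2 : ∀ z : ZMod 2, z = 0 ∨ z = 1 := by decide
    unfold alternatingSum windowSum
    rw [sum_Ioc_step hw, sum_Ioc_step hw, hW]
    by_cases hx : G + 1 ∈ W
    · rw [h.rankParity_turn hw hW ⟨_, hx⟩, rankParity_succ, if_pos hx]
      rcases h2 (rankParity W G) with e | e <;> rw [e]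
      · simp [hx]; ring
      · have : (1 + 1 : ZMod 2) = 0 := rfl
        simp [hx, this]; ring
    · rw [rankParity_succ, if_neg hx]
      simp [hx]
  induction G using Int.induction_on with
  | zero => rfl
  | succ n ih => rw [step, ih]
  | pred n ih => rw [← ih, ← step, sub_add_cancel]

/-- The total displacement under the composite of two matchings vanishes if the gaps that they do
not cross have ranks of the same parity. -/
theorem sum_displacement (h : PeriodicMatching W w σ) (h' : PeriodicMatching W w ρ) (hw : 0 < w)
    (hW : ∀ x, x + w ∈ W ↔ x ∈ W) (hne : W.Nonempty) {G G' : ℤ}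
    (hG : ∀ x ∈ W, σ x ≤ G ↔ x ≤ G) (hG' : ∀ x ∈ W, ρ x ≤ G' ↔ x ≤ G')
    (hr : rankParity W G = rankParity W G') :
    windowSum W w 0 (fun x => ρ (σ x) - x) 0 = 0 := by
  -- In the window at the gap of `σ`, the values `σ x` at the even-ranked `x` are just the
  -- odd-ranked points.
  have e₁ : windowSum W w 0 (fun x => σ x - x) G = alternatingSum W w G := by
    rw [windowSum_sub, h.windowSum_mate_gap hW hG 0 fun x => x, zero_add]
    rfl
  have e₂ : windowSum W w 1 (fun x => ρ x - x) G' = -alternatingSum W w G' := by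
    rw [windowSum_sub, h'.windowSum_mate_gap hW hG' 1 fun x => x]
    exact (neg_sub _ _).symm
  have e₃ : alternatingSum W w G = alternatingSum W w G' := by
    have h₁ := h.alternatingSum_eq hw hW G
    have h₂ := h.alternatingSum_eq hw hW G'
    rw [hr] at h₁
    linarith
  -- The displacement is split into a move by `σ` from even to odd ranks and a move by `ρ` back.
  have e₄ : (fun x => ρ (σ x) - x) = fun x => (ρ (σ x) - σ x) + (σ x - x) := by funext x; ring
  rw [e₄, windowSum_add, h.windowSum_mate hw hW hne 0 (g := fun x => ρ x - x)
      (fun x hx => by rw [h'.periodic x hx]; ring), zero_add,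
    h.windowSum_periodic hw hW (g := fun x => ρ x - x)
      (fun x hx => by rw [h'.periodic x hx]; ring) 0 G', e₂,
    h.windowSum_periodic hw hW (g := fun x => σ x - x)
      (fun x hx => by rw [h.periodic x hx]; ring) 0 G, e₁, e₃, neg_add_cancel]

/-- Even-ranked points of `W`. -/
def IsEven (W : Set ℤ) (x : ℤ) : Prop := x ∈ W ∧ rankParity W x = 0

theorem isEven_step (h : PeriodicMatching W w σ) (h' : PeriodicMatching W w ρ) {x : ℤ}
    (hx : IsEven W x) : IsEven W (ρ (σ x)) :=
  ⟨h'.mem _ (h.mem _ hx.1), by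
    rw [h'.rankParity_mate (h.mem _ hx.1), h.rankParity_mate hx.1, hx.2]; rfl⟩

theorem isEven_iterate (h : PeriodicMatching W w σ) (h' : PeriodicMatching W w ρ) {x : ℤ}
    (hx : IsEven W x) (n : ℕ) : IsEven W ((fun x => ρ (σ x))^[n] x) := by
  induction n with
  | zero => exact hx
  | succ n ih => rw [Function.iterate_succ_apply']; exact h.isEven_step h' ih

theorem step_injective (h : PeriodicMatching W w σ) (h' : PeriodicMatching W w ρ) {x y : ℤ}
    (hx : x ∈ W) (hy : y ∈ W) (e : ρ (σ x) = ρ (σ y)) : x = y := by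
  rw [← h.invol x hx, ← h.invol y hy, ← h'.invol _ (h.mem x hx), ← h'.invol _ (h.mem y hy), e]

theorem iterate_injective (h : PeriodicMatching W w σ) (h' : PeriodicMatching W w ρ) {x y : ℤ}
    (hx : x ∈ W) (hy : y ∈ W) {n : ℕ} (e : (fun x => ρ (σ x))^[n] x = (fun x => ρ (σ x))^[n] y) :
    x = y := by
  induction n generalizing x y with
  | zero => exact e
  | succ n ih =>
    rw [Function.iterate_succ_apply, Function.iterate_succ_apply] at e
    exact h.step_injective h' hx hy (ih (h'.mem _ (h.mem x hx)) (h'.mem _ (h.mem y hy)) e)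

theorem iterate_turn (h : PeriodicMatching W w σ) (h' : PeriodicMatching W w ρ)
    (hW : ∀ x, x + w ∈ W ↔ x ∈ W) {x : ℤ} (hx : x ∈ W) (k : ℤ) (n : ℕ) :
    (fun x => ρ (σ x))^[n] (x + k * w) = (fun x => ρ (σ x))^[n] x + k * w := by
  induction n generalizing x with
  | zero => rfl
  | succ n ih =>
    rw [Function.iterate_succ_apply, Function.iterate_succ_apply, h.periodic_mul hW hx,
      h'.periodic_mul hW (h.mem x hx), ih (h'.mem _ (h.mem x hx))]

/-- Even-ranked points in the same component are related by iterating the two matchings. -/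
theorem exists_iterate (h : PeriodicMatching W w σ) (h' : PeriodicMatching W w ρ) {x v : ℤ}
    (hx : IsEven W x) (hv : IsEven W v)
    (hxv : Relation.EqvGen (fun u v => u ∈ W ∧ (v = σ u ∨ v = ρ u)) x v) :
    ∃ n : ℕ, v = (fun x => ρ (σ x))^[n] x ∨ x = (fun x => ρ (σ x))^[n] v := by
  let K₀ : ℤ → Prop := fun v => ∃ n : ℕ, v = (fun x => ρ (σ x))^[n] x ∨
    x = (fun x => ρ (σ x))^[n] v
  -- An odd-ranked point is recorded through its even-ranked `ρ`-partner, so that `K` is defined on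
  -- the whole component.
  let K : ℤ → Prop := fun u => (IsEven W u ∧ K₀ u) ∨ (u ∈ W ∧ rankParity W u = 1 ∧ K₀ (ρ u))
  have odd_of : ∀ {u}, IsEven W u → rankParity W (σ u) = 1 := fun hu => by
    rw [h.rankParity_mate hu.1, hu.2, zero_add]
  have odd_of' : ∀ {u}, IsEven W u → rankParity W (ρ u) = 1 := fun hu => by
    rw [h'.rankParity_mate hu.1, hu.2, zero_add]
  have stepσ : ∀ u, K u → K (σ u) := by
    rintro u (⟨hu, hk⟩ | ⟨hu, hr, hk⟩)
    · refine Or.inr ⟨h.mem u hu.1, odd_of hu, ?_⟩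
      obtain ⟨n, e | e⟩ := hk
      · exact ⟨n + 1, Or.inl (by rw [Function.iterate_succ_apply', ← e])⟩
      · rcases n with _ | n
        · exact ⟨1, Or.inl (by rw [e]; rfl)⟩
        · exact ⟨n, Or.inr (by rw [e, Function.iterate_succ_apply])⟩
    · have hs : IsEven W (σ u) := ⟨h.mem u hu, by rw [h.rankParity_mate hu, hr]; rfl⟩
      have hπ : (fun x => ρ (σ x)) (σ u) = ρ u := by simp only [h.invol u hu]
      refine Or.inl ⟨hs, ?_⟩
      obtain ⟨n, e | e⟩ := hk
      · rcases n with _ | n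
        · exact ⟨1, Or.inr (by rw [Function.iterate_one, h.invol u hu]; exact e.symm)⟩
        · rw [← hπ, Function.iterate_succ_apply'] at e
          exact ⟨n, Or.inl (h.step_injective h' hs.1 (h.isEven_iterate h' hx n).1 e)⟩
      · exact ⟨n + 1, Or.inr (by rw [Function.iterate_succ_apply, h.invol u hu]; exact e)⟩
  have stepρ : ∀ u, K u → K (ρ u) := by
    rintro u (⟨hu, hk⟩ | ⟨hu, hr, hk⟩)
    · exact Or.inr ⟨h'.mem u hu.1, odd_of' hu, by rwa [h'.invol u hu.1]⟩
    · exact Or.inl ⟨⟨h'.mem u hu, by rw [h'.rankParity_mate hu, hr]; rfl⟩, hk⟩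
  have key : ∀ u v, Relation.EqvGen (fun u v => u ∈ W ∧ (v = σ u ∨ v = ρ u)) u v →
      (K u ↔ K v) := by
    intro u v huv
    induction huv with
    | rel u v huv =>
      obtain ⟨hu, rfl | rfl⟩ := huv
      · exact ⟨stepσ u, fun e => by simpa only [h.invol u hu] using stepσ _ e⟩
      · exact ⟨stepρ u, fun e => by simpa only [h'.invol u hu] using stepρ _ e⟩
    | refl => exact Iff.rfl
    | symm _ _ _ ih => exact ih.symm
    | trans _ _ _ _ _ ih₁ ih₂ => exact ih₁.trans ih₂
  rcases (key x v hxv).1 (Or.inl ⟨hx, 0, Or.inl rfl⟩) with hk | hk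
  · exact hk.2
  · rw [hv.2] at hk
    exact absurd hk.2.1 (by decide)

/-- The composite permutes the even-ranked points modulo the period, so every step of the iteration
has the same total displacement as the first. -/
theorem windowSum_iterate (h : PeriodicMatching W w σ) (h' : PeriodicMatching W w ρ) (hw : 0 < w)
    (hW : ∀ x, x + w ∈ W ↔ x ∈ W) (hne : W.Nonempty)
    (h0 : windowSum W w 0 (fun x => ρ (σ x) - x) 0 = 0) (n : ℕ) :
    windowSum W w 0 (fun x => (fun x => ρ (σ x))^[n] x - x) 0 = 0 := by
  have hper : ∀ n : ℕ, ∀ x ∈ W, (fun x => ρ (σ x))^[n] (x + w) - (x + w) =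
      (fun x => ρ (σ x))^[n] x - x := fun n x hx => by
    have := h.iterate_turn h' hW hx 1 n
    rw [one_mul] at this
    rw [this]; ring
  induction n with
  | zero =>
    simp only [Function.iterate_zero, id_eq, sub_self]
    exact Finset.sum_eq_zero fun x _ => ite_self _
  | succ n ih =>
    have e : (fun x => (fun x => ρ (σ x))^[n + 1] x - x) = fun x =>
        ((fun x => ρ (σ x))^[n] (ρ (σ x)) - ρ (σ x)) + (ρ (σ x) - x) := by
      funext x; rw [Function.iterate_succ_apply]; ring
    rw [e, windowSum_add, h0, add_zero,
      h.windowSum_mate hw hW hne 0 (g := fun x => (fun x => ρ (σ x))^[n] (ρ x) - ρ x)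
        (fun x hx => by rw [h'.periodic x hx, hper n _ (h'.mem x hx)]),
      h'.windowSum_mate hw hW hne _ (g := fun x => (fun x => ρ (σ x))^[n] x - x) (hper n)]
    exact ih

/-- If two matchings connect all points of `W`, up to translation, by a single infinite path, then
they cross each gap an odd number of times. -/
theorem odd_crossings (h : PeriodicMatching W w σ) (h' : PeriodicMatching W w ρ) (hw : 0 < w)
    (hW : ∀ x, x + w ∈ W ↔ x ∈ W)
    (hconn : ∀ x ∈ W, ∀ y ∈ W, ∃ j : ℤ,
      Relation.EqvGen (fun u v => u ∈ W ∧ (v = σ u ∨ v = ρ u)) x (y + j * w))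
    (hwind : ∀ x ∈ W, ∃ k : ℤ, k ≠ 0 ∧
      Relation.EqvGen (fun u v => u ∈ W ∧ (v = σ u ∨ v = ρ u)) x (x + k * w))
    (hne : W.Nonempty) (m : ℤ) : (({u | u ∈ W ∧ u ≤ m ∧ ¬ σ u ≤ m}.ncard : ℕ) : ZMod 2) +
      (({u | u ∈ W ∧ u ≤ m ∧ ¬ ρ u ≤ m}.ncard : ℕ) : ZMod 2) = 1 := by
  classical
  obtain ⟨G, hG⟩ := h.exists_gap hw hW hne
  obtain ⟨G', hG'⟩ := h'.exists_gap hw hW hne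
  rw [h.card_crossings hw hW hne hG m, h'.card_crossings hw hW hne hG' m]
  -- The two counts add up to the sum of the rank parities of the uncrossed gaps. If these agree,
  -- the total displacement vanishes.
  by_contra hcon
  have hr : rankParity W G = rankParity W G' := by
    generalize rankParity W G = p, rankParity W G' = q, rankParity W m = r at hcon
    revert p q r; decide
  have h0 := h.sum_displacement h' hw hW hne hG hG' hr
  obtain ⟨x, hx⟩ : ∃ x, IsEven W x := by
    obtain ⟨x, hx⟩ := hne
    have h2 : ∀ z : ZMod 2, z = 0 ∨ z = 1 := by decide
    rcases h2 (rankParity W x) with e | e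
    · exact ⟨x, hx, e⟩
    · exact ⟨σ x, h.mem x hx, by rw [h.rankParity_mate hx, e]; rfl⟩
  have heven : ∀ {y : ℤ}, IsEven W y → ∀ k : ℤ, IsEven W (y + k * w) := fun hy k =>
    ⟨(periodic_mem hW _ k).2 hy.1, by rw [h.rankParity_turn_mul hw hW hne, hy.2]⟩
  -- The path of `x` passes through another translate of `x`, so some iterate translates `x` by a
  -- nonzero number of turns.
  obtain ⟨n, k, hk, hn⟩ : ∃ (n : ℕ) (k : ℤ), k ≠ 0 ∧ (fun x => ρ (σ x))^[n] x = x + k * w := by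
    obtain ⟨k, hk, hxk⟩ := hwind x hx.1
    obtain ⟨n, e | e⟩ := h.exists_iterate h' hx (heven hx k) hxk
    · exact ⟨n, k, hk, e.symm⟩
    · rw [h.iterate_turn h' hW hx.1] at e
      exact ⟨n, -k, neg_ne_zero.2 hk, by linarith⟩
  -- Up to translation every even-ranked point is on the path of `x`, so the same iterate translates
  -- it by the same amount.
  have hall : ∀ u, IsEven W u → (fun x => ρ (σ x))^[n] u = u + k * w := by
    intro u hu
    obtain ⟨j, hj⟩ := hconn x hx.1 u hu.1
    have hju := heven hu j
    have : (fun x => ρ (σ x))^[n] (u + j * w) = u + j * w + k * w := by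
      obtain ⟨i, e | e⟩ := h.exists_iterate h' hx hju hj
      · rw [e, ← Function.iterate_add_apply, add_comm, Function.iterate_add_apply, hn,
          h.iterate_turn h' hW hx.1]
      · refine h.iterate_injective h' (n := i) (h.isEven_iterate h' hju n).1 (heven hju k).1 ?_
        rw [← Function.iterate_add_apply, add_comm, Function.iterate_add_apply, ← e, hn,
          h.iterate_turn h' hW hju.1, ← e]
    rw [h.iterate_turn h' hW hu.1] at this
    linarith
  have hsum := h.windowSum_iterate h' hw hW hne h0 n
  -- The total displacement is thus `k * w` times the number of even-ranked points in a period. The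
  -- window is started at `x - 1` so that it contains `x`.
  rw [windowSum_congr (g' := fun _ => k * w) (fun x h₁ h₂ => by rw [hall x ⟨h₁, h₂⟩]; ring),
    h.windowSum_periodic hw hW (fun _ _ => rfl) 0 (x - 1)] at hsum
  unfold windowSum at hsum
  rw [← Finset.sum_filter, Finset.sum_const, nsmul_eq_mul] at hsum
  have hpos : 0 < ((Finset.Ioc (x - 1) (x - 1 + w)).filter
      (fun x => x ∈ W ∧ rankParity W x = 0)).card :=
    Finset.card_pos.2 ⟨x, Finset.mem_filter.2 ⟨Finset.mem_Ioc.2 ⟨by omega, by omega⟩, hx⟩⟩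
  have : k * w ≠ 0 := mul_ne_zero hk hw.ne'
  rcases mul_eq_zero.1 hsum with e | e
  · exact absurd e (by exact_mod_cast hpos.ne')
  · exact this e

end PeriodicMatching
end Annular

namespace Annular
namespace Diagram
variable {a b c : AObj} {S : Diagram a b} {T : Diagram b c}

/-! ### Loops created by gluing -/

theorem OnLoop.congr {y z : Pt b} (h : OnLoop S T y)
    (hyz : Conn S T (Glued.mid y) (Glued.mid z)) : OnLoop S T z := fun p hp => h p (hyz.trans hp)

theorem Glued.turn_mid (k : ℤ) (y : Pt b) :
    Glued.turn k (Glued.mid y : Glued a b c) = Glued.mid (y.turn k) := rfl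

theorem conn_mid_turn (hS : S.IsTangle) (hT : T.IsTangle) (k : ℤ) {y z : Pt b} :
    Conn S T (Glued.mid (y.turn k)) (Glued.mid (z.turn k)) ↔
      Conn S T (Glued.mid y) (Glued.mid z) := by
  rw [← Glued.turn_mid, ← Glued.turn_mid, Conn.turn hS hT]

theorem OnLoop.turn (hS : S.IsTangle) (hT : T.IsTangle) {y : Pt b} (h : OnLoop S T y) (k : ℤ) :
    OnLoop S T (y.turn k) := fun p hp => h (p.turn (-k)) <| by
  rw [← Conn.turn hS hT k, ← Glued.outer_turn, Bdry.turn_turn, neg_add_cancel, Bdry.turn_zero]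
  exact hp

theorem Winds.congr (hS : S.IsTangle) (hT : T.IsTangle) {y z : Pt b} (h : Winds S T y)
    (hyz : Conn S T (Glued.mid y) (Glued.mid z)) : Winds S T z := by
  obtain ⟨k, hk, h⟩ := h
  exact ⟨k, hk, (hyz.symm.trans h).trans ((conn_mid_turn hS hT k).2 hyz)⟩

theorem Winds.turn (hS : S.IsTangle) (hT : T.IsTangle) {y : Pt b} (h : Winds S T y) (k : ℤ) :
    Winds S T (y.turn k) := by
  obtain ⟨j, hj, h⟩ := h
  refine ⟨j, hj, ?_⟩
  rw [Pt.turn_turn, add_comm, ← Pt.turn_turn, conn_mid_turn hS hT]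
  exact h

theorem self_mem_loopThrough (y : Pt b) : y ∈ loopThrough S T y :=
  ⟨0, by rw [Pt.turn_zero]; exact .refl _⟩

theorem turn_mem_loopThrough {y z : Pt b} (k : ℤ) :
    z.turn k ∈ loopThrough S T y ↔ z ∈ loopThrough S T y := by
  constructor
  · rintro ⟨j, h⟩
    exact ⟨k + j, by rwa [Pt.turn_turn] at h⟩
  · rintro ⟨j, h⟩
    exact ⟨-k + j, by rwa [Pt.turn_turn, add_neg_cancel_left]⟩

theorem loopThrough_eq_of_conn (hS : S.IsTangle) (hT : T.IsTangle) {y z : Pt b} {k : ℤ}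
    (h : Conn S T (Glued.mid y) (Glued.mid (z.turn k))) :
    loopThrough S T z = loopThrough S T y := by
  ext u
  constructor
  · rintro ⟨j, hj⟩
    refine ⟨j + k, ?_⟩
    rw [← Pt.turn_turn]
    exact h.trans ((conn_mid_turn hS hT k).2 hj)
  · rintro ⟨j, hj⟩
    refine ⟨j - k, ?_⟩
    rw [← conn_mid_turn hS hT k, Pt.turn_turn, sub_add_cancel]
    exact h.symm.trans hj

theorem loopThrough_eq_iff (hS : S.IsTangle) (hT : T.IsTangle) {y z : Pt b} :
    loopThrough S T z = loopThrough S T y ↔ z ∈ loopThrough S T y :=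
  ⟨fun h => h ▸ self_mem_loopThrough z, fun ⟨_, h⟩ => loopThrough_eq_of_conn hS hT h⟩

theorem mem_loopThrough_props (hS : S.IsTangle) (hT : T.IsTangle) {y z : Pt b}
    (hz : z ∈ loopThrough S T y) :
    (OnLoop S T y → OnLoop S T z) ∧ (Winds S T y → Winds S T z) := by
  obtain ⟨k, h⟩ := hz
  refine ⟨fun hy => ?_, fun hy => ?_⟩
  · have := (hy.congr h).turn hS hT (-k)
    rwa [Pt.turn_turn, add_neg_cancel, Pt.turn_zero] at this
  · have := (hy.congr hS hT h).turn hS hT (-k)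
    rwa [Pt.turn_turn, add_neg_cancel, Pt.turn_zero] at this

theorem OnLoop.exists_lower (hS : S.IsTangle) {y : Pt b} (h : OnLoop S T y) :
    ∃ z, S.joined (.inr y) (.inr z) := by
  obtain ⟨q | q, hq, -⟩ := hS.existsUnique (.inr y)
  · exact absurd (Conn.lower hq) (h (.inl q))
  · exact ⟨q, hq⟩

theorem OnLoop.exists_upper (hT : T.IsTangle) {y : Pt b} (h : OnLoop S T y) :
    ∃ z, T.joined (.inl y) (.inl z) := by
  obtain ⟨q | q, hq, -⟩ := hT.existsUnique (.inl y)
  · exact ⟨q, hq⟩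
  · exact absurd (Conn.upper hq) (h (.inr q))

theorem finite_range_turn {β : Type*} (f : Pt b → β) (hf : ∀ y k, f (Pt.turn k y) = f y) :
    (Set.range f).Finite := by
  refine ((Pt.finite_idx (a := b) 0).image f).subset ?_
  rintro _ ⟨y, rfl⟩
  exact ⟨y.turn (-y.idx), by simp [Pt.idx_turn], hf _ _⟩

theorem finite_loops (hS : S.IsTangle) (hT : T.IsTangle) (P : Pt b → Prop) :
    {L : Set (Pt b) | ∃ y, P y ∧ L = loopThrough S T y}.Finite := by
  refine (finite_range_turn (loopThrough S T) fun y k => ?_).subset ?_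
  · exact (loopThrough_eq_iff hS hT).2 ((turn_mem_loopThrough k).2 (self_mem_loopThrough y))
  · rintro L ⟨y, -, rfl⟩
    exact ⟨y, rfl⟩

/-! ### Through strings of a composite block loops -/

/-- A tangle with non-contractible loops has no through strings, so the component could not pass it.
A winding loop created by gluing is excluded by `lev`: it avoids the component of `x` but visits
points far to its left and far to its right, while that component has an odd number of points on the
middle circle. -/
theorem core_eq_zero_comp (hS : S.IsTangle) (hT : T.IsTangle) (x : Pt a) (z : Pt c)
    (h : (S.comp T).joined (.inl x) (.inr z)) : (S.comp T).core = 0 := by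
  have hS0 : S.core = 0 := by
    by_contra hne
    -- Without through strings of `S`, the inner circle is a union of components.
    have := h.2.invariant (fun u : Glued a b c => ∃ x, u = .inl x) (fun p q hpq => ?_)
      (fun p q hpq => ?_)
    · have := this.mp ⟨x, rfl⟩
      simp [Glued.outer] at this
    · rcases p with p | p <;> rcases q with q | q
      · simp [Glued.lower]
      · exact absurd (hS.core_eq_zero _ _ hpq) hne
      · exact absurd (hS.core_eq_zero _ _ (hS.symm _ _ hpq)) hne
      · simp [Glued.lower]
    · rcases p with p | p <;> rcases q with q | q <;> simp [Glued.upper]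
  have hT0 : T.core = 0 := by
    by_contra hne
    have := h.2.invariant (fun u : Glued a b c => ∃ z, u = .inr (.inr z)) (fun p q hpq => ?_)
      (fun p q hpq => ?_)
    · have := this.mpr ⟨z, rfl⟩
      simp [Glued.outer] at this
    · rcases p with p | p <;> rcases q with q | q <;> simp [Glued.lower]
    · rcases p with p | p <;> rcases q with q | q
      · simp [Glued.upper]
      · exact absurd (hT.core_eq_zero _ _ hpq) hne
      · exact absurd (hT.core_eq_zero _ _ (hT.symm _ _ hpq)) hne
      · simp [Glued.upper]
  have hL : {L : Set (Pt b) | ∃ y, OnLoop S T y ∧ Winds S T y ∧ L = loopThrough S T y} = ∅ := by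
    refine Set.eq_empty_of_forall_notMem ?_
    rintro L ⟨y, hy, ⟨k, hk, hyk⟩, -⟩
    obtain ⟨A, B, E, hc, hA, hB, hE⟩ := exists_levels
      (finite_component hS hT fun k hk => outer_turn_eq_zero hS hT (p := .inl x) hk)
      (fun u v huv (hu : Conn S T (Glued.outer (.inl x)) u) => hu.trans huv)
    -- The second end of the component of `x` is on the outer circle.
    have hA1 : A = {x} := by
      ext x'
      rw [hA, Finset.mem_singleton]
      constructor
      · intro (hx : Conn S T (Glued.outer (.inl x)) (Glued.outer (.inl x')))
        by_contra hne
        have := outer_unique hS hT hx h.2 (by simpa using hne) h.1.symm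
        simp at this
      · rintro rfl
        exact Conn.refl (Glued.outer (.inl x'))
    have hB1 : (B.card : ZMod 2) = 1 := by
      rw [(card_closedUnder hS hT hc).1, hA1, Finset.card_singleton, Nat.cast_one]
    have hnot : ∀ j : ℤ, y.turn (j * k) ∉ B := fun j hj => by
      have : Conn S T (Glued.outer (.inl x)) (Glued.mid (y.turn (j * k))) := (hB _).1 hj
      have h₂ : Conn S T (Glued.mid y) (Glued.mid (y.turn (j * k))) := Conn.turn_mul hS hT hyk j
      exact hy _ (h₂.trans this.symm)
    have hconst : ∀ j : ℤ, rk B (y.turn (j * k)) = rk B y := fun j => by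
      have h₂ : Conn S T (Glued.mid y) (Glued.mid (y.turn (j * k))) := Conn.turn_mul hS hT hyk j
      have := lev₃_eq hS hT hc h₂
      have hy0 := hnot 0
      rw [zero_mul, Pt.turn_zero] at hy0
      simpa [lev₃, lev, Glued.mid, hnot j, hy0] using this.symm
    obtain ⟨M, hM⟩ : ∃ M : ℕ, ∀ v ∈ B, |v.1 - y.1| < M := by
      obtain ⟨M, hM⟩ := (B.image fun v => |v.1 - y.1|).bddAbove
      refine ⟨(M + 1).toNat, fun v hv => ?_⟩
      have := hM (Finset.mem_coe.2 (Finset.mem_image_of_mem _ hv))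
      have h₂ : |v.1 - y.1| ≤ M := this
      omega
    have hk2 : 1 ≤ k * k := by
      have := mul_self_pos.2 hk
      omega
    have hw := y.width_pos
    have hkw : 1 ≤ k * k * b.width := by nlinarith
    -- The factor `k * k` is positive whatever the sign of `k`, so these translates lie beyond all
    -- of `B`, on the right here and on the left in `h₂`.
    have h₁ : rk B (y.turn (M * k * k)) = 0 := by
      refine Finset.sum_eq_zero fun v hv => if_neg ?_
      have := abs_lt.1 (hM v hv)
      have h₃ : (M : ℤ) * 1 ≤ M * (k * k * b.width) := by gcongr
      rw [Pt.turn_val]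
      nlinarith
    have h₂ : rk B (y.turn (-M * k * k)) = 1 := by
      rw [← hB1, rk, Finset.sum_congr rfl (g := fun _ => 1), Finset.sum_const, nsmul_eq_mul, mul_one]
      intro v hv
      refine if_pos ?_
      have := abs_lt.1 (hM v hv)
      have h₃ : (M : ℤ) * 1 ≤ M * (k * k * b.width) := by gcongr
      rw [Pt.turn_val]
      nlinarith
    rw [hconst (M * k)] at h₁
    rw [hconst (-M * k), h₁] at h₂
    exact absurd h₂ (by decide)
  simp only [comp, hS0, hT0, hL, Set.ncard_empty]

/-! ### Non-contractible loops meet each transversal an odd number of times -/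

/-- The coordinate of the other end of the string at an inner point. -/
noncomputable def innerMate {D : Diagram a b} (h : D.IsTangle) (ha : 0 < a.width) (x : ℤ) : ℤ :=
  Sum.elim (fun p => p.1) (fun p => p.1) (h.mate (.inl ⟨x, ha⟩))

theorem innerMate_eq {D : Diagram a b} (h : D.IsTangle) (ha : 0 < a.width) {x : ℤ} {z : Pt a}
    (hz : D.joined (.inl ⟨x, ha⟩) (.inl z)) : innerMate h ha x = z.1 := by
  rw [innerMate, h.mate_eq hz]; rfl

theorem periodicMatching_innerMate {D : Diagram a b} (h : D.IsTangle) (ha : 0 < a.width)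
    {L : Set (Pt a)} (hL : ∀ z ∈ L, ∃ z' ∈ L, D.joined (.inl z) (.inl z')) :
    PeriodicMatching {x | (⟨x, ha⟩ : Pt a) ∈ L} a.width (innerMate h ha) where
  mem x hx := by
    obtain ⟨z, hz, hj⟩ := hL _ hx
    rw [innerMate_eq h ha hj]
    exact hz
  invol x hx := by
    obtain ⟨z, hz, hj⟩ := hL _ hx
    rw [innerMate_eq h ha hj, innerMate_eq h ha (h.symm _ _ hj)]
  ne x hx := by
    obtain ⟨z, hz, hj⟩ := hL _ hx
    rw [innerMate_eq h ha hj]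
    intro e
    have : z = ⟨x, ha⟩ := Pt.ext_val e
    exact h.irrefl _ (this ▸ hj)
  nested x hx y hy hxy hyx := by
    obtain ⟨z, hz, hj⟩ := hL _ hx
    obtain ⟨z', hz', hj'⟩ := hL _ hy
    rw [innerMate_eq h ha hj] at hyx
    rw [innerMate_eq h ha hj, innerMate_eq h ha hj']
    exact h.between_closed hj hj' hxy hyx
  periodic x hx := by
    obtain ⟨z, hz, hj⟩ := hL _ hx
    have hp := h.periodic _ _ hj
    have e : (⟨x + a.width, ha⟩ : Pt a) = Pt.turn 1 ⟨x, ha⟩ := Pt.ext_val (by simp [Pt.turn])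
    have : D.joined (.inl ⟨x + a.width, ha⟩) (.inl (z.turn 1)) := by rw [e]; exact hp
    rw [innerMate_eq h ha hj, innerMate_eq h ha this, Pt.turn_val, one_mul]

/-- A loop never leaves the middle circle, so its connections are chains of cups of `S` and caps of
`T`; reflection turns the former into caps. -/
theorem eqvGen_of_conn (hS : S.IsTangle) (hT : T.IsTangle) {y u v : Pt b} (hy : OnLoop S T y)
    (hu : u ∈ loopThrough S T y) (huv : Conn S T (Glued.mid u) (Glued.mid v)) :
    Relation.EqvGen (fun s t => s ∈ {x | (⟨x, y.2⟩ : Pt b) ∈ loopThrough S T y} ∧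
      (t = innerMate hS.star y.2 s ∨ t = innerMate hT y.2 s)) u.1 v.1 := by
  have hu' : OnLoop S T u := (mem_loopThrough_props hS hT hu).1 hy
  have hmem : ∀ z, Conn S T (Glued.mid u) (Glued.mid z) → z ∈ loopThrough S T y := by
    intro z hz
    obtain ⟨k, hk⟩ := hu
    exact ⟨k, hk.trans ((conn_mid_turn hS hT k).2 hz)⟩
  let K : Glued a b c → Prop := fun w => ∃ z, w = Glued.mid z ∧
    Conn S T (Glued.mid u) (Glued.mid z) ∧ Relation.EqvGen (fun s t => s ∈ {x | (⟨x, y.2⟩ : Pt b) ∈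
      loopThrough S T y} ∧ (t = innerMate hS.star y.2 s ∨ t = innerMate hT y.2 s)) u.1 z.1
  have key := huv.invariant K (fun p q hpq => ?_) (fun p q hpq => ?_)
  · obtain ⟨z, hz, -, h⟩ := key.mp ⟨u, rfl, .refl _, .refl _⟩
    have : v = z := by simpa [Glued.mid] using hz
    exact this ▸ h
  · have imp : ∀ p q, S.joined p q → K (Glued.lower p) → K (Glued.lower q) := by
      rintro p q hpq ⟨z, hz, hc, h⟩
      obtain rfl : p = .inr z := by
        rcases p with p | p <;> simp [Glued.lower, Glued.mid] at hz ⊢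
        exact hz
      obtain ⟨z', hz'⟩ := (hu'.congr hc).exists_lower hS
      obtain rfl := hS.eq_of_joined hpq hz'
      refine ⟨z', rfl, hc.trans (.lower hz'), h.trans _ _ _ (.rel _ _ ⟨hmem z hc, Or.inl ?_⟩)⟩
      exact (innerMate_eq hS.star y.2 (z := z') hz').symm
    exact propext ⟨imp p q hpq, imp q p (hS.symm _ _ hpq)⟩
  · have imp : ∀ p q, T.joined p q → K (Glued.upper p) → K (Glued.upper q) := by
      rintro p q hpq ⟨z, hz, hc, h⟩
      obtain rfl : p = .inl z := by
        rcases p with p | p <;> simp [Glued.upper, Glued.mid] at hz ⊢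
        exact hz
      obtain ⟨z', hz'⟩ := (hu'.congr hc).exists_upper hT
      obtain rfl := hT.eq_of_joined hpq hz'
      refine ⟨z', rfl, hc.trans (.upper hz'), h.trans _ _ _ (.rel _ _ ⟨hmem z hc, Or.inr ?_⟩)⟩
      exact (innerMate_eq hT y.2 (z := z') hz').symm
    exact propext ⟨imp p q hpq, imp q p (hT.symm _ _ hpq)⟩

/-- This is `PeriodicMatching.odd_crossings` for the cups of `S` and the caps of `T` at the lifted
points of one loop. -/
theorem odd_crossings_loop (hS : S.IsTangle) (hT : T.IsTangle) {y : Pt b} (hy : OnLoop S T y)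
    (hw : Winds S T y) (m : ℤ) :
    (({u : Pt b | u ∈ loopThrough S T y ∧ u.1 ≤ m ∧ ¬ innerMate hS.star y.2 u.1 ≤ m}.ncard : ℕ) :
      ZMod 2) + (({u : Pt b | u ∈ loopThrough S T y ∧ u.1 ≤ m ∧ ¬ innerMate hT y.2 u.1 ≤ m}.ncard :
      ℕ) : ZMod 2) = 1 := by
  have hval : ∀ Q : ℤ → Prop, {u : Pt b | u ∈ loopThrough S T y ∧ u.1 ≤ m ∧ Q u.1}.ncard =
      {u : ℤ | u ∈ {x | (⟨x, y.2⟩ : Pt b) ∈ loopThrough S T y} ∧ u ≤ m ∧ Q u}.ncard := by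
    intro Q
    refine Set.ncard_congr (fun u _ => u.1) (fun u hu => hu) (fun _ _ _ _ e => Pt.ext_val e) ?_
    exact fun u hu => ⟨⟨u, y.2⟩, hu, rfl⟩
  refine (congrArg₂ (fun i j : ℕ => (i : ZMod 2) + j) (hval fun u => ¬ innerMate hS.star y.2 u ≤ m)
    (hval fun u => ¬ innerMate hT y.2 u ≤ m)).trans ?_
  have hturn : ∀ (x k : ℤ), (⟨x + k * b.width, y.2⟩ : Pt b) = Pt.turn k ⟨x, y.2⟩ := fun x k => rfl
  refine PeriodicMatching.odd_crossings (w := b.width)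
    (W := {x | (⟨x, y.2⟩ : Pt b) ∈ loopThrough S T y}) (periodicMatching_innerMate hS.star y.2 ?_)
    (periodicMatching_innerMate hT y.2 ?_) y.width_pos (fun x => ?_) (fun u hu v hv => ?_)
    (fun u hu => ?_) ⟨y.1, self_mem_loopThrough (S := S) (T := T) y⟩ m
  · intro z hz
    obtain ⟨z', h⟩ := ((mem_loopThrough_props hS hT hz).1 hy).exists_lower hS
    obtain ⟨k, hk⟩ := hz
    exact ⟨z', ⟨k, hk.trans ((conn_mid_turn hS hT k).2 (.lower h))⟩, h⟩
  · intro z hz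
    obtain ⟨z', h⟩ := ((mem_loopThrough_props hS hT hz).1 hy).exists_upper hT
    obtain ⟨k, hk⟩ := hz
    exact ⟨z', ⟨k, hk.trans ((conn_mid_turn hS hT k).2 (.upper h))⟩, h⟩
  · have := turn_mem_loopThrough (S := S) (T := T) (y := y) (z := ⟨x, y.2⟩) 1
    rw [← hturn, one_mul] at this
    exact this
  · have e : loopThrough S T (⟨u, y.2⟩ : Pt b) = loopThrough S T y :=
      (loopThrough_eq_iff hS hT).2 hu
    have hv' : (⟨v, y.2⟩ : Pt b) ∈ loopThrough S T (⟨u, y.2⟩ : Pt b) := e ▸ hv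
    obtain ⟨j, hj⟩ := hv'
    exact ⟨j, eqvGen_of_conn hS hT hy hu hj⟩
  · obtain ⟨k, hk, h⟩ := (mem_loopThrough_props hS hT hu).2 hw
    exact ⟨k, hk, eqvGen_of_conn hS hT hy hu h⟩

/-! ### The checkerboard shading of a composite -/

/-- A point on a non-contractible loop created by gluing. -/
def OnWinding (S : Diagram a b) (T : Diagram b c) (u : Glued a b c) : Prop :=
  ∃ y, u = Glued.mid y ∧ OnLoop S T y ∧ Winds S T y

theorem OnWinding.congr (hS : S.IsTangle) (hT : T.IsTangle) {u v : Glued a b c}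
    (h : OnWinding S T u) (huv : Conn S T u v) : OnWinding S T v := by
  obtain ⟨y, rfl, hy, hw⟩ := h
  rcases v with x | z | x
  · exact absurd huv (hy (.inl x))
  · exact ⟨z, rfl, hy.congr huv, hw.congr hS hT huv⟩
  · exact absurd huv (hy (.inr x))

theorem finite_component_of_not_onWinding (hS : S.IsTangle) (hT : T.IsTangle) {u : Glued a b c}
    (h : ¬ OnWinding S T u) : {v | Conn S T u v}.Finite := by
  have houter : ∀ p : Bdry a c, {v | Conn S T (Glued.outer p) v}.Finite := fun p =>
    finite_component hS hT fun k hk => outer_turn_eq_zero hS hT hk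
  rcases u with x | y | z
  · exact houter (.inl x)
  · by_cases hy : OnLoop S T y
    · refine finite_component hS hT fun k hk => ?_
      by_contra hne
      exact h ⟨y, rfl, hy, k, hne, hk⟩
    · simp only [OnLoop, not_forall, not_not] at hy
      obtain ⟨p, hp⟩ := hy
      refine (houter p).subset fun v hv => ?_
      exact hp.symm.trans hv
  · exact houter (.inr z)

-- The transversal is drawn through the gap `0` of the middle line, and the conditions for `S` and
-- `T` are added; the shade of the middle gap cancels. The crossings with winding loops contribute
-- an odd number for each loop. The other crossings lie on finitely many finite components, where
-- the crossings within one tangle are counted, modulo `2`, by the points to the left on its two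
-- circles; the middle circle is counted twice.
open Classical in
theorem checkerboard_comp (hS : S.IsTangle) (hT : T.IsTangle) (g k : ℤ) :
    (((S.comp T).crossings g k + (S.comp T).core : ℕ) : ZMod 2) = a.shade g + c.shade k := by
  let XS : Set (Bdry a b) := {p | p.left g 0 ∧ ∃ q, S.joined p q ∧ ¬ q.left g 0}
  let XT : Set (Bdry b c) := {p | p.left 0 k ∧ ∃ q, T.joined p q ∧ ¬ q.left 0 k}
  let YS : Set (Pt b) := {y | (OnLoop S T y ∧ Winds S T y) ∧ y.1 ≤ 0 ∧
    ¬ innerMate hS.star y.2 y.1 ≤ 0}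
  let YT : Set (Pt b) := {y | (OnLoop S T y ∧ Winds S T y) ∧ y.1 ≤ 0 ∧ ¬ innerMate hT y.2 y.1 ≤ 0}
  have fS : XS.Finite := hS.finite_crossings g 0
  have fT : XT.Finite := hT.finite_crossings 0 k
  have hYS : ∀ y : Pt b, y ∈ YS ↔ (OnLoop S T y ∧ Winds S T y) ∧ Sum.inr y ∈ XS := by
    intro y
    refine and_congr_right fun hy => and_congr_right fun _ => ?_
    obtain ⟨z, hz⟩ := hy.1.exists_lower hS
    rw [innerMate_eq hS.star y.2 (z := z) hz]
    constructor
    · exact fun e => ⟨_, hz, e⟩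
    · rintro ⟨q, hq, hq'⟩
      obtain rfl := hS.eq_of_joined hq hz
      exact hq'
  have hYT : ∀ y : Pt b, y ∈ YT ↔ (OnLoop S T y ∧ Winds S T y) ∧ Sum.inl y ∈ XT := by
    intro y
    refine and_congr_right fun hy => and_congr_right fun _ => ?_
    obtain ⟨z, hz⟩ := hy.1.exists_upper hT
    rw [innerMate_eq hT y.2 (z := z) hz]
    constructor
    · exact fun e => ⟨_, hz, e⟩
    · rintro ⟨q, hq, hq'⟩
      obtain rfl := hT.eq_of_joined hq hz
      exact hq'
  have fYS : YS.Finite := (fS.preimage (f := Sum.inr) Sum.inr_injective.injOn).subset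
    fun y hy => ((hYS y).1 hy).2
  have fYT : YT.Finite := (fT.preimage (f := Sum.inl) Sum.inl_injective.injOn).subset
    fun y hy => ((hYT y).1 hy).2
  -- the non-contractible loops
  have hloops : ((YS.ncard : ℕ) : ZMod 2) + (YT.ncard : ℕ) =
      ({L : Set (Pt b) | ∃ y, OnLoop S T y ∧ Winds S T y ∧ L = loopThrough S T y}.ncard : ℕ) := by
    have fF : {L : Set (Pt b) | ∃ y, OnLoop S T y ∧ Winds S T y ∧ L = loopThrough S T y}.Finite := by
      simpa only [and_assoc] using finite_loops hS hT fun y => OnLoop S T y ∧ Winds S T y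
    rw [Set.ncard_eq_toFinset_card _ fYS, Set.ncard_eq_toFinset_card _ fYT,
      Set.ncard_eq_toFinset_card _ fF,
      Finset.card_eq_sum_card_fiberwise (f := loopThrough S T) (t := fF.toFinset),
      Finset.card_eq_sum_card_fiberwise (f := loopThrough S T) (t := fF.toFinset) (s := fYT.toFinset),
      Nat.cast_sum, Nat.cast_sum, ← Finset.sum_add_distrib, Finset.sum_congr rfl (g := fun _ => 1),
      Finset.sum_const, nsmul_eq_mul, mul_one]
    · intro L hL
      obtain ⟨y, hy, hw, rfl⟩ := fF.mem_toFinset.1 hL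
      rw [← odd_crossings_loop hS hT hy hw 0]
      have key : ∀ (Q : Pt b → Prop) (f : Finset (Pt b)), (∀ u, u ∈ f ↔
          (OnLoop S T u ∧ Winds S T u) ∧ u.1 ≤ 0 ∧ Q u) →
          (f.filter fun u => loopThrough S T u = loopThrough S T y).card =
          {u : Pt b | u ∈ loopThrough S T y ∧ u.1 ≤ 0 ∧ Q u}.ncard := by
        intro Q f hf
        rw [← Set.ncard_coe_finset]
        congr 1
        ext u
        simp only [Finset.coe_filter, Set.mem_ofPred_eq, hf, loopThrough_eq_iff hS hT]
        constructor
        · rintro ⟨⟨-, h₁⟩, h₂⟩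
          exact ⟨h₂, h₁⟩
        · rintro ⟨h₁, h₂⟩
          have := mem_loopThrough_props hS hT h₁
          exact ⟨⟨⟨this.1 hy, this.2 hw⟩, h₂⟩, h₁⟩
      rw [key (fun u => ¬ innerMate hS.star y.2 u.1 ≤ 0) _ (fun u => fYS.mem_toFinset),
        key (fun u => ¬ innerMate hT y.2 u.1 ≤ 0) _ (fun u => fYT.mem_toFinset)]
    · intro y hy
      have := ((fYT.mem_toFinset).1 (Finset.mem_coe.1 hy)).1
      exact Finset.mem_coe.2 (fF.mem_toFinset.2 ⟨y, this.1, this.2, rfl⟩)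
    · intro y hy
      have := ((fYS.mem_toFinset).1 (Finset.mem_coe.1 hy)).1
      exact Finset.mem_coe.2 (fF.mem_toFinset.2 ⟨y, this.1, this.2, rfl⟩)
  -- the other strings
  let WS : Set (Bdry a b) := {p | OnWinding S T (Glued.lower p)}
  let WT : Set (Bdry b c) := {p | OnWinding S T (Glued.upper p)}
  have hWS : (XS ∩ WS).ncard = YS.ncard := by
    rw [← Set.ncard_image_of_injective YS (f := (Sum.inr : Pt b → Bdry a b)) Sum.inr_injective]
    congr 1
    ext p
    constructor
    · rintro ⟨hp, y, hy, hw⟩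
      obtain rfl : p = .inr y := by
        rcases p with p | p <;> simp [Glued.lower, Glued.mid] at hy ⊢
        exact hy
      exact ⟨y, (hYS y).2 ⟨hw, hp⟩, rfl⟩
    · rintro ⟨y, hy, rfl⟩
      have := (hYS y).1 hy
      exact ⟨this.2, y, rfl, this.1⟩
  have hWT : (XT ∩ WT).ncard = YT.ncard := by
    rw [← Set.ncard_image_of_injective YT (f := (Sum.inl : Pt b → Bdry b c)) Sum.inl_injective]
    congr 1
    ext p
    constructor
    · rintro ⟨hp, y, hy, hw⟩
      obtain rfl : p = .inl y := by
        rcases p with p | p <;> simp [Glued.upper, Glued.mid] at hy ⊢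
        exact hy
      exact ⟨y, (hYT y).2 ⟨hw, hp⟩, rfl⟩
    · rintro ⟨y, hy, rfl⟩
      have := (hYT y).1 hy
      exact ⟨this.2, y, rfl, this.1⟩
  -- The crossings off the winding loops; the set `V` below is the finite union of their components.
  let F : Set (Glued a b c) := Glued.lower '' (XS \ WS) ∪ Glued.upper '' (XT \ WT)
  have hF : ∀ u ∈ F, ¬ OnWinding S T u := by
    rintro u (⟨p, hp, rfl⟩ | ⟨p, hp, rfl⟩)
    · exact hp.2
    · exact hp.2
  let V : Set (Glued a b c) := {v | ∃ u ∈ F, Conn S T u v}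
  have fV : V.Finite := by
    have : V = ⋃ u ∈ F, {v | Conn S T u v} := by ext; simp [V]
    rw [this]
    exact ((fS.sdiff.image _).union (fT.sdiff.image _)).biUnion fun u hu =>
      finite_component_of_not_onWinding hS hT (hF u hu)
  have hV : ∀ u v, Conn S T u v → u ∈ V → v ∈ V := fun u v huv ⟨w, hw, hwu⟩ =>
    ⟨w, hw, hwu.trans huv⟩
  have hVW : ∀ v ∈ V, ¬ OnWinding S T v := fun v ⟨u, hu, huv⟩ h =>
    hF u hu (h.congr hS hT huv.symm)
  obtain ⟨A, B, E, hc, hA, hB, hE⟩ := exists_levels fV hV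
  have hlow : ∀ p : Bdry a b, p ∈ A.disjSum B ↔ Glued.lower p ∈ V := by
    rintro (p | p)
    · simpa [Glued.lower] using hA p
    · simpa [Glued.lower] using hB p
  have hup : ∀ p : Bdry b c, p ∈ B.disjSum E ↔ Glued.upper p ∈ V := by
    rintro (p | p)
    · simpa [Glued.upper] using hB p
    · simpa [Glued.upper] using hE p
  have hout : ∀ p : Bdry a c, p ∈ A.disjSum E ↔ Glued.outer p ∈ V := by
    rintro (p | p)
    · simpa [Glued.outer] using hA p
    · simpa [Glued.outer] using hE p
  have cS : (((XS \ WS).ncard : ℕ) : ZMod 2) =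
      (∑ x ∈ A, if x.1 ≤ g then 1 else 0) + ∑ y ∈ B, if y.1 ≤ 0 then 1 else 0 := by
    have := card_separated (A.disjSum B) hS.mate (Bdry.left g 0)
      (fun p hp => hc.1 _ _ (hS.joined_mate p) hp) hS.mate_mate hS.mate_ne
    rw [Finset.sum_disjSum] at this
    have h₂ : (XS \ WS) = ((A.disjSum B).filter fun p =>
        Bdry.left g 0 p ∧ ¬ Bdry.left g 0 (hS.mate p) : Finset (Bdry a b)) := by
      ext p
      rw [Finset.coe_filter, Set.mem_ofPred_eq, hlow]
      constructor
      · rintro ⟨⟨h₁, q, hq, hq'⟩, h₂⟩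
        refine ⟨⟨_, Or.inl ⟨p, ⟨⟨h₁, q, hq, hq'⟩, h₂⟩, rfl⟩, .refl _⟩, h₁, ?_⟩
        rwa [hS.mate_eq hq]
      · rintro ⟨h₁, h₂, h₃⟩
        exact ⟨⟨h₂, _, hS.joined_mate p, h₃⟩, hVW _ h₁⟩
    rw [h₂, Set.ncard_coe_finset, this]
    congr!
  have cT : (((XT \ WT).ncard : ℕ) : ZMod 2) =
      (∑ y ∈ B, if y.1 ≤ 0 then 1 else 0) + ∑ z ∈ E, if z.1 ≤ k then 1 else 0 := by
    have := card_separated (B.disjSum E) hT.mate (Bdry.left 0 k)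
      (fun p hp => hc.2 _ _ (hT.joined_mate p) hp) hT.mate_mate hT.mate_ne
    rw [Finset.sum_disjSum] at this
    have h₂ : (XT \ WT) = ((B.disjSum E).filter fun p =>
        Bdry.left 0 k p ∧ ¬ Bdry.left 0 k (hT.mate p) : Finset (Bdry b c)) := by
      ext p
      rw [Finset.coe_filter, Set.mem_ofPred_eq, hup]
      constructor
      · rintro ⟨⟨h₁, q, hq, hq'⟩, h₂⟩
        refine ⟨⟨_, Or.inr ⟨p, ⟨⟨h₁, q, hq, hq'⟩, h₂⟩, rfl⟩, .refl _⟩, h₁, ?_⟩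
        rwa [hT.mate_eq hq]
      · rintro ⟨h₁, h₂, h₃⟩
        exact ⟨⟨h₂, _, hT.joined_mate p, h₃⟩, hVW _ h₁⟩
    rw [h₂, Set.ncard_coe_finset, this]
    congr!
  have cC : (((S.comp T).crossings g k : ℕ) : ZMod 2) =
      (∑ x ∈ A, if x.1 ≤ g then 1 else 0) + ∑ z ∈ E, if z.1 ≤ k then 1 else 0 := by
    choose f hf hfu using existsUnique_comp (a := a) (c := c) hS hT
    have hff : ∀ p, f (f p) = p := fun p =>
      (hfu (f p) p ⟨(hf p).1.symm, (hf p).2.symm⟩).symm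
    have := card_separated (A.disjSum E) f (Bdry.left g k)
      (fun p hp => (hout _).2 (hV _ _ (hf p).2 ((hout _).1 hp))) hff (fun p => (hf p).1.symm)
    rw [Finset.sum_disjSum] at this
    have h₂ : {p : Bdry a c | p.left g k ∧ ∃ q, (S.comp T).joined p q ∧ ¬ q.left g k} =
        ((A.disjSum E).filter fun p =>
        Bdry.left g k p ∧ ¬ Bdry.left g k (f p) : Finset (Bdry a c)) := by
      ext p
      rw [Finset.coe_filter, Set.mem_ofPred_eq, Set.mem_ofPred_eq, hout]
      constructor
      · rintro ⟨h₁, q, hq, hq'⟩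
        obtain rfl := hfu p q hq
        refine ⟨?_, h₁, hq'⟩
        -- Along a component that avoids `F` no string crosses the transversal, so both ends would
        -- be on its left side.
        by_contra hp
        have hpW : ∀ u, Conn S T (Glued.outer p) u → ¬ OnWinding S T u := fun u hu h => by
          obtain ⟨y, rfl, hy, -⟩ := h
          exact hy _ hu.symm
        let K : Glued a b c → Prop := fun u => Conn S T (Glued.outer p) u ∧
          Sum.elim (fun x => x.1 ≤ g) (Sum.elim (fun y => y.1 ≤ 0) (fun z => z.1 ≤ k)) u
        have hKl : ∀ r : Bdry a b, K (Glued.lower r) ↔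
            Conn S T (Glued.outer p) (Glued.lower r) ∧ r.left g 0 := by
          rintro (r | r) <;> exact Iff.rfl
        have hKu : ∀ r : Bdry b c, K (Glued.upper r) ↔
            Conn S T (Glued.outer p) (Glued.upper r) ∧ r.left 0 k := by
          rintro (r | r) <;> exact Iff.rfl
        have impl : ∀ p' q', S.joined p' q' → K (Glued.lower p') → K (Glued.lower q') := by
          intro p' q' h h'
          rw [hKl] at h' ⊢
          refine ⟨h'.1.trans (.lower h), ?_⟩
          by_contra hq'
          exact hp ⟨_, Or.inl ⟨p', ⟨⟨h'.2, q', h, hq'⟩, hpW _ h'.1⟩, rfl⟩, h'.1.symm⟩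
        have impu : ∀ p' q', T.joined p' q' → K (Glued.upper p') → K (Glued.upper q') := by
          intro p' q' h h'
          rw [hKu] at h' ⊢
          refine ⟨h'.1.trans (.upper h), ?_⟩
          by_contra hq'
          exact hp ⟨_, Or.inr ⟨p', ⟨⟨h'.2, q', h, hq'⟩, hpW _ h'.1⟩, rfl⟩, h'.1.symm⟩
        have hKo : ∀ r : Bdry a c, K (Glued.outer r) ↔
            Conn S T (Glued.outer p) (Glued.outer r) ∧ r.left g k := by
          rintro (r | r) <;> exact Iff.rfl
        have := (hf p).2.invariant K
          (fun p' q' h => propext ⟨impl _ _ h, impl _ _ (hS.symm _ _ h)⟩)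
          (fun p' q' h => propext ⟨impu _ _ h, impu _ _ (hT.symm _ _ h)⟩)
        exact hq' ((hKo _).1 (this.mp ((hKo p).2 ⟨.refl _, h₁⟩))).2
      · rintro ⟨h₁, h₂, h₃⟩
        exact ⟨h₂, _, hf p, h₃⟩
    rw [crossings, h₂, Set.ncard_coe_finset, this]
    congr!
  have eS := hS.checkerboard g 0
  have eT := hT.checkerboard 0 k
  have nS : S.crossings g 0 = (XS ∩ WS).ncard + (XS \ WS).ncard :=
    (Set.ncard_inter_add_ncard_sdiff_eq_ncard XS WS fS).symm
  have nT : T.crossings 0 k = (XT ∩ WT).ncard + (XT \ WT).ncard :=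
    (Set.ncard_inter_add_ncard_sdiff_eq_ncard XT WT fT).symm
  rw [nS, hWS] at eS
  rw [nT, hWT] at eT
  have h2 : (2 : ZMod 2) = 0 := rfl
  simp only [comp, Nat.cast_add] at eS eT ⊢
  rw [cS] at eS
  rw [cT] at eT
  have := cC
  simp only [comp] at this
  rw [this, ← hloops]
  -- Twice the shade of the middle gap and twice the count on the middle circle vanish.
  linear_combination eS + eT + (b.shade 0 - ∑ y ∈ B, if y.1 ≤ 0 then (1 : ZMod 2) else 0) * h2

theorem IsTangle.comp (hS : S.IsTangle) (hT : T.IsTangle) : (S.comp T).IsTangle where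
  symm _ _ h := ⟨h.1.symm, h.2.symm⟩
  irrefl _ h := h.1 rfl
  existsUnique := existsUnique_comp hS hT
  periodic p q h := by
    refine ⟨(Bdry.turn_inj 1).not.2 h.1, ?_⟩
    rw [Glued.outer_turn, Glued.outer_turn, Conn.turn hS hT]
    exact h.2
  planar := planar_comp hS hT
  core_eq_zero := core_eq_zero_comp hS hT
  checkerboard := checkerboard_comp hS hT

end Diagram
end Annular

/-! ### Recognizing tangles; units, twists and reflection. -/

namespace Annular

/-- Only the pair of `p₀` is affected: it becomes separated or stops being so, depending on the side
of `f p₀`. -/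
theorem ncard_separated_insert {X : Type} {f : X → X} (hf : ∀ p, f (f p) = p) (hne : ∀ p, f p ≠ p)
    {l l' : X → Prop} {p₀ : X} (h₀ : ¬ l p₀) (hl : ∀ p, l' p ↔ l p ∨ p = p₀)
    (hfin : {p | l p ∧ ¬ l (f p)}.Finite) :
    (({p | l' p ∧ ¬ l' (f p)}.ncard : ℕ) : ZMod 2) = ({p | l p ∧ ¬ l (f p)}.ncard : ℕ) + 1 := by
  have hswap : ∀ p, f p = p₀ ↔ p = f p₀ := fun p =>
    ⟨fun h => by rw [← h, hf], fun h => by rw [h, hf]⟩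
  by_cases h₁ : l (f p₀)
  · have e : {p | l p ∧ ¬ l (f p)} = insert (f p₀) {p | l' p ∧ ¬ l' (f p)} := by
      ext p
      simp only [Set.mem_insert_iff, Set.mem_ofPred_eq, hl, hswap]
      by_cases h₂ : p = f p₀
      · subst h₂
        simp [hf, h₁, h₀]
      · have h₃ : p = p₀ → l (f p) := fun h => h ▸ h₁
        tauto
    have hmem : f p₀ ∉ {p | l' p ∧ ¬ l' (f p)} := by
      simp [hl, hf]
    rw [e, Set.ncard_insert_of_notMem hmem ((hfin.subset (by rw [e]; exact Set.subset_insert _ _))),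
      Nat.cast_add, Nat.cast_one, add_assoc, CharTwo.add_self_eq_zero, add_zero]
  · have e : {p | l' p ∧ ¬ l' (f p)} = insert p₀ {p | l p ∧ ¬ l (f p)} := by
      ext p
      simp only [Set.mem_insert_iff, Set.mem_ofPred_eq, hl, hswap]
      by_cases h₂ : p = p₀
      · subst h₂
        simp [h₁, (hne p).symm]
      · have h₃ : p = f p₀ → ¬ l p := fun h => h ▸ h₁
        tauto
    rw [e, Set.ncard_insert_of_notMem (fun h => h₀ h.1) hfin, Nat.cast_add, Nat.cast_one]

namespace Diagram
variable {a b c : AObj}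

/-- Moving the transversal past one marked point changes the parity of the crossings, just as it
changes the shade. -/
theorem crossings_step {D : Diagram a b} (symm : ∀ p q, D.joined p q → D.joined q p)
    (irrefl : ∀ p, ¬ D.joined p p) (existsUnique : ∀ p, ∃! q, D.joined p q)
    (periodic : ∀ p q, D.joined p q → D.joined (p.turn 1) (q.turn 1)) :
    (∀ g k g' k' p₀, ¬ p₀.left g k → (∀ p : Bdry a b, p.left g' k' ↔ p.left g k ∨ p = p₀) →
      ((D.crossings g' k' : ℕ) : ZMod 2) = (D.crossings g k : ℕ) + 1) := by
  intro g k g' k' p₀ h₀ hl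
  choose f hf hfu using existsUnique
  have hff : ∀ p, f (f p) = p := fun p => (hfu _ _ (symm _ _ (hf p))).symm
  have hne : ∀ p, f p ≠ p := fun p h => irrefl p (by have := hf p; rwa [h] at this)
  have hturn : ∀ p : Bdry a b, f (p.turn 1) = (f p).turn 1 := fun p =>
    (hfu _ _ (periodic _ _ (hf p))).symm
  have hcr : ∀ g k, D.crossings g k = {p : Bdry a b | p.left g k ∧ ¬ (f p).left g k}.ncard := by
    intro g k
    rw [crossings]
    congr 1
    ext p
    exact and_congr_right fun _ =>
      ⟨fun ⟨q, hq, hq'⟩ => hfu _ _ hq ▸ hq', fun hp => ⟨_, hf p, hp⟩⟩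
  rw [hcr, hcr]
  exact ncard_separated_insert hff hne h₀ hl (Bdry.finite_separated hturn g k)

theorem shade_of_width_eq_zero (ha : ¬ 0 < a.width) (g g' : ℤ) : a.shade g = a.shade g' := by
  cases a with
  | zeroPlus => rfl
  | zeroMinus => rfl
  | pos n => exact absurd (Nat.mul_pos two_pos n.succ_pos) ha

theorem iff_of_step {F : ℤ → Prop} (hF : ∀ g, F (g + 1) ↔ F g) (g g₀ : ℤ) : F g ↔ F g₀ := by
  have : ∀ n : ℤ, F (g₀ + n) ↔ F g₀ := fun n => by
    induction n using Int.induction_on with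
    | zero => rw [add_zero]
    | succ n ih => rw [← add_assoc, hF, ih]
    | pred n ih => rw [← hF, add_assoc, sub_add_cancel, ih]
  rw [← this (g - g₀), add_sub_cancel]

/-- A planar pairing is a tangle as soon as one transversal that meets no string joins regions of
the same shade. -/
theorem isTangle_of_transversal {D : Diagram a b} (symm : ∀ p q, D.joined p q → D.joined q p)
    (irrefl : ∀ p, ¬ D.joined p p) (existsUnique : ∀ p, ∃! q, D.joined p q)
    (periodic : ∀ p q, D.joined p q → D.joined (p.turn 1) (q.turn 1))
    (planar : ∀ p p' q q', D.joined p p' → D.joined q q' →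
      ¬ (p.before q ∧ q.before p' ∧ p'.before q'))
    (core : D.core = 0) {g₀ h₀ : ℤ} (left : ∀ p q, D.joined p q → p.left g₀ h₀ → q.left g₀ h₀)
    (shade : a.shade g₀ + b.shade h₀ = 0) : D.IsTangle where
  symm := symm
  irrefl := irrefl
  existsUnique := existsUnique
  periodic := periodic
  planar := planar
  core_eq_zero _ _ _ := core
  checkerboard g k := by
    rw [core, add_zero]
    have step := crossings_step symm irrefl existsUnique periodic
    have stepg : ∀ k g, ((D.crossings (g + 1) k : ℕ) : ZMod 2) = a.shade (g + 1) + b.shade k ↔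
        ((D.crossings g k : ℕ) : ZMod 2) = a.shade g + b.shade k := by
      intro k g
      by_cases ha : 0 < a.width
      · have s : ∀ g, a.shade g = (g : ZMod 2) := Pt.shade ⟨0, ha⟩
        have e := step g k (g + 1) k (.inl ⟨g + 1, ha⟩) (by simp [Bdry.left]) (by
          rintro (p | p)
          · have : (Sum.inl p : Bdry a b) = Sum.inl ⟨g + 1, ha⟩ ↔ p.1 = g + 1 :=
              ⟨fun h => Sum.inl.inj h ▸ rfl, fun h => congrArg Sum.inl (Pt.ext_val h)⟩
            show p.1 ≤ g + 1 ↔ p.1 ≤ g ∨ _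
            rw [this]
            omega
          · simp [Bdry.left])
        rw [e, s, s, Int.cast_add, Int.cast_one, add_right_comm, add_left_inj]
      · have : ∀ p : Bdry a b, p.left (g + 1) k ↔ p.left g k := by
          rintro (p | p)
          · exact absurd p.2 ha
          · exact Iff.rfl
        simp only [crossings, this, shade_of_width_eq_zero ha (g + 1) g]
    have stepk : ∀ g k, ((D.crossings g (k + 1) : ℕ) : ZMod 2) = a.shade g + b.shade (k + 1) ↔
        ((D.crossings g k : ℕ) : ZMod 2) = a.shade g + b.shade k := by
      intro g k
      by_cases hb : 0 < b.width
      · have s : ∀ g, b.shade g = (g : ZMod 2) := Pt.shade ⟨0, hb⟩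
        have e := step g k g (k + 1) (.inr ⟨k + 1, hb⟩) (by simp [Bdry.left]) (by
          rintro (p | p)
          · simp [Bdry.left]
          · have : (Sum.inr p : Bdry a b) = Sum.inr ⟨k + 1, hb⟩ ↔ p.1 = k + 1 :=
              ⟨fun h => Sum.inr.inj h ▸ rfl, fun h => congrArg Sum.inr (Pt.ext_val h)⟩
            show p.1 ≤ k + 1 ↔ p.1 ≤ k ∨ _
            rw [this]
            omega)
        rw [e, s, s, Int.cast_add, Int.cast_one, ← add_assoc, add_left_inj]
      · have : ∀ p : Bdry a b, p.left g (k + 1) ↔ p.left g k := by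
          rintro (p | p)
          · exact Iff.rfl
          · exact absurd p.2 hb
        simp only [crossings, this, shade_of_width_eq_zero hb (k + 1) k]
    have base : ((D.crossings g₀ h₀ : ℕ) : ZMod 2) = a.shade g₀ + b.shade h₀ := by
      have : {p : Bdry a b | p.left g₀ h₀ ∧ ∃ q, D.joined p q ∧ ¬ q.left g₀ h₀} = ∅ :=
        Set.eq_empty_of_forall_notMem fun p ⟨hp, q, hq, hq'⟩ => hq' (left _ _ hq hp)
      rw [shade, crossings, this, Set.ncard_empty, Nat.cast_zero]
    exact (iff_of_step (F := fun k => ((D.crossings g k : ℕ) : ZMod 2) = a.shade g + b.shade k)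
      (stepk g) k h₀).2
      ((iff_of_step (F := fun g => ((D.crossings g h₀ : ℕ) : ZMod 2) = a.shade g + b.shade h₀)
        (stepg h₀) g g₀).2 base)

/-- Each point is the end of exactly one string, so one common string at every point suffices; the
twist is `0`. -/
theorem same_of_joined {D D' : Diagram a b} (h : D.IsTangle) (h' : D'.IsTangle)
    (hj : ∀ p, ∃ q, D.joined p q ∧ D'.joined p q) (hc : D'.core = D.core)
    (hs : D'.shadedLoops = D.shadedLoops) (hu : D'.unshadedLoops = D.unshadedLoops) :
    D.Same D' := by
  refine ⟨⟨0, fun p q => ?_⟩, hc, hs, hu⟩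
  rw [twist_zero, twist_zero]
  obtain ⟨r, hr, hr'⟩ := hj p
  constructor
  · intro hq
    rwa [h'.eq_of_joined hq hr']
  · intro hq
    rwa [h.eq_of_joined hq hr]

/-- Radial strings that shift the numbering by an even number. -/
def shift (a : AObj) (s : ℤ) : Diagram a a where
  joined
    | .inl x, .inr y => y.1 = x.1 + s
    | .inr y, .inl x => y.1 = x.1 + s
    | _, _ => False
  core := 0
  shadedLoops := 0
  unshadedLoops := 0

theorem shift_isTangle (a : AObj) {s : ℤ} (hs : Even s) : (shift a s).IsTangle := by
  -- The transversal from the gap `0` to the gap `s` is parallel to the strings.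
  refine isTangle_of_transversal (g₀ := 0) (h₀ := s) ?_ ?_ ?_ ?_ ?_ rfl ?_ ?_
  · rintro (p | p) (q | q) h <;> exact h
  · rintro (p | p) h <;> exact h
  · rintro (p | p)
    · refine ⟨.inr ⟨p.1 + s, p.2⟩, rfl, ?_⟩
      rintro (q | q) h
      · exact h.elim
      · exact congrArg Sum.inr (Pt.ext_val h)
    · refine ⟨.inl ⟨p.1 - s, p.2⟩, (sub_add_cancel _ _).symm, ?_⟩
      rintro (q | q) h
      · exact congrArg Sum.inl (Pt.ext_val (eq_sub_of_add_eq (Eq.symm h)))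
      · exact h.elim
  · rintro (p | p) (q | q) h <;> simp only [shift, Bdry.turn, Sum.map_inl, Sum.map_inr] at h ⊢ <;>
      rw [Pt.turn_val, Pt.turn_val, h] <;> ring
  · rintro (p | p) (p' | p') (q | q) (q' | q') h h' <;> simp [shift, Bdry.before] at h h' ⊢ <;> omega
  · rintro (p | p) (q | q) h <;> simp [shift, Bdry.left] at h ⊢ <;> omega
  · cases a with
    | zeroPlus => rfl
    | zeroMinus => rfl
    | pos n =>
      show ((0 : ℤ) : ZMod 2) + (s : ZMod 2) = 0
      rw [Int.cast_zero, zero_add, ZMod.intCast_zmod_eq_zero_iff_dvd]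
      exact_mod_cast hs.two_dvd

theorem id_eq_shift (a : AObj) : Diagram.id a = shift a 0 := by
  unfold Diagram.id shift
  congr 1
  funext p q
  rcases p with p | p <;> rcases q with q | q <;> simp [eq_comm]

theorem rot_eq_shift (a : AObj) : Diagram.rot a = shift a 2 := by
  unfold rot shift
  congr 1

theorem id_isTangle (a : AObj) : (Diagram.id a).IsTangle := id_eq_shift a ▸ shift_isTangle a (by simp)

theorem rot_isTangle (a : AObj) : (Diagram.rot a).IsTangle := rot_eq_shift a ▸ shift_isTangle a (by simp)

theorem comp_counts_of_no_loop {S : Diagram a b} {T : Diagram b c} (h : ∀ y, ¬ OnLoop S T y) :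
    (S.comp T).core = S.core + T.core ∧
    (S.comp T).shadedLoops = S.shadedLoops + T.shadedLoops ∧
    (S.comp T).unshadedLoops = S.unshadedLoops + T.unshadedLoops := by
  simp [comp, h]

theorem not_onLoop_of_joined {S : Diagram a b} {T : Diagram b c} {y : Pt b} {x : Pt a}
    (h : S.joined (.inr y) (.inl x)) : ¬ OnLoop S T y := fun e => e (.inl x) (Conn.lower h)

theorem not_onLoop_of_joined' {S : Diagram a b} {T : Diagram b c} {y : Pt b} {z : Pt c}
    (h : T.joined (.inl y) (.inr z)) : ¬ OnLoop S T y := fun e => e (.inr z) (Conn.upper h)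

theorem comp_joined_of_conn {S : Diagram a b} {T : Diagram b c} {p q : Bdry a c} (hne : p ≠ q)
    (h : Conn S T (Glued.outer p) (Glued.outer q)) : (S.comp T).joined p q := ⟨hne, h⟩

theorem id_comp_same {S : Diagram a b} (hS : S.IsTangle) : ((Diagram.id a).comp S).Same S := by
  have hc := comp_counts_of_no_loop (S := Diagram.id a) (T := S) fun y =>
    not_onLoop_of_joined (x := y) rfl
  have hl : ∀ p : Bdry a b, Conn (Diagram.id a) S (Glued.outer p) (Glued.upper p) := by
    rintro (p | p)
    · exact Conn.lower (S := Diagram.id a) (p := .inl p) (q := .inr p) rfl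
    · exact .refl _
  refine same_of_joined ((id_isTangle a).comp hS) hS (fun p => ?_) ?_ ?_ ?_
  · refine ⟨_, ⟨(hS.mate_ne p).symm, ?_⟩, hS.joined_mate p⟩
    exact ((hl p).trans (.upper (hS.joined_mate p))).trans (hl _).symm
  · rw [hc.1]; exact (zero_add _).symm
  · rw [hc.2.1]; exact (zero_add _).symm
  · rw [hc.2.2]; exact (zero_add _).symm

theorem comp_id_same {S : Diagram a b} (hS : S.IsTangle) : (S.comp (Diagram.id b)).Same S := by
  have hc := comp_counts_of_no_loop (S := S) (T := Diagram.id b) fun y =>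
    not_onLoop_of_joined' (z := y) rfl
  have hl : ∀ p : Bdry a b, Conn S (Diagram.id b) (Glued.outer p) (Glued.lower p) := by
    rintro (p | p)
    · exact .refl _
    · exact Conn.upper (T := Diagram.id b) (p := .inr p) (q := .inl p) rfl
  refine same_of_joined (hS.comp (id_isTangle b)) hS (fun p => ?_) ?_ ?_ ?_
  · refine ⟨_, ⟨(hS.mate_ne p).symm, ?_⟩, hS.joined_mate p⟩
    exact ((hl p).trans (.lower (hS.joined_mate p))).trans (hl _).symm
  · rw [hc.1]; rfl
  · rw [hc.2.1]; rfl
  · rw [hc.2.2]; rfl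

/-- The loops created by gluing depend only on the components of the points of the middle circle. -/
theorem loops_congr {a' c' : AObj} {S : Diagram a b} {T : Diagram b c} {S' : Diagram a' b}
    {T' : Diagram b c'} (hm : ∀ y z : Pt b, Conn S T (Glued.mid y) (Glued.mid z) ↔
      Conn S' T' (Glued.mid y) (Glued.mid z)) (hl : ∀ y, OnLoop S T y ↔ OnLoop S' T' y) :
    (S.comp T).core + (S'.core + T'.core) = (S'.comp T').core + (S.core + T.core) ∧
    (S.comp T).shadedLoops + (S'.shadedLoops + T'.shadedLoops) =
      (S'.comp T').shadedLoops + (S.shadedLoops + T.shadedLoops) ∧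
    (S.comp T).unshadedLoops + (S'.unshadedLoops + T'.unshadedLoops) =
      (S'.comp T').unshadedLoops + (S.unshadedLoops + T.unshadedLoops) := by
  simp only [comp, hl, Winds, loopThrough, IsLeftmost, hm]
  refine ⟨?_, ?_, ?_⟩ <;> ring

/-- Twisting `S` by `k` moves the middle circle by `k`. For `T` to follow, the outer circle moves by
`k` in addition to its own twist `l`. -/
theorem Conn.twist {S S' : Diagram a b} {T T' : Diagram b c} {k l : ℤ}
    (hS : ∀ p q, S'.joined (p.twist k) (q.twist k) ↔ S.joined p q)
    (hT : ∀ p q, T'.joined (p.twist l) (q.twist l) ↔ T.joined p q) (hT' : T.IsTangle)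
    {u v : Glued a b c} (h : Conn S T u v) :
    Conn S' T' (Sum.map _root_.id (Sum.map (Pt.turn k) (Pt.turn (k + l))) u)
      (Sum.map _root_.id (Sum.map (Pt.turn k) (Pt.turn (k + l))) v) := by
  have e₁ : ∀ p : Bdry a b, Sum.map _root_.id (Sum.map (Pt.turn k) (Pt.turn (k + l)))
      (Glued.lower p : Glued a b c) = Glued.lower (p.twist k) := by
    rintro (p | p) <;> rfl
  have e₂ : ∀ p : Bdry b c, Sum.map _root_.id (Sum.map (Pt.turn k) (Pt.turn (k + l)))
      (Glued.upper p : Glued a b c) = Glued.upper ((p.turn k).twist l) := by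
    rintro (p | p)
    · rfl
    · exact congrArg (fun x => Sum.inr (Sum.inr x)) (Pt.turn_turn k l p).symm
  refine h.map _ (fun p q hpq => ?_) (fun p q hpq => ?_)
  · rw [e₁, e₁]
    exact .lower ((hS p q).2 hpq)
  · rw [e₂, e₂]
    exact .upper ((hT _ _).2 ((hT'.joined_turn k).2 hpq))

theorem untwist {D D' : Diagram a b} {k : ℤ}
    (h : ∀ p q, D'.joined (p.twist k) (q.twist k) ↔ D.joined p q) (p q : Bdry a b) :
    D.joined (p.twist (-k)) (q.twist (-k)) ↔ D'.joined p q := by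
  rw [← h, twist_twist, twist_twist, neg_add_cancel, twist_zero, twist_zero]

theorem comp_same {S S' : Diagram a b} {T T' : Diagram b c} (hS' : S'.IsTangle)
    (hT : T.IsTangle) (hT' : T'.IsTangle) (h : S.Same S') (h' : T.Same T') :
    (S.comp T).Same (S'.comp T') := by
  obtain ⟨⟨k, hk⟩, h₁, h₂, h₃⟩ := h
  obtain ⟨⟨l, hl⟩, h₁', h₂', h₃'⟩ := h'
  let f : ℤ → ℤ → Glued a b c → Glued a b c := fun k l =>
    Sum.map _root_.id (Sum.map (Pt.turn k) (Pt.turn (k + l)))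
  have hf : ∀ u, f (-k) (-l) (f k l u) = u := by
    rintro (u | u | u)
    · rfl
    · simp [f, Pt.turn_turn, Pt.turn_zero]
    · simp [f, Pt.turn_turn]
      convert Pt.turn_zero u using 2
      ring
  have key : ∀ u v, Conn S' T' (f k l u) (f k l v) ↔ Conn S T u v := fun u v =>
    ⟨fun e => by
      have := Conn.twist (untwist hk) (untwist hl) hT' e
      rwa [← hf u, ← hf v], Conn.twist hk hl hT⟩
  have hout : ∀ p : Bdry a c, f k l (Glued.outer p) = Glued.outer (p.twist (k + l)) := by
    rintro (p | p) <;> rfl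
  have hm : ∀ y z : Pt b, Conn S T (Glued.mid y) (Glued.mid z) ↔
      Conn S' T' (Glued.mid y) (Glued.mid z) := fun y z => by
    rw [← key, ← conn_mid_turn hS' hT' k]; rfl
  have hloop : ∀ y, OnLoop S T y ↔ OnLoop S' T' y := by
    intro y
    have hy : OnLoop S' T' y ↔ OnLoop S' T' (y.turn k) :=
      ⟨fun h => h.turn hS' hT' k, fun h => by
        have := h.turn hS' hT' (-k)
        rwa [Pt.turn_turn, add_neg_cancel, Pt.turn_zero] at this⟩
    rw [hy]
    constructor
    · intro h p hp
      refine h (p.twist (-(k + l))) ((key _ _).1 ?_)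
      rw [hout, twist_twist, neg_add_cancel, twist_zero]
      exact hp
    · intro h p hp
      refine h (p.twist (k + l)) ?_
      rw [← hout]
      exact (key _ _).2 hp
  have hc := loops_congr hm hloop
  refine ⟨⟨k + l, fun p q => ?_⟩, by omega, by omega, by omega⟩
  have hinj : p.twist (k + l) ≠ q.twist (k + l) ↔ p ≠ q := by
    refine not_congr ⟨fun e => ?_, fun e => e ▸ rfl⟩
    have := congrArg (Bdry.twist (-(k + l))) e
    rwa [twist_twist, twist_twist, add_neg_cancel, twist_zero, twist_zero] at this
  exact and_congr hinj (by rw [← hout, ← hout, key])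

/-! ### Reflection -/

theorem star_star (D : Diagram a b) : D.star.star = D := by
  unfold star
  simp

theorem Conn.reflect {S : Diagram a b} {T : Diagram b c} {u v : Glued a b c} (h : Conn S T u v) :
    Conn T.star S.star (Sum.elim (fun x => .inr (.inr x)) (Sum.elim (fun y => .inr (.inl y)) .inl) u)
      (Sum.elim (fun x => .inr (.inr x)) (Sum.elim (fun y => .inr (.inl y)) .inl) v) := by
  have e₁ : ∀ p : Bdry a b, (Sum.elim (fun x => .inr (.inr x))
      (Sum.elim (fun y => .inr (.inl y)) .inl) (Glued.lower p : Glued a b c) : Glued c b a) =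
      Glued.upper p.swap := by
    rintro (p | p) <;> rfl
  have e₂ : ∀ p : Bdry b c, (Sum.elim (fun x => .inr (.inr x))
      (Sum.elim (fun y => .inr (.inl y)) .inl) (Glued.upper p : Glued a b c) : Glued c b a) =
      Glued.lower p.swap := by
    rintro (p | p) <;> rfl
  refine h.map _ (fun p q hpq => ?_) (fun p q hpq => ?_)
  · rw [e₁, e₁]
    exact .upper (by simpa [star] using hpq)
  · rw [e₂, e₂]
    exact .lower (by simpa [star] using hpq)

/-- Reflection exchanges the outer circles and fixes the middle one pointwise, so the diagrams are
equal and not only equal up to a twist. -/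
theorem star_comp (S : Diagram a b) (T : Diagram b c) :
    (S.comp T).star = T.star.comp S.star := by
  have hm : ∀ y z : Pt b, Conn S T (Glued.mid y) (Glued.mid z) ↔
      Conn T.star S.star (Glued.mid y) (Glued.mid z) := fun y z =>
    ⟨fun h => h.reflect, fun h => by
      have := h.reflect
      rw [star_star, star_star] at this
      exact this⟩
  have ho : ∀ p q : Bdry a c, Conn S T (Glued.outer p) (Glued.outer q) ↔
      Conn T.star S.star (Glued.outer p.swap) (Glued.outer q.swap) := by
    have e : ∀ p : Bdry a c, (Sum.elim (fun x => .inr (.inr x))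
      (Sum.elim (fun y => .inr (.inl y)) .inl) (Glued.outer p : Glued a b c) : Glued c b a) =
      Glued.outer p.swap := by
      rintro (p | p) <;> rfl
    have e' : ∀ p : Bdry a c, (Sum.elim (fun x => .inr (.inr x))
      (Sum.elim (fun y => .inr (.inl y)) .inl) (Glued.outer p.swap : Glued c b a) : Glued a b c) =
      Glued.outer p := by
      rintro (p | p) <;> rfl
    refine fun p q => ⟨fun h => ?_, fun h => ?_⟩
    · rw [← e, ← e]
      exact h.reflect
    · have := h.reflect
      rw [e', e'] at this
      rwa [star_star, star_star] at this
  have hl : ∀ y, OnLoop S T y ↔ OnLoop T.star S.star y := by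
    intro y
    constructor
    · rintro h (p | p) hp
      · have := hp.reflect
        rw [star_star, star_star] at this
        exact h (.inr p) this
      · have := hp.reflect
        rw [star_star, star_star] at this
        exact h (.inl p) this
    · rintro h (p | p) hp
      · exact h (.inr p) hp.reflect
      · exact h (.inl p) hp.reflect
  have hc := loops_congr hm hl
  have e : ∀ {a b : AObj} (D D' : Diagram a b), D.joined = D'.joined → D.core = D'.core →
      D.shadedLoops = D'.shadedLoops → D.unshadedLoops = D'.unshadedLoops → D = D' := by
    rintro _ _ ⟨⟩ ⟨⟩ ⟨⟩ ⟨⟩ ⟨⟩ ⟨⟩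
    rfl
  have h₁ := hc.1
  have h₂ := hc.2.1
  have h₃ := hc.2.2
  refine e _ _ ?_ ?_ ?_ ?_
  · funext p q
    refine propext (and_congr ?_ ?_)
    · exact (not_congr ⟨fun h => by simpa using congrArg Sum.swap h, fun h => h ▸ rfl⟩)
    · rw [ho, Sum.swap_swap, Sum.swap_swap]
  · simp only [star] at h₁ ⊢; omega
  · simp only [star] at h₂ ⊢; omega
  · simp only [star] at h₃ ⊢; omega

/-- The outer twist becomes an inner one, and a simultaneous turn converts it into an outer twist by
the negative amount. -/
theorem Same.star {D D' : Diagram a b} (hD' : D'.IsTangle) (h : D.Same D') :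
    D.star.Same D'.star := by
  obtain ⟨⟨k, hk⟩, h₁, h₂, h₃⟩ := h
  refine ⟨⟨-k, fun p q => ?_⟩, h₁, h₂, h₃⟩
  have e : ∀ p : Bdry b a, Bdry.turn k (p.twist (-k)).swap = Bdry.twist k p.swap := by
    rintro (p | p)
    · rfl
    · exact congrArg Sum.inl (by rw [Pt.turn_turn, neg_add_cancel, Pt.turn_zero]; rfl)
  show D'.joined _ _ ↔ D.joined _ _
  rw [← hD'.joined_turn k, e, e, hk]

end Diagram
end Annular

/-! ### Components of three glued tangles. -/

namespace Annular

section Restrict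
variable {G X Y : Type} {i : G → X} {j : Y → X} {r : G → G → Prop} {R : X → X → Prop}
  {R' : Y → Y → Prop}

/-- The components of a union of two graphs, one of which is first replaced by its components. -/
theorem eqvGen_restrict (hi : Function.Injective i) (hj : Function.Injective j)
    (hR : ∀ u v, R u v → (∃ p q, u = i p ∧ v = i q ∧ r p q) ∨ ∃ p q, u = j p ∧ v = j q ∧ R' p q)
    (h' : ∀ p q, R' p q → Relation.EqvGen R (j p) (j q))
    (key : ∀ g g' p q, i g = j p → i g' = j q → Relation.EqvGen r g g' → Relation.EqvGen R' p q)
    {p q : Y} : Relation.EqvGen R (j p) (j q) ↔ Relation.EqvGen R' p q := by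
  constructor
  · intro h
    -- The expected component of `j w`: the points of `Y` in its `R'`-component, and the points of
    -- `G` that `r` connects to one of them.
    let N : X → Y → Prop := fun u w => (∃ w', u = j w' ∧ Relation.EqvGen R' w' w) ∨
      ∃ g g' w', u = i g ∧ Relation.EqvGen r g g' ∧ i g' = j w' ∧ Relation.EqvGen R' w' w
    have hr : ∀ g g' w, Relation.EqvGen r g g' → N (i g) w → N (i g') w := by
      rintro g g' w hg (⟨w', h₁, h₂⟩ | ⟨k, k', w', h₁, h₂, h₃, h₄⟩)
      · exact .inr ⟨g', g, w', rfl, hg.symm, h₁, h₂⟩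
      · obtain rfl := hi h₁
        exact .inr ⟨g', k', w', rfl, hg.symm.trans _ _ _ h₂, h₃, h₄⟩
    have hr' : ∀ p p' w, Relation.EqvGen R' p p' → N (j p) w → N (j p') w := by
      rintro p p' w hp (⟨w', h₁, h₂⟩ | ⟨k, k', w', h₁, h₂, h₃, h₄⟩)
      · obtain rfl := hj h₁
        exact .inl ⟨p', rfl, hp.symm.trans _ _ _ h₂⟩
      · exact .inl ⟨p', rfl, hp.symm.trans _ _ _ ((key _ _ _ _ h₁.symm h₃ h₂).trans _ _ _ h₄)⟩
    have hN : ∀ u v, Relation.EqvGen R u v → ∀ w, N u w ↔ N v w := by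
      intro u v huv
      induction huv with
      | rel u v huv =>
        intro w
        obtain ⟨p, q, rfl, rfl, hpq⟩ | ⟨p, q, rfl, rfl, hpq⟩ := hR u v huv
        · exact ⟨hr _ _ _ (.rel _ _ hpq), hr _ _ _ (.symm _ _ (.rel _ _ hpq))⟩
        · exact ⟨hr' _ _ _ (.rel _ _ hpq), hr' _ _ _ (.symm _ _ (.rel _ _ hpq))⟩
      | refl => exact fun _ => Iff.rfl
      | symm _ _ _ ih => exact fun w => (ih w).symm
      | trans _ _ _ _ _ ih ih' => exact fun w => (ih w).trans (ih' w)
    obtain ⟨w', h₁, h₂⟩ | ⟨k, k', w', h₁, h₂, h₃, h₄⟩ :=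
      (hN _ _ h p).1 (.inl ⟨p, rfl, .refl p⟩)
    · obtain rfl := hj h₁
      exact h₂.symm
    · exact ((key _ _ _ _ h₁.symm h₃ h₂).trans _ _ _ h₄).symm
  · intro h
    induction h with
    | rel _ _ h => exact h' _ _ h
    | refl => exact .refl _
    | symm _ _ _ ih => exact ih.symm
    | trans _ _ _ _ _ ih ih' => exact ih.trans _ _ _ ih'

/-- A component of `r` that never touches the image of `j` is not enlarged by `R'`. -/
theorem eqvGen_of_forall_ne (hi : Function.Injective i)
    (hR : ∀ u v, R u v → (∃ p q, u = i p ∧ v = i q ∧ r p q) ∨ ∃ p q, u = j p ∧ v = j q ∧ R' p q)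
    {g : G} (hg : ∀ g' p, Relation.EqvGen r g g' → i g' ≠ j p) {v : X}
    (h : Relation.EqvGen R (i g) v) : ∃ g', v = i g' ∧ Relation.EqvGen r g g' := by
  have key : ∀ u v, Relation.EqvGen R u v →
      ((∃ g', u = i g' ∧ Relation.EqvGen r g g') ↔ ∃ g', v = i g' ∧ Relation.EqvGen r g g') := by
    intro u v huv
    induction huv with
    | rel u v huv =>
      obtain ⟨p, q, rfl, rfl, hpq⟩ | ⟨p, q, rfl, rfl, hpq⟩ := hR u v huv
      · constructor
        · rintro ⟨g', h, hg'⟩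
          obtain rfl := hi h
          exact ⟨q, rfl, hg'.trans _ _ _ (.rel _ _ hpq)⟩
        · rintro ⟨g', h, hg'⟩
          obtain rfl := hi h
          exact ⟨p, rfl, hg'.trans _ _ _ (.symm _ _ (.rel _ _ hpq))⟩
      · exact ⟨fun ⟨g', h, hg'⟩ => (hg _ _ hg' h.symm).elim,
          fun ⟨g', h, hg'⟩ => (hg _ _ hg' h.symm).elim⟩
    | refl => exact Iff.rfl
    | symm _ _ _ ih => exact ih.symm
    | trans _ _ _ _ _ ih ih' => exact ih.trans ih'
  exact (key _ _ h).1 ⟨g, rfl, .refl g⟩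

end Restrict

namespace Diagram
variable {a b c d : AObj}

/-- The lifted marked points on the four circles that appear when three tangles are glued. -/
abbrev Glued₃ (a b c d : AObj) : Type := Pt a ⊕ Pt b ⊕ Pt c ⊕ Pt d

namespace Glued₃

/-- The circles `a`, `b`, `c`. -/
def abc : Glued a b c → Glued₃ a b c d :=
  Sum.map _root_.id (Sum.map _root_.id .inl)

/-- The circles `a`, `c`, `d`. -/
def acd : Glued a c d → Glued₃ a b c d := Sum.map _root_.id .inr

/-- The circles `b`, `c`, `d`. -/
def bcd : Glued b c d → Glued₃ a b c d := .inr

/-- The circles `a`, `b`, `d`. -/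
def abd : Glued a b d → Glued₃ a b c d := Sum.map _root_.id (Sum.map _root_.id .inr)

/-- The boundary of the union of the three annuli. -/
def outer : Bdry a d → Glued₃ a b c d := Sum.map _root_.id fun w => .inr (.inr w)

/-- A point of the circle `b`. -/
def ptb (y : Pt b) : Glued₃ a b c d := .inr (.inl y)

/-- A point of the circle `c`. -/
def ptc (z : Pt c) : Glued₃ a b c d := .inr (.inr (.inl z))

theorem abc_injective : Function.Injective (abc : Glued a b c → Glued₃ a b c d) :=
  Function.injective_id.sumMap (Function.injective_id.sumMap Sum.inl_injective)

theorem acd_injective : Function.Injective (acd : Glued a c d → Glued₃ a b c d) :=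
  Function.injective_id.sumMap Sum.inr_injective

theorem bcd_injective : Function.Injective (bcd : Glued b c d → Glued₃ a b c d) :=
  Sum.inr_injective

theorem abd_injective : Function.Injective (abd : Glued a b d → Glued₃ a b c d) :=
  Function.injective_id.sumMap (Function.injective_id.sumMap Sum.inr_injective)

end Glued₃

open Glued₃

/-- Two points are the ends of a lifted string of one of the three glued tangles. -/
inductive Link₃ (S : Diagram a b) (T : Diagram b c) (U : Diagram c d) :
    Glued₃ a b c d → Glued₃ a b c d → Prop
  | first {p q : Bdry a b} : S.joined p q → Link₃ S T U (abc (Glued.lower p)) (abc (Glued.lower q))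
  | second {p q : Bdry b c} : T.joined p q →
      Link₃ S T U (abc (Glued.upper p)) (abc (Glued.upper q))
  | third {p q : Bdry c d} : U.joined p q → Link₃ S T U (bcd (Glued.upper p)) (bcd (Glued.upper q))

/-- Two points lie on the same component of the union of the lifted strings of three tangles. -/
def Conn₃ (S : Diagram a b) (T : Diagram b c) (U : Diagram c d) :
    Glued₃ a b c d → Glued₃ a b c d → Prop :=
  Relation.EqvGen (Link₃ S T U)

variable {S : Diagram a b} {T : Diagram b c} {U : Diagram c d}

theorem Conn₃.symm {u v : Glued₃ a b c d} (h : Conn₃ S T U u v) : Conn₃ S T U v u :=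
  Relation.EqvGen.symm _ _ h

theorem Conn₃.trans {u v w : Glued₃ a b c d} (h : Conn₃ S T U u v) (h' : Conn₃ S T U v w) :
    Conn₃ S T U u w :=
  Relation.EqvGen.trans _ _ _ h h'

theorem Conn₃.invariant {β : Type*} (f : Glued₃ a b c d → β)
    (h : ∀ u v, Link₃ S T U u v → f u = f v) {u v : Glued₃ a b c d} (huv : Conn₃ S T U u v) :
    f u = f v := by
  induction huv with
  | rel _ _ huv => exact h _ _ huv
  | refl => rfl
  | symm _ _ _ ih => exact ih.symm
  | trans _ _ _ _ _ ih ih' => exact ih.trans ih'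

theorem Conn₃.of_link {X : Type} {R : X → X → Prop}
    (f : X → Glued₃ a b c d) (h : ∀ u v, R u v → Conn₃ S T U (f u) (f v)) {u v : X}
    (huv : Relation.EqvGen R u v) : Conn₃ S T U (f u) (f v) := by
  induction huv with
  | rel _ _ huv => exact h _ _ huv
  | refl => exact .refl _
  | symm _ _ _ ih => exact ih.symm
  | trans _ _ _ _ _ ih ih' => exact ih.trans ih'

theorem conn_joined {p q : Bdry a c} (h : Conn S T (Glued.outer p) (Glued.outer q)) :
    p = q ∨ (S.comp T).joined p q :=
  or_iff_not_imp_left.2 fun hne => ⟨hne, h⟩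

theorem conn₃_abc {u v : Glued a b c} (h : Conn S T u v) : Conn₃ S T U (abc u) (abc v) := by
  refine Conn₃.of_link abc (fun u v huv => ?_) h
  cases huv with
  | lower h => exact .rel _ _ (.first h)
  | upper h => exact .rel _ _ (.second h)

theorem conn₃_bcd {u v : Glued b c d} (h : Conn T U u v) : Conn₃ S T U (bcd u) (bcd v) := by
  refine Conn₃.of_link bcd (fun u v huv => ?_) h
  cases huv with
  | lower h => exact .rel _ _ (by
      have e : ∀ p : Bdry b c, (bcd (Glued.lower p : Glued b c d) : Glued₃ a b c d) =
        abc (Glued.upper p) := by rintro (p | p) <;> rfl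
      rw [e, e]
      exact .second h)
  | upper h => exact .rel _ _ (.third h)

theorem link₃_left (u v : Glued₃ a b c d) (h : Link₃ S T U u v) :
    (∃ p q, u = abc p ∧ v = abc q ∧ Link S T p q) ∨
      ∃ p q, u = acd p ∧ v = acd q ∧ Link (S.comp T) U p q := by
  cases h with
  | first h => exact .inl ⟨_, _, rfl, rfl, .lower h⟩
  | second h => exact .inl ⟨_, _, rfl, rfl, .upper h⟩
  | @third p q h =>
    refine .inr ⟨Glued.upper p, Glued.upper q, ?_, ?_, .upper h⟩
    · rcases p with p | p <;> rfl
    · rcases q with q | q <;> rfl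

theorem link₃_right (u v : Glued₃ a b c d) (h : Link₃ S T U u v) :
    (∃ p q, u = bcd p ∧ v = bcd q ∧ Link T U p q) ∨
      ∃ p q, u = abd p ∧ v = abd q ∧ Link S (T.comp U) p q := by
  cases h with
  | @first p q h =>
    refine .inr ⟨Glued.lower p, Glued.lower q, ?_, ?_, .lower h⟩
    · rcases p with p | p <;> rfl
    · rcases q with q | q <;> rfl
  | @second p q h =>
    refine .inl ⟨Glued.lower p, Glued.lower q, ?_, ?_, .lower h⟩
    · rcases p with p | p <;> rfl
    · rcases q with q | q <;> rfl
  | third h => exact .inl ⟨_, _, rfl, rfl, .upper h⟩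

theorem abc_eq_acd {u : Glued a b c} {v : Glued a c d}
    (h : (abc u : Glued₃ a b c d) = acd v) : ∃ p, u = Glued.outer p ∧ v = Glued.lower p := by
  rcases u with x | y | z <;> rcases v with x' | z' | w'
  · cases h; exact ⟨.inl _, rfl, rfl⟩
  · cases h
  · cases h
  · cases h
  · cases h
  · cases h
  · cases h
  · cases h; exact ⟨.inr _, rfl, rfl⟩
  · cases h

theorem bcd_eq_abd {u : Glued b c d} {v : Glued a b d}
    (h : (bcd u : Glued₃ a b c d) = abd v) : ∃ p, u = Glued.outer p ∧ v = Glued.upper p := by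
  rcases u with y | z | w <;> rcases v with x' | y' | w'
  · cases h
  · cases h; exact ⟨.inl _, rfl, rfl⟩
  · cases h
  · cases h
  · cases h
  · cases h
  · cases h
  · cases h
  · cases h; exact ⟨.inr _, rfl, rfl⟩

/-- The strings of `S.comp T` are the components of the first two tangles seen on `a` and `c`, so
replacing these tangles by their composite does not change the components on `a`, `c`, `d`. -/
theorem conn₃_acd {u v : Glued a c d} :
    Conn₃ S T U (acd u) (acd v) ↔ Conn (S.comp T) U u v := by
  refine eqvGen_restrict abc_injective acd_injective link₃_left ?_ ?_
  · intro u v huv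
    cases huv with
    | @lower p q h =>
      have e : ∀ p : Bdry a c, (acd (Glued.lower p : Glued a c d) : Glued₃ a b c d) =
        abc (Glued.outer p) := by rintro (p | p) <;> rfl
      rw [e, e]
      exact conn₃_abc h.2
    | @upper p q h =>
      have e : ∀ p : Bdry c d, (acd (Glued.upper p : Glued a c d) : Glued₃ a b c d) =
        bcd (Glued.upper p) := by rintro (p | p) <;> rfl
      rw [e, e]
      exact .rel _ _ (.third h)
  · intro g g' p q hp hq h
    obtain ⟨p, rfl, rfl⟩ := abc_eq_acd hp
    obtain ⟨q, rfl, rfl⟩ := abc_eq_acd hq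
    obtain rfl | h := conn_joined h
    · exact .refl _
    · exact Conn.lower h

theorem conn₃_abd {u v : Glued a b d} :
    Conn₃ S T U (abd u) (abd v) ↔ Conn S (T.comp U) u v := by
  refine eqvGen_restrict bcd_injective abd_injective link₃_right ?_ ?_
  · intro u v huv
    cases huv with
    | @lower p q h =>
      have e : ∀ p : Bdry a b, (abd (Glued.lower p : Glued a b d) : Glued₃ a b c d) =
        abc (Glued.lower p) := by rintro (p | p) <;> rfl
      rw [e, e]
      exact .rel _ _ (.first h)
    | @upper p q h =>
      have e : ∀ p : Bdry b d, (abd (Glued.upper p : Glued a b d) : Glued₃ a b c d) =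
        bcd (Glued.outer p) := by rintro (p | p) <;> rfl
      rw [e, e]
      exact conn₃_bcd h.2
  · intro g g' p q hp hq h
    obtain ⟨p, rfl, rfl⟩ := bcd_eq_abd hp
    obtain ⟨q, rfl, rfl⟩ := bcd_eq_abd hq
    obtain rfl | h := conn_joined h
    · exact .refl _
    · exact Conn.upper h

/-- A loop of the first two tangles has no end to which the third one could be attached. -/
theorem OnLoop.of_conn₃_left {y : Pt b} (hy : OnLoop S T y) {v : Glued₃ a b c d}
    (h : Conn₃ S T U (ptb y) v) : ∃ y' : Pt b, v = ptb y' ∧ Conn S T (Glued.mid y) (Glued.mid y') := by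
  have ho : ∀ p, ¬ Conn S T (Glued.mid y) (Glued.outer p) := hy
  obtain ⟨g, rfl, hg⟩ := eqvGen_of_forall_ne (g := Glued.mid y) abc_injective link₃_left
    (fun g' p hg' he => by
      obtain ⟨q, rfl, -⟩ := abc_eq_acd he
      exact ho _ hg') h
  rcases g with x | y' | z
  · exact (ho (.inl x) hg).elim
  · exact ⟨y', rfl, hg⟩
  · exact (ho (.inr z) hg).elim

theorem OnLoop.of_conn₃_right {z : Pt c} (hz : OnLoop T U z) {v : Glued₃ a b c d}
    (h : Conn₃ S T U (ptc z) v) : ∃ z' : Pt c, v = ptc z' ∧ Conn T U (Glued.mid z) (Glued.mid z') := by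
  have ho : ∀ p, ¬ Conn T U (Glued.mid z) (Glued.outer p) := hz
  obtain ⟨g, rfl, hg⟩ := eqvGen_of_forall_ne (g := Glued.mid z) bcd_injective link₃_right
    (fun g' p hg' he => by
      obtain ⟨q, rfl, -⟩ := bcd_eq_abd he
      exact ho _ hg') h
  rcases g with y | z' | w
  · exact (ho (.inl y) hg).elim
  · exact ⟨z', rfl, hg⟩
  · exact (ho (.inr w) hg).elim

theorem OnLoop.conn₃_ptb {y : Pt b} (hy : OnLoop S T y) {y' : Pt b} :
    Conn₃ S T U (ptb y) (ptb y') ↔ Conn S T (Glued.mid y) (Glued.mid y') := by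
  constructor
  · intro h
    obtain ⟨y'', h₁, h₂⟩ := hy.of_conn₃_left h
    cases h₁
    exact h₂
  · exact fun h => conn₃_abc h

theorem OnLoop.conn₃_ptc {z : Pt c} (hz : OnLoop T U z) {z' : Pt c} :
    Conn₃ S T U (ptc z) (ptc z') ↔ Conn T U (Glued.mid z) (Glued.mid z') := by
  constructor
  · intro h
    obtain ⟨y'', h₁, h₂⟩ := hz.of_conn₃_right h
    cases h₁
    exact h₂
  · exact fun h => conn₃_bcd h

theorem conn₃_ptb {y y' : Pt b} : Conn₃ S T U (ptb y) (ptb y') ↔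
    Conn S (T.comp U) (Glued.mid y) (Glued.mid y') :=
  conn₃_abd (u := Glued.mid y) (v := Glued.mid y')

theorem conn₃_ptc {z z' : Pt c} : Conn₃ S T U (ptc z) (ptc z') ↔
    Conn (S.comp T) U (Glued.mid z) (Glued.mid z') :=
  conn₃_acd (u := Glued.mid z) (v := Glued.mid z')

/-- No end of the component of a point is on the boundary of the union of three annuli. -/
def NoEnd (S : Diagram a b) (T : Diagram b c) (U : Diagram c d) (u : Glued₃ a b c d) : Prop :=
  ∀ p : Bdry a d, ¬ Conn₃ S T U u (Glued₃.outer p)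

theorem NoEnd.congr {u v : Glued₃ a b c d} (h : NoEnd S T U u) (huv : Conn₃ S T U u v) :
    NoEnd S T U v := fun p hp => h p (huv.trans hp)

theorem noEnd_ptb {y : Pt b} : NoEnd S T U (ptb y) ↔ OnLoop S (T.comp U) y := by
  refine forall_congr' fun p => not_congr ?_
  rw [← conn₃_abd]
  rcases p with p | p <;> rfl

theorem noEnd_ptc {z : Pt c} : NoEnd S T U (ptc z) ↔ OnLoop (S.comp T) U z := by
  refine forall_congr' fun p => not_congr ?_
  rw [← conn₃_acd]
  rcases p with p | p <;> rfl

theorem OnLoop.noEnd_ptb {y : Pt b} (hy : OnLoop S T y) : NoEnd S T U (ptb y) := by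
  intro p hp
  obtain ⟨y', h, -⟩ := hy.of_conn₃_left hp
  rcases p with p | p <;> cases h

theorem OnLoop.noEnd_ptc {z : Pt c} (hz : OnLoop T U z) : NoEnd S T U (ptc z) := by
  intro p hp
  obtain ⟨y', h, -⟩ := hz.of_conn₃_right hp
  rcases p with p | p <;> cases h

/-- If the component is not a loop of `S` and `T` alone, it reaches the boundary of their union, and
this can only be at the circle `c`. -/
theorem NoEnd.exists_ptc {y : Pt b} (h : NoEnd S T U (ptb y)) (hy : ¬ OnLoop S T y) :
    ∃ z, Conn₃ S T U (ptb y) (ptc z) := by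
  obtain ⟨p, hp⟩ := not_forall_not.1 hy
  have hp' := conn₃_abc (U := U) hp
  rcases p with p | p
  · exact (h (.inl p) hp').elim
  · exact ⟨p, hp'⟩

theorem NoEnd.exists_ptb {z : Pt c} (h : NoEnd S T U (ptc z)) (hz : ¬ OnLoop T U z) :
    ∃ y, Conn₃ S T U (ptc z) (ptb y) := by
  obtain ⟨p, hp⟩ := not_forall_not.1 hz
  have hp' := conn₃_bcd (S := S) hp
  rcases p with p | p
  · exact ⟨p, hp'⟩
  · exact (h (.inr p) hp').elim

end Diagram
end Annular

/-! ### Counting the loops of three glued tangles; associativity. -/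

namespace Annular

/-- A class on one circle is the trace of a class on all circles, and a nonempty trace determines
the class. This makes loops on different circles comparable. -/
theorem ncard_classes {M V : Type} {κ : V → Set V} (i : M → V) {l : M → Set M} {P : M → Prop}
    (hl : ∀ y, P y → l y = i ⁻¹' κ (i y)) (hself : ∀ v, v ∈ κ v)
    (heq : ∀ v v', v ∈ κ v' → κ v = κ v') :
    {L | ∃ y, P y ∧ L = l y}.ncard = {L | ∃ y, P y ∧ L = κ (i y)}.ncard := by
  have e : {L | ∃ y, P y ∧ L = l y} = (fun L => i ⁻¹' L) '' {L | ∃ y, P y ∧ L = κ (i y)} := by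
    ext L
    constructor
    · rintro ⟨y, hy, rfl⟩
      exact ⟨_, ⟨y, hy, rfl⟩, (hl y hy).symm⟩
    · rintro ⟨_, ⟨y, hy, rfl⟩, rfl⟩
      exact ⟨y, hy, (hl y hy).symm⟩
  rw [e, Set.InjOn.ncard_image]
  rintro _ ⟨y, hy, rfl⟩ _ ⟨y', hy', rfl⟩ h
  exact heq _ _ (Set.ext_iff.1 h y |>.1 (hself (i y)))

/-- All other points are to the right of `x`, and their number is odd. The parity of a leftmost
point can thus be read off from `lev`, which is constant on components. -/
theorem lev_leftmost {a : AObj} {A : Finset (Pt a)} (hA : (A.card : ZMod 2) = 0) {x : Pt a}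
    (hx : x ∈ A) (h : ∀ v ∈ A, x.1 ≤ v.1) : lev A x = 1 + (x.1 : ZMod 2) := by
  classical
  have e : rk A x = 1 := by
    rw [rk, ← Finset.add_sum_erase _ _ hx, if_neg (lt_irrefl _), zero_add,
      Finset.sum_congr rfl (g := fun _ => (1 : ZMod 2)) fun v hv => if_pos ?_]
    · rw [Finset.sum_const, nsmul_eq_mul, mul_one]
      have := Finset.card_erase_add_one hx
      rw [← this, Nat.cast_add, Nat.cast_one] at hA
      rw [← add_zero (((A.erase x).card : ℕ) : ZMod 2), ← CharTwo.add_self_eq_zero (1 : ZMod 2),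
        ← add_assoc, hA, zero_add]
    · exact lt_of_le_of_ne (h v (Finset.mem_of_mem_erase hv)) fun h =>
        Finset.ne_of_mem_erase hv (Pt.ext_val h.symm)
  rw [lev, e, if_pos hx]

namespace Diagram
open Glued₃
variable {a b c d : AObj} {S : Diagram a b} {T : Diagram b c} {U : Diagram c d}

/-- Translation by `k` full turns. -/
def Glued₃.turn (k : ℤ) : Glued₃ a b c d → Glued₃ a b c d := Sum.map (Pt.turn k) (Glued.turn k)

theorem Conn₃.turn (hS : S.IsTangle) (hT : T.IsTangle) (hU : U.IsTangle) (k : ℤ)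
    {u v : Glued₃ a b c d} (h : Conn₃ S T U u v) :
    Conn₃ S T U (Glued₃.turn k u) (Glued₃.turn k v) := by
  refine Conn₃.of_link (Glued₃.turn k) (fun u v huv => ?_) h
  cases huv with
  | first h =>
    have e : ∀ p : Bdry a b, Glued₃.turn k (abc (Glued.lower p) : Glued₃ a b c d) =
        abc (Glued.lower (p.turn k)) := by rintro (p | p) <;> rfl
    rw [e, e]
    exact .rel _ _ (.first ((hS.joined_turn k).2 h))
  | second h =>
    have e : ∀ p : Bdry b c, Glued₃.turn k (abc (Glued.upper p) : Glued₃ a b c d) =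
        abc (Glued.upper (p.turn k)) := by rintro (p | p) <;> rfl
    rw [e, e]
    exact .rel _ _ (.second ((hT.joined_turn k).2 h))
  | third h =>
    have e : ∀ p : Bdry c d, Glued₃.turn k (bcd (Glued.upper p) : Glued₃ a b c d) =
        bcd (Glued.upper (p.turn k)) := by rintro (p | p) <;> rfl
    rw [e, e]
    exact .rel _ _ (.third ((hU.joined_turn k).2 h))

/-- The points on the two inner circles. -/
def Glued₃.inner (p : Bdry b c) : Glued₃ a b c d := abc (Glued.upper p)

theorem Glued₃.turn_inner (k : ℤ) (p : Bdry b c) :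
    Glued₃.turn k (inner p : Glued₃ a b c d) = inner (p.turn k) := by
  rcases p with p | p <;> rfl

/-- All lifts of the points at which the component of a point meets the two inner circles. -/
def class₃ (S : Diagram a b) (T : Diagram b c) (U : Diagram c d) (p : Bdry b c) :
    Set (Bdry b c) :=
  {q | ∃ k : ℤ, Conn₃ S T U (inner p) (inner (q.turn k))}

theorem self_mem_class₃ (p : Bdry b c) : p ∈ class₃ S T U p :=
  ⟨0, by rw [Bdry.turn_zero]; exact .refl _⟩

theorem class₃_eq (hS : S.IsTangle) (hT : T.IsTangle) (hU : U.IsTangle) {p q : Bdry b c}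
    (h : p ∈ class₃ S T U q) : class₃ S T U p = class₃ S T U q := by
  obtain ⟨k, h⟩ := h
  ext r
  constructor
  · rintro ⟨j, hj⟩
    refine ⟨j + k, h.trans ?_⟩
    rw [← Bdry.turn_turn, ← turn_inner, ← turn_inner]
    exact hj.turn hS hT hU k
  · rintro ⟨j, hj⟩
    refine ⟨j - k, ?_⟩
    have := (h.symm.trans hj).turn hS hT hU (-k)
    rwa [turn_inner, turn_inner, Bdry.turn_turn, Bdry.turn_turn, add_neg_cancel,
      Bdry.turn_zero, ← sub_eq_add_neg] at this

theorem class₃_turn (hS : S.IsTangle) (hT : T.IsTangle) (hU : U.IsTangle) (p : Bdry b c) (k : ℤ) :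
    class₃ S T U (p.turn k) = class₃ S T U p :=
  class₃_eq hS hT hU ⟨-k, by rw [Bdry.turn_turn, add_neg_cancel, Bdry.turn_zero]; exact .refl _⟩

/-- Both sides count the closed components on the circles `b` and `c` with a given property: the
left side separates those on `b` alone from those that meet `c`, the right side those on `c` alone
from those that meet `b`. By `h₃` the property can be read off on either circle. -/
theorem ncard_loops_assoc (hS : S.IsTangle) (hT : T.IsTangle) (hU : U.IsTangle)
    {Q₁ Q₁' : Pt b → Prop} {Q₂ Q₂' : Pt c → Prop} (h₁ : ∀ y, OnLoop S T y → (Q₁ y ↔ Q₁' y))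
    (h₂ : ∀ z, OnLoop T U z → (Q₂ z ↔ Q₂' z))
    (h₃ : ∀ y z, NoEnd S T U (ptb y) → Conn₃ S T U (ptb y) (ptc z) → (Q₁' y ↔ Q₂ z)) :
    {L | ∃ y, (OnLoop S T y ∧ Q₁ y) ∧ L = loopThrough S T y}.ncard +
      {L | ∃ z, (OnLoop (S.comp T) U z ∧ Q₂ z) ∧ L = loopThrough (S.comp T) U z}.ncard =
    {L | ∃ z, (OnLoop T U z ∧ Q₂' z) ∧ L = loopThrough T U z}.ncard +
      {L | ∃ y, (OnLoop S (T.comp U) y ∧ Q₁' y) ∧ L = loopThrough S (T.comp U) y}.ncard := by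
  have hself := self_mem_class₃ (S := S) (T := T) (U := U)
  have heq := fun p q => class₃_eq hS hT hU (p := p) (q := q)
  have fin : ∀ (e : Type) (i : e → Bdry b c) (P : e → Prop), (Set.range fun y => class₃ S T U (i y)).Finite →
      {L | ∃ y, P y ∧ L = class₃ S T U (i y)}.Finite := by
    rintro e i P h
    refine h.subset ?_
    rintro L ⟨y, -, rfl⟩
    exact ⟨y, rfl⟩
  have finb := finite_range_turn (b := b) (fun y => class₃ S T U (.inl y)) fun y k =>
    class₃_turn hS hT hU (.inl y) k
  have finc := finite_range_turn (b := c) (fun z => class₃ S T U (.inr z)) fun z k =>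
    class₃_turn hS hT hU (.inr z) k
  have key : ∀ {p q}, class₃ S T U p = class₃ S T U q → ∃ k, Conn₃ S T U (inner q) (inner (p.turn k)) :=
    fun {p q} h => (h ▸ hself p : p ∈ class₃ S T U q)
  rw [ncard_classes (κ := class₃ S T U) Sum.inl ?_ hself heq,
    ncard_classes (κ := class₃ S T U) Sum.inr ?_ hself heq,
    ncard_classes (κ := class₃ S T U) Sum.inr ?_ hself heq,
    ncard_classes (κ := class₃ S T U) Sum.inl ?_ hself heq,
    ← Set.ncard_union_eq ?_ (fin _ _ _ finb) (fin _ _ _ finc),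
    ← Set.ncard_union_eq ?_ (fin _ _ _ finc) (fin _ _ _ finb)]
  · congr 1
    ext L
    constructor
    · rintro (⟨y, ⟨hy, hQ⟩, rfl⟩ | ⟨z, ⟨hz, hQ⟩, rfl⟩)
      · exact .inr ⟨y, ⟨noEnd_ptb.1 hy.noEnd_ptb, (h₁ y hy).1 hQ⟩, rfl⟩
      · by_cases hz' : OnLoop T U z
        · exact .inl ⟨z, ⟨hz', (h₂ z hz').1 hQ⟩, rfl⟩
        · obtain ⟨y, hy⟩ := (noEnd_ptc.2 hz).exists_ptb hz'
          have hn := (noEnd_ptc.2 hz).congr hy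
          exact .inr ⟨y, ⟨noEnd_ptb.1 hn, (h₃ y z hn hy.symm).2 hQ⟩, heq _ _ ⟨0, by
            rw [Bdry.turn_zero]; exact hy.symm⟩⟩
    · rintro (⟨z, ⟨hz, hQ⟩, rfl⟩ | ⟨y, ⟨hy, hQ⟩, rfl⟩)
      · exact .inr ⟨z, ⟨noEnd_ptc.1 hz.noEnd_ptc, (h₂ z hz).2 hQ⟩, rfl⟩
      · by_cases hy' : OnLoop S T y
        · exact .inl ⟨y, ⟨hy', (h₁ y hy').2 hQ⟩, rfl⟩
        · have hn := noEnd_ptb.2 hy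
          obtain ⟨z, hz⟩ := hn.exists_ptc hy'
          exact .inr ⟨z, ⟨noEnd_ptc.1 (hn.congr hz), (h₃ y z hn hz).1 hQ⟩, heq _ _ ⟨0, by
            rw [Bdry.turn_zero]; exact hz.symm⟩⟩
  -- A loop of `T` and `U` alone never reaches the circle `b`.
  · refine Set.disjoint_left.2 ?_
    rintro _ ⟨z, ⟨hz, -⟩, rfl⟩ ⟨y, -, h⟩
    obtain ⟨k, hk⟩ := key h.symm
    obtain ⟨z', h', -⟩ := hz.of_conn₃_right hk
    cases h'
  · refine Set.disjoint_left.2 ?_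
    rintro _ ⟨y, ⟨hy, -⟩, rfl⟩ ⟨z, -, h⟩
    obtain ⟨k, hk⟩ := key h.symm
    obtain ⟨z', h', -⟩ := hy.of_conn₃_left hk
    cases h'
  · exact fun y _ => Set.ext fun y' => exists_congr fun k => conn₃_ptb.symm
  · exact fun z hz => Set.ext fun z' => exists_congr fun k => hz.1.conn₃_ptc.symm
  · exact fun z _ => Set.ext fun z' => exists_congr fun k => conn₃_ptc.symm
  · exact fun y hy => Set.ext fun y' => exists_congr fun k => hy.1.conn₃_ptb.symm

theorem winds_congr {a' c' : AObj} {S' : Diagram a' b} {T' : Diagram b c'} {y : Pt b}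
    (h : ∀ y', Conn S T (Glued.mid y) (Glued.mid y') ↔ Conn S' T' (Glued.mid y) (Glued.mid y')) :
    Winds S T y ↔ Winds S' T' y :=
  exists_congr fun _ => and_congr_right fun _ => h _

theorem isLeftmost_congr {a' c' : AObj} {S' : Diagram a' b} {T' : Diagram b c'} {y : Pt b}
    (h : ∀ y', Conn S T (Glued.mid y) (Glued.mid y') ↔ Conn S' T' (Glued.mid y) (Glued.mid y'))
    (z : Pt b) : IsLeftmost S T y z ↔ IsLeftmost S' T' y z := by
  simp only [IsLeftmost, h]

theorem IsLeftmost.unique {y z z' : Pt b} (h : IsLeftmost S T y z) (h' : IsLeftmost S T y z') :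
    z = z' := Pt.ext_val (le_antisymm (h.2 _ h'.1) (h'.2 _ h.1))

theorem winds_assoc (hS : S.IsTangle) (hT : T.IsTangle) (hU : U.IsTangle) {y : Pt b} {z : Pt c}
    (h : Conn₃ S T U (ptb y) (ptc z)) : Winds S (T.comp U) y ↔ Winds (S.comp T) U z := by
  refine exists_congr fun k => and_congr_right fun _ => ?_
  rw [← conn₃_ptb, ← conn₃_ptc]
  have := h.turn hS hT hU k
  exact ⟨fun e => h.symm.trans (e.trans this), fun e => h.trans (e.trans this.symm)⟩

/-- The closed component has an even number of points on each circle, and `lev` is constant on it.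
At the leftmost point of either circle its value is one plus the coordinate. -/
theorem exists_isLeftmost_assoc (hS : S.IsTangle) (hT : T.IsTangle) (hU : U.IsTangle) {y : Pt b}
    {z : Pt c} (hn : NoEnd S T U (ptb y)) (h : Conn₃ S T U (ptb y) (ptc z))
    (hw : ¬ Winds S (T.comp U) y) : ∃ y' z', IsLeftmost S (T.comp U) y y' ∧
      IsLeftmost (S.comp T) U z z' ∧ (y'.1 : ZMod 2) = (z'.1 : ZMod 2) := by
  have hw' := mt (winds_assoc hS hT hU h).2 hw
  have hy := noEnd_ptb.1 hn
  have hz := noEnd_ptc.1 (hn.congr h)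
  obtain ⟨A, B, E, hc, hA, hB, hE⟩ := exists_levels (finite_component hS (hT.comp hU)
    (u := Glued.mid y) fun k hk => by_contra fun hk' => hw ⟨k, hk', hk⟩)
    fun u v huv hu => Conn.trans hu huv
  obtain ⟨A', C, E', hc', hA', hC, hE'⟩ := exists_levels (finite_component (hS.comp hT) hU
    (u := Glued.mid z) fun k hk => by_contra fun hk' => hw' ⟨k, hk', hk⟩)
    fun u v huv hu => Conn.trans hu huv
  have hB' : ∀ y', y' ∈ B ↔ Conn₃ S T U (ptb y) (ptb y') := fun y' => (hB y').trans conn₃_ptb.symm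
  have hC' : ∀ z', z' ∈ C ↔ Conn₃ S T U (ptb y) (ptc z') := fun z' =>
    (hC z').trans (conn₃_ptc.symm.trans ⟨fun e => h.trans e, fun e => h.symm.trans e⟩)
  -- The traces `B` and `C` come from different bracketings but belong to the same component of the
  -- three tangles.
  have hBC : T.Closed B C := by
    have e : ∀ p : Bdry b c, p ∈ B.disjSum C ↔ Conn₃ S T U (ptb y) (inner p) := by
      rintro (p | p)
      · rw [Finset.inl_mem_disjSum, hB']; rfl
      · rw [Finset.inr_mem_disjSum, hC']; rfl
    intro p q hpq hp
    rw [e] at hp ⊢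
    exact hp.trans (.rel _ _ (.second hpq))
  have hA0 : A = ∅ := Finset.eq_empty_of_forall_notMem fun x hx => hy (.inl x) ((hA x).1 hx)
  have hE0 : E' = ∅ := Finset.eq_empty_of_forall_notMem fun x hx => hz (.inr x) ((hE' x).1 hx)
  have cB := (card_closedUnder hS (hT.comp hU) hc).1
  have cC := (card_closedUnder (hS.comp hT) hU hc').2
  rw [hA0, Finset.card_empty, Nat.cast_zero] at cB
  rw [hE0, Finset.card_empty, Nat.cast_zero] at cC
  have hl : ∀ u v, Conn₃ S T U u v →
      Sum.elim (lev A) (Sum.elim (lev B) (Sum.elim (lev C) (lev E'))) u =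
      Sum.elim (lev A) (Sum.elim (lev B) (Sum.elim (lev C) (lev E'))) v := by
    intro u v huv
    refine Conn₃.invariant _ (fun u v huv => ?_) huv
    cases huv with
    | @first p q hpq =>
      have := hS.lev_eq hc.1 hpq
      rcases p with p | p <;> rcases q with q | q <;> exact this
    | @second p q hpq =>
      have := hT.lev_eq hBC hpq
      rcases p with p | p <;> rcases q with q | q <;> exact this
    | @third p q hpq =>
      have := hU.lev_eq hc'.2 hpq
      rcases p with p | p <;> rcases q with q | q <;> exact this
  obtain ⟨y', hy', hmin⟩ := B.exists_min_image (fun y => y.1) ⟨y, (hB' y).2 (.refl _)⟩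
  obtain ⟨z', hz', hmin'⟩ := C.exists_min_image (fun y => y.1) ⟨z, (hC' z).2 h⟩
  refine ⟨y', z', ⟨(hB y').1 hy', fun u hu => hmin u ((hB u).2 hu)⟩,
    ⟨(hC z').1 hz', fun u hu => hmin' u ((hC u).2 hu)⟩, ?_⟩
  have e : lev B y' = lev C z' := hl _ _ (((hB' y').1 hy').symm.trans ((hC' z').1 hz'))
  rw [lev_leftmost cB hy' hmin, lev_leftmost cC hz' hmin'] at e
  exact add_left_cancel e

theorem leftmost_assoc (hS : S.IsTangle) (hT : T.IsTangle) (hU : U.IsTangle) (P : ℤ → Prop)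
    (hP : ∀ m n : ℤ, (m : ZMod 2) = n → (P m ↔ P n)) {y : Pt b}
    {z : Pt c} (hn : NoEnd S T U (ptb y)) (h : Conn₃ S T U (ptb y) (ptc z)) :
    (¬ Winds S (T.comp U) y ∧ ∃ y', IsLeftmost S (T.comp U) y y' ∧ P y'.1) ↔
    (¬ Winds (S.comp T) U z ∧ ∃ z', IsLeftmost (S.comp T) U z z' ∧ P z'.1) := by
  rw [← winds_assoc hS hT hU h]
  refine and_congr_right fun hw => ?_
  obtain ⟨y', z', hy', hz', e⟩ := exists_isLeftmost_assoc hS hT hU hn h hw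
  exact ⟨fun ⟨y'', hy'', hp⟩ => ⟨z', hz', (hP _ _ e).1 (hy'.unique hy'' ▸ hp)⟩,
    fun ⟨z'', hz'', hp⟩ => ⟨y', hy', (hP _ _ e).2 (hz'.unique hz'' ▸ hp)⟩⟩

theorem odd_congr (m n : ℤ) (h : (m : ZMod 2) = n) : Odd m ↔ Odd n := by
  rw [ZMod.intCast_eq_intCast_iff_dvd_sub, Nat.cast_ofNat] at h
  rw [Int.odd_iff, Int.odd_iff]
  omega

theorem even_congr (m n : ℤ) (h : (m : ZMod 2) = n) : Even m ↔ Even n := by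
  rw [← Int.not_odd_iff_even, ← Int.not_odd_iff_even, odd_congr m n h]

theorem comp_assoc_same (hS : S.IsTangle) (hT : T.IsTangle) (hU : U.IsTangle) :
    ((S.comp T).comp U).Same (S.comp (T.comp U)) := by
  have c₁ : ∀ y, OnLoop S T y → ∀ y', Conn S T (Glued.mid y) (Glued.mid y') ↔
      Conn S (T.comp U) (Glued.mid y) (Glued.mid y') := fun y hy y' =>
    hy.conn₃_ptb.symm.trans conn₃_ptb
  have c₂ : ∀ z, OnLoop T U z → ∀ z', Conn (S.comp T) U (Glued.mid z) (Glued.mid z') ↔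
      Conn T U (Glued.mid z) (Glued.mid z') := fun z hz z' =>
    conn₃_ptc.symm.trans hz.conn₃_ptc
  have n₁ := ncard_loops_assoc hS hT hU (Q₁ := Winds S T) (Q₁' := Winds S (T.comp U))
    (Q₂ := Winds (S.comp T) U) (Q₂' := Winds T U) (fun y hy => winds_congr (c₁ y hy))
    (fun z hz => winds_congr (c₂ z hz)) (fun y z _ h => winds_assoc hS hT hU h)
  -- This covers shaded and unshaded loops at once, as `P` depends on the parity of the leftmost
  -- coordinate only.
  have nP := fun (P : ℤ → Prop) (hP : ∀ m n : ℤ, (m : ZMod 2) = n → (P m ↔ P n)) =>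
    ncard_loops_assoc hS hT hU
      (Q₁ := fun y => ¬ Winds S T y ∧ ∃ y', IsLeftmost S T y y' ∧ P y'.1)
      (Q₁' := fun y => ¬ Winds S (T.comp U) y ∧ ∃ y', IsLeftmost S (T.comp U) y y' ∧ P y'.1)
      (Q₂ := fun z => ¬ Winds (S.comp T) U z ∧ ∃ z', IsLeftmost (S.comp T) U z z' ∧ P z'.1)
      (Q₂' := fun z => ¬ Winds T U z ∧ ∃ z', IsLeftmost T U z z' ∧ P z'.1)
      (fun y hy => by simp only [winds_congr (c₁ y hy), isLeftmost_congr (c₁ y hy)])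
      (fun z hz => by simp only [winds_congr (c₂ z hz), isLeftmost_congr (c₂ z hz)])
      (fun y z hn h => leftmost_assoc hS hT hU P hP hn h)
  have n₂ := nP Odd odd_congr
  have n₃ := nP Even even_congr
  simp only [and_assoc] at n₁ n₂ n₃
  refine ⟨⟨0, fun p q => ?_⟩, ?_, ?_, ?_⟩
  · rw [twist_zero, twist_zero]
    refine and_congr_right fun _ => ?_
    have e₁ : ∀ p : Bdry a d, (abd (Glued.outer p) : Glued₃ a b c d) = Glued₃.outer p := by
      rintro (p | p) <;> rfl
    have e₂ : ∀ p : Bdry a d, (acd (Glued.outer p) : Glued₃ a b c d) = Glued₃.outer p := by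
      rintro (p | p) <;> rfl
    rw [← conn₃_abd, ← conn₃_acd, e₁, e₁, e₂, e₂]
  · simp only [comp] at n₁ ⊢; omega
  · simp only [comp] at n₂ ⊢; omega
  · simp only [comp] at n₃ ⊢; omega

end Diagram

theorem atlIsCategory : AtlIsCategory where
  id_isTangle := Diagram.id_isTangle
  comp_isTangle _ _ hS hT := hS.comp hT
  comp_same _ _ _ _ _ hS' hT hT' h h' := Diagram.comp_same hS' hT hT' h h'
  id_comp _ hS := Diagram.id_comp_same hS
  comp_id _ hS := Diagram.comp_id_same hS
  assoc _ _ _ hS hT hU := Diagram.comp_assoc_same hS hT hU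

end Annular

/-! ### Cap tangles. -/

namespace Annular

/-- Integers are compared lexicographically by quotient and remainder. -/
theorem window_lt {W lo r r' k k' : ℤ} (h₁ : lo ≤ r) (h₂ : r < lo + W) (h₁' : lo ≤ r')
    (h₂' : r' < lo + W) : r + k * W < r' + k' * W ↔ k < k' ∨ k = k' ∧ r < r' := by
  have hW : 0 < W := by omega
  rcases lt_trichotomy k k' with h | rfl | h
  · have : (k + 1) * W ≤ k' * W := mul_le_mul_of_nonneg_right h hW.le
    rw [add_mul] at this
    exact ⟨fun _ => .inl h, fun _ => by omega⟩
  · simp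
  · have : (k' + 1) * W ≤ k * W := mul_le_mul_of_nonneg_right h hW.le
    rw [add_mul] at this
    exact ⟨fun _ => by omega, fun _ => by omega⟩

theorem window_eq {W lo r r' k k' : ℤ} (h₁ : lo ≤ r) (h₂ : r < lo + W) (h₁' : lo ≤ r')
    (h₂' : r' < lo + W) (h : r + k * W = r' + k' * W) : k = k' ∧ r = r' := by
  have := window_lt (k := k) (k' := k') h₁ h₂ h₁' h₂'
  have := window_lt (k := k') (k' := k) h₁' h₂' h₁ h₂
  omega

theorem exists_window {W : ℤ} (hW : 0 < W) (lo x : ℤ) :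
    ∃ r k, lo ≤ r ∧ r < lo + W ∧ x = r + k * W := by
  refine ⟨lo + (x - lo) % W, (x - lo) / W, ?_, ?_, ?_⟩
  · have := Int.emod_nonneg (x - lo) hW.ne'
    omega
  · have := Int.emod_lt_of_pos (x - lo) hW
    omega
  · have := Int.emod_add_mul_ediv (x - lo) W
    rw [mul_comm] at this
    omega

/-- A property of the marked points that is invariant under turns holds everywhere if it holds in
one turn. -/
theorem Pt.forall_of_window {a : AObj} {P : Pt a → Prop} (hP : ∀ x k, P x → P (x.turn k)) (lo : ℤ)
    (h : ∀ x : Pt a, lo ≤ x.1 → x.1 < lo + a.width → P x) (x : Pt a) : P x := by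
  obtain ⟨r, k, h₁, h₂, h₃⟩ := exists_window x.width_pos lo x.1
  have : x = Pt.turn k ⟨r, x.2⟩ := Pt.ext_val h₃
  rw [this]
  exact hP _ _ (h _ h₁ h₂)

namespace Diagram
variable {a b c : AObj}

section Cap
variable {i : ℕ}

theorem cap_joined_lo {x : Pt a} {y : Pt b} (h₁ : (i : ℤ) - a.width + 2 ≤ x.1)
    (h₂ : x.1 ≤ (i : ℤ) - 1) (h : y.1 = x.1) : (cap a b i).joined (.inl x) (.inr y) :=
  ⟨x.1, 0, h₁, h₂, by ring, by rw [h]; ring⟩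

theorem cap_joined_hi (hab : a.width = b.width + 2) {x : Pt a} {y : Pt b}
    (h₁ : (i : ℤ) + 2 ≤ x.1) (h₂ : x.1 ≤ (i : ℤ) + a.width - 1) (h : y.1 = x.1 - 2) :
    (cap a b i).joined (.inl x) (.inr y) :=
  ⟨x.1 - a.width, 1, by omega, by omega, by omega, by omega⟩

theorem cap_joined_cap {x y : Pt a} (hx : x.1 = i) (hy : y.1 = i + 1) :
    (cap a b i).joined (.inl x) (.inl y) :=
  ⟨0, .inl ⟨by rw [hx]; ring, by rw [hy]; ring⟩⟩

theorem cap_symm {p q : Bdry a b} (h : (cap a b i).joined p q) : (cap a b i).joined q p := by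
  rcases p with p | p <;> rcases q with q | q
  · obtain ⟨k, h⟩ := h
    exact ⟨k, h.symm.imp And.symm And.symm |>.imp And.symm And.symm⟩
  · exact h
  · exact h
  · exact h

theorem cap_turn {p q : Bdry a b} (h : (cap a b i).joined p q) :
    (cap a b i).joined (p.turn 1) (q.turn 1) := by
  have t : ∀ {a b : AObj} {x : Pt a} {y : Pt b},
      (∃ r k : ℤ, (i : ℤ) - a.width + 2 ≤ r ∧ r ≤ (i : ℤ) - 1 ∧
        x.1 = r + k * a.width ∧ y.1 = r + k * b.width) →
      ∃ r k : ℤ, (i : ℤ) - a.width + 2 ≤ r ∧ r ≤ (i : ℤ) - 1 ∧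
        (x.turn 1).1 = r + k * a.width ∧ (y.turn 1).1 = r + k * b.width := by
    rintro a b x y ⟨r, k, h₁, h₂, h₃, h₄⟩
    refine ⟨r, k + 1, h₁, h₂, ?_, ?_⟩
    · rw [Pt.turn_val, h₃]; ring
    · rw [Pt.turn_val, h₄]; ring
  rcases p with p | p <;> rcases q with q | q
  · obtain ⟨k, h⟩ := h
    refine ⟨k + 1, ?_⟩
    rw [Pt.turn_val, Pt.turn_val, add_mul]
    omega
  · exact t h
  · exact t h
  · exact h

/-- The two ends of a through string have the same quotient and remainder, relative to the periods
of their circles, and these decide the order. -/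
theorem cap_mono (hab : a.width = b.width + 2) {x u : Pt a} {y z : Pt b}
    (h : (cap a b i).joined (.inl x) (.inr y)) (h' : (cap a b i).joined (.inl u) (.inr z))
    (hxu : x.1 < u.1) : y.1 < z.1 := by
  obtain ⟨r, k, h₁, h₂, h₃, h₄⟩ := h
  obtain ⟨s, l, h₁', h₂', h₃', h₄'⟩ := h'
  rw [h₃, h₃', window_lt h₁ (by omega) h₁' (by omega)] at hxu
  rw [h₄, h₄', window_lt h₁ (by omega) h₁' (by omega)]
  exact hxu

/-- The remainders of the through strings fill exactly one period of the outer circle. -/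
theorem cap_outer (hab : a.width = b.width + 2) (y : Pt b) :
    ∃ x : Pt a, (cap a b i).joined (.inl x) (.inr y) := by
  obtain ⟨r, k, h₁, h₂, h₃⟩ := exists_window y.width_pos ((i : ℤ) - a.width + 2) y.1
  exact ⟨⟨r + k * a.width, by omega⟩, r, k, h₁, by omega, rfl, h₃⟩

theorem cap_unique (hab : a.width = b.width + 2) {p q q' : Bdry a b}
    (h : (cap a b i).joined p q) (h' : (cap a b i).joined p q') : q = q' := by
  rcases p with p | p
  · have hw := p.width_pos
    rcases q with q | q <;> rcases q' with q' | q'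
    · obtain ⟨k, h⟩ := h
      obtain ⟨l, h'⟩ := h'
      refine congrArg Sum.inl (Pt.ext_val ?_)
      rcases h with ⟨h₁, h₂⟩ | ⟨h₁, h₂⟩ <;> rcases h' with ⟨h₁', h₂'⟩ | ⟨h₁', h₂'⟩
      · omega
      · exact absurd (window_eq (lo := i) le_rfl (by omega) (by omega) (by omega)
          (h₁.symm.trans h₂')).2 (by omega)
      · exact absurd (window_eq (lo := i) le_rfl (by omega) (by omega) (by omega)
          (h₁'.symm.trans h₂)).2 (by omega)
      · omega
    · obtain ⟨k, h⟩ := h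
      obtain ⟨r, l, h₁', h₂', h₃', -⟩ := h'
      exfalso
      rcases h with ⟨h₁, h₂⟩ | ⟨h₁, h₂⟩
      · exact absurd (window_eq h₁' (by omega) (by omega) (by omega) (h₃'.symm.trans h₁)).2
          (by omega)
      · exact absurd (window_eq h₁' (by omega) (by omega) (by omega) (h₃'.symm.trans h₂)).2
          (by omega)
    · obtain ⟨k, h'⟩ := h'
      obtain ⟨r, l, h₁, h₂, h₃, -⟩ := h
      exfalso
      rcases h' with ⟨h₁', h₂'⟩ | ⟨h₁', h₂'⟩
      · exact absurd (window_eq h₁ (by omega) (by omega) (by omega) (h₃.symm.trans h₁')).2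
          (by omega)
      · exact absurd (window_eq h₁ (by omega) (by omega) (by omega) (h₃.symm.trans h₂')).2
          (by omega)
    · obtain ⟨r, l, h₁, h₂, h₃, h₄⟩ := h
      obtain ⟨r', l', h₁', h₂', h₃', h₄'⟩ := h'
      obtain ⟨rfl, rfl⟩ := window_eq h₁ (by omega) h₁' (by omega) (h₃.symm.trans h₃')
      exact congrArg Sum.inr (Pt.ext_val (h₄.trans h₄'.symm))
  · have hw := p.width_pos
    rcases q with q | q <;> rcases q' with q' | q'
    · obtain ⟨r, l, h₁, h₂, h₃, h₄⟩ := h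
      obtain ⟨r', l', h₁', h₂', h₃', h₄'⟩ := h'
      obtain ⟨rfl, rfl⟩ := window_eq h₁ (by omega) h₁' (by omega) (h₄.symm.trans h₄')
      exact congrArg Sum.inl (Pt.ext_val (h₃.trans h₃'.symm))
    · exact h'.elim
    · exact h.elim
    · exact h.elim

theorem cap_isTangle (hab : a.width = b.width + 2) (hsh : a.shade (i - 1) + b.shade (i - 1) = 0) :
    (cap a b i).IsTangle := by
  -- The transversal passes just before the cap: on either circle, a through string is to its left
  -- exactly if the number of its turn is at most `0`.
  refine isTangle_of_transversal (g₀ := i - 1) (h₀ := i - 1) (fun p q => cap_symm) ?_ ?_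
    (fun p q => cap_turn) ?_ rfl ?_ hsh
  · rintro (p | p) h
    · obtain ⟨k, h⟩ := h
      omega
    · exact h
  · intro p
    suffices ∃ q, (cap a b i).joined p q from
      let ⟨q, hq⟩ := this
      ⟨q, hq, fun q' hq' => cap_unique hab hq' hq⟩
    rcases p with p | p
    · obtain ⟨r, k, h₁, h₂, h₃⟩ := exists_window p.width_pos ((i : ℤ) - a.width + 2) p.1
      by_cases h₄ : r ≤ i - 1
      · exact ⟨.inr ⟨r + k * b.width, by omega⟩, r, k, h₁, h₄, h₃, rfl⟩
      · by_cases h₅ : r = i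
        · exact ⟨.inl ⟨i + 1 + k * a.width, p.2⟩, k, .inl ⟨by rw [h₃, h₅], rfl⟩⟩
        · have h₆ : r = i + 1 := by omega
          exact ⟨.inl ⟨i + k * a.width, p.2⟩, k, .inr ⟨rfl, by rw [h₃, h₆]⟩⟩
    · obtain ⟨x, hx⟩ := cap_outer (i := i) hab p
      exact ⟨_, cap_symm hx⟩
  · rintro (p | p) p' q q' hp hq ⟨h₁, h₂, h₃⟩
    · rcases p' with p' | p'
      · rcases q with q | q
        · obtain ⟨k, hp⟩ := hp
          have h₁ : p.1 < q.1 := h₁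
          have h₂ : q.1 < p'.1 := h₂
          omega
        · exact h₂
      · rcases q' with q' | q'
        · exact h₃
        · have h₃ : q'.1 < p'.1 := h₃
          rcases q with q | q
          · exact absurd (cap_mono hab hp hq h₁) (by omega)
          · exact hq
    · rcases q with q | q
      · exact h₁
      · rcases p' with p' | p'
        · exact h₂
        · exact hp
  · have hneg : ∀ k : ℤ, k < 0 → k * a.width ≤ -a.width := fun k hk => by nlinarith
    have hpos : ∀ k : ℤ, 0 < k → (a.width : ℤ) ≤ k * a.width := fun k hk => by nlinarith
    have hpos' : ∀ k : ℤ, 0 ≤ k → 0 ≤ k * a.width := fun k hk => by positivity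
    have hnb : ∀ k : ℤ, k ≤ 0 → k * b.width ≤ 0 := fun k hk =>
      mul_nonpos_of_nonpos_of_nonneg hk (by positivity)
    have hpb : ∀ k : ℤ, 0 < k → (b.width : ℤ) ≤ k * b.width := fun k hk => by nlinarith
    have hna : ∀ k : ℤ, k ≤ 0 → k * a.width ≤ 0 := fun k hk =>
      mul_nonpos_of_nonpos_of_nonneg hk (by positivity)
    rintro (p | p) (q | q) h hl
    · obtain ⟨k, h⟩ := h
      have hl : p.1 ≤ i - 1 := hl
      show q.1 ≤ i - 1
      rcases lt_or_ge k 0 with hk | hk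
      · have := hneg k hk
        omega
      · have := hpos' k hk
        omega
    · obtain ⟨r, k, h₁, h₂, h₃, h₄⟩ := h
      have hl : p.1 ≤ i - 1 := hl
      show q.1 ≤ i - 1
      rcases lt_or_ge 0 k with hk | hk
      · have := hpos k hk
        omega
      · have := hnb k hk
        omega
    · obtain ⟨r, k, h₁, h₂, h₃, h₄⟩ := h
      have hl : p.1 ≤ i - 1 := hl
      show q.1 ≤ i - 1
      rcases lt_or_ge 0 k with hk | hk
      · have := hpb k hk
        omega
      · have := hna k hk
        omega
    · exact h.elim

end Cap

/-! ### Composites -/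

section Comp
variable {S : Diagram a b} {T : Diagram b c}

theorem Conn.inner {x : Pt a} {y : Pt b} (h : S.joined (.inl x) (.inr y)) :
    Conn S T (Glued.outer (.inl x)) (Glued.mid y) := Conn.lower h

theorem Conn.midLower {y y' : Pt b} (h : S.joined (.inr y) (.inr y')) :
    Conn S T (Glued.mid y) (Glued.mid y') := Conn.lower h

theorem Conn.midUpper {y y' : Pt b} (h : T.joined (.inl y) (.inl y')) :
    Conn S T (Glued.mid y) (Glued.mid y') := Conn.upper h

theorem Conn.outer {y : Pt b} {z : Pt c} (h : T.joined (.inl y) (.inr z)) :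
    Conn S T (Glued.mid y) (Glued.outer (.inr z)) := Conn.upper h

theorem comp_joined_through {x : Pt a} {y : Pt b} {z : Pt c} (h : S.joined (.inl x) (.inr y))
    (h' : T.joined (.inl y) (.inr z)) : (S.comp T).joined (.inl x) (.inr z) :=
  ⟨Sum.inl_ne_inr, (Conn.inner h).trans (.outer h')⟩

theorem comp_joined_inner (hS : S.IsTangle) {x x' : Pt a} (h : S.joined (.inl x) (.inl x')) :
    (S.comp T).joined (.inl x) (.inl x') :=
  ⟨fun e => hS.irrefl (.inl x) (by
    have : x = x' := Sum.inl_injective e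
    rwa [← this] at h), Conn.lower h⟩

theorem comp_joined_outer (hT : T.IsTangle) {z z' : Pt c} (h : T.joined (.inr z) (.inr z')) :
    (S.comp T).joined (.inr z) (.inr z') :=
  ⟨fun e => hT.irrefl (.inr z) (by
    have : z = z' := Sum.inr_injective e
    rwa [← this] at h), Conn.upper h⟩

theorem comp_joined_cap {x x' : Pt a} {y y' : Pt b} (hx : x.1 ≠ x'.1)
    (h : S.joined (.inl x) (.inr y))
    (h' : S.joined (.inl x') (.inr y')) (hy : T.joined (.inl y) (.inl y')) :
    (S.comp T).joined (.inl x) (.inl x') :=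
  ⟨fun e => hx (congrArg Subtype.val (Sum.inl_injective e)),
    ((Conn.inner h).trans (.midUpper hy)).trans (Conn.inner h').symm⟩

theorem comp_joined_cup {z z' : Pt c} {y y' : Pt b} (hz : z.1 ≠ z'.1)
    (h : T.joined (.inl y) (.inr z)) (h' : T.joined (.inl y') (.inr z'))
    (hy : S.joined (.inr y) (.inr y')) : (S.comp T).joined (.inr z) (.inr z') :=
  ⟨fun e => hz (congrArg Subtype.val (Sum.inr_injective e)),
    ((Conn.outer h).symm.trans (.midLower hy)).trans (Conn.outer h')⟩

theorem not_onLoop_of_window (hS : S.IsTangle) (hT : T.IsTangle) (lo : ℤ)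
    (h : ∀ y : Pt b, lo ≤ y.1 → y.1 < lo + b.width → ¬ OnLoop S T y) (y : Pt b) :
    ¬ OnLoop S T y := by
  refine Pt.forall_of_window (P := fun y => ¬ OnLoop S T y) (fun y k hy hl => hy ?_) lo h y
  have := hl.turn hS hT (-k)
  rwa [Pt.turn_turn, add_neg_cancel, Pt.turn_zero] at this

end Comp

theorem same_of_window {D D' : Diagram a b} (h : D.IsTangle) (h' : D'.IsTangle) (lo lo' : ℤ)
    (hin : ∀ x : Pt a, lo ≤ x.1 → x.1 < lo + a.width →
      ∃ q, D.joined (.inl x) q ∧ D'.joined (.inl x) q)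
    (hout : ∀ y : Pt b, lo' ≤ y.1 → y.1 < lo' + b.width →
      ∃ q, D.joined (.inr y) q ∧ D'.joined (.inr y) q) (hc : D'.core = D.core)
    (hs : D'.shadedLoops = D.shadedLoops) (hu : D'.unshadedLoops = D.unshadedLoops) :
    D.Same D' := by
  refine same_of_joined h h' ?_ hc hs hu
  rintro (p | p)
  · refine Pt.forall_of_window (P := fun x => ∃ q, D.joined (.inl x) q ∧ D'.joined (.inl x) q)
      ?_ lo hin p
    rintro x k ⟨q, hq, hq'⟩
    exact ⟨q.turn k, (h.joined_turn k).2 hq, (h'.joined_turn k).2 hq'⟩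
  · refine Pt.forall_of_window (P := fun x => ∃ q, D.joined (.inr x) q ∧ D'.joined (.inr x) q)
      ?_ lo' hout p
    rintro x k ⟨q, hq, hq'⟩
    exact ⟨q.turn k, (h.joined_turn k).2 hq, (h'.joined_turn k).2 hq'⟩

/-- Two composites without loops agree if they agree in one turn. -/
theorem comp_same_of_window {b' : AObj} {S : Diagram a b} {T : Diagram b c} {S' : Diagram a b'}
    {T' : Diagram b' c} (h : (S.comp T).IsTangle) (h' : (S'.comp T').IsTangle)
    (hl : ∀ y, ¬ OnLoop S T y) (hl' : ∀ y, ¬ OnLoop S' T' y) (hc : S'.core + T'.core = S.core + T.core)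
    (hs : S'.shadedLoops + T'.shadedLoops = S.shadedLoops + T.shadedLoops)
    (hu : S'.unshadedLoops + T'.unshadedLoops = S.unshadedLoops + T.unshadedLoops) (lo lo' : ℤ)
    (hin : ∀ x : Pt a, lo ≤ x.1 → x.1 < lo + a.width →
      ∃ q, (S.comp T).joined (.inl x) q ∧ (S'.comp T').joined (.inl x) q)
    (hout : ∀ y : Pt c, lo' ≤ y.1 → y.1 < lo' + c.width →
      ∃ q, (S.comp T).joined (.inr y) q ∧ (S'.comp T').joined (.inr y) q) :
    (S.comp T).Same (S'.comp T') := by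
  obtain ⟨h₁, h₂, h₃⟩ := comp_counts_of_no_loop hl
  obtain ⟨h₁', h₂', h₃'⟩ := comp_counts_of_no_loop hl'
  exact same_of_window h h' lo lo' hin hout (by omega) (by omega) (by omega)

/-- Caps at disjoint places do not interact; `hne` excludes the places `1` and `a.width`, whose caps
share the point `1` across the star. -/
theorem cap_comp_cap {i j : ℕ} (hab : a.width = b.width + 2) (hbc : b.width = c.width + 2)
    (hi : 1 ≤ i) (hij : i + 1 < j) (hj : j ≤ a.width) (hne : ¬ (i = 1 ∧ j = a.width))
    (h₁ : (cap a b j).IsTangle) (h₂ : (cap b c i).IsTangle) (h₃ : (cap a b i).IsTangle)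
    (h₄ : (cap b c (j - 2)).IsTangle) :
    ((cap a b j).comp (cap b c i)).Same ((cap a b i).comp (cap b c (j - 2))) := by
  have t₁ := h₁.comp h₂
  have t₂ := h₃.comp h₄
  have hb : 0 < b.width := by omega
  have lo : ∀ (x : Pt a) (z : Pt c), (j : ℤ) - a.width + 2 ≤ x.1 → x.1 ≤ i - 1 → z.1 = x.1 →
      ((cap a b j).comp (cap b c i)).joined (.inl x) (.inr z) ∧
      ((cap a b i).comp (cap b c (j - 2))).joined (.inl x) (.inr z) := fun x z _ _ _ =>
    ⟨comp_joined_through (y := ⟨x.1, hb⟩) (cap_joined_lo (by omega) (by omega) rfl)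
      (cap_joined_lo (by simp only; omega) (by simp only; omega) (by simpa)),
    comp_joined_through (y := ⟨x.1, hb⟩) (cap_joined_lo (by omega) (by omega) rfl)
      (cap_joined_lo (by simp only; omega) (by simp only; omega) (by simpa))⟩
  -- Between the two caps the numbering drops by two, at the second stage of one composite and at
  -- the first stage of the other.
  have hi : ∀ (x : Pt a) (z : Pt c), (i : ℤ) + 2 ≤ x.1 → x.1 ≤ j - 1 → z.1 = x.1 - 2 →
      ((cap a b j).comp (cap b c i)).joined (.inl x) (.inr z) ∧
      ((cap a b i).comp (cap b c (j - 2))).joined (.inl x) (.inr z) := fun x z _ _ _ =>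
    ⟨comp_joined_through (y := ⟨x.1, hb⟩) (cap_joined_lo (by omega) (by omega) rfl)
      (cap_joined_hi hbc (by simp only; omega) (by simp only; omega) (by simpa)),
    comp_joined_through (y := ⟨x.1 - 2, hb⟩) (cap_joined_hi hab (by omega) (by omega) rfl)
      (cap_joined_lo (by simp only; omega) (by simp only; omega) (by simpa))⟩
  have capi : ∀ x x' : Pt a, x.1 = i → x'.1 = i + 1 →
      ((cap a b j).comp (cap b c i)).joined (.inl x) (.inl x') ∧
      ((cap a b i).comp (cap b c (j - 2))).joined (.inl x) (.inl x') := fun x x' _ _ =>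
    ⟨comp_joined_cap (y := ⟨i, hb⟩) (y' := ⟨i + 1, hb⟩) (by omega)
      (cap_joined_lo (by omega) (by omega) (by simp only; omega))
      (cap_joined_lo (by omega) (by omega) (by simp only; omega)) (cap_joined_cap rfl rfl),
    comp_joined_inner h₃ (cap_joined_cap (by omega) (by omega))⟩
  have capj : ∀ x x' : Pt a, x.1 = j → x'.1 = j + 1 →
      ((cap a b j).comp (cap b c i)).joined (.inl x) (.inl x') ∧
      ((cap a b i).comp (cap b c (j - 2))).joined (.inl x) (.inl x') := fun x x' _ _ =>
    ⟨comp_joined_inner h₁ (cap_joined_cap (by omega) (by omega)),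
    comp_joined_cap (y := ⟨j - 2, hb⟩) (y' := ⟨j - 1, hb⟩) (by omega)
      (cap_joined_hi hab (by omega) (by omega) (by simp only; omega))
      (cap_joined_hi hab (by omega) (by omega) (by simp only; omega))
      (cap_joined_cap (by simp only; omega) (by simp only; omega))⟩
  refine comp_same_of_window t₁ t₂ (fun y => ?_) (fun y => ?_) rfl rfl rfl
    (j - a.width + 2) (j - a.width + 2) (fun x _ _ => ?_) (fun z _ _ => ?_)
  · obtain ⟨x, hx⟩ := cap_outer (i := j) hab y
    exact not_onLoop_of_joined (cap_symm hx)
  · obtain ⟨x, hx⟩ := cap_outer (i := i) hab y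
    exact not_onLoop_of_joined (cap_symm hx)
  · by_cases e₁ : x.1 ≤ i - 1
    · exact ⟨_, lo x ⟨x.1, by omega⟩ (by omega) e₁ rfl⟩
    by_cases e₂ : x.1 = i
    · exact ⟨_, capi x ⟨x.1 + 1, x.2⟩ e₂ (by simp only; omega)⟩
    by_cases e₃ : x.1 = i + 1
    · have := capi ⟨x.1 - 1, x.2⟩ x (by simp only; omega) e₃
      exact ⟨_, t₁.symm _ _ this.1, t₂.symm _ _ this.2⟩
    by_cases e₄ : x.1 = j
    · exact ⟨_, capj x ⟨x.1 + 1, x.2⟩ e₄ (by simp only; omega)⟩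
    by_cases e₅ : x.1 = j + 1
    · have := capj ⟨x.1 - 1, x.2⟩ x (by simp only; omega) e₅
      exact ⟨_, t₁.symm _ _ this.1, t₂.symm _ _ this.2⟩
    exact ⟨_, hi x ⟨x.1 - 2, by omega⟩ (by omega) (by omega) rfl⟩
  · by_cases e₁ : z.1 ≤ i - 1
    · have := lo ⟨z.1, by omega⟩ z (by simp only; omega) e₁ rfl
      exact ⟨_, t₁.symm _ _ this.1, t₂.symm _ _ this.2⟩
    · have := hi ⟨z.1 + 2, by omega⟩ z (by simp only; omega) (by simp only; omega) (by simp)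
      exact ⟨_, t₁.symm _ _ this.1, t₂.symm _ _ this.2⟩

end Diagram
end Annular

/-! ### Cups followed by caps. -/

namespace Annular
namespace Diagram
variable {a b c : AObj}

theorem cup_comp_cap_lt {i j : ℕ} (hab : b.width = a.width + 2) (hac : a.width = c.width + 2)
    (hi : 1 ≤ i) (hij : i + 1 < j) (hj : j ≤ b.width) (hne : ¬ (i = 1 ∧ j = b.width))
    (h₁ : (cap b a j).IsTangle) (h₂ : (cap b a i).IsTangle) (h₃ : (cap a c i).IsTangle)
    (h₄ : (cap a c (j - 2)).IsTangle) :
    ((cap b a j).star.comp (cap b a i)).Same ((cap a c i).comp (cap a c (j - 2)).star) := by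
  have t₁ := h₁.star.comp h₂
  have t₂ := h₃.comp h₄.star
  have hb : 0 < b.width := by omega
  have ha : 0 < a.width := by omega
  have S₁ : ∀ {x : Pt a} {y : Pt b}, (j : ℤ) - b.width + 2 ≤ x.1 → x.1 ≤ j - 1 → y.1 = x.1 →
      (cap b a j).star.joined (.inl x) (.inr y) := fun {x y} h h' e =>
    cap_joined_lo (x := y) (y := x) (by omega) (by omega) e.symm
  have S₂ : ∀ {y : Pt c} {x : Pt a}, (j : ℤ) - 2 - a.width + 2 ≤ x.1 → x.1 ≤ j - 2 - 1 → y.1 = x.1 →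
      (cap a c (j - 2)).star.joined (.inl y) (.inr x) := fun {y x} h h' e =>
    cap_joined_lo (x := x) (y := y) (by omega) (by omega) e
  have lo : ∀ (x z : Pt a), (j : ℤ) - a.width ≤ x.1 → x.1 ≤ i - 1 → z.1 = x.1 →
      ((cap b a j).star.comp (cap b a i)).joined (.inl x) (.inr z) ∧
      ((cap a c i).comp (cap a c (j - 2)).star).joined (.inl x) (.inr z) := fun x z _ _ _ =>
    ⟨comp_joined_through (y := ⟨x.1, hb⟩) (S₁ (by omega) (by omega) rfl)
      (cap_joined_lo (by simp only; omega) (by simp only; omega) (by simpa)),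
    comp_joined_through (y := ⟨x.1, by omega⟩) (cap_joined_lo (by omega) (by omega) rfl)
      (S₂ (by omega) (by omega) (by simp only; omega))⟩
  have hi : ∀ (x z : Pt a), (i : ℤ) + 2 ≤ x.1 → x.1 ≤ j - 1 → z.1 = x.1 - 2 →
      ((cap b a j).star.comp (cap b a i)).joined (.inl x) (.inr z) ∧
      ((cap a c i).comp (cap a c (j - 2)).star).joined (.inl x) (.inr z) := fun x z _ _ _ =>
    ⟨comp_joined_through (y := ⟨x.1, hb⟩) (S₁ (by omega) (by omega) rfl)
      (cap_joined_hi hab (by simp only; omega) (by simp only; omega) (by simpa)),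
    comp_joined_through (y := ⟨x.1 - 2, by omega⟩) (cap_joined_hi hac (by omega) (by omega) rfl)
      (S₂ (by omega) (by omega) (by simp only; omega))⟩
  have capi : ∀ x x' : Pt a, x.1 = i → x'.1 = i + 1 →
      ((cap b a j).star.comp (cap b a i)).joined (.inl x) (.inl x') ∧
      ((cap a c i).comp (cap a c (j - 2)).star).joined (.inl x) (.inl x') := fun x x' _ _ =>
    ⟨comp_joined_cap (y := ⟨i, hb⟩) (y' := ⟨i + 1, hb⟩) (by omega)
      (S₁ (by omega) (by omega) (by simp only; omega))
      (S₁ (by omega) (by omega) (by simp only; omega)) (cap_joined_cap rfl rfl),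
    comp_joined_inner h₃ (cap_joined_cap (by omega) (by omega))⟩
  have cupj : ∀ z z' : Pt a, z.1 = j - 2 → z'.1 = j - 1 →
      ((cap b a j).star.comp (cap b a i)).joined (.inr z) (.inr z') ∧
      ((cap a c i).comp (cap a c (j - 2)).star).joined (.inr z) (.inr z') := fun z z' _ _ =>
    ⟨comp_joined_cup (y := ⟨j, hb⟩) (y' := ⟨j + 1, hb⟩) (by omega)
      (cap_joined_hi hab (by simp only; omega) (by simp only; omega) (by simp only; omega))
      (cap_joined_hi hab (by simp only; omega) (by simp only; omega) (by simp only; omega))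
      (cap_joined_cap (a := b) (b := a) rfl rfl),
    comp_joined_outer h₄.star
      (cap_joined_cap (a := a) (b := c) (x := z) (y := z') (by omega) (by omega))⟩
  refine comp_same_of_window t₁ t₂ (not_onLoop_of_window h₁.star h₂ (j - b.width + 2)
    fun y _ _ => ?_) (fun y => ?_) rfl rfl rfl
    (j - a.width) (j - a.width) (fun x _ _ => ?_) (fun z _ _ => ?_)
  -- The middle points before `j` are ends of through strings of the cup tangle, and `j`, `j + 1`
  -- are ends of through strings of the cap tangle.
  · by_cases e : y.1 ≤ j - 1
    · exact not_onLoop_of_joined (x := ⟨y.1, ha⟩)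
        (h₁.star.symm _ _ (S₁ (by simp only; omega) (by simp only; omega) rfl))
    · exact not_onLoop_of_joined' (z := ⟨y.1 - 2, ha⟩)
        (cap_joined_hi hab (by omega) (by omega) rfl)
  · obtain ⟨x, hx⟩ := cap_outer (i := i) hac y
    exact not_onLoop_of_joined (cap_symm hx)
  · by_cases e₁ : x.1 ≤ i - 1
    · exact ⟨_, lo x x (by omega) e₁ rfl⟩
    by_cases e₂ : x.1 = i
    · exact ⟨_, capi x ⟨x.1 + 1, x.2⟩ e₂ (by simp only; omega)⟩
    by_cases e₃ : x.1 = i + 1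
    · have := capi ⟨x.1 - 1, x.2⟩ x (by simp only; omega) e₃
      exact ⟨_, t₁.symm _ _ this.1, t₂.symm _ _ this.2⟩
    exact ⟨_, hi x ⟨x.1 - 2, by omega⟩ (by omega) (by omega) rfl⟩
  · by_cases e₁ : z.1 ≤ i - 1
    · have := lo z z (by omega) e₁ rfl
      exact ⟨_, t₁.symm _ _ this.1, t₂.symm _ _ this.2⟩
    by_cases e₂ : z.1 = j - 2
    · exact ⟨_, cupj z ⟨z.1 + 1, z.2⟩ e₂ (by simp only; omega)⟩
    by_cases e₃ : z.1 = j - 1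
    · have := cupj ⟨z.1 - 1, z.2⟩ z (by simp only; omega) e₃
      exact ⟨_, t₁.symm _ _ this.1, t₂.symm _ _ this.2⟩
    have := hi ⟨z.1 + 2, by omega⟩ z (by simp only; omega) (by simp only; omega) (by simp)
    exact ⟨_, t₁.symm _ _ this.1, t₂.symm _ _ this.2⟩

/-- The string at `i` runs in a zigzag through the middle points `i`, `i + 1`, `i + 2` and comes out
at `i`. -/
theorem cup_comp_cap_succ {i : ℕ} (hab : b.width = a.width + 2) (ha : 0 < a.width)
    (h₁ : (cap b a (i + 1)).IsTangle) (h₂ : (cap b a i).IsTangle) :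
    ((cap b a (i + 1)).star.comp (cap b a i)).Same (Diagram.id a) := by
  have t₁ := h₁.star.comp h₂
  have hb : 0 < b.width := by omega
  have S₁ : ∀ {x : Pt a} {y : Pt b}, (i : ℤ) + 1 - b.width + 2 ≤ x.1 → x.1 ≤ i → y.1 = x.1 →
      (cap b a (i + 1)).star.joined (.inl x) (.inr y) := fun {x y} h h' e =>
    cap_joined_lo (x := y) (y := x) (by omega) (by omega) e.symm
  have lo : ∀ x : Pt a, (i : ℤ) + 1 - a.width ≤ x.1 → x.1 ≤ i →
      ((cap b a (i + 1)).star.comp (cap b a i)).joined (.inl x) (.inr x) := by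
    intro x h h'
    by_cases e : x.1 = i
    · refine ⟨Sum.inl_ne_inr, (Conn.inner (y := ⟨x.1, hb⟩) (S₁ (by omega) (by omega) rfl)).trans ?_⟩
      refine (Conn.midUpper (y' := ⟨i + 1, hb⟩) (cap_joined_cap e rfl)).trans ?_
      refine (Conn.midLower (y' := ⟨i + 2, hb⟩)
        (cap_joined_cap (a := b) (b := a) (by simp) (by simp only; omega))).trans ?_
      exact Conn.outer (cap_joined_hi hab (by simp) (by simp only; omega) (by simp only; omega))
    · exact comp_joined_through (y := ⟨x.1, hb⟩) (S₁ (by omega) (by omega) rfl)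
        (cap_joined_lo (by simp only; omega) (by simp only; omega) rfl)
  have hl : ∀ y, ¬ OnLoop (cap b a (i + 1)).star (cap b a i) y := by
    refine not_onLoop_of_window h₁.star h₂ (i + 1 - b.width + 2) fun y _ _ => ?_
    by_cases e : y.1 ≤ i
    · exact not_onLoop_of_joined (x := ⟨y.1, ha⟩)
        (h₁.star.symm _ _ (S₁ (by simp only; omega) (by simp only; omega) rfl))
    by_cases e' : y.1 = i + 1
    · intro hy
      refine not_onLoop_of_joined' (z := ⟨i, ha⟩) ?_ (hy.congr (Conn.midLower
        (y' := ⟨i + 2, hb⟩) (cap_joined_cap (a := b) (b := a) (by omega) (by simp only; omega))))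
      exact cap_joined_hi hab (by simp) (by simp only; omega) (by simp only; omega)
    · exact not_onLoop_of_joined' (z := ⟨y.1 - 2, ha⟩)
        (cap_joined_hi hab (by omega) (by omega) rfl)
  obtain ⟨c₁, c₂, c₃⟩ := comp_counts_of_no_loop hl
  refine same_of_window t₁ (id_isTangle a) (i + 1 - a.width) (i + 1 - a.width)
    (fun x _ _ => ⟨_, lo x (by omega) (by omega), rfl⟩)
    (fun x _ _ => ⟨_, t₁.symm _ _ (lo x (by omega) (by omega)), rfl⟩) c₁.symm c₂.symm c₃.symm

/-- The zigzag passes the star, through the middle points `2`, `1`, `0`, and every string is shifted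
by `-2`. -/
theorem cup_comp_cap_last_first (hab : b.width = a.width + 2) (ha : 0 < a.width)
    (h₁ : (cap b a b.width).IsTangle) (h₂ : (cap b a 1).IsTangle) :
    ((cap b a b.width).star.comp (cap b a 1)).Same (shift a (-2)) := by
  have t₁ := h₁.star.comp h₂
  have hb : 0 < b.width := by omega
  have S₁ : ∀ {x : Pt a} {y : Pt b}, 2 ≤ x.1 → x.1 ≤ (b.width : ℤ) - 1 → y.1 = x.1 →
      (cap b a b.width).star.joined (.inl x) (.inr y) := fun {x y} h h' e =>
    cap_joined_lo (x := y) (y := x) (by omega) (by omega) e.symm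
  -- This is the cup at `b.width`, one turn earlier.
  have hcup : ∀ y y' : Pt b, y.1 = 1 → y'.1 = 0 →
      (cap b a b.width).star.joined (.inr y) (.inr y') := fun y y' e e' =>
    ⟨-1, .inr ⟨by rw [e']; ring, by rw [e]; ring⟩⟩
  have lo : ∀ x z : Pt a, 2 ≤ x.1 → x.1 ≤ (a.width : ℤ) + 1 → z.1 = x.1 - 2 →
      ((cap b a b.width).star.comp (cap b a 1)).joined (.inl x) (.inr z) := by
    intro x z h h' hz
    by_cases e : x.1 = 2
    · refine ⟨Sum.inl_ne_inr, (Conn.inner (y := ⟨2, hb⟩) (S₁ (by omega) (by omega) e.symm)).trans ?_⟩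
      refine (Conn.midUpper (y := ⟨1, hb⟩) (cap_joined_cap rfl rfl)).symm.trans ?_
      refine (Conn.midLower (y' := ⟨0, hb⟩) (hcup _ _ rfl rfl)).trans ?_
      exact Conn.outer (cap_joined_lo (by simp only; omega) (by simp) (by simp only; omega))
    · exact comp_joined_through (y := ⟨x.1, hb⟩) (S₁ (by omega) (by omega) rfl)
        (cap_joined_hi hab (by simp only; omega) (by simp only; omega) hz)
  have hl : ∀ y, ¬ OnLoop (cap b a b.width).star (cap b a 1) y := by
    refine not_onLoop_of_window h₁.star h₂ 0 fun y _ _ => ?_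
    have h0 : ¬ OnLoop (cap b a b.width).star (cap b a 1) ⟨0, hb⟩ :=
      not_onLoop_of_joined' (z := ⟨0, ha⟩)
        (cap_joined_lo (by simp only; omega) (by simp) rfl)
    by_cases e : y.1 = 0
    · rwa [show y = ⟨0, hb⟩ from Pt.ext_val e]
    by_cases e' : y.1 = 1
    · exact fun hy => h0 (hy.congr (Conn.midLower (hcup _ _ e' rfl)))
    · exact not_onLoop_of_joined (x := ⟨y.1, ha⟩)
        (h₁.star.symm _ _ (S₁ (by simp only; omega) (by simp only; omega) rfl))
  obtain ⟨c₁, c₂, c₃⟩ := comp_counts_of_no_loop hl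
  refine same_of_window t₁ (shift_isTangle a (by decide)) 2 0
    (fun x _ _ => ⟨.inr ⟨x.1 - 2, ha⟩, lo x _ (by omega) (by omega) rfl, by simp [shift]; omega⟩)
    (fun z _ _ => ⟨.inl ⟨z.1 + 2, ha⟩, t₁.symm _ _ (lo _ z (by simp only; omega)
      (by simp only; omega) (by simp)), by simp [shift]⟩) c₁.symm c₂.symm c₃.symm

/-- Radial strings together with contractible loops. -/
def loopId (a : AObj) (m n : ℕ) : Diagram a a :=
  { Diagram.id a with shadedLoops := m, unshadedLoops := n }

theorem loopId_isTangle (a : AObj) (m n : ℕ) : (loopId a m n).IsTangle :=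
  let h := id_isTangle a
  ⟨h.symm, h.irrefl, h.existsUnique, h.periodic, h.planar, h.core_eq_zero, h.checkerboard⟩

theorem loopId_comp_same {S : Diagram a b} (hS : S.IsTangle) (m n : ℕ) :
    ((loopId a m n).comp S).Same (S.comp (loopId b m n)) := by
  have hc := comp_counts_of_no_loop (S := loopId a m n) (T := S) fun y =>
    not_onLoop_of_joined (x := y) rfl
  have hc' := comp_counts_of_no_loop (S := S) (T := loopId b m n) fun y =>
    not_onLoop_of_joined' (z := y) rfl
  have hl : ∀ p : Bdry a b, Conn (loopId a m n) S (Glued.outer p) (Glued.upper p) := by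
    rintro (p | p)
    · exact Conn.lower (S := loopId a m n) (p := .inl p) (q := .inr p) rfl
    · exact .refl _
  have hl' : ∀ p : Bdry a b, Conn S (loopId b m n) (Glued.outer p) (Glued.lower p) := by
    rintro (p | p)
    · exact .refl _
    · exact Conn.upper (T := loopId b m n) (p := .inr p) (q := .inl p) rfl
  refine same_of_joined ((loopId_isTangle a m n).comp hS) (hS.comp (loopId_isTangle b m n))
    (fun p => ⟨hS.mate p, ⟨(hS.mate_ne p).symm, ?_⟩, ⟨(hS.mate_ne p).symm, ?_⟩⟩) ?_ ?_ ?_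
  · exact ((hl p).trans (.upper (hS.joined_mate p))).trans (hl _).symm
  · exact ((hl' p).trans (.lower (hS.joined_mate p))).trans (hl' _).symm
  · rw [hc.1, hc'.1, add_comm]; rfl
  · rw [hc.2.1, hc'.2.1, add_comm]; rfl
  · rw [hc.2.2, hc'.2.2, add_comm]; rfl

theorem ncard_single_loop {S : Diagram a b} {T : Diagram b c} {P : Pt b → Prop} {L : Set (Pt b)}
    (h : ∀ y, P y → loopThrough S T y = L) {Q : Prop} (hQ : Q ↔ ∃ y, P y) [Decidable Q] :
    {L | ∃ y, P y ∧ L = loopThrough S T y}.ncard = if Q then 1 else 0 := by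
  split_ifs with hq
  · obtain ⟨y, hy⟩ := hQ.1 hq
    rw [Set.ncard_eq_one]
    refine ⟨L, Set.ext fun L' => ⟨?_, ?_⟩⟩
    · rintro ⟨y, hy, rfl⟩
      exact h y hy
    · rintro rfl
      exact ⟨y, hy, (h y hy).symm⟩
  · convert Set.ncard_empty (Set (Pt b))
    exact Set.eq_empty_of_forall_notMem fun L ⟨y, hy, _⟩ => hq (hQ.2 ⟨y, hy⟩)

/-- The cup and the cap close up to a loop through `i` and `i + 1`. Its leftmost point is `i`, whose
parity decides the shade. -/
theorem cup_comp_cap_self {i : ℕ} (hab : b.width = a.width + 2)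
    (h : (cap b a i).IsTangle) : ((cap b a i).star.comp (cap b a i)).Same
      (loopId a (if Odd i then 1 else 0) (if Even i then 1 else 0)) := by
  have t₁ := h.star.comp h
  have hb : 0 < b.width := by omega
  have lo : ∀ x : Pt a, (i : ℤ) - a.width ≤ x.1 → x.1 ≤ i - 1 →
      ((cap b a i).star.comp (cap b a i)).joined (.inl x) (.inr x) := by
    intro x h h'
    refine comp_joined_through (y := ⟨x.1, hb⟩) ?_
        (cap_joined_lo (by simp only; omega) (by simp only; omega) rfl)
    exact cap_joined_lo (x := (⟨x.1, hb⟩ : Pt b)) (y := x) (by simp only; omega) (by simp only; omega) rfl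
  let y₀ : Pt b := ⟨i, hb⟩
  let y₁ : Pt b := ⟨i + 1, hb⟩
  have h01 : (cap b a i).joined (.inl y₀) (.inl y₁) := cap_joined_cap rfl rfl
  have hlink : Conn (cap b a i).star (cap b a i) (Glued.mid y₀) (Glued.mid y₁) := Conn.midUpper h01
  have key : ∀ v, Conn (cap b a i).star (cap b a i) (Glued.mid y₀) v →
      v = Glued.mid y₀ ∨ v = Glued.mid y₁ := by
    have e : ∀ p q, (cap b a i).joined p q → ((p = .inl y₀ ∨ p = .inl y₁) ↔
        (q = .inl y₀ ∨ q = .inl y₁)) := by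
      have : ∀ p q, (cap b a i).joined p q → p = .inl y₀ ∨ p = .inl y₁ → q = .inl y₀ ∨ q = .inl y₁ := by
        rintro p q hpq (rfl | rfl)
        · exact .inr (h.eq_of_joined hpq h01)
        · exact .inl (h.eq_of_joined hpq (h.symm _ _ h01))
      exact fun p q hpq => ⟨this p q hpq, this q p (h.symm _ _ hpq)⟩
    have m₁ : ∀ (y : Pt b) (p : Bdry a b), (Glued.lower p : Glued a b a) = Glued.mid y ↔
        p.swap = .inl y := by
      rintro y (p | p)
      · exact ⟨fun h => (by cases h), fun h => (by cases h)⟩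
      · exact ⟨fun h => by cases h; rfl, fun h => by cases h; rfl⟩
    have m₂ : ∀ (y : Pt b) (p : Bdry b a), (Glued.upper p : Glued a b a) = Glued.mid y ↔
        p = .inl y := by
      rintro y (p | p)
      · exact ⟨fun h => by cases h; rfl, fun h => by cases h; rfl⟩
      · exact ⟨fun h => (by cases h), fun h => (by cases h)⟩
    intro v hv
    have := hv.invariant (fun u => u = Glued.mid y₀ ∨ u = Glued.mid y₁) (fun p q hpq => propext (by
      rw [m₁, m₁, m₁, m₁]; exact e _ _ hpq)) (fun p q hpq => propext (by
      rw [m₂, m₂, m₂, m₂]; exact e _ _ hpq))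
    exact this.mp (.inl rfl)
  have hon : OnLoop (cap b a i).star (cap b a i) y₀ := by
    intro p hp
    rcases key _ hp with h | h <;> rcases p with p | p <;> cases h
  have hmid : ∀ y, Conn (cap b a i).star (cap b a i) (Glued.mid y₀) (Glued.mid y) →
      y = y₀ ∨ y = y₁ := fun y hy =>
    (key _ hy).imp (fun e => Sum.inl_injective (Sum.inr_injective e))
      (fun e => Sum.inl_injective (Sum.inr_injective e))
  have hw : ¬ Winds (cap b a i).star (cap b a i) y₀ := by
    rintro ⟨k, hk, hc⟩
    rcases hmid _ hc with e | e
    · exact hk (Pt.turn_injective y₀ (e.trans (Pt.turn_zero y₀).symm))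
    -- The points `i` and `i + 1` are not translates of each other, as the period is even.
    · have e := congrArg Subtype.val e
      rw [Pt.turn_val] at e
      have e : k * b.width = 1 := add_left_cancel e
      have := b.two_dvd_width.mul_left k
      omega
  have hleft : ∀ z, IsLeftmost (cap b a i).star (cap b a i) y₀ z ↔ z = y₀ := by
    have : IsLeftmost (cap b a i).star (cap b a i) y₀ y₀ := by
      refine ⟨.refl _, fun u hu => ?_⟩
      rcases hmid u hu with rfl | rfl
      · exact le_rfl
      · exact (Int.lt_add_one_iff.2 le_rfl).le
    exact fun z => ⟨fun hz => hz.unique this, fun hz => hz ▸ this⟩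
  have hcov : ∀ y, OnLoop (cap b a i).star (cap b a i) y →
      ∃ k, Conn (cap b a i).star (cap b a i) (Glued.mid (y.turn k)) (Glued.mid y₀) := by
    intro y hy
    obtain ⟨r, k, h₁, h₂, h₃⟩ := exists_window y.width_pos ((i : ℤ) - b.width + 2) y.1
    have hr : Pt.turn (-k) y = ⟨r, hb⟩ := Pt.ext_val (by rw [Pt.turn_val, h₃]; ring)
    refine ⟨-k, ?_⟩
    rw [hr]
    by_cases e : r ≤ i - 1
    · have hy' := hy.turn h.star h (-k)
      rw [hr] at hy'
      exact absurd hy' (not_onLoop_of_joined' (z := ⟨r, by omega⟩)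
        (cap_joined_lo (by simp only; omega) (by simp only; omega) rfl))
    by_cases e' : r = i
    · subst e'
      exact .refl _
    · have : r = i + 1 := by omega
      subst this
      exact hlink.symm
  have hL : ∀ y, OnLoop (cap b a i).star (cap b a i) y → loopThrough (cap b a i).star (cap b a i) y =
      loopThrough (cap b a i).star (cap b a i) y₀ := fun y hy => by
    obtain ⟨k, hk⟩ := hcov y hy
    exact loopThrough_eq_of_conn h.star h hk.symm
  have hwy : ∀ y, OnLoop (cap b a i).star (cap b a i) y → ¬ Winds (cap b a i).star (cap b a i) y :=
    fun y hy hwy => by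
      obtain ⟨k, hk⟩ := hcov y hy
      exact hw ((hwy.turn h.star h k).congr h.star h hk)
  -- Every loop is a translate of the one through `y₀`, and translation preserves the parity of the
  -- leftmost point.
  have hcount : ∀ P : ℤ → Prop, (∀ m n : ℤ, (m : ZMod 2) = n → (P m ↔ P n)) → [Decidable (P i)] →
      Set.ncard {L | ∃ y, (OnLoop (cap b a i).star (cap b a i) y ∧
        ¬ Winds (cap b a i).star (cap b a i) y ∧
        ∃ z, IsLeftmost (cap b a i).star (cap b a i) y z ∧ P z.1) ∧
        L = loopThrough (cap b a i).star (cap b a i) y} = if P i then 1 else 0 := by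
    intro P hP _
    refine ncard_single_loop (fun y hy => hL y hy.1) ⟨fun hp => ⟨y₀, hon, hw, y₀, (hleft _).2 rfl, hp⟩, ?_⟩
    rintro ⟨y, hy, -, z, ⟨hz, hz'⟩, hp⟩
    obtain ⟨k, hk⟩ := hcov y hy
    have : IsLeftmost (cap b a i).star (cap b a i) y₀ (z.turn k) := by
      refine ⟨hk.symm.trans ((conn_mid_turn h.star h k).2 hz), fun u hu => ?_⟩
      have e := (conn_mid_turn h.star h (-k)).2 (hk.trans hu)
      rw [Pt.turn_turn, add_neg_cancel, Pt.turn_zero] at e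
      have := hz' _ e
      rw [Pt.turn_val] at this ⊢
      linarith [neg_mul k (b.width : ℤ)]
    have e := congrArg Subtype.val ((hleft _).1 this)
    refine (hP _ _ ?_).1 hp
    rw [← Pt.turn_cast k z, e]
  have n₁ : Set.ncard {L | ∃ y, OnLoop (cap b a i).star (cap b a i) y ∧
      Winds (cap b a i).star (cap b a i) y ∧ L = loopThrough (cap b a i).star (cap b a i) y} = 0 := by
    convert Set.ncard_empty (Set (Pt b))
    exact Set.eq_empty_of_forall_notMem fun L ⟨y, hy, hy', _⟩ => hwy y hy hy'
  have n₂ := hcount Odd odd_congr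
  have n₃ := hcount Even even_congr
  simp only [and_assoc, Int.odd_coe_nat, Int.even_coe_nat] at n₂ n₃
  refine same_of_window t₁ (loopId_isTangle a _ _) (i - a.width) (i - a.width)
    (fun x _ _ => ⟨_, lo x (by omega) (by omega), rfl⟩)
    (fun x _ _ => ⟨_, t₁.symm _ _ (lo x (by omega) (by omega)), rfl⟩) ?_ ?_ ?_
  · exact n₁.symm.trans (Nat.zero_add _).symm
  · exact n₂.symm.trans (Nat.zero_add _).symm
  · exact n₃.symm.trans (Nat.zero_add _).symm

end Diagram
end Annular

/-! ### Rotations, and the relations of `aΔ` in `Atl`. -/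

namespace Annular
namespace Diagram
variable {a b c : AObj}

theorem shift_comp_shift (a : AObj) {s t : ℤ} (hs : Even s) (ht : Even t) :
    ((shift a s).comp (shift a t)).Same (shift a (s + t)) := by
  have t₁ := (shift_isTangle a hs).comp (shift_isTangle a ht)
  have lo : ∀ x z : Pt a, z.1 = x.1 + (s + t) →
      ((shift a s).comp (shift a t)).joined (.inl x) (.inr z) := fun x z h =>
    comp_joined_through (y := ⟨x.1 + s, x.2⟩) rfl (by show _ = _; simp only; omega)
  obtain ⟨c₁, c₂, c₃⟩ := comp_counts_of_no_loop (S := shift a s) (T := shift a t) fun y =>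
    not_onLoop_of_joined' (z := ⟨y.1 + t, y.2⟩) rfl
  refine same_of_joined t₁ (shift_isTangle a (hs.add ht)) ?_ c₁.symm c₂.symm c₃.symm
  rintro (x | z)
  · exact ⟨.inr ⟨x.1 + (s + t), x.2⟩, lo _ _ rfl, rfl⟩
  · exact ⟨.inl ⟨z.1 - (s + t), z.2⟩, t₁.symm _ _ (lo _ _ (by simp)), by simp [shift]⟩

/-- A shift by full turns is an outer twist, which is what makes `t` periodic in `Atl`. -/
theorem shift_add_width (a : AObj) (s k : ℤ) : (shift a s).Same (shift a (s + k * a.width)) := by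
  refine ⟨⟨k, ?_⟩, rfl, rfl, rfl⟩
  rintro (p | p) (q | q)
  · exact Iff.rfl
  · show q.1 + k * a.width = p.1 + (s + k * a.width) ↔ q.1 = p.1 + s
    omega
  · show p.1 + k * a.width = q.1 + (s + k * a.width) ↔ p.1 = q.1 + s
    omega
  · exact Iff.rfl

theorem shift_comp_cap {i i' : ℕ} {s : ℤ} (hab : a.width = b.width + 2) (hs : Even s)
    (hi : (i : ℤ) = i' + s) (h : (cap a b i).IsTangle) (h' : (cap a b i').IsTangle) :
    ((shift a s).comp (cap a b i)).Same ((cap a b i').comp (shift b s)) := by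
  have t₁ := (shift_isTangle a hs).comp h
  have t₂ := h'.comp (shift_isTangle b hs)
  have lo : ∀ (x : Pt a) (z : Pt b), (i' : ℤ) - a.width + 2 ≤ x.1 → x.1 ≤ i' - 1 → z.1 = x.1 + s →
      ((shift a s).comp (cap a b i)).joined (.inl x) (.inr z) ∧
      ((cap a b i').comp (shift b s)).joined (.inl x) (.inr z) := fun x z _ _ e =>
    ⟨comp_joined_through (y := ⟨x.1 + s, x.2⟩) rfl
      (cap_joined_lo (by simp only; omega) (by simp only; omega) e),
    comp_joined_through (y := ⟨x.1, z.2⟩) (cap_joined_lo (by omega) (by omega) rfl) e⟩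
  have hcap : ∀ x x' : Pt a, x.1 = i' → x'.1 = i' + 1 →
      ((shift a s).comp (cap a b i)).joined (.inl x) (.inl x') ∧
      ((cap a b i').comp (shift b s)).joined (.inl x) (.inl x') := fun x x' _ _ =>
    ⟨comp_joined_cap (y := ⟨x.1 + s, x.2⟩) (y' := ⟨x'.1 + s, x.2⟩) (by omega) rfl rfl
      (cap_joined_cap (by simp only; omega) (by simp only; omega)),
    comp_joined_inner h' (cap_joined_cap (by omega) (by omega))⟩
  refine comp_same_of_window t₁ t₂ (fun y => ?_) (fun y => ?_) rfl rfl rfl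
    (i' - a.width + 2) (i - a.width + 2) (fun x _ _ => ?_) (fun z _ _ => ?_)
  · exact not_onLoop_of_joined (x := ⟨y.1 - s, y.2⟩) (by simp [shift])
  · exact not_onLoop_of_joined' (z := ⟨y.1 + s, y.2⟩) rfl
  · by_cases e₁ : x.1 ≤ i' - 1
    · exact ⟨_, lo x ⟨x.1 + s, by omega⟩ (by omega) e₁ rfl⟩
    by_cases e₂ : x.1 = i'
    · exact ⟨_, hcap x ⟨x.1 + 1, x.2⟩ e₂ (by simp only; omega)⟩
    have := hcap ⟨x.1 - 1, x.2⟩ x (by simp only; omega) (by omega)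
    exact ⟨_, t₁.symm _ _ this.1, t₂.symm _ _ this.2⟩
  · have := lo ⟨z.1 - s, by omega⟩ z (by simp only; omega) (by simp only; omega) (by simp)
    exact ⟨_, t₁.symm _ _ this.1, t₂.symm _ _ this.2⟩

theorem star_shift (a : AObj) (s : ℤ) : (shift a s).star = shift a (-s) := by
  unfold star shift
  congr 1
  funext p q
  rcases p with p | p <;> rcases q with q | q <;> simp only [Sum.swap_inl, Sum.swap_inr, eq_iff_iff] <;>
    omega

end Diagram

open Diagram

theorem AGen.isTangle : ∀ {a b : AObj} (e : AGen a b), e.diagram.IsTangle := by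
  have hpos : ∀ n i : ℕ, (cap (.pos (n + 1)) (.pos n) i).IsTangle := fun n i =>
    cap_isTangle rfl (by simp only [AObj.shade]; exact CharTwo.add_self_eq_zero _)
  have hplus : (cap (.pos 0) .zeroPlus 1).IsTangle := cap_isTangle rfl (by simp [AObj.shade])
  have hminus : (cap (.pos 0) .zeroMinus 2).IsTangle := cap_isTangle rfl (by
    simp only [AObj.shade]; rfl)
  intro a b e
  cases e with
  | αPlus => exact hplus
  | αMinus => exact hminus
  | α n i => exact hpos n i
  | βPlus => exact hplus.star
  | βMinus => exact hminus.star
  | β n i => exact (hpos n i).star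
  | τ n => exact rot_isTangle _
  | δPlus a => exact loopId_isTangle a 1 0
  | δMinus a => exact loopId_isTangle a 0 1

/-- The morphism of `Atl` given by a tangle. -/
def atlMk (hA : AtlIsCategory) {a b : AObj} {D : Diagram a b} (h : D.IsTangle) :
    (⟨a⟩ : Atl hA) ⟶ ⟨b⟩ := Quotient.mk (tangleSetoid a b) ⟨D, h⟩

section Functor
variable {hA : AtlIsCategory} {a b c : AObj}

theorem atlMk_eq {D D' : Diagram a b} (h : D.IsTangle) (h' : D'.IsTangle) (e : D.Same D') :
    atlMk hA h = atlMk hA h' := Quotient.sound (s := tangleSetoid a b) e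

theorem same_of_atlMk_eq {D D' : Diagram a b} {h : D.IsTangle} {h' : D'.IsTangle}
    (e : atlMk hA h = atlMk hA h') : D.Same D' := Quotient.exact (s := tangleSetoid a b) e

theorem atlMk_comp {D : Diagram a b} {E : Diagram b c} (h : D.IsTangle) (h' : E.IsTangle) :
    atlMk hA h ≫ atlMk hA h' = atlMk hA (h.comp h') := rfl

theorem iter_rot (n k : ℕ) : iter (atlMk hA (rot_isTangle (.pos n))) k =
    atlMk hA (shift_isTangle (.pos n) (s := 2 * k) (even_two_mul _)) := by
  induction k with
  | zero => exact atlMk_eq _ _ (by rw [id_eq_shift]; exact .refl _)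
  | succ k ih =>
    show iter _ k ≫ _ = _
    rw [ih, atlMk_comp]
    refine atlMk_eq _ _ ?_
    rw [rot_eq_shift]
    have := shift_comp_shift (.pos n) (s := 2 * k) (t := 2) (even_two_mul _) even_two
    rwa [show (2 * k + 2 : ℤ) = 2 * (k + 1 : ℕ) by push_cast; ring] at this

theorem iter_map {C D : Type} [Category.{0} C] [Category.{0} D] (F : C ⥤ D) {X : C} (f : X ⟶ X)
    (k : ℕ) : F.map (iter f k) = iter (F.map f) k := by
  induction k with
  | zero => exact F.map_id X
  | succ k ih =>
    show F.map (iter f k ≫ f) = iter (F.map f) k ≫ F.map f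
    rw [F.map_comp, ih]

theorem lift_aw (hg : ∀ (a b : AObj) (e : AGen a b), e.diagram.IsTangle) (e : AGen a b) :
    (Paths.lift (FGen hA hg)).map (aw e) = atlMk hA (hg _ _ e) :=
  Paths.lift_toPath (FGen hA hg) e

theorem lift_comp_eq (hg : ∀ (a b : AObj) (e : AGen a b), e.diagram.IsTangle) {b' : AObj}
    {e : AGen a b} {e' : AGen b c} {f : AGen a b'} {f' : AGen b' c}
    (h : (e.diagram.comp e'.diagram).Same (f.diagram.comp f'.diagram)) :
    (Paths.lift (FGen hA hg)).map (aw e ≫ aw e') = (Paths.lift (FGen hA hg)).map (aw f ≫ aw f') := by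
  rw [Functor.map_comp, Functor.map_comp, lift_aw, lift_aw, lift_aw, lift_aw]
  exact atlMk_eq ((hg _ _ e).comp (hg _ _ e')) ((hg _ _ f).comp (hg _ _ f')) h

theorem lift_comp_eq_single (hg : ∀ (a b : AObj) (e : AGen a b), e.diagram.IsTangle)
    {e : AGen a b} {e' : AGen b c} {f : AGen a c} (h : (e.diagram.comp e'.diagram).Same f.diagram) :
    (Paths.lift (FGen hA hg)).map (aw e ≫ aw e') = (Paths.lift (FGen hA hg)).map (aw f) := by
  rw [Functor.map_comp, lift_aw, lift_aw, lift_aw]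
  exact atlMk_eq ((hg _ _ e).comp (hg _ _ e')) (hg _ _ f) h

theorem lift_comp_eq_id (hg : ∀ (a b : AObj) (e : AGen a b), e.diagram.IsTangle)
    {e : AGen a b} {e' : AGen b a} (h : (e.diagram.comp e'.diagram).Same (Diagram.id a)) :
    (Paths.lift (FGen hA hg)).map (aw e ≫ aw e') =
      (Paths.lift (FGen hA hg)).map (𝟙 ((Paths.of AObj).obj a)) := by
  rw [CategoryTheory.Functor.map_id, Functor.map_comp, lift_aw, lift_aw]
  exact atlMk_eq ((hg _ _ e).comp (hg _ _ e')) (id_isTangle a) h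

/-- Each relation is one of the comparisons of composites above or the reflection of one: `β_β`
reflects `α_α`, `β_τ` reflects `α_τ`, `α_β_gt` reflects `α_β_lt`, `α_β_pred` reflects `α_β_succ`,
and `α_β_last_first` reflects `α_β_first_last`. -/
theorem lift_eq_of_aRel (hg : ∀ (a b : AObj) (e : AGen a b), e.diagram.IsTangle)
    (X Y : Paths AObj) (f g : X ⟶ Y) (h : ARel f g) :
    (Paths.lift (FGen hA hg)).map f = (Paths.lift (FGen hA hg)).map g := by
  have hpos : ∀ n i : ℕ, 1 ≤ i → i ≤ 2 * n + 4 → (cap (.pos (n + 1)) (.pos n) i).IsTangle :=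
    fun n i h h' => hg _ _ (.α n i h h')
  have hplus : (cap (.pos 0) .zeroPlus 1).IsTangle := hg _ _ .αPlus
  have hminus : (cap (.pos 0) .zeroMinus 2).IsTangle := hg _ _ .αMinus
  have w : ∀ n, (AObj.pos n).width = 2 * (n + 1) := fun n => rfl
  have lf : ∀ n : ℕ, (((cap (.pos (n + 1)) (.pos n) (2 * n + 4)).star.comp
      (cap (.pos (n + 1)) (.pos n) 1))).Same (shift (.pos n) (-2)) := fun n =>
    cup_comp_cap_last_first (b := .pos (n + 1)) rfl (Nat.mul_pos two_pos n.succ_pos)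
      (hpos n (2 * n + 4) (by omega) le_rfl) (hpos n 1 (by omega) (by omega))
  cases h with
  | α_α n i j hi hij hj hne =>
    exact lift_comp_eq hg (cap_comp_cap rfl rfl hi hij hj (by
        rintro ⟨rfl, h⟩
        exact hne (by rw [h, w]; congr 1)) (hpos _ j (by omega) (by omega))
      (hpos _ _ hi (by omega)) (hpos _ _ hi (by omega)) (hpos _ (j - 2) (by omega) (by omega)))
  | α_α_plus =>
    exact lift_comp_eq hg (cap_comp_cap (i := 1) (j := 3) rfl rfl le_rfl (by omega) (by rw [w]; omega)
      (by rw [w]; omega) (hpos _ _ (by omega) (by omega)) hplus (hpos _ _ (by omega) (by omega)) hplus)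
  | α_α_minus =>
    exact lift_comp_eq hg (cap_comp_cap (i := 2) (j := 4) rfl rfl (by omega) (by omega)
      (by rw [w]) (by omega) (hpos _ _ (by omega) (by omega)) hminus
      (hpos _ _ (by omega) (by omega)) hminus)
  | β_β n i j hi hij hj hne =>
    have := (cap_comp_cap (a := .pos (n + 2)) (b := .pos (n + 1)) (c := .pos n) (i := i) (j := j + 2)
      rfl rfl hi (by omega) (by rw [w]; omega) (by
        rintro ⟨rfl, h⟩
        rw [w] at h
        exact hne (by congr 1; omega)) (hpos _ _ (by omega) (by omega)) (hpos _ _ hi (by omega))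
      (hpos _ _ hi (by omega)) (hpos _ _ (by omega) (by omega))).symm.star
        ((hpos _ _ (by omega) (by omega)).comp (hpos _ _ hi (by omega)))
    rw [star_comp, star_comp] at this
    exact lift_comp_eq hg this
  | β_β_plus =>
    have := (cap_comp_cap (a := .pos 1) (b := .pos 0) (c := .zeroPlus) (i := 1) (j := 3)
      rfl rfl le_rfl (by omega) (by rw [w]; omega) (by rw [w]; omega)
      (hpos _ _ (by omega) (by omega)) hplus (hpos _ _ (by omega) (by omega)) hplus).symm.star
        ((hpos _ _ (by omega) (by omega)).comp hplus)
    rw [star_comp, star_comp] at this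
    exact lift_comp_eq hg this
  | β_β_minus =>
    have := (cap_comp_cap (a := .pos 1) (b := .pos 0) (c := .zeroMinus) (i := 2) (j := 4)
      rfl rfl (by omega) (by omega) (by rw [w]) (by omega)
      (hpos _ _ (by omega) (by omega)) hminus (hpos _ _ (by omega) (by omega)) hminus).symm.star
        ((hpos _ _ (by omega) (by omega)).comp hminus)
    rw [star_comp, star_comp] at this
    exact lift_comp_eq hg this
  | τ_pow n =>
    rw [iter_map, lift_aw]
    refine (iter_rot n (n + 1)).trans (Eq.trans ?_
      ((Paths.lift (FGen hA hg)).map_id ((Paths.of AObj).obj (.pos n))).symm)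
    refine atlMk_eq _ (id_isTangle _) ?_
    rw [id_eq_shift]
    refine (shift_add_width (.pos n) _ (-1)).trans ?_
    rw [w, show (2 * ((n + 1 : ℕ) : ℤ) + -1 * ((2 * (n + 1) : ℕ) : ℤ)) = 0 by push_cast; ring]
    exact .refl _
  | α_τ n i hi hi' =>
    refine lift_comp_eq hg ?_
    have := shift_comp_cap (a := .pos (n + 1)) (b := .pos n) (i := i) (i' := i - 2) (s := 2) rfl
      even_two (by omega) (hpos _ _ (by omega) hi') (hpos _ _ (by omega) (by omega))
    rw [← rot_eq_shift, ← rot_eq_shift] at this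
    exact this
  | β_τ n i hi hi' =>
    refine lift_comp_eq hg ?_
    have h₁ := hpos n i (by omega) hi'
    have h₂ := hpos n (i - 2) (by omega) (by omega)
    have := (shift_comp_cap (a := .pos (n + 1)) (b := .pos n) (i := i - 2) (i' := i) (s := -2) rfl
      (by decide) (by omega) h₂ h₁).symm.star ((shift_isTangle _ (by decide)).comp h₂)
    rw [star_comp, star_comp, star_shift, star_shift, neg_neg, ← rot_eq_shift, ← rot_eq_shift] at this
    exact this
  | α_β_zeroPlus =>
    exact lift_comp_eq_single hg (cup_comp_cap_self (i := 1) rfl hplus)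
  | α_β_zeroMinus =>
    exact lift_comp_eq_single hg (cup_comp_cap_self (i := 2) rfl hminus)
  | α_β_first_last n =>
    have h₁ := hpos n (2 * n + 4) (by omega) (by omega)
    have h₂ := hpos n 1 (by omega) (by omega)
    have e : atlMk hA h₁.star ≫ atlMk hA h₂ = atlMk hA (shift_isTangle _ (s := -2) (by decide)) :=
      atlMk_eq _ _ (lf n)
    rw [← Category.assoc, CategoryTheory.Functor.map_id, Functor.map_comp, Functor.map_comp,
      lift_aw, lift_aw, lift_aw]
    refine (congrArg (fun f => f ≫ atlMk hA (rot_isTangle _)) e).trans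
      (atlMk_eq ((shift_isTangle _ (s := -2) (by decide)).comp (rot_isTangle _)) (id_isTangle _) ?_)
    rw [rot_eq_shift, id_eq_shift]
    exact shift_comp_shift _ (by decide) (by decide)
  | α_β_lt n i j hi hij hj hne =>
    exact lift_comp_eq hg (cup_comp_cap_lt rfl rfl hi hij hj (by
        rintro ⟨rfl, h⟩
        exact hne (by rw [h, w]; congr 1)) (hpos _ j (by omega) (by omega))
      (hpos _ _ hi (by omega)) (hpos _ _ hi (by omega)) (hpos _ (j - 2) (by omega) (by omega)))
  | α_β_lt_plus =>
    exact lift_comp_eq hg (cup_comp_cap_lt (i := 1) (j := 3) rfl rfl le_rfl (by omega)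
      (by rw [w]; omega) (by rw [w]; omega) (hpos _ _ (by omega) (by omega))
      (hpos _ _ (by omega) (by omega)) hplus hplus)
  | α_β_lt_minus =>
    exact lift_comp_eq hg (cup_comp_cap_lt (i := 2) (j := 4) rfl rfl (by omega) (by omega)
      (by rw [w]) (by omega) (hpos _ _ (by omega) (by omega))
      (hpos _ _ (by omega) (by omega)) hminus hminus)
  | α_β_succ n i hi hi' =>
    exact lift_comp_eq_id hg (cup_comp_cap_succ (a := .pos n) (b := .pos (n + 1)) rfl (Nat.mul_pos two_pos n.succ_pos)
      (hpos _ _ (by omega) hi') (hpos _ _ hi (by omega)))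
  | α_β_odd n i hi hi' ho =>
    refine lift_comp_eq_single hg ((cup_comp_cap_self (i := i) rfl (hpos _ _ hi hi')).trans ?_)
    rw [if_pos ho, if_neg (Nat.not_even_iff_odd.2 ho)]
    exact .refl _
  | α_β_even n i hi hi' he =>
    refine lift_comp_eq_single hg ((cup_comp_cap_self (i := i) rfl (hpos _ _ hi hi')).trans ?_)
    rw [if_pos he, if_neg (Nat.not_odd_iff_even.2 he)]
    exact .refl _
  | α_β_pred n j hj hj' =>
    have h₁ := hpos n j hj (by omega)
    have h₂ := hpos n (j + 1) (by omega) hj'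
    have := (cup_comp_cap_succ (a := .pos n) (b := .pos (n + 1)) rfl (Nat.mul_pos two_pos n.succ_pos) h₂ h₁).star (id_isTangle _)
    rw [star_comp, Diagram.star_star, id_eq_shift, star_shift, neg_zero, ← id_eq_shift] at this
    exact lift_comp_eq_id hg this
  | α_β_gt n i j hj hij hi hne =>
    have h₁ := hpos (n + 1) i (by omega) (by omega)
    have h₂ := hpos (n + 1) j hj (by omega)
    have h₃ := hpos n j hj (by omega)
    have h₄ := hpos n (i - 2) (by omega) (by omega)
    have := (cup_comp_cap_lt (b := .pos (n + 2)) (a := .pos (n + 1)) (c := .pos n) (i := j) (j := i)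
      rfl rfl hj hij hi (by
        rintro ⟨rfl, h⟩
        exact hne (by rw [h, w]; congr 1)) h₁ h₂ h₃ h₄).star (h₃.comp h₄.star)
    rw [star_comp, star_comp, Diagram.star_star, Diagram.star_star] at this
    exact lift_comp_eq hg this
  | α_β_gt_plus =>
    have := (cup_comp_cap_lt (i := 1) (j := 3) rfl rfl le_rfl (by omega)
      (by rw [w]; omega) (by rw [w]; omega) (hpos _ _ (by omega) (by omega))
      (hpos _ _ (by omega) (by omega)) hplus hplus).star (hplus.comp hplus.star)
    rw [star_comp, star_comp, Diagram.star_star, Diagram.star_star] at this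
    exact lift_comp_eq hg this
  | α_β_gt_minus =>
    have := (cup_comp_cap_lt (i := 2) (j := 4) rfl rfl (by omega) (by omega)
      (by rw [w]) (by omega) (hpos _ _ (by omega) (by omega))
      (hpos _ _ (by omega) (by omega)) hminus hminus).star (hminus.comp hminus.star)
    rw [star_comp, star_comp, Diagram.star_star, Diagram.star_star] at this
    exact lift_comp_eq hg this
  | α_β_last_first n =>
    have := (lf n).star (shift_isTangle _ (by decide))
    rw [star_comp, Diagram.star_star, star_shift, neg_neg, ← rot_eq_shift] at this
    exact lift_comp_eq_single hg this
  | δPlus_comm e =>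
    exact lift_comp_eq hg (loopId_comp_same (hg _ _ e) 1 0)
  | δMinus_comm e =>
    exact lift_comp_eq hg (loopId_comp_same (hg _ _ e) 0 1)

end Functor
end Annular


/-! ### The functors `H^±` and `F`. -/

namespace Annular

/-- Functors out of a category given by generators and relations. -/
theorem eq_lift_iff {V C : Type} [Quiver.{0} V] [Category.{0} C] (r : HomRel (Paths V)) (φ : V ⥤q C)
    (h : ∀ (X Y : Paths V) (f g : X ⟶ Y), r f g → (Paths.lift φ).map f = (Paths.lift φ).map g)
    (F' : CategoryTheory.Quotient r ⥤ C) :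
    (Paths.of V ⋙q (CategoryTheory.Quotient.functor r).toPrefunctor) ⋙q F'.toPrefunctor = φ ↔
      F' = CategoryTheory.Quotient.lift r (Paths.lift φ) h := by
  constructor
  · intro e
    exact CategoryTheory.Quotient.lift_unique r _ _ F' (Paths.lift_unique φ (CategoryTheory.Quotient.functor r ⋙ F') e)
  · rintro rfl
    exact Paths.lift_spec φ

section HFunctor
variable {ε : Sgn}

theorem lift_cw {m n : ℕ} (e : CGen m n) : (Paths.lift (HGen ε)).map (cw e) =
    (CategoryTheory.Quotient.functor ARel).map (aw (e.toAGen ε)) :=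
  Paths.lift_toPath (V := CObj) (X := ⟨m⟩) (Y := ⟨n⟩) (HGen ε) e

theorem lift_cw_eq {m n k l : ℕ} {e : CGen m n} {e' : CGen n k} {f : CGen m l} {f' : CGen l k}
    (h : ARel (aw (e.toAGen ε) ≫ aw (e'.toAGen ε)) (aw (f.toAGen ε) ≫ aw (f'.toAGen ε))) :
    (Paths.lift (HGen ε)).map (cw e ≫ cw e') = (Paths.lift (HGen ε)).map (cw f ≫ cw f') := by
  rw [Functor.map_comp, Functor.map_comp, lift_cw, lift_cw, lift_cw, lift_cw]
  exact CategoryTheory.Quotient.sound ARel h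

theorem lift_cw_eq_id {m n : ℕ} {e : CGen m n} {e' : CGen n m}
    (h : ARel (aw (e.toAGen ε) ≫ aw (e'.toAGen ε)) (𝟙 _)) :
    (Paths.lift (HGen ε)).map (cw e ≫ cw e') = (Paths.lift (HGen ε)).map (𝟙 _) := by
  rw [Functor.map_comp, CategoryTheory.Functor.map_id, lift_cw, lift_cw]
  exact CategoryTheory.Quotient.sound ARel h

theorem α_congr {n i i' : ℕ} (h : i = i') (h₁ : 1 ≤ i) (h₂ : i ≤ 2 * n + 4) :
    AGen.α n i h₁ h₂ = AGen.α n i' (h ▸ h₁) (h ▸ h₂) := by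
  subst h
  rfl

theorem β_congr {n i i' : ℕ} (h : i = i') (h₁ : 1 ≤ i) (h₂ : i ≤ 2 * n + 4) :
    AGen.β n i h₁ h₂ = AGen.β n i' (h ▸ h₁) (h ▸ h₂) := by
  subst h
  rfl

theorem Sgn.offset_le (ε : Sgn) : ε.offset ≤ 1 := by
  cases ε <;> simp [Sgn.offset]

/-- The substitutions `2 * i + 1 + ε.offset` for `d_i` and `2 * i + 2 + ε.offset` for `s_i` turn
each relation into one of `aΔ`; the excluded pairs of indices do not occur, by parity and range. -/
theorem lift_eq_of_cRel (X Y : Paths CObj) (f g : X ⟶ Y) (h : CRel f g) :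
    (Paths.lift (HGen ε)).map f = (Paths.lift (HGen ε)).map g := by
  have ho := ε.offset_le
  cases h with
  | d_d n i j hij hj =>
    refine lift_cw_eq ?_
    simp only [CGen.toAGen]
    rw [α_congr (show 2 * (j - 1) + 1 + ε.offset = 2 * j + 1 + ε.offset - 2 by omega)]
    exact .α_α n (2 * i + 1 + ε.offset) (2 * j + 1 + ε.offset) (by omega) (by omega) (by omega)
      (by rw [ne_eq, Prod.mk.injEq]; omega)
  | s_s n i j hij hj =>
    refine lift_cw_eq ?_
    simp only [CGen.toAGen]
    rw [β_congr (show 2 * (j + 1) + 2 + ε.offset = 2 * j + 2 + ε.offset + 2 by omega)]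
    exact .β_β n (2 * i + 2 + ε.offset) (2 * j + 2 + ε.offset) (by omega) (by omega) (by omega)
      (by rw [ne_eq, Prod.mk.injEq]; omega)
  | d_s_lt n i j hij hj =>
    refine lift_cw_eq ?_
    simp only [CGen.toAGen]
    rw [β_congr (show 2 * (j - 1) + 2 + ε.offset = 2 * j + 2 + ε.offset - 2 by omega)]
    exact .α_β_lt n (2 * i + 1 + ε.offset) (2 * j + 2 + ε.offset) (by omega) (by omega) (by omega)
      (by rw [ne_eq, Prod.mk.injEq]; omega)
  | d_s_eq n i hi =>
    refine lift_cw_eq_id ?_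
    simp only [CGen.toAGen]
    rw [β_congr (show 2 * i + 2 + ε.offset = 2 * i + 1 + ε.offset + 1 by omega)]
    exact .α_β_succ n (2 * i + 1 + ε.offset) (by omega) (by omega)
  | d_s_succ n j hj =>
    refine lift_cw_eq_id ?_
    simp only [CGen.toAGen]
    rw [α_congr (show 2 * (j + 1) + 1 + ε.offset = 2 * j + 2 + ε.offset + 1 by omega)]
    exact .α_β_pred n (2 * j + 2 + ε.offset) (by omega) (by omega)
  | d_s_gt n i j hij hi =>
    refine lift_cw_eq ?_
    simp only [CGen.toAGen]
    rw [α_congr (show 2 * (i - 1) + 1 + ε.offset = 2 * i + 1 + ε.offset - 2 by omega)]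
    exact .α_β_gt n (2 * i + 1 + ε.offset) (2 * j + 2 + ε.offset) (by omega) (by omega) (by omega)
      (by rw [ne_eq, Prod.mk.injEq]; omega)
  | t_pow n =>
    rw [iter_map, lift_cw, CategoryTheory.Functor.map_id]
    refine (iter_map (CategoryTheory.Quotient.functor ARel) (aw (.τ n)) (n + 1)).symm.trans ?_
    exact CategoryTheory.Quotient.sound ARel (.τ_pow n)
  | d_t n i hi hi' =>
    refine lift_cw_eq ?_
    simp only [CGen.toAGen]
    rw [α_congr (show 2 * (i - 1) + 1 + ε.offset = 2 * i + 1 + ε.offset - 2 by omega)]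
    exact .α_τ n (2 * i + 1 + ε.offset) (by omega) (by omega)
  | s_t n i hi hi' =>
    refine lift_cw_eq ?_
    simp only [CGen.toAGen]
    rw [β_congr (show 2 * (i - 1) + 2 + ε.offset = 2 * i + 2 + ε.offset - 2 by omega)]
    exact .β_τ n (2 * i + 2 + ε.offset) (by omega) (by omega)

/-- The functor `H^±`. -/
def functorH (ε : Sgn) : CDeltaOp ⥤ ADelta :=
  CategoryTheory.Quotient.lift CRel (Paths.lift (HGen ε)) (lift_eq_of_cRel)

theorem functorH_obj_injective (ε : Sgn) : Function.Injective (functorH ε).obj := by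
  rintro ⟨⟨m⟩⟩ ⟨⟨n⟩⟩ h
  have h : AObj.pos m = AObj.pos n := congrArg (fun X : ADelta => (X.as : AObj)) h
  rw [AObj.pos.inj h]

/-- The functor `F`. -/
noncomputable def functorF (hA : AtlIsCategory) (hg : ∀ (a b : AObj) (e : AGen a b), e.diagram.IsTangle) :
    ADelta ⥤ Atl hA :=
  CategoryTheory.Quotient.lift ARel (Paths.lift (FGen hA hg)) (lift_eq_of_aRel hg)

end HFunctor
end Annular

/-! ### Consequences of the relations of `cΔᵒᵖ`. -/

namespace Annular

section Iter
variable {C : Type} [Category.{0} C] {X : C}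

theorem iter_add (f : X ⟶ X) (k l : ℕ) : iter f (k + l) = iter f k ≫ iter f l := by
  induction l with
  | zero => exact (Category.comp_id _).symm
  | succ l ih =>
    show iter f (k + l) ≫ f = iter f k ≫ iter f l ≫ f
    rw [ih, Category.assoc]

theorem iter_one (f : X ⟶ X) : iter f 1 = f := Category.id_comp f

theorem iter_mul {f : X ⟶ X} {n : ℕ} (h : iter f n = 𝟙 X) (k : ℕ) : iter f (n * k) = 𝟙 X := by
  induction k with
  | zero => rfl
  | succ k ih => rw [Nat.mul_succ, iter_add, ih, h, Category.comp_id]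

theorem iter_congr {f : X ⟶ X} {n : ℕ} (h : iter f n = 𝟙 X) {k l : ℕ} (e : k ≡ l [MOD n]) :
    iter f k = iter f l := by
  rw [← Nat.mod_add_div k n, ← Nat.mod_add_div l n, iter_add, iter_add, iter_mul h, iter_mul h, e]

end Iter

/-- The objects of `cΔᵒᵖ`. -/
abbrev cX (n : ℕ) : CDeltaOp := CDeltaOp.gens.obj ⟨n⟩

/-- The generators as morphisms of `cΔᵒᵖ`. -/
def cm {m n : ℕ} (e : CGen m n) : cX m ⟶ cX n := (CategoryTheory.Quotient.functor CRel).map (cw e)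

/-- The morphism `d_i`. -/
abbrev cd (n i : ℕ) (h : i ≤ n + 1) : cX (n + 1) ⟶ cX n := cm (.d n i h)

/-- The morphism `s_i`. -/
abbrev cs (n i : ℕ) (h : i ≤ n) : cX n ⟶ cX (n + 1) := cm (.s n i h)

/-- The powers of `t`. -/
abbrev ct (n k : ℕ) : cX n ⟶ cX n := iter (cm (.t n)) k

section Relations

theorem cm_eq {m n k l : ℕ} {e : CGen m n} {e' : CGen n k} {f : CGen m l} {f' : CGen l k}
    (h : CRel (cw e ≫ cw e') (cw f ≫ cw f')) : cm e ≫ cm e' = cm f ≫ cm f' := by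
  have := CategoryTheory.Quotient.sound CRel h
  rwa [Functor.map_comp, Functor.map_comp] at this

theorem cm_eq_id {m n : ℕ} {e : CGen m n} {e' : CGen n m} (h : CRel (cw e ≫ cw e') (𝟙 _)) :
    cm e ≫ cm e' = 𝟙 _ := by
  have := CategoryTheory.Quotient.sound CRel h
  rwa [Functor.map_comp, CategoryTheory.Functor.map_id] at this

theorem cd_cd {n i j : ℕ} (hij : i < j) (hj : j ≤ n + 2) : cd (n + 1) j hj ≫ cd n i (by omega) =
    cd (n + 1) i (by omega) ≫ cd n (j - 1) (by omega) := cm_eq (.d_d n i j hij hj)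

theorem cs_cs {n i j : ℕ} (hij : i ≤ j) (hj : j ≤ n) : cs n j hj ≫ cs (n + 1) i (by omega) =
    cs n i (by omega) ≫ cs (n + 1) (j + 1) (by omega) := cm_eq (.s_s n i j hij hj)

theorem ct_period (n : ℕ) : ct n (n + 1) = 𝟙 _ := by
  have := CategoryTheory.Quotient.sound CRel (.t_pow n)
  rwa [iter_map, CategoryTheory.Functor.map_id] at this

theorem ct_congr {n k l : ℕ} (h : k ≡ l [MOD n + 1]) : ct n k = ct n l :=
  iter_congr (ct_period n) h

theorem ct_ct (n k l : ℕ) : ct n k ≫ ct n l = ct n (k + l) := (iter_add _ k l).symm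

theorem ct_cd {n : ℕ} (k i : ℕ) (h : k + i ≤ n + 1) :
    ct (n + 1) k ≫ cd n (k + i) h = cd n i (by omega) ≫ ct n k := by
  induction k with
  | zero =>
    have : ∀ (j : ℕ) (hj : j = i) (h : j ≤ n + 1), cd n j h = cd n i (hj ▸ h) := by
      rintro _ rfl _
      rfl
    rw [this _ (Nat.zero_add i)]
    exact (Category.id_comp _).trans (Category.comp_id _).symm
  | succ k ih =>
    have e : cm (.t (n + 1)) ≫ cd n (k + 1 + i) h = cd n (k + 1 + i - 1) (by omega) ≫ cm (.t n) :=
      cm_eq (.d_t n (k + 1 + i) (by omega) h)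
    have : ∀ (j : ℕ) (hj : j = k + i) (h : j ≤ n + 1), cd n j h = cd n (k + i) (hj ▸ h) := by
      rintro _ rfl _
      rfl
    show (ct (n + 1) k ≫ cm (.t (n + 1))) ≫ cd n _ h = cd n i _ ≫ ct n k ≫ cm _
    rw [Category.assoc, e, this (k + 1 + i - 1) (by omega), ← Category.assoc, ih, Category.assoc]

theorem ct_cs {n : ℕ} (k i : ℕ) (h : k + i ≤ n) :
    ct n k ≫ cs n (k + i) h = cs n i (by omega) ≫ ct (n + 1) k := by
  induction k with
  | zero =>
    have : ∀ (j : ℕ) (hj : j = i) (h : j ≤ n), cs n j h = cs n i (hj ▸ h) := by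
      rintro _ rfl _
      rfl
    rw [this _ (Nat.zero_add i)]
    exact (Category.id_comp _).trans (Category.comp_id _).symm
  | succ k ih =>
    have e : cm (.t n) ≫ cs n (k + 1 + i) h = cs n (k + 1 + i - 1) (by omega) ≫ cm (.t (n + 1)) :=
      cm_eq (.s_t n (k + 1 + i) (by omega) h)
    have : ∀ (j : ℕ) (hj : j = k + i) (h : j ≤ n), cs n j h = cs n (k + i) (hj ▸ h) := by
      rintro _ rfl _
      rfl
    show (ct n k ≫ cm (.t n)) ≫ cs n _ h = cs n i _ ≫ ct (n + 1) k ≫ cm _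
    rw [Category.assoc, e, this (k + 1 + i - 1) (by omega), ← Category.assoc, ih, Category.assoc]

/-- The case `i = 0`, which the relations leave out. It follows from the different periods of `t`:
`n + 2` on the source of `d_0` and `n + 1` on its target. -/
theorem ct_cd_zero (n : ℕ) : cm (.t (n + 1)) ≫ cd n 0 (Nat.zero_le _) = cd n (n + 1) le_rfl := by
  refine (congrArg (· ≫ _) (iter_one (cm (.t (n + 1))))).symm.trans ?_
  have e := ct_cd (n := n) (n + 1) 0 le_rfl
  rw [ct_period, Category.comp_id] at e
  rw [← e, ← Category.assoc, ct_ct, show 1 + (n + 1) = n + 1 + 1 by omega, ct_period,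
    Category.id_comp]

/-- `s_k` is conjugate to `s_0`. -/
theorem cs_eq {n : ℕ} (k : ℕ) (h : k ≤ n) :
    cs n k h = ct n (n + 1 - k) ≫ cs n 0 (Nat.zero_le _) ≫ ct (n + 1) k := by
  have e := ct_cs (n := n) k 0 h
  rw [← e, ← Category.assoc, ct_ct, Nat.sub_add_cancel (by omega), ct_period, Category.id_comp]
  rfl

/-- Two cups can be created in either order: the one created first on the left side is created last
on the right side. -/
theorem exists_cs_ct_cs {n : ℕ} (b : ℕ) (hb : b ≤ n + 1) : ∃ w : cX n ⟶ cX (n + 1),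
    cs n 0 (Nat.zero_le _) ≫ ct (n + 1) b ≫ cs (n + 1) 0 (Nat.zero_le _) =
      w ≫ cs (n + 1) 0 (Nat.zero_le _) ≫ ct (n + 2) (b + 1) := by
  rcases Nat.eq_zero_or_pos b with rfl | hb'
  · refine ⟨cs n 0 (Nat.zero_le _) ≫ ct (n + 1) (n + 1), ?_⟩
    have e := cs_cs (n := n) (le_refl 0) (Nat.zero_le _)
    rw [show ct (n + 1) 0 = 𝟙 _ from rfl, Category.id_comp, e, cs_eq (n := n + 1) (0 + 1),
      Category.assoc]
    rfl
  -- The index `a` is chosen such that `s_{a+1}`, conjugated to `s_0`, starts with exactly the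
  -- rotation `t ^ b`.
  · obtain ⟨a, ha⟩ : ∃ a, a + b = n + 1 + 1 := ⟨n + 1 + 1 - b, by omega⟩
    obtain ⟨a, rfl⟩ : ∃ a', a = a' + 1 := ⟨a - 1, by omega⟩
    refine ⟨cs n a (by omega), ?_⟩
    have e := cs_cs (n := n) (Nat.zero_le a) (by omega)
    rw [← Category.assoc (cs n a _), e, Category.assoc, cs_eq (n := n + 1) (a + 1) (by omega),
      Category.assoc, Category.assoc, ct_ct, show n + 1 + 1 - (a + 1) = b by omega,
      show a + 1 + (b + 1) = n + 1 + 1 + 1 by omega, ct_period, Category.comp_id]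

theorem exists_section (n i : ℕ) (h : i ≤ n + 1) : ∃ s : cX n ⟶ cX (n + 1), s ≫ cd n i h = 𝟙 _ := by
  by_cases hi : i ≤ n
  · exact ⟨cs n i hi, cm_eq_id (.d_s_eq n i hi)⟩
  · obtain rfl : i = n + 1 := by omega
    exact ⟨cs n n le_rfl, cm_eq_id (.d_s_succ n n le_rfl)⟩

/-- The exponents `j` and `(n + 1) * j` add up to a multiple of the period `n + 2`, after which
`d_0` undoes `s_0`. -/
theorem exists_retraction (n j : ℕ) : ∃ p : cX (n + 1) ⟶ cX n,
    (cs n 0 (Nat.zero_le _) ≫ ct (n + 1) j) ≫ p = 𝟙 _ := by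
  refine ⟨ct (n + 1) ((n + 1) * j) ≫ cd n 0 (Nat.zero_le _), ?_⟩
  rw [Category.assoc, ← Category.assoc (ct _ _), ct_ct,
    ct_congr (show j + (n + 1) * j ≡ 0 [MOD n + 1 + 1] from ?_)]
  · exact (congrArg _ (Category.id_comp _)).trans (cm_eq_id (.d_s_eq n 0 (Nat.zero_le _)))
  · rw [show j + (n + 1) * j = (n + 1 + 1) * j by ring]
    exact (Nat.modEq_zero_iff_dvd.2 (dvd_mul_right _ _))

end Relations

/-! ### Normal forms -/

/-- Composites of generators `s_i` and `t`. -/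
inductive IsST : ∀ {m n : ℕ}, (cX m ⟶ cX n) → Prop
  | id (m : ℕ) : IsST (𝟙 (cX m))
  | s {m n : ℕ} {u : cX m ⟶ cX n} (h : IsST u) (i : ℕ) (hi : i ≤ n) : IsST (u ≫ cs n i hi)
  | t {m n : ℕ} {u : cX m ⟶ cX n} (h : IsST u) : IsST (u ≫ cm (.t n))

/-- Composites of generators `d_i`, followed by a composite of generators `s_i` and `t`. -/
inductive IsDST : ∀ {m n : ℕ}, (cX m ⟶ cX n) → Prop
  | st {m n : ℕ} {u : cX m ⟶ cX n} (h : IsST u) : IsDST u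
  | d {m n : ℕ} {u : cX m ⟶ cX n} (h : IsDST u) (i : ℕ) (hi : i ≤ m + 1) : IsDST (cd m i hi ≫ u)

/-- The morphism factors through `d_i`. -/
inductive StartsD : ∀ {m n : ℕ}, (cX m ⟶ cX n) → ℕ → Prop
  | mk {m n : ℕ} (i : ℕ) (hi : i ≤ m + 1) (u : cX m ⟶ cX n) : StartsD (cd m i hi ≫ u) i

/-- The morphism factors through `s_0 ≫ t ^ j`. -/
inductive EndsS : ∀ {m n : ℕ}, (cX m ⟶ cX n) → ℕ → Prop
  | mk {m n : ℕ} (j : ℕ) (u : cX m ⟶ cX n) :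
      EndsS (u ≫ cs n 0 (Nat.zero_le _) ≫ ct (n + 1) j) j

/-- Powers of `t`. -/
inductive IsRot : ∀ {m n : ℕ}, (cX m ⟶ cX n) → Prop
  | mk (m k : ℕ) : IsRot (ct m k)

theorem EndsS.eq {m n j : ℕ} {u : cX m ⟶ cX (n + 1)} (h : EndsS u j) :
    ∃ w : cX m ⟶ cX n, u = w ≫ cs n 0 (Nat.zero_le _) ≫ ct (n + 1) j := by
  cases h with
  | mk _ w => exact ⟨w, rfl⟩

theorem StartsD.eq {m n i : ℕ} {u : cX (m + 1) ⟶ cX n} (h : StartsD u i) :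
    ∃ (hi : i ≤ m + 1) (w : cX m ⟶ cX n), u = cd m i hi ≫ w := by
  cases h with
  | mk _ hi w => exact ⟨hi, w, rfl⟩

theorem IsST.isRot_or_endsS {m n : ℕ} {u : cX m ⟶ cX n} (h : IsST u) :
    IsRot u ∨ ∃ j, EndsS u j := by
  induction h with
  | id => exact .inl (.mk m 0)
  | s h i hi =>
    refine .inr ⟨i, ?_⟩
    rw [cs_eq, ← Category.assoc]
    exact .mk _ _
  | t h ih =>
    rcases ih with ih | ⟨j, ih⟩
    · cases ih with
      | mk k => exact .inl (.mk _ (k + 1))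
    · cases ih with
      | mk _ u =>
        refine .inr ⟨j + 1, ?_⟩
        rw [Category.assoc, Category.assoc]
        exact .mk (j + 1) u

/-- On its way to the front, `d_i` passes the generators `t` and `s` with a changed index, unless it
is cancelled by some `s`. -/
theorem IsST.comp_d {m n : ℕ} {u : cX m ⟶ cX (n + 1)} (h : IsST u) (i : ℕ) (hi : i ≤ n + 1) :
    IsDST (u ≫ cd n i hi) := by
  -- For the induction on `IsST` the target is a variable `k` with an equation. The conclusion is
  -- sharpened: at most one generator `d` comes out in front.
  suffices H : ∀ {m k : ℕ} {u : cX m ⟶ cX k}, IsST u → ∀ n (hk : k = n + 1) i (hi : i ≤ n + 1),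
      IsST (u ≫ eqToHom (by rw [hk]) ≫ cd n i hi) ∨
        ∃ m' j, ∃ (hm : m = m' + 1) (hj : j ≤ m' + 1) (v : cX m' ⟶ cX n), IsST v ∧
          u ≫ eqToHom (by rw [hk]) ≫ cd n i hi = eqToHom (by rw [hm]) ≫ cd m' j hj ≫ v by
    obtain h' | ⟨m', j, rfl, hj, v, hv, e⟩ := H h n rfl i hi
    · rw [eqToHom_refl, Category.id_comp] at h'
      exact .st h'
    · rw [eqToHom_refl, Category.id_comp, eqToHom_refl, Category.id_comp] at e
      rw [e]
      exact .d (.st hv) _ _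
  clear h hi i u
  intro m k u h
  induction h with
  | id =>
    rintro n rfl i hi
    refine .inr ⟨n, i, rfl, hi, 𝟙 _, .id n, ?_⟩
    rw [Category.comp_id, Category.id_comp]
  | @s k u h j hj ih =>
    rintro n hn i hi
    obtain rfl : k = n := by omega
    rw [eqToHom_refl, Category.id_comp]
    by_cases h₁ : i = j ∨ i = j + 1
    · left
      have e : cs k j hj ≫ cd k i hi = 𝟙 _ := by
        rcases h₁ with rfl | rfl
        · exact cm_eq_id (.d_s_eq k i hj)
        · exact cm_eq_id (.d_s_succ k j hj)
      rw [Category.assoc, e, Category.comp_id]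
      exact h
    · obtain ⟨p, rfl⟩ : ∃ p, k = p + 1 := ⟨k - 1, by omega⟩
      have key : ∀ i' hi' j' hj', cs (p + 1) j hj ≫ cd (p + 1) i hi = cd p i' hi' ≫ cs p j' hj' →
          IsST ((u ≫ cs (p + 1) j hj) ≫ cd (p + 1) i hi) ∨
          ∃ m' j_1, ∃ (hm : m = m' + 1) (hj_1 : j_1 ≤ m' + 1) (v : cX m' ⟶ cX (p + 1)), IsST v ∧
            (u ≫ cs (p + 1) j hj) ≫ cd (p + 1) i hi = eqToHom (by rw [hm]) ≫ cd m' j_1 hj_1 ≫ v := by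
        intro i' hi' j' hj' e
        have ih := ih p rfl i' hi'
        rw [eqToHom_refl, Category.id_comp] at ih
        rw [Category.assoc, e, ← Category.assoc]
        obtain ih | ⟨m', l, rfl, hl, v, hv, e'⟩ := ih
        · exact .inl (ih.s _ _)
        · refine .inr ⟨m', l, rfl, hl, _, hv.s j' hj', ?_⟩
          rw [e', Category.assoc, Category.assoc]
      by_cases h₂ : i < j
      · exact key i (by omega) (j - 1) (by omega) (cm_eq (.d_s_lt p i j h₂ hj))
      · exact key (i - 1) (by omega) j (by omega) (cm_eq (.d_s_gt p i j (by omega) hi))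
  | @t k u h ih =>
    rintro n rfl i hi
    rw [eqToHom_refl, Category.id_comp]
    rcases Nat.eq_zero_or_pos i with rfl | hi'
    -- Here `t` turns `d_0` into `d_{n+1}`.
    · have ih := ih n rfl (n + 1) le_rfl
      rw [eqToHom_refl, Category.id_comp, ← ct_cd_zero, ← Category.assoc] at ih
      exact ih
    · have ih := ih n rfl (i - 1) (by omega)
      rw [eqToHom_refl, Category.id_comp] at ih
      have e := cm_eq (.d_t n i hi' hi)
      rw [Category.assoc, e, ← Category.assoc]
      obtain ih | ⟨m', l, rfl, hl, v, hv, e'⟩ := ih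
      · exact .inl ih.t
      · refine .inr ⟨m', l, rfl, hl, _, hv.t, ?_⟩
        rw [e', Category.assoc, Category.assoc]

theorem IsDST.comp_cm {m n k : ℕ} {u : cX m ⟶ cX n} (h : IsDST u) (e : CGen n k) :
    IsDST (u ≫ cm e) := by
  induction h with
  | st h =>
    cases e with
    | d _ i hi => exact h.comp_d i hi
    | s _ i hi => exact .st (h.s i hi)
    | t _ => exact .st h.t
  | d h i hi ih =>
    rw [Category.assoc]
    exact (ih e).d i hi

theorem isDST {m n : ℕ} (u : cX m ⟶ cX n) : IsDST u := by
  obtain ⟨p, rfl⟩ := (CategoryTheory.Quotient.functor CRel).map_surjective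
    (X := (Paths.of CObj).obj ⟨m⟩) (Y := (Paths.of CObj).obj ⟨n⟩) u
  suffices H : ∀ (X : CObj) (p : Quiver.Path (⟨m⟩ : CObj) X),
      IsDST (m := m) (n := X.idx) ((CategoryTheory.Quotient.functor CRel).map
        (X := (Paths.of CObj).obj ⟨m⟩) (Y := (Paths.of CObj).obj X) p) from H _ p
  intro X p
  induction p with
  | nil => exact .st (.id m)
  | cons p e ih =>
    exact ih.comp_cm e

end Annular

/-! ### Detecting and splitting off caps. -/

namespace Annular
namespace Diagram
variable {a b c : AObj}

/-- The lifted inner points `x` and `x + 1` are joined. -/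
def HasCap (D : Diagram a b) (x : ℤ) : Prop :=
  ∃ h : 0 < a.width, D.joined (.inl ⟨x, h⟩) (.inl ⟨x + 1, h⟩)

/-- No string joins two inner points. -/
def NoCaps (D : Diagram a b) : Prop := ∀ x y : Pt a, ¬ D.joined (.inl x) (.inl y)

theorem Same.hasCap {D D' : Diagram a b} (h : D.Same D') {x : ℤ} (hx : D.HasCap x) :
    D'.HasCap x := by
  obtain ⟨⟨k, hk⟩, -⟩ := h
  obtain ⟨hw, hx⟩ := hx
  exact ⟨hw, (hk (.inl _) (.inl _)).2 hx⟩

theorem Same.noCaps {D D' : Diagram a b} (h : D.Same D') (hD : D.NoCaps) : D'.NoCaps := by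
  obtain ⟨⟨k, hk⟩, -⟩ := h
  exact fun x y hxy => hD x y ((hk (.inl _) (.inl _)).1 hxy)

theorem HasCap.not_noCaps {D : Diagram a b} {x : ℤ} (h : D.HasCap x) : ¬ D.NoCaps :=
  fun h' => h' _ _ h.2

theorem hasCap_add_iff {D : Diagram a b} (hD : D.IsTangle) (x k : ℤ) :
    D.HasCap (x + k * a.width) ↔ D.HasCap x := by
  refine exists_congr fun h => ?_
  rw [← hD.joined_turn k (p := .inl ⟨x, h⟩)]
  have : (Bdry.turn k (.inl ⟨x + 1, h⟩) : Bdry a b) = .inl ⟨x + k * a.width + 1, h⟩ :=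
    congrArg Sum.inl (Pt.ext_val (show x + 1 + k * a.width = x + k * a.width + 1 by ring))
  rw [this]
  exact Iff.rfl

theorem NoCaps.exists_through {D : Diagram a b} (hD : D.IsTangle) (h : D.NoCaps) (x : Pt a) :
    ∃ y, D.joined (.inl x) (.inr y) := by
  obtain ⟨y | y, hy, -⟩ := hD.existsUnique (.inl x)
  · exact absurd hy (h x y)
  · exact ⟨y, hy⟩

section Comp
variable {S : Diagram a b} {T : Diagram b c}

theorem NoCaps.comp (hS : S.IsTangle) (hT : T.IsTangle) (h : S.NoCaps) (h' : T.NoCaps) :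
    (S.comp T).NoCaps := by
  intro x x' hx
  obtain ⟨y, hy⟩ := h.exists_through hS x
  obtain ⟨z, hz⟩ := h'.exists_through hT y
  exact Sum.inr_ne_inl ((hS.comp hT).eq_of_joined (comp_joined_through hy hz) hx)

/-- As `S` has no cups, a cap of `T` at `y` continues through `S` to the inner circle, and its other
end can only be `x'`. -/
theorem joined_of_comp_joined (hS : S.IsTangle) (hT : T.IsTangle) (h : S.star.NoCaps) {x x' : Pt a}
    {y y' : Pt b} (hy : S.joined (.inl x) (.inr y)) (hy' : S.joined (.inl x') (.inr y'))
    (hx : (S.comp T).joined (.inl x) (.inl x')) : T.joined (.inl y) (.inl y') := by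
  obtain ⟨z | z, hz, -⟩ := hT.existsUnique (.inl y)
  · obtain ⟨w, hw⟩ := h.exists_through hS.star z
    have hw : S.joined (.inr z) (.inl w) := hw
    have hne : x.1 ≠ w.1 := fun e => by
      obtain rfl := Pt.ext_val e
      obtain rfl := Sum.inr_injective (hS.eq_of_joined hy (hS.symm _ _ hw))
      exact hT.irrefl _ hz
    have := (hS.comp hT).eq_of_joined (comp_joined_cap hne hy (hS.symm _ _ hw) hz) hx
    obtain rfl := Sum.inl_injective this
    obtain rfl := Sum.inr_injective (hS.eq_of_joined hy' (hS.symm _ _ hw))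
    exact hz
  · exact absurd ((hS.comp hT).eq_of_joined (comp_joined_through hy hz) hx) Sum.inr_ne_inl

theorem hasCap_of_comp (hS : S.IsTangle) (hT : T.IsTangle) (h : S.star.NoCaps) {x y : ℤ}
    {hx : 0 < a.width} {hy : 0 < b.width} (h₀ : S.joined (.inl ⟨x, hx⟩) (.inr ⟨y, hy⟩))
    (h₁ : S.joined (.inl ⟨x + 1, hx⟩) (.inr ⟨y + 1, hy⟩)) (hc : (S.comp T).HasCap x) :
    T.HasCap y :=
  ⟨hy, joined_of_comp_joined hS hT h h₀ h₁ hc.2⟩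

theorem HasCap.comp (hS : S.IsTangle) {x : ℤ} (h : S.HasCap x) : (S.comp T).HasCap x :=
  ⟨h.1, comp_joined_inner hS h.2⟩

theorem HasCap.comp_through {x y : ℤ} {hx : 0 < a.width} {hy : 0 < b.width}
    (h₀ : S.joined (.inl ⟨x, hx⟩) (.inr ⟨y, hy⟩))
    (h₁ : S.joined (.inl ⟨x + 1, hx⟩) (.inr ⟨y + 1, hy⟩)) (hc : T.HasCap y) :
    (S.comp T).HasCap x :=
  ⟨hx, comp_joined_cap (by simp) h₀ h₁ hc.2⟩

end Comp

theorem noCaps_star_cap (i : ℕ) : (cap a b i).star.NoCaps := fun _ _ h => h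

theorem noCaps_shift (s : ℤ) : (shift a s).NoCaps := fun _ _ h => h

theorem noCaps_star_shift (s : ℤ) : (shift a s).star.NoCaps := fun _ _ h => h

theorem hasCap_cap (i : ℕ) (h : 0 < a.width) : (cap a b i).HasCap i :=
  ⟨h, cap_joined_cap rfl rfl⟩

theorem hasCap_of_cap_comp {i : ℕ} {T : Diagram b c} (hab : a.width = b.width + 2)
    (h : (cap a b i).IsTangle) (hT : T.IsTangle) {x : ℤ} (h₁ : (i : ℤ) - a.width + 2 ≤ x)
    (h₂ : x + 2 ≤ i) (hc : ((cap a b i).comp T).HasCap x) : T.HasCap x :=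
  hasCap_of_comp (hx := hc.1) (hy := by omega) h hT (noCaps_star_cap i)
    (cap_joined_lo h₁ (by simp only; omega) rfl)
    (cap_joined_lo (by simp only; omega) (by simp only; omega) rfl) hc

theorem hasCap_of_shift_comp {s : ℤ} {T : Diagram a b} (hs : Even s) (hT : T.IsTangle) {x : ℤ}
    (hc : ((shift a s).comp T).HasCap x) : T.HasCap (x + s) :=
  hasCap_of_comp (hx := hc.1) (hy := hc.1) (shift_isTangle a hs) hT (noCaps_star_shift s) rfl
    (by show _ = _; simp only; ring) hc

theorem HasCap.shift_comp {s : ℤ} {T : Diagram a b} {x : ℤ} (hc : T.HasCap (x + s)) :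
    ((shift a s).comp T).HasCap x :=
  .comp_through (hx := hc.1) (hy := hc.1) rfl (by show _ = _; simp only; ring) hc

/-- A cap that does not join neighbours encloses a shorter one, at the point next to its left end.
-/
theorem exists_hasCap {D : Diagram a b} (hD : D.IsTangle) (h : ¬ D.NoCaps) :
    ∃ x, D.HasCap x := by
  have key : ∀ (n : ℕ) (x y : Pt a), D.joined (.inl x) (.inl y) → x.1 < y.1 → y.1 - x.1 ≤ n →
      ∃ x, D.HasCap x := by
    intro n
    induction n with
    | zero =>
      intro x y _ _ _
      omega
    | succ n ih =>
      intro x y hxy hlt hle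
      by_cases e : y.1 = x.1 + 1
      · obtain rfl : y = ⟨x.1 + 1, x.2⟩ := Pt.ext_val e
        exact ⟨x.1, x.2, hxy⟩
      · obtain ⟨w, hw, -⟩ := hD.existsUnique (.inl ⟨x.1 + 1, x.2⟩)
        have hb := hD.between_closed hxy hw (show x.1 < x.1 + 1 by omega)
          (show x.1 + 1 < y.1 by omega)
        rcases w with w | w
        · have h₁ : x.1 < w.1 := hb.1
          have h₂ : w.1 < y.1 := hb.2
          have h₃ : w.1 ≠ x.1 + 1 := fun e => by
            obtain rfl : w = ⟨x.1 + 1, x.2⟩ := Pt.ext_val e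
            exact hD.irrefl _ hw
          exact ih _ w hw (by simp only; omega) (by simp only; omega)
        · exact hb.2.elim
  simp only [NoCaps, not_forall, not_not] at h
  obtain ⟨x, y, hxy⟩ := h
  rcases lt_trichotomy x.1 y.1 with e | e | e
  · exact key _ x y hxy e (Int.self_le_toNat _)
  · obtain rfl := Pt.ext_val e
    exact absurd hxy (hD.irrefl _)
  · exact key _ y x (hD.symm _ _ hxy) e (Int.self_le_toNat _)

/-- A tangle with a string joining the inner points `i` and `i + 1` factors through `a_i`. -/
theorem same_cap_comp {D : Diagram a c} {i : ℕ} (hab : a.width = b.width + 2) (hb : 0 < b.width)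
    (hD : D.IsTangle) (h₁ : (cap a b i).IsTangle) (h₂ : (cap a b (i + 1)).IsTangle)
    (h : D.HasCap i) : D.Same ((cap a b i).comp ((cap a b (i + 1)).star.comp D)) := by
  refine Same.trans ?_ (comp_assoc_same h₁ h₂.star hD)
  -- Apart from straight strings, `E` has a cap at `i`, a cup at `i + 1` and a string from `i + 2`
  -- to `i`. With the cap of `D` at `i` this is a zigzag from `i + 2` through `i` and `i + 1` to `i
  -- + 2`, so `D` absorbs `E`.
  set E := (cap a b i).comp (cap a b (i + 1)).star with hE
  have tE : E.IsTangle := h₁.comp h₂.star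
  obtain ⟨c₁, c₂, c₃⟩ := comp_counts_of_no_loop (S := cap a b i) (T := (cap a b (i + 1)).star)
    fun y => by
      obtain ⟨x, hx⟩ := cap_outer (i := i) hab y
      exact not_onLoop_of_joined (h₁.symm _ _ hx)
  have hw := h.1
  have ecap : ∀ x y : Pt a, x.1 = i → y.1 = i + 1 → E.joined (.inl x) (.inl y) := fun x y hx hy =>
    comp_joined_inner h₁ (cap_joined_cap hx hy)
  have ecup : ∀ x y : Pt a, x.1 = i + 1 → y.1 = i + 2 → E.joined (.inr x) (.inr y) := fun x y hx hy =>
    comp_joined_outer h₂.star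
      (show (cap a b (i + 1)).joined (.inl x) (.inl y) from cap_joined_cap (by push_cast; exact hx)
        (by push_cast; omega))
  have ethr : ∀ x y : Pt a, (i : ℤ) + 3 ≤ x.1 → x.1 ≤ i + a.width - 1 → y.1 = x.1 →
      E.joined (.inl x) (.inr y) := fun x y _ _ hy =>
    comp_joined_through (y := ⟨x.1 - 2, hb⟩) (cap_joined_hi hab (by omega) (by omega) rfl)
      (h₂.symm (.inl _) (.inr _) (cap_joined_hi hab (by push_cast; omega) (by push_cast; omega)
        (by simp only; omega)))
  have eslide : ∀ x y : Pt a, x.1 = i + 2 → y.1 = i → E.joined (.inl x) (.inr y) := fun x y _ hy =>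
    comp_joined_through (y := ⟨i, hb⟩) (cap_joined_hi hab (by omega) (by omega) (by simp only; omega))
      (h₂.symm (.inl _) (.inr _) (cap_joined_lo (by push_cast; omega) (by push_cast; omega)
        hy.symm))
  have dcap : ∀ x y : Pt a, x.1 = i → y.1 = i + 1 → D.joined (.inl x) (.inl y) := by
    intro x y hx hy
    obtain rfl : x = ⟨i, hw⟩ := Pt.ext_val hx
    obtain rfl : y = ⟨i + 1, hw⟩ := Pt.ext_val hy
    exact h.2
  have cslide : ∀ x : Pt a, x.1 = i + 2 → Conn E D (Glued.outer (.inl x)) (Glued.mid x) := by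
    intro x hx
    have c₁ : Conn E D (Glued.outer (.inl x)) (Glued.mid ⟨i, hw⟩) := .inner (eslide x _ hx rfl)
    have c₂ : Conn E D (Glued.mid ⟨i, hw⟩) (Glued.mid ⟨i + 1, hw⟩) := .midUpper h.2
    exact (c₁.trans c₂).trans (.midLower (ecup _ _ rfl hx))
  have cthr : ∀ x : Pt a, (i : ℤ) + 2 ≤ x.1 → x.1 ≤ i + a.width - 1 →
      Conn E D (Glued.outer (.inl x)) (Glued.mid x) := by
    intro x hx hx'
    by_cases e : x.1 = i + 2
    · exact cslide x e
    · exact .inner (ethr x x (by omega) hx' rfl)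
  have hloop : ∀ y, ¬ OnLoop E D y := by
    refine not_onLoop_of_window tE hD i fun y hy hy' => ?_
    by_cases e : y.1 = i
    · exact not_onLoop_of_joined (tE.symm _ _ (eslide ⟨i + 2, hw⟩ y rfl e))
    by_cases e' : y.1 = i + 1
    · intro hl
      exact hl (.inl ⟨i + 2, hw⟩) (.trans (.midLower (ecup y ⟨i + 2, hw⟩ e' rfl))
        (cslide _ rfl).symm)
    · exact fun hl => hl _ (cthr y (by omega) (by omega)).symm
  obtain ⟨d₁, d₂, d₃⟩ := comp_counts_of_no_loop hloop
  have tED := tE.comp hD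
  have cany : ∀ x : Pt a, (∀ y : Pt a, ¬ (cap a b i).joined (.inl x) (.inl y)) →
      Conn E D (Glued.outer (.inl x)) (Glued.mid x) := by
    refine Pt.forall_of_window (lo := i) (fun x k hP hx => ?_) (fun x hx hx' hn => ?_)
    · have := hP fun y hy => hx (y.turn k) ((h₁.joined_turn k (p := .inl x) (q := .inl y)).2 hy)
      exact (Conn.turn tE hD k).2 this
    · by_cases e : x.1 = i
      · exact absurd (cap_joined_cap e rfl) (hn ⟨i + 1, hw⟩)
      by_cases e' : x.1 = i + 1
      · exact absurd (cap_symm (cap_joined_cap rfl e')) (hn ⟨i, hw⟩)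
      · exact cthr x (by omega) (by omega)
  have ccap : ∀ x y : Pt a, (cap a b i).joined (.inl x) (.inl y) →
      D.joined (.inl x) (.inl y) ∧ E.joined (.inl x) (.inl y) := by
    have aux : ∀ (k : ℤ) (x y : Pt a), x.1 = i + k * a.width → y.1 = i + 1 + k * a.width →
        D.joined (.inl x) (.inl y) ∧ E.joined (.inl x) (.inl y) := by
      intro k x y hx hy
      obtain rfl : x = Pt.turn k ⟨i, hw⟩ := Pt.ext_val hx
      obtain rfl : y = Pt.turn k ⟨i + 1, hw⟩ := Pt.ext_val hy
      exact ⟨(hD.joined_turn k (p := .inl _) (q := .inl _)).2 (dcap _ _ rfl rfl),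
        (tE.joined_turn k (p := .inl _) (q := .inl _)).2 (ecap _ _ rfl rfl)⟩
    rintro x y ⟨k, ⟨hx, hy⟩ | ⟨hy, hx⟩⟩
    · exact aux k x y hx hy
    · exact ⟨hD.symm _ _ (aux k y x hy hx).1, tE.symm _ _ (aux k y x hy hx).2⟩
  -- Every point that is not on a cap of `E` is connected through `E` to the same point of `D`.
  have hup : ∀ p : Bdry a c, (∃ q, D.joined p q ∧ (E.comp D).joined p q) ∨
      Conn E D (Glued.outer p) (Glued.upper p) := by
    rintro (x | z)
    · by_cases e : ∃ y, (cap a b i).joined (.inl x) (.inl y)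
      · obtain ⟨y, hy⟩ := e
        exact .inl ⟨.inl y, (ccap x y hy).1, comp_joined_inner tE (ccap x y hy).2⟩
      · exact .inr (cany x (not_exists.1 e))
    · exact .inr (.refl _)
  refine same_of_joined hD tED (fun p => ?_) (by rw [d₁, c₁]; exact Nat.zero_add _)
    (by rw [d₂, c₂]; exact Nat.zero_add _) (by rw [d₃, c₃]; exact Nat.zero_add _)
  obtain ⟨q, hq, -⟩ := hD.existsUnique p
  rcases hup p with e | ep
  · exact e
  rcases hup q with ⟨p', h', h''⟩ | eq
  · obtain rfl := hD.eq_of_joined (hD.symm _ _ hq) h'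
    exact ⟨q, hq, tED.symm _ _ h''⟩
  · exact ⟨q, hq, comp_joined_of_conn (fun e => hD.irrefl p (by rwa [← e] at hq))
      ((ep.trans (.upper hq)).trans eq.symm)⟩

end Diagram
end Annular

/-! ### Faithfulness of `F ∘ H^±`. -/

namespace Annular
open Diagram

/-- The composite `F ∘ H^±`. -/
noncomputable def functorG (ε : Sgn) : CDeltaOp ⥤ Atl atlIsCategory :=
  functorH ε ⋙ functorF atlIsCategory fun _ _ e => e.isTangle

/-- The diagram `D` represents the image of `u` under `F ∘ H^±`. -/
def Rep (ε : Sgn) {m n : ℕ} (u : cX m ⟶ cX n) (D : Diagram (.pos m) (.pos n)) : Prop :=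
  ∃ h : D.IsTangle, (functorG ε).map u = atlMk atlIsCategory h

section Rep
variable {ε : Sgn} {m n k : ℕ} {u v : cX m ⟶ cX n} {D D' : Diagram (.pos m) (.pos n)}

theorem Rep.isTangle (h : Rep ε u D) : D.IsTangle := h.1

theorem Rep.same (h : Rep ε u D) (h' : Rep ε u D') : D.Same D' :=
  same_of_atlMk_eq (h.2.symm.trans h'.2)

theorem Rep.of_same (h : Rep ε u D) (hD' : D'.IsTangle) (e : D.Same D') : Rep ε u D' :=
  ⟨hD', h.2.trans (atlMk_eq _ _ e)⟩

theorem Rep.of_eq (h : Rep ε u D) (e : (functorG ε).map u = (functorG ε).map v) : Rep ε v D :=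
  ⟨h.1, e.symm.trans h.2⟩

theorem exists_rep (ε : Sgn) (u : cX m ⟶ cX n) : ∃ D, Rep ε u D := by
  obtain ⟨⟨D, hD⟩, e⟩ := Quotient.exists_rep (s := tangleSetoid (.pos m) (.pos n))
    ((functorG ε).map u)
  exact ⟨D, hD, e.symm⟩

theorem Rep.comp {w : cX n ⟶ cX k} {E : Diagram (.pos n) (.pos k)} (h : Rep ε u D)
    (h' : Rep ε w E) : Rep ε (u ≫ w) (D.comp E) :=
  ⟨h.1.comp h'.1, ((functorG ε).map_comp u w).trans (by rw [h.2, h'.2]; rfl)⟩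

theorem rep_id (ε : Sgn) (m : ℕ) : Rep ε (𝟙 (cX m)) (Diagram.id (.pos m)) :=
  ⟨id_isTangle _, (functorG ε).map_id (cX m)⟩

theorem rep_cm (ε : Sgn) (e : CGen m n) : Rep ε (cm e) (e.toAGen ε).diagram :=
  ⟨(e.toAGen ε).isTangle, (congrArg (functorF atlIsCategory fun _ _ e => e.isTangle).map
    (lift_cw e)).trans (lift_aw (hA := atlIsCategory) (fun _ _ e => e.isTangle) (e.toAGen ε))⟩

theorem rep_cd (ε : Sgn) (n i : ℕ) (h : i ≤ n + 1) :
    Rep ε (cd n i h) (cap (.pos (n + 1)) (.pos n) (2 * i + 1 + ε.offset)) := rep_cm ε (.d n i h)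

theorem rep_cs (ε : Sgn) (n i : ℕ) (h : i ≤ n) :
    Rep ε (cs n i h) (cap (.pos (n + 1)) (.pos n) (2 * i + 2 + ε.offset)).star :=
  rep_cm ε (.s n i h)

theorem rep_t (ε : Sgn) (n : ℕ) : Rep ε (cm (.t n)) (shift (.pos n) 2) :=
  rot_eq_shift (.pos n) ▸ rep_cm ε (.t n)

theorem rep_ct (ε : Sgn) (n k : ℕ) : Rep ε (ct n k) (shift (.pos n) (2 * k)) := by
  refine ⟨shift_isTangle _ (even_two_mul _), ?_⟩
  refine (iter_map (functorG ε) (cm (.t n)) k).trans (Eq.trans ?_ (iter_rot n k))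
  exact congrArg (fun f : (⟨.pos n⟩ : Atl atlIsCategory) ⟶ ⟨.pos n⟩ => iter f k) (rep_cm ε (.t n)).2

end Rep

theorem AObj.width_pos (n : ℕ) : (AObj.pos n).width = 2 * (n + 1) := rfl

section Peel
variable {ε : Sgn}

theorem IsST.noCaps {m n : ℕ} {u : cX m ⟶ cX n} (h : IsST u) :
    ∀ {D}, Rep ε u D → D.NoCaps := by
  induction h with
  | id =>
    intro D hD
    refine ((rep_id ε _).same hD).noCaps ?_
    rw [id_eq_shift]
    exact noCaps_shift 0
  | @s k u h i hi ih =>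
    intro D hD
    obtain ⟨E, hE⟩ := exists_rep ε u
    refine ((hE.comp (rep_cs ε _ i hi)).same hD).noCaps ?_
    exact (ih hE).comp hE.isTangle (rep_cs ε _ i hi).isTangle (noCaps_star_cap _)
  | @t k u h ih =>
    intro D hD
    obtain ⟨E, hE⟩ := exists_rep ε u
    refine ((hE.comp (rep_t ε _)).same hD).noCaps ?_
    exact (ih hE).comp hE.isTangle (rep_t ε _).isTangle (noCaps_shift 2)

theorem StartsD.hasCap {m n i : ℕ} {u : cX m ⟶ cX n} (h : StartsD u i)
    {D : Diagram (.pos m) (.pos n)} (hD : Rep ε u D) :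
    D.HasCap ((2 * i + 1 + ε.offset : ℕ) : ℤ) := by
  cases h with
  | mk _ hi w =>
    obtain ⟨E, hE⟩ := exists_rep ε w
    refine (((rep_cd ε _ i hi).comp hE).same hD).hasCap ?_
    exact (hasCap_cap _ (by rw [AObj.width_pos]; omega)).comp (rep_cd ε _ i hi).isTangle

/-- The cup of `s_0` is at `2 + ε.offset`, and `t ^ j` moves it by `2 * j`. -/
theorem EndsS.hasCup {m n j : ℕ} {u : cX m ⟶ cX n} (h : EndsS u j)
    {D : Diagram (.pos m) (.pos n)} (hD : Rep ε u D) :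
    D.star.HasCap ((2 + ε.offset : ℕ) + 2 * j : ℤ) := by
  cases h with
  | @mk n _ w =>
    obtain ⟨E, hE⟩ := exists_rep ε w
    have h₀ := rep_cs ε n 0 (Nat.zero_le _)
    have h₁ := rep_ct ε (n + 1) j
    refine (((hE.comp (h₀.comp h₁)).same hD).star hD.isTangle).hasCap ?_
    have t := h₁.isTangle.star.comp h₀.isTangle.star
    rw [star_shift, star_star] at t
    rw [star_comp, star_comp, star_shift, star_star]
    refine HasCap.comp t (HasCap.shift_comp ?_)
    rw [add_neg_cancel_right, ← zero_add 2, ← mul_zero 2]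
    exact hasCap_cap _ (by rw [AObj.width_pos]; omega)

/-- Converse of `StartsD.hasCap`: the tangle shows which `d_i` can be split off. If the first
generator is another `d_k`, the cap stems from the rest of the word, and the relation between `d_i`
and `d_k` brings `d_i` to the front. -/
theorem IsDST.startsD {m n : ℕ} {u : cX m ⟶ cX n} (h : IsDST u) : ∀ {D}, Rep ε u D →
    ∀ i, i ≤ m → D.HasCap ((2 * i + 1 + ε.offset : ℕ) : ℤ) → StartsD u i := by
  have ho := ε.offset_le
  induction h with
  | st h => exact fun hD i _ hc => absurd (h.noCaps hD) hc.not_noCaps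
  | @d m n w h k hk ih =>
    intro D hD i hi hc
    obtain ⟨E, hE⟩ := exists_rep ε w
    have hk' := rep_cd ε m k hk
    have hc := (hD.same (hk'.comp hE)).hasCap hc
    rcases lt_trichotomy i k with hik | rfl | hik
    · have := ih hE i (by omega) (hasCap_of_cap_comp rfl hk'.isTangle hE.isTangle
        (by rw [AObj.width_pos]; omega) (by omega) hc)
      cases this with
      | mk _ hi' w =>
        rw [← Category.assoc, cd_cd hik, Category.assoc]
        exact .mk _ _ _
    · exact .mk _ _ _
    -- After the cap of `d_k` the numbering changes, so the cap is considered one turn earlier,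
    -- where it does not.
    · have e : ((2 * i + 1 + ε.offset : ℕ) : ℤ) = (2 * i + 1 + ε.offset : ℕ) -
        (AObj.pos (m + 1)).width + 1 * (AObj.pos (m + 1)).width := by ring
      rw [e, hasCap_add_iff (hk'.comp hE).isTangle] at hc
      have hc := hasCap_of_cap_comp rfl hk'.isTangle hE.isTangle
        (by rw [AObj.width_pos]; omega) (by rw [AObj.width_pos]; omega) hc
      have e : ((2 * i + 1 + ε.offset : ℕ) : ℤ) - (AObj.pos (m + 1)).width =
          (2 * (i - 1) + 1 + ε.offset : ℕ) + -1 * (AObj.pos m).width := by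
        rw [AObj.width_pos, AObj.width_pos]; omega
      rw [e, hasCap_add_iff hE.isTangle] at hc
      have := ih hE (i - 1) (by omega) hc
      cases this with
      | mk _ hi' w =>
        rw [← Category.assoc, ← cd_cd hik (by omega), Category.assoc]
        exact .mk _ _ _

/-- Converse of `EndsS.hasCup`. If the last generator is `s_k` and the cup is not its own, the cup
stems from the preceding word, and `exists_cs_ct_cs` interchanges the two. -/
theorem IsST.endsS {m n : ℕ} {u : cX m ⟶ cX n} (h : IsST u) : ∀ {D}, Rep ε u D →
    ∀ j : ℕ, D.star.HasCap ((2 + ε.offset : ℕ) + 2 * j : ℤ) → EndsS u j := by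
  have ho := ε.offset_le
  induction h with
  | id =>
    intro D hD j hc
    refine absurd ?_ ((hD.same (rep_id ε _)).star (id_isTangle _) |>.hasCap hc).not_noCaps
    rw [id_eq_shift]
    exact noCaps_star_shift 0
  | @s n w h k hk ih =>
    intro D hD j hc
    obtain ⟨E, hE⟩ := exists_rep ε w
    have hk' := rep_cs ε n k hk
    have hc := ((hD.same (hE.comp hk')).star (hE.comp hk').isTangle).hasCap hc
    rw [star_comp, star_star] at hc
    obtain ⟨r, K, h₁, h₂, e⟩ := exists_window (W := (AObj.pos (n + 1)).width)
      (by exact_mod_cast hc.1) ((2 * k + 2 + ε.offset : ℕ) - (AObj.pos (n + 1)).width + 2)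
      ((2 + ε.offset : ℕ) + 2 * j : ℤ)
    have hEs := hE.isTangle.star
    have hks : (cap (.pos (n + 1)) (.pos n) (2 * k + 2 + ε.offset)).IsTangle := by
      have := hk'.isTangle.star
      rwa [star_star] at this
    rw [e, hasCap_add_iff (hks.comp hEs)] at hc
    rw [AObj.width_pos] at h₁ h₂ e
    -- The period is even, so the remainder has the same parity as the place of the cup.
    obtain ⟨q, rfl⟩ : ∃ q : ℤ, r = (2 + ε.offset : ℕ) + 2 * q :=
      ⟨j - K * (n + 2), by push_cast at e ⊢; linear_combination -e⟩
    have e' : (j : ℤ) = q + K * (n + 1 + 1 : ℕ) := by push_cast at e ⊢; linarith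
    by_cases hq : q = k
    · subst hq
      rw [cs_eq, ct_congr (n := n + 1) (l := j) ((Int.natCast_modEq_iff.1
        (e' ▸ Int.modEq_iff_dvd.2 ⟨K, by ring⟩))), ← Category.assoc]
      exact .mk _ _
    · have hc := hasCap_of_cap_comp rfl hks hEs (by rw [AObj.width_pos]; omega) (by omega) hc
      -- On the circle of `w` only `q` modulo `n + 1` matters; it is written as `k + b` so that `t ^
      -- k` can be moved past `s_k`.
      obtain ⟨b, hb⟩ : ∃ b : ℕ, q + (n + 1) = (k + b : ℕ) :=
        ⟨(q + (n + 1) - k).toNat, by omega⟩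
      have e₁ : (2 + ε.offset : ℕ) + 2 * q = (2 + ε.offset : ℕ) + 2 * ((k + b : ℕ) : ℤ) +
          -1 * (AObj.pos n).width := by rw [AObj.width_pos, ← hb]; push_cast; ring
      rw [e₁, hasCap_add_iff hEs] at hc
      have := ih hE _ hc
      cases this with
      | @mk p _ w =>
        have e₂ : ct (p + 1) (k + b) ≫ cs (p + 1) k hk =
            ct (p + 1) b ≫ cs (p + 1) 0 (Nat.zero_le _) ≫ ct (p + 1 + 1) k := by
          rw [add_comm k b, ← ct_ct, Category.assoc]
          exact congrArg _ (ct_cs k 0 hk)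
        obtain ⟨w', hw'⟩ := exists_cs_ct_cs (n := p) b (by omega)
        have e₃ : (w ≫ cs p 0 (Nat.zero_le _) ≫ ct (p + 1) (k + b)) ≫ cs (p + 1) k hk =
            (w ≫ w') ≫ cs (p + 1) 0 (Nat.zero_le _) ≫ ct (p + 1 + 1) j := by
          rw [Category.assoc, Category.assoc, e₂, ← Category.assoc (cs p 0 _),
            ← Category.assoc (cs p 0 _ ≫ _), Category.assoc (cs p 0 _), hw', Category.assoc,
            Category.assoc, Category.assoc, ct_ct, ct_congr (n := p + 1 + 1) (l := j)]
          refine Int.natCast_modEq_iff.1 (e' ▸ Int.modEq_iff_dvd.2 ⟨K - 1, ?_⟩)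
          push_cast at hb ⊢
          linear_combination hb
        rw [e₃]
        exact .mk _ _
  | @t n w h ih =>
    intro D hD j hc
    obtain ⟨E, hE⟩ := exists_rep ε w
    have hc := ((hD.same (hE.comp (rep_t ε n))).star (hE.comp (rep_t ε n)).isTangle).hasCap hc
    rw [star_comp, star_shift] at hc
    have hc := hasCap_of_shift_comp (by decide) hE.isTangle.star hc
    have e : ((2 + ε.offset : ℕ) + 2 * j + -2 : ℤ) = (2 + ε.offset : ℕ) + 2 * (j + n : ℕ) +
        -1 * (AObj.pos n).width := by rw [AObj.width_pos]; push_cast; ring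
    rw [e, hasCap_add_iff hE.isTangle.star] at hc
    have := ih hE _ hc
    cases this with
    | @mk p _ w =>
      rw [Category.assoc, Category.assoc]
      have e : ct (p + 1) (j + (p + 1)) ≫ cm (.t (p + 1)) = ct (p + 1) j :=
        ct_congr (k := j + (p + 1) + 1) (by rw [Nat.ModEq, add_assoc, Nat.add_mod_right])
      rw [e]
      exact .mk _ _

end Peel

theorem IsDST.isST_or_startsD {m n : ℕ} {u : cX m ⟶ cX n} (h : IsDST u) :
    IsST u ∨ ∃ i, i ≤ m ∧ StartsD u i := by
  cases h with
  | st h => exact .inl h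
  | d h i hi => exact .inr ⟨i, hi, .mk _ _ _⟩

theorem IsRot.eq {m : ℕ} {u : cX m ⟶ cX m} (h : IsRot u) : ∃ k, u = ct m k := by
  cases h with
  | mk k => exact ⟨k, rfl⟩

theorem exists_of_shift_same {a : AObj} (ha : 0 < a.width) {s t : ℤ}
    (h : (shift a s).Same (shift a t)) : ∃ k : ℤ, t = s + k * a.width := by
  obtain ⟨⟨k, hk⟩, -⟩ := h
  have := (hk (.inl ⟨0, ha⟩) (.inr ⟨s, ha⟩)).2 (zero_add s).symm
  have this : s + k * a.width = 0 + t := this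
  exact ⟨k, by omega⟩

/-- If `u` starts with `d_i`, the common tangle has the corresponding cap, so `v` starts with `d_i`
as well, and a section of `d_i` cancels both. Cups are treated in the same way with a retraction of
`s_0 ≫ t ^ j`. The remaining powers of `t` are determined by their shifts modulo a full turn. -/
theorem functorG_map_injective (ε : Sgn) (N : ℕ) : ∀ {m n : ℕ}, m + n = N → ∀ u v : cX m ⟶ cX n,
    (functorG ε).map u = (functorG ε).map v → u = v := by
  induction N using Nat.strong_induction_on with
  | _ N ih =>
  have hD : ∀ {m n : ℕ}, m + n = N → ∀ u v : cX m ⟶ cX n,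
      (functorG ε).map u = (functorG ε).map v → ∀ i, i ≤ m → StartsD u i → u = v := by
    intro m n hN u v e i hi hu
    obtain ⟨D, hD⟩ := exists_rep ε u
    have hv := (isDST v).startsD (hD.of_eq e) i hi (hu.hasCap hD)
    obtain ⟨m, rfl⟩ : ∃ m', m = m' + 1 := by
      cases hu with
      | mk => exact ⟨_, rfl⟩
    obtain ⟨hi', u', rfl⟩ := hu.eq
    obtain ⟨_, v', rfl⟩ := hv.eq
    obtain ⟨s, hs⟩ := exists_section m i hi'
    have := congrArg (fun f => (functorG ε).map s ≫ f) e
    simp only [← Functor.map_comp] at this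
    rw [← Category.assoc, ← Category.assoc, hs, Category.id_comp, Category.id_comp] at this
    rw [ih (m + n) (by omega) rfl u' v' this]
  have hS : ∀ {m n : ℕ}, m + n = N → ∀ u v : cX m ⟶ cX n, IsST u → IsST v →
      (functorG ε).map u = (functorG ε).map v → ∀ j, EndsS u j → u = v := by
    intro m n hN u v hu hv e j hj
    obtain ⟨D, hD⟩ := exists_rep ε u
    have hj' := hv.endsS (hD.of_eq e) j (hj.hasCup hD)
    obtain ⟨n, rfl⟩ : ∃ n', n = n' + 1 := by
      cases hj with
      | mk => exact ⟨_, rfl⟩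
    obtain ⟨u', rfl⟩ := hj.eq
    obtain ⟨v', rfl⟩ := hj'.eq
    obtain ⟨p, hp⟩ := exists_retraction n j
    have := congrArg (fun f => f ≫ (functorG ε).map p) e
    simp only [← Functor.map_comp] at this
    rw [Category.assoc u', hp, Category.assoc v', hp, Category.comp_id, Category.comp_id] at this
    rw [ih (m + n) (by omega) rfl u' v' this]
  intro m n hN u v e
  rcases (isDST u).isST_or_startsD with hu | ⟨i, hi, hu⟩
  swap
  · exact hD hN u v e i hi hu
  rcases (isDST v).isST_or_startsD with hv | ⟨i, hi, hv⟩
  swap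
  · exact (hD hN v u e.symm i hi hv).symm
  rcases hu.isRot_or_endsS with hu' | ⟨j, hj⟩
  swap
  · exact hS hN u v hu hv e j hj
  rcases hv.isRot_or_endsS with hv' | ⟨j, hj⟩
  swap
  · exact (hS hN v u hv hu e.symm j hj).symm
  obtain rfl : m = n := by
    cases hu' with
    | mk => rfl
  obtain ⟨k, rfl⟩ := hu'.eq
  obtain ⟨l, rfl⟩ := hv'.eq
  obtain ⟨c, hc⟩ := exists_of_shift_same (a := .pos m) (Nat.mul_pos two_pos m.succ_pos)
    ((rep_ct ε m k).of_eq e |>.same (rep_ct ε m l))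
  refine ct_congr (Int.natCast_modEq_iff.1 (Int.modEq_iff_dvd.2 ⟨c, ?_⟩))
  rw [AObj.width_pos] at hc
  push_cast at hc ⊢
  linarith

end Annular

/-! ### Tangles whose caps and cups have prescribed parities. -/

namespace Annular
namespace Diagram
variable {a b c : AObj}

/-- The left ends of the lifted strings joining inner points have parity `p`. -/
def CapsAt (p : ZMod 2) (D : Diagram a b) : Prop :=
  ∀ x y : Pt a, D.joined (.inl x) (.inl y) → x.1 < y.1 → (x.1 : ZMod 2) = p

/-- There are no loops, and the left ends of caps and cups have the parities `p + 1` and `p`. -/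
def Cyc (p : ZMod 2) (D : Diagram a b) : Prop :=
  D.core = 0 ∧ D.shadedLoops = 0 ∧ D.unshadedLoops = 0 ∧ D.CapsAt (p + 1) ∧ D.star.CapsAt p

theorem add_one_ne (p : ZMod 2) : p + 1 ≠ p := by
  revert p
  decide

theorem eq_or_eq_add_one (p q : ZMod 2) : q = p ∨ q = p + 1 := by
  revert p q
  decide

theorem add_one_add_one (p : ZMod 2) : p + 1 + 1 = p := by
  revert p
  decide

theorem isCyclic_iff {ε : Sgn} {D : Diagram a b} : D.IsCyclic ε ↔ D.Cyc (ε.offset : ZMod 2) := by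
  cases ε
  · simp only [IsCyclic, Cyc, CapsAt, Sgn.offset, Nat.cast_zero, zero_add, ZMod.intCast_eq_one_iff_odd,
      ZMod.intCast_eq_zero_iff_even]
    exact Iff.rfl
  · have : (1 : ZMod 2) + 1 = 0 := by decide
    simp only [IsCyclic, Cyc, CapsAt, Sgn.offset, Nat.cast_one, this, ZMod.intCast_eq_one_iff_odd,
      ZMod.intCast_eq_zero_iff_even]
    exact Iff.rfl

theorem Cyc.star {p : ZMod 2} {D : Diagram a b} (h : D.Cyc p) : D.star.Cyc (p + 1) := by
  obtain ⟨h₁, h₂, h₃, h₄, h₅⟩ := h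
  refine ⟨h₁, h₂, h₃, ?_, ?_⟩
  · rwa [add_one_add_one]
  · rwa [star_star]

/-- Otherwise `x + 1` would be the left end of an enclosed cap, with the wrong parity. -/
theorem CapsAt.eq_add_one {p : ZMod 2} {D : Diagram a b} (hD : D.IsTangle) (h : D.CapsAt p)
    {x y : Pt a} (hxy : D.joined (.inl x) (.inl y)) (hlt : x.1 < y.1) : y.1 = x.1 + 1 := by
  by_contra e
  obtain ⟨w, hw, -⟩ := hD.existsUnique (.inl ⟨x.1 + 1, x.2⟩)
  have hb := hD.between_closed hxy hw (show x.1 < x.1 + 1 by omega) (show x.1 + 1 < y.1 by omega)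
  rcases w with w | w
  · have h₁ : x.1 < w.1 := hb.1
    have h₃ : w.1 ≠ x.1 + 1 := fun e => by
      obtain rfl : w = ⟨x.1 + 1, x.2⟩ := Pt.ext_val e
      exact hD.irrefl _ hw
    have := h _ w hw (by simp only; omega)
    push_cast at this
    rw [h x y hxy hlt] at this
    exact add_one_ne p this
  · exact hb.2.elim

/-- The dichotomy for a cap at `x`. -/
theorem CapsAt.cases {p : ZMod 2} {D : Diagram a b} (hD : D.IsTangle) (h : D.CapsAt p)
    {x y : Pt a} (hxy : D.joined (.inl x) (.inl y)) :
    ((x.1 : ZMod 2) = p ∧ y.1 = x.1 + 1) ∨ ((x.1 : ZMod 2) = p + 1 ∧ y.1 = x.1 - 1) := by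
  rcases lt_trichotomy x.1 y.1 with e | e | e
  · exact .inl ⟨h x y hxy e, h.eq_add_one hD hxy e⟩
  · obtain rfl := Pt.ext_val e
    exact absurd hxy (hD.irrefl _)
  · have hyx := hD.symm _ _ hxy
    have e' := h.eq_add_one hD hyx e
    refine .inr ⟨?_, by omega⟩
    rw [e', Int.cast_add, h y x hyx e, Int.cast_one]

/-- Caps and cups join neighbours. Without through strings, the transversal from the gap `p` to the
gap `p + 1` would meet nothing, since caps start at the parity `p + 1` and cups at `p`; but the
shades of these two gaps differ. -/
theorem Cyc.exists_through {p : ZMod 2} {D : Diagram a b} (hD : D.IsTangle) (h : D.Cyc p)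
    (x₀ : Pt a) (y₀ : Pt b) : ∃ x y, D.joined (.inl x) (.inr y) := by
  obtain ⟨h₁, -, -, h₄, h₅⟩ := h
  by_contra hn
  simp only [not_exists] at hn
  have hp : (((p.val : ℕ) : ℤ) : ZMod 2) = p := by
    rw [Int.cast_natCast, ZMod.natCast_zmod_val]
  have hc := hD.checkerboard p.val (p.val + 1)
  have h0 : D.crossings p.val (p.val + 1) = 0 := by
    rw [crossings]
    convert Set.ncard_empty (Bdry a b)
    rw [Set.eq_empty_iff_forall_notMem]
    rintro (x | x) ⟨hl, (y | y), hj, hr⟩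
    · have hl : x.1 ≤ p.val := hl
      have hr : ¬ y.1 ≤ p.val := hr
      rcases h₄.cases hD hj with ⟨e, e'⟩ | ⟨e, e'⟩
      · rw [show x.1 = p.val by omega, hp] at e
        exact add_one_ne p e.symm
      · omega
    · exact hn _ _ hj
    · exact hn _ _ (hD.symm _ _ hj)
    · have hl : x.1 ≤ p.val + 1 := hl
      have hr : ¬ y.1 ≤ p.val + 1 := hr
      rcases h₅.cases hD.star (x := x) (y := y) hj with ⟨e, e'⟩ | ⟨e, e'⟩
      · rw [show x.1 = p.val + 1 by omega, Int.cast_add, hp, Int.cast_one] at e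
        exact add_one_ne p e
      · omega
  rw [h0, h₁, x₀.shade, y₀.shade, Int.cast_add, hp, Int.cast_one, Nat.cast_zero] at hc
  have : ∀ p : ZMod 2, (0 : ZMod 2) ≠ p + (p + 1) := by decide
  exact this p hc

section Comp
variable {S : Diagram a b} {T : Diagram b c} {p : ZMod 2}

/-- Suppose that the left end `x` has parity `p`. Its string reaches a middle point of parity `p`,
from where a cap of `T` and then a cup of `S` each lead one place to the left. Returning to the
inner circle it would cross its own beginning, so it runs to the left for ever, although a component
with an end is finite. -/
theorem CapsAt.comp (hS : S.IsTangle) (hT : T.IsTangle) (h₁ : S.CapsAt (p + 1))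
    (h₂ : S.star.CapsAt p) (h₃ : T.CapsAt (p + 1)) : (S.comp T).CapsAt (p + 1) := by
  intro x x' hj hlt
  refine (eq_or_eq_add_one p x.1).resolve_left fun hx => ?_
  have tST := hS.comp hT
  obtain ⟨y | y, hy, -⟩ := hS.existsUnique (.inl x)
  · obtain rfl := Sum.inl_injective (tST.eq_of_joined (comp_joined_inner hS hy) hj)
    exact add_one_ne p ((h₁ _ _ hy hlt).symm.trans hx)
  have hyx := hS.joined_inr_inl_eq hy
  have c₀ : Conn S T (Glued.outer (.inl x)) (Glued.mid y) := .inner hy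
  have key : ∀ n : ℕ, Conn S T (Glued.outer (.inl x)) (Glued.mid ⟨y.1 - 2 * n, y.2⟩) := by
    intro n
    induction n with
    | zero =>
      have : (⟨y.1 - 2 * (0 : ℕ), y.2⟩ : Pt b) = y := Pt.ext_val (by simp)
      rwa [this]
    | succ n ih =>
      set z : Pt b := ⟨y.1 - 2 * n, y.2⟩ with hz
      have hzp : (z.1 : ZMod 2) = p := by
        simp only [hz, Int.cast_sub, Int.cast_mul, ← hyx, hx, Int.cast_ofNat,
          show (2 : ZMod 2) = 0 from rfl, zero_mul, sub_zero]
      obtain ⟨w | w, hw, -⟩ := hT.existsUnique (.inl z)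
      swap
      · exact absurd (tST.eq_of_joined (comp_joined_of_conn (by simp) (ih.trans (.outer hw))) hj)
          Sum.inr_ne_inl
      have ih := ih.trans (.midUpper hw)
      rcases h₃.cases hT hw with ⟨e, -⟩ | ⟨-, e⟩
      · exact absurd (e.symm.trans hzp) (add_one_ne p)
      have hwp : (w.1 : ZMod 2) = p + 1 := by
        rw [e, Int.cast_sub, hzp, Int.cast_one, CharTwo.sub_eq_add]
      obtain ⟨u | u, hu, -⟩ := hS.existsUnique (.inr w)
      · have hu' := hS.symm _ _ hu
        have hne : x ≠ u := by
          rintro rfl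
          exact add_one_ne p ((hwp.symm.trans (hS.joined_inr_inl_eq hu').symm).trans hx)
        obtain rfl := Sum.inl_injective (tST.eq_of_joined (comp_joined_of_conn
          (fun e => hne (Sum.inl_injective e)) (ih.trans (Conn.inner hu').symm)) hj)
        -- The through strings of `S` at `x` and at `u` would cross, as `u` is to the right of `x`
        -- but `w` to the left of `y`.
        refine absurd ⟨?_, trivial, ?_⟩ (hS.planar _ _ _ _ hy hu')
        · exact hlt
        · show w.1 < y.1
          simp only [hz] at e
          omega
      · rcases h₂.cases hS.star (x := w) (y := u) hu with ⟨e', -⟩ | ⟨-, e'⟩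
        · exact absurd (hwp.symm.trans e') (add_one_ne p)
        · have : u = ⟨y.1 - 2 * (n + 1 : ℕ), y.2⟩ := Pt.ext_val (by
            simp only [hz] at e
            push_cast
            omega)
          rw [← this]
          exact ih.trans (.midLower hu)
  refine Set.infinite_of_injective_forall_mem (f := fun n : ℕ =>
    (Glued.mid ⟨y.1 - 2 * n, y.2⟩ : Glued a b c)) (fun m n e => ?_) key
    (finite_component hS hT fun k hk => outer_turn_eq_zero hS hT hk)
  have e : y.1 - 2 * (m : ℤ) = y.1 - 2 * n :=
    congrArg Subtype.val (Sum.inl_injective (Sum.inr_injective e))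
  omega

/-- A point on a loop is joined to its right neighbour, by a cup of `S` or a cap of `T` depending on
its parity. So all points further right are on loops, although a translate of an end of a through
string of `S` is among them. -/
theorem Cyc.not_onLoop (hS : S.IsTangle) (hT : T.IsTangle) (h : S.Cyc p) (h' : T.Cyc p) (x₀ : Pt a)
    (y : Pt b) : ¬ OnLoop S T y := by
  intro hy
  have step : ∀ y : Pt b, OnLoop S T y → OnLoop S T ⟨y.1 + 1, y.2⟩ := by
    intro y hy
    obtain ⟨z, hz⟩ := hy.exists_lower hS
    obtain ⟨w, hw⟩ := hy.exists_upper hT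
    rcases h.2.2.2.2.cases hS.star (x := y) (y := z) hz with ⟨e, e'⟩ | ⟨e, -⟩
    · obtain rfl : z = ⟨y.1 + 1, y.2⟩ := Pt.ext_val e'
      exact hy.congr (.midLower hz)
    · rcases h'.2.2.2.1.cases hT hw with ⟨-, e'⟩ | ⟨e₂, -⟩
      · obtain rfl : w = ⟨y.1 + 1, y.2⟩ := Pt.ext_val e'
        exact hy.congr (.midUpper hw)
      · exact absurd (e₂.symm.trans e) (add_one_ne _)
  have hall : ∀ n : ℕ, OnLoop S T ⟨y.1 + n, y.2⟩ := by
    intro n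
    induction n with
    | zero =>
      have : (⟨y.1 + (0 : ℕ), y.2⟩ : Pt b) = y := Pt.ext_val (by simp)
      rwa [this]
    | succ n ih =>
      have := step _ ih
      simpa only [Nat.cast_succ, ← add_assoc] using this
  obtain ⟨u, v, huv⟩ := h.exists_through hS x₀ y
  have hw := y.width_pos
  have hle : y.1 ≤ v.1 + |y.1 - v.1| * b.width := by
    nlinarith [le_abs_self (y.1 - v.1), abs_nonneg (y.1 - v.1)]
  obtain ⟨n, hn⟩ := Int.eq_ofNat_of_zero_le (sub_nonneg.2 hle)
  refine not_onLoop_of_joined (T := T)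
    (hS.symm _ _ ((hS.joined_turn |y.1 - v.1| (p := .inl u) (q := .inr v)).2 huv)) ?_
  have := hall n
  rwa [show (⟨y.1 + n, y.2⟩ : Pt b) = v.turn |y.1 - v.1| from Pt.ext_val (by
    simp only [Pt.turn_val]; omega)] at this

theorem Cyc.comp (hS : S.IsTangle) (hT : T.IsTangle) (h : S.Cyc p) (h' : T.Cyc p) (x₀ : Pt a) :
    (S.comp T).Cyc p := by
  obtain ⟨c₁, c₂, c₃⟩ := comp_counts_of_no_loop (h.not_onLoop hS hT h' x₀)
  refine ⟨by rw [c₁, h.1, h'.1], by rw [c₂, h.2.1, h'.2.1], by rw [c₃, h.2.2.1, h'.2.2.1],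
    CapsAt.comp hS hT h.2.2.2.1 h.2.2.2.2 h'.2.2.2.1, ?_⟩
  rw [star_comp, ← add_one_add_one p]
  exact CapsAt.comp hT.star hS.star h'.star.2.2.2.1 h'.star.2.2.2.2 h.star.2.2.2.1

end Comp

theorem cyc_shift (a : AObj) (s : ℤ) (p : ZMod 2) : (shift a s).Cyc p :=
  ⟨rfl, rfl, rfl, fun _ _ h => h.elim, fun _ _ h => h.elim⟩

theorem cyc_cap {i : ℕ} {p : ZMod 2} (h : (i : ZMod 2) = p + 1) : (cap a b i).Cyc p := by
  refine ⟨rfl, rfl, rfl, ?_, fun _ _ h => h.elim⟩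
  rintro x y ⟨k, ⟨hx, hy⟩ | ⟨hy, hx⟩⟩ hlt
  · rw [hx, Int.cast_add, Int.cast_mul, AObj.width_cast, mul_zero, add_zero, Int.cast_natCast, h]
  · omega

/-- The through strings form an increasing bijection of the integers, hence a translation.
Periodicity compares the widths, and the shading makes the translation even. -/
theorem exists_shift {D : Diagram a b} (ha : 0 < a.width) (hD : D.IsTangle) (h : D.NoCaps)
    (h' : D.star.NoCaps) : a.width = b.width ∧ ∃ s : ℤ, Even s ∧
      ∀ x y, D.joined (.inl x) (.inr y) → y.1 = x.1 + s := by
  choose f hf using fun x : ℤ => h.exists_through hD ⟨x, ha⟩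
  have hmono : StrictMono fun x => (f x).1 := by
    intro x x' hlt
    refine lt_of_le_of_ne (not_lt.1 fun e => ?_) fun e => ?_
    · exact hD.planar _ _ _ _ (hf x) (hf x') ⟨hlt, trivial, e⟩
    · have := hf x'
      rw [← Pt.ext_val e] at this
      have : x' = x := congrArg Subtype.val (Sum.inl_injective (hD.eq_of_joined
        (hD.symm _ _ this) (hD.symm _ _ (hf x))))
      omega
  have hb : 0 < b.width := (f 0).2
  have hsurj : ∀ y : ℤ, ∃ x, (f x).1 = y := by
    intro y
    obtain ⟨x, hx⟩ := h'.exists_through hD.star ⟨y, hb⟩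
    have hx : D.joined (.inr ⟨y, hb⟩) (.inl x) := hx
    exact ⟨x.1, congrArg Subtype.val (Sum.inr_injective
      (hD.eq_of_joined (hf x.1) (hD.symm _ _ hx)))⟩
  have hstep : ∀ x, (f (x + 1)).1 = (f x).1 + 1 := by
    intro x
    obtain ⟨z, hz⟩ := hsurj ((f x).1 + 1)
    have h₁ : x < z := hmono.lt_iff_lt.1 (show (f x).1 < (f z).1 by omega)
    have h₂ : ¬ x + 1 < z := fun e => by
      have e₁ : (f (x + 1)).1 < (f z).1 := hmono e
      have e₂ : (f x).1 < (f (x + 1)).1 := hmono (lt_add_one x)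
      omega
    rw [← hz, show z = x + 1 by omega]
  have hlin : ∀ x, (f x).1 = x + (f 0).1 := by
    intro x
    induction x using Int.induction_on with
    | zero => simp
    | succ x ih => rw [hstep, ih]; ring
    | pred x ih =>
      have := hstep (-x - 1)
      rw [sub_add_cancel, ih] at this
      omega
  have hall : ∀ x y, D.joined (.inl x) (.inr y) → y.1 = x.1 + (f 0).1 := by
    intro x y hxy
    rw [← hlin]
    exact congrArg Subtype.val (Sum.inr_injective (hD.eq_of_joined hxy (hf x.1)))
  refine ⟨?_, (f 0).1, ?_, hall⟩
  · have := hall _ _ ((hD.joined_turn 1 (p := .inl ⟨0, ha⟩) (q := .inr (f 0))).2 (hf 0))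
    have this : (f 0).1 + 1 * (b.width : ℤ) = 0 + 1 * (a.width : ℤ) + (f 0).1 := this
    omega
  · have := hD.joined_inr_inl_eq (hf 0)
    rw [← ZMod.intCast_eq_zero_iff_even]
    rw [← this]
    rfl

end Diagram
end Annular

/-! ### The image of `F ∘ H^±`. -/

namespace Annular
open Diagram

/-- A lifted marked point on a circle of type `[n]`, `n ≥ 1`. -/
def AObj.origin (n : ℕ) : Pt (.pos n) := ⟨0, Nat.mul_pos two_pos n.succ_pos⟩

section Cyclic
variable {ε : Sgn}

theorem cyc_cap_d (ε : Sgn) (a b : AObj) (i : ℕ) :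
    (cap a b (2 * i + 1 + ε.offset)).Cyc (ε.offset : ZMod 2) := by
  refine cyc_cap ?_
  push_cast
  rw [show (2 : ZMod 2) = 0 from rfl, zero_mul, zero_add, add_comm]

theorem cyc_cap_s (ε : Sgn) (a b : AObj) (i : ℕ) :
    (cap a b (2 * i + 2 + ε.offset)).star.Cyc (ε.offset : ZMod 2) := by
  rw [← add_one_add_one (ε.offset : ZMod 2)]
  refine (cyc_cap ?_).star
  rw [add_one_add_one]
  push_cast
  rw [show (2 : ZMod 2) = 0 from rfl, zero_mul, add_zero, zero_add]

theorem IsST.exists_cyc {m n : ℕ} {u : cX m ⟶ cX n} (h : IsST u) :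
    ∃ D, Rep ε u D ∧ D.Cyc (ε.offset : ZMod 2) := by
  induction h with
  | id => exact ⟨_, rep_id ε _, by rw [id_eq_shift]; exact cyc_shift _ _ _⟩
  | @s n u h i hi ih =>
    obtain ⟨D, hD, hc⟩ := ih
    exact ⟨_, hD.comp (rep_cs ε n i hi), hc.comp hD.isTangle (rep_cs ε n i hi).isTangle
      (cyc_cap_s ε _ _ i) (AObj.origin _)⟩
  | @t n u h ih =>
    obtain ⟨D, hD, hc⟩ := ih
    exact ⟨_, hD.comp (rep_t ε n), hc.comp hD.isTangle (rep_t ε n).isTangle (cyc_shift _ _ _)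
      (AObj.origin _)⟩

theorem exists_cyc {m n : ℕ} (u : cX m ⟶ cX n) :
    ∃ D, Rep ε u D ∧ D.Cyc (ε.offset : ZMod 2) := by
  induction isDST u with
  | st h => exact h.exists_cyc
  | @d m n u h i hi ih =>
    obtain ⟨D, hD, hc⟩ := ih
    exact ⟨_, (rep_cd ε m i hi).comp hD, (cyc_cap_d ε _ _ i).comp (rep_cd ε m i hi).isTangle
      hD.isTangle hc (AObj.origin _)⟩

theorem exists_rep_shift (ε : Sgn) (n : ℕ) {s : ℤ} (hs : Even s) :
    ∃ u : cX n ⟶ cX n, Rep ε u (shift (.pos n) s) := by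
  obtain ⟨e, he⟩ := hs
  have h₁ := Int.emod_nonneg e (show ((n + 1 : ℕ) : ℤ) ≠ 0 by omega)
  have h₂ := Int.emod_add_mul_ediv e (n + 1 : ℕ)
  -- The exponent of `t` is the remainder of `s / 2` modulo `n + 1`; the remaining full turns are
  -- absorbed by a twist.
  obtain ⟨k, hk⟩ := Int.eq_ofNat_of_zero_le h₁
  refine ⟨ct n k, (rep_ct ε n k).of_same (shift_isTangle _ ⟨e, he⟩) ?_⟩
  have := shift_add_width (.pos n) (2 * k) (e / (n + 1 : ℕ))
  rwa [show (2 * k + e / (n + 1 : ℕ) * (AObj.pos n).width : ℤ) = s by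
    rw [AObj.width_pos, he]
    push_cast at h₂ hk ⊢
    linear_combination 2 * h₂ - 2 * hk] at this

theorem shift_neg_comp_shift_comp {a b : AObj} {D : Diagram a b} (hD : D.IsTangle) {s : ℤ}
    (hs : Even s) : ((shift a (-s)).comp ((shift a s).comp D)).Same D := by
  have h₁ := shift_isTangle a hs
  have h₂ := shift_isTangle a hs.neg
  refine (comp_assoc_same h₂ h₁ hD).symm.trans (.trans ?_ (id_comp_same hD))
  refine comp_same (id_isTangle a) hD hD ?_ (.refl D)
  have := shift_comp_shift a hs.neg hs
  rwa [neg_add_cancel, ← id_eq_shift] at this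

/-- If there is a cap, there are at least four inner points. -/
theorem exists_eq_succ {m n : ℕ} {p : ZMod 2} {D : Diagram (.pos m) (.pos n)} (hD : D.IsTangle)
    (h : D.Cyc p) {x : ℤ} (hx : D.HasCap x) : ∃ m', m = m' + 1 := by
  refine Nat.exists_eq_succ_of_ne_zero ?_
  rintro rfl
  obtain ⟨z, y, hzy⟩ := h.exists_through hD (AObj.origin _) (AObj.origin _)
  obtain ⟨k, hk⟩ : ∃ k : ℤ, z.1 = x + k * (AObj.pos 0).width ∨
      z.1 = x + k * (AObj.pos 0).width + 1 := by
    refine ⟨(z.1 - x) / 2, ?_⟩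
    show z.1 = x + (z.1 - x) / 2 * 2 ∨ z.1 = x + (z.1 - x) / 2 * 2 + 1
    omega
  obtain ⟨hw, hj⟩ := (hasCap_add_iff hD x k).2 hx
  rcases hk with hk | hk
  · rw [← show z = ⟨x + k * (AObj.pos 0).width, hw⟩ from Pt.ext_val hk] at hj
    exact Sum.inl_ne_inr (hD.eq_of_joined hj hzy)
  · rw [← show z = ⟨x + k * (AObj.pos 0).width + 1, hw⟩ from Pt.ext_val hk] at hj
    exact Sum.inl_ne_inr (hD.eq_of_joined (hD.symm _ _ hj) hzy)

/-- A cyclic tangle with a cap is the composite of a rotation, a tangle with the cap at a prescribed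
place `i`, and hence a composite with `a_i`. -/
theorem exists_factor {m n i : ℕ} {p : ZMod 2} {D : Diagram (.pos (m + 1)) (.pos n)}
    (hD : D.IsTangle) (h : D.Cyc p) {x : ℤ} (hx : D.HasCap x) (hi : (i : ZMod 2) = p + 1)
    (h₁ : (cap (.pos (m + 1)) (.pos m) i).IsTangle)
    (h₂ : (cap (.pos (m + 1)) (.pos m) (i + 1)).IsTangle) :
    ∃ (s : ℤ) (E : Diagram (.pos m) (.pos n)), Even s ∧ E.IsTangle ∧ E.Cyc p ∧
      ((shift (.pos (m + 1)) s).comp ((cap (.pos (m + 1)) (.pos m) i).comp E)).Same D := by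
  have hxp := h.2.2.2.1 _ _ hx.2 (lt_add_one x)
  have hs : Even (x - i) := by
    rw [← ZMod.intCast_eq_zero_iff_even, Int.cast_sub, hxp, Int.cast_natCast, hi, sub_self]
  have t := shift_isTangle (.pos (m + 1)) hs
  have tD := t.comp hD
  have hc : ((shift (.pos (m + 1)) (x - i)).comp D).HasCap i :=
    HasCap.shift_comp (by rwa [add_sub_cancel])
  refine ⟨-(x - i), _, hs.neg, h₂.star.comp tD, ?_, ?_⟩
  · refine Cyc.comp h₂.star tD ?_ ((cyc_shift _ _ p).comp t hD h (AObj.origin _)) (AObj.origin _)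
    rw [← add_one_add_one p]
    refine (cyc_cap ?_).star
    push_cast
    rw [hi]
  · refine Same.trans ?_ (shift_neg_comp_shift_comp hD hs)
    exact comp_same (shift_isTangle _ hs.neg) (h₁.comp (h₂.star.comp tD)) tD (.refl _)
      (same_cap_comp (b := .pos m) rfl (Nat.mul_pos two_pos m.succ_pos) tD h₁ h₂ hc).symm

theorem cap_pos_isTangle (n i : ℕ) : (cap (.pos (n + 1)) (.pos n) i).IsTangle :=
  cap_isTangle rfl (by simp only [AObj.shade]; exact CharTwo.add_self_eq_zero _)

/-- A cap is rotated to the place of `d_0` and split off, a cup is treated likewise after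
reflection, and a tangle with neither is an even shift, that is, a power of `t`. -/
theorem exists_rep_of_cyc (ε : Sgn) (N : ℕ) : ∀ {m n : ℕ}, m + n = N →
    ∀ D : Diagram (.pos m) (.pos n), D.IsTangle → D.Cyc (ε.offset : ZMod 2) →
      ∃ u : cX m ⟶ cX n, Rep ε u D := by
  induction N using Nat.strong_induction_on with
  | _ N ih =>
  intro m n hN D hD hc
  by_cases h : D.NoCaps
  swap
  · obtain ⟨x, hx⟩ := exists_hasCap hD h
    obtain ⟨m, rfl⟩ := exists_eq_succ hD hc hx
    have hd := rep_cd ε m 0 (Nat.zero_le _)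
    obtain ⟨s, E, hs, hE, hcE, e⟩ := exists_factor hD hc hx (i := 2 * 0 + 1 + ε.offset)
      (by simp [add_comm]) hd.isTangle
      (cap_pos_isTangle m _)
    obtain ⟨v, hv⟩ := ih (m + n) (by omega) rfl E hE hcE
    obtain ⟨w, hw⟩ := exists_rep_shift ε (m + 1) hs
    exact ⟨_, (hw.comp (hd.comp hv)).of_same hD e⟩
  by_cases h' : D.star.NoCaps
  swap
  · obtain ⟨x, hx⟩ := exists_hasCap hD.star h'
    obtain ⟨n, rfl⟩ := exists_eq_succ hD.star hc.star hx
    have hd := rep_cs ε n 0 (Nat.zero_le _)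
    have hd' := cap_pos_isTangle n (2 * 0 + 2 + ε.offset)
    obtain ⟨s, E, hs, hE, hcE, e⟩ := exists_factor hD.star hc.star hx (i := 2 * 0 + 2 + ε.offset)
      (by
        rw [add_one_add_one]
        push_cast
        rw [show (2 : ZMod 2) = 0 from rfl, zero_add]) hd'
      (cap_pos_isTangle n _)
    have hcE' := hcE.star
    rw [add_one_add_one] at hcE'
    obtain ⟨v, hv⟩ := ih (m + n) (by omega) rfl E.star hE.star hcE'
    obtain ⟨w, hw⟩ := exists_rep_shift ε (n + 1) hs.neg
    have e := e.star hD.star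
    rw [star_comp, star_comp, Diagram.star_star, star_shift] at e
    exact ⟨_, ((hv.comp hd).comp hw).of_same hD e⟩
  obtain ⟨e, s, hs, hj⟩ := exists_shift (AObj.origin m).2 hD h h'
  rw [AObj.width_pos, AObj.width_pos] at e
  obtain rfl : m = n := by omega
  obtain ⟨w, hw⟩ := exists_rep_shift ε m hs
  refine ⟨w, hw.of_same hD (same_of_joined hw.isTangle hD (fun p => ?_) hc.1 hc.2.1 hc.2.2.1)⟩
  rcases p with x | y
  · obtain ⟨y, hy⟩ := h.exists_through hD x
    exact ⟨.inr y, hj x y hy, hy⟩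
  · obtain ⟨x, hx⟩ := h'.exists_through hD.star y
    have hx : D.joined (.inr y) (.inl x) := hx
    exact ⟨.inl x, hj x y (hD.symm _ _ hx), hx⟩

end Cyclic
end Annular

/-! ### The isomorphism onto `cAtl^±`. -/

namespace Annular
open Diagram

theorem isIsoOfCats_of_bijective {C D : Type} [Category.{0} C] [Category.{0} D] (E : C ⥤ D)
    (h : Function.Bijective E.obj) [E.Full] [E.Faithful] : IsIsoOfCats E := by
  obtain ⟨g, hg, hg'⟩ := Function.bijective_iff_has_inverse.1 h
  let G : D ⥤ C :=
    { obj := g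
      map := fun {X Y} f => E.preimage (eqToHom (hg' X) ≫ f ≫ eqToHom (hg' Y).symm)
      map_id := fun X => E.map_injective (by simp)
      map_comp := fun f f' => E.map_injective (by simp) }
  refine ⟨G, CategoryTheory.Functor.ext hg fun X Y f => E.map_injective ?_,
    CategoryTheory.Functor.ext hg' fun X Y f => ?_⟩
  · simp [G, eqToHom_map]
  · simp [G]

theorem map_mem_cAtlHom (ε : Sgn) {m n : ℕ} (u : cX m ⟶ cX n) :
    cAtlHom atlIsCategory ε ((functorG ε).map u) := by
  obtain ⟨D, hD, hc⟩ := exists_cyc (ε := ε) u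
  exact ⟨⟨m, rfl⟩, ⟨n, rfl⟩, ⟨D, hD.1⟩, isCyclic_iff.2 hc, hD.2.symm⟩

theorem exists_map_eq (ε : Sgn) {m n : ℕ} (f : (functorG ε).obj (cX m) ⟶ (functorG ε).obj (cX n))
    (hf : cAtlHom atlIsCategory ε f) : ∃ u : cX m ⟶ cX n, (functorG ε).map u = f := by
  obtain ⟨-, -, D, hD, e⟩ := hf
  obtain ⟨u, hu⟩ := exists_rep_of_cyc ε _ rfl D.1 D.2 (isCyclic_iff.1 hD)
  exact ⟨u, hu.2.trans e⟩

theorem functorG_obj_injective (ε : Sgn) : Function.Injective (functorG ε).obj := by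
  rintro ⟨⟨m⟩⟩ ⟨⟨n⟩⟩ h
  have h : AObj.pos m = AObj.pos n := congrArg Atl.obj h
  rw [AObj.pos.inj h]

theorem range_functorG_obj (ε : Sgn) :
    Set.range (functorG ε).obj = cAtlObj atlIsCategory := by
  ext X
  constructor
  · rintro ⟨⟨⟨n⟩⟩, rfl⟩
    exact ⟨n, rfl⟩
  · rcases X with ⟨X⟩
    rintro ⟨n, hn : X = _⟩
    subst hn
    exact ⟨cX n, rfl⟩

instance (ε : Sgn) : (functorG ε).Faithful where
  map_injective {X Y} u v h := by
    rcases X with ⟨⟨m⟩⟩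
    rcases Y with ⟨⟨n⟩⟩
    exact functorG_map_injective ε _ rfl u v h

theorem cAtlHom_id (ε : Sgn) (X : Atl atlIsCategory) (hX : X ∈ cAtlObj atlIsCategory) :
    cAtlHom atlIsCategory ε (𝟙 X) := by
  rw [← range_functorG_obj ε] at hX
  obtain ⟨⟨⟨m⟩⟩, rfl⟩ := hX
  have := map_mem_cAtlHom ε (𝟙 (cX m))
  rwa [CategoryTheory.Functor.map_id] at this

/-- Both factors lift to `cΔᵒᵖ` with a common middle object, and the image of their composite is
cyclic. -/
theorem cAtlHom_comp (ε : Sgn) {X Y Z : Atl atlIsCategory} (f : X ⟶ Y) (g : Y ⟶ Z)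
    (hf : cAtlHom atlIsCategory ε f) (hg : cAtlHom atlIsCategory ε g) :
    cAtlHom atlIsCategory ε (f ≫ g) := by
  have hX := hf.1
  have hY := hf.2.1
  have hZ := hg.2.1
  rw [← range_functorG_obj ε] at hX hY hZ
  obtain ⟨⟨⟨m⟩⟩, rfl⟩ := hX
  obtain ⟨⟨⟨n⟩⟩, rfl⟩ := hY
  obtain ⟨⟨⟨k⟩⟩, rfl⟩ := hZ
  obtain ⟨u, rfl⟩ := exists_map_eq ε (m := m) (n := n) f hf
  obtain ⟨v, rfl⟩ := exists_map_eq ε (m := n) (n := k) g hg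
  have := map_mem_cAtlHom ε (u ≫ v)
  rwa [Functor.map_comp] at this

/-- The subcategory `cAtl^±`. -/
def subcatCAtl (ε : Sgn) : Subcat (Atl atlIsCategory) where
  obj := cAtlObj atlIsCategory
  hom := cAtlHom atlIsCategory ε
  source_mem _ h := h.1
  target_mem _ h := h.2.1
  id_mem := cAtlHom_id ε
  comp_mem := cAtlHom_comp ε

/-- The functor `F ∘ H^±` with values in `cAtl^±`. -/
noncomputable def functorE (ε : Sgn) : CDeltaOp ⥤ (subcatCAtl ε).Carrier where
  obj X := ⟨(functorG ε).obj X, (range_functorG_obj ε).le (Set.mem_range_self X)⟩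
  map {X Y} u := ⟨(functorG ε).map u, map_mem_cAtlHom ε (m := X.as.idx) (n := Y.as.idx) u⟩
  map_id X := Subtype.ext ((functorG ε).map_id X)
  map_comp u v := Subtype.ext ((functorG ε).map_comp u v)

theorem isIsoOfCats_functorE (ε : Sgn) : IsIsoOfCats (functorE ε) := by
  have h₁ : (functorE ε).Faithful := ⟨fun h => (functorG ε).map_injective (congrArg Subtype.val h)⟩
  have h₂ : (functorE ε).Full := ⟨fun {X Y} f => by
    obtain ⟨u, hu⟩ := exists_map_eq ε (m := X.as.idx) (n := Y.as.idx) f.1 f.2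
    exact ⟨u, Subtype.ext hu⟩⟩
  refine isIsoOfCats_of_bijective _ ⟨fun X Y h => functorG_obj_injective ε (congrArg Subtype.val h),
    fun X => ?_⟩
  have hX : X.1 ∈ cAtlObj atlIsCategory := X.2
  rw [← range_functorG_obj ε] at hX
  obtain ⟨Y, hY⟩ := hX
  exact ⟨Y, Subtype.ext hY⟩

theorem strictMap_functorG (ε : Sgn) :
    (⊤ : MorphismProperty CDeltaOp).strictMap (functorG ε) = cAtlHom atlIsCategory ε := by
  ext X Y f
  constructor
  · rintro ⟨-⟩
    exact map_mem_cAtlHom ε _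
  · intro hf
    have hX := hf.1
    have hY := hf.2.1
    rw [← range_functorG_obj ε] at hX hY
    obtain ⟨⟨⟨m⟩⟩, rfl⟩ := hX
    obtain ⟨⟨⟨n⟩⟩, rfl⟩ := hY
    obtain ⟨u, rfl⟩ := exists_map_eq ε (m := m) (n := n) f hf
    exact .map (MorphismProperty.top_apply u)

end Annular

theorem mainTheorem6 :
    -- gluing makes the tangles into a category `Atl`, and `a_i`, `b_i`, `t` are tangles
    ∃ (hA : Annular.AtlIsCategory)
      (hg : ∀ (a b : Annular.AObj) (e : Annular.AGen a b), e.diagram.IsTangle),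
      -- the assignments on generators define a functor `F : aΔ ⥤ Atl`
      ∃ F : Annular.ADelta ⥤ Annular.Atl hA,
        (∀ F' : Annular.ADelta ⥤ Annular.Atl hA,
          Annular.ADelta.gens ⋙q F'.toPrefunctor = Annular.FGen hA hg ↔ F' = F) ∧
        ∀ ε : Annular.Sgn,
          -- the assignments on generators define a functor `H^± : cΔᵒᵖ ⥤ aΔ`, which is injective
          ∃ H : Annular.CDeltaOp ⥤ Annular.ADelta,
            (∀ H' : Annular.CDeltaOp ⥤ Annular.ADelta,
              Annular.CDeltaOp.gens ⋙q H'.toPrefunctor = Annular.HGen ε ↔ H' = H) ∧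
            Function.Injective H.obj ∧ H.Faithful ∧
            -- `cAtl^±` is a subcategory of `Atl`, it is the image of `F ∘ H^±`,
            -- and `F ∘ H^±` is an isomorphism from `cΔᵒᵖ` onto it
            ∃ S : Annular.Subcat (Annular.Atl hA),
              S.obj = Annular.cAtlObj hA ∧ S.hom = Annular.cAtlHom hA ε ∧
              Set.range (H ⋙ F).obj = S.obj ∧
              (⊤ : CategoryTheory.MorphismProperty Annular.CDeltaOp).strictMap (H ⋙ F) = S.hom ∧
              ∃ E : Annular.CDeltaOp ⥤ S.Carrier,
                Annular.IsIsoOfCats E ∧ E ⋙ S.incl = H ⋙ F := by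
  refine ⟨Annular.atlIsCategory, fun _ _ e => e.isTangle, Annular.functorF _ _,
    fun F' => Annular.eq_lift_iff _ _ _ F', fun ε => ⟨Annular.functorH ε,
      fun H' => Annular.eq_lift_iff _ _ _ H', Annular.functorH_obj_injective ε, ?_,
      Annular.subcatCAtl ε, rfl, rfl, Annular.range_functorG_obj ε, Annular.strictMap_functorG ε,
      Annular.functorE ε, Annular.isIsoOfCats_functorE ε, rfl⟩⟩
  -- `H^±` is faithful because `F ∘ H^±` is.
  exact ⟨fun h => (Annular.functorG ε).map_injective
    (congrArg (Annular.functorF _ fun _ _ e => e.isTangle).map h)⟩
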